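/- Let $n\ge 1$, $s,\sigma\in(0,1)$, $a:=1-2s$, $r>0$; $B_r\subset\mathbb{R}^n$ is the ball of radius $r$ centred at $0$, and points of $\mathbb{R}^{n+1}$ are written $X=(x,z)$ with $x\in\mathbb{R}^n$, $z\in\mathbb{R}$. All functions and sets are Lebesgue measurable. For $\Omega\subset\mathbb{R}^n$ put $$\mathcal{F}_\Omega(u,E):=\iint_{Q_\Omega}\frac{|u(x)-u(y)|^2}{|x-y|^{n+2s}}\,dx\,dy+\mathrm{Per}_\sigma(E,\Omega),\qquad Q_\Omega:=(\Omega\times\Omega)\cup((\mathbb{R}^n\setminus\Omega)\times\Omega)\cup(\Omega\times(\mathbb{R}^n\setminus\Omega)),$$ $$\mathrm{Per}_\sigma(E,\Omega):=L(E\cap\Omega,\Omega\setminus E)+L(E\cap\Omega,(\mathbb{R}^n\setminus E)\setminus\Omega)+L(E\setminus\Omega,\Omega\setminus E),\qquad L(A,B):=\iint_{A\times B}\frac{dx\,dy}{|x-y|^{n+\sigma}}.$$ A pair $(v,F)$ is admissible if $v\ge0$ a.e. in $F$ and $v\le 0$ a.e. in $\mathbb{R}^n\setminus F$. A pair $(u,E)$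 is minimizing in $\Omega$ if $\mathcal{F}_\Omega(u,E)<+\infty$ and $\mathcal{F}_\Omega(u,E)\le\mathcal{F}_\Omega(v,F)$ for every admissible pair $(v,F)$ with $u-v\in H^s(\mathbb{R}^n)$, $u=v$ a.e. in $\mathbb{R}^n\setminus\Omega$ and $E\setminus\Omega=F\setminus\Omega$. For $z\neq0$ set $$\overline u(x,z):=\int_{\mathbb{R}^n}\frac{|z|^{2s}\,u(y)}{(|x-y|^2+z^2)^{\frac{n+2s}{2}}}\,dy,\qquad c_{n,s}:=\Big(2s\int_{\mathbb{R}^n}\frac{dy}{(1+|y|^2)^{\frac{n+2s}{2}}}\Big)^{-1}.$$ **Lemma.** Let $(u,E)$ be a minimizing pair in $B_r$, and let $\mathcal{U}\subset\mathbb{R}^{n+1}$ be a bounded Lipschitz domain, symmetric under $(x,z)\mapsto(x,-z)$, with $\mathcal{U}\cap\{z=0\}\subset B_r\times\{0\}$. Then $$c_{n,s}\int_{\mathcal{U}}|z|^a|\nabla\overline u|^2\,dX+\mathrm{Per}_\sigma(E,B_r)\le c_{n,s}\int_{\mathcal{U}}|z|^a|\nabla\tilde v|^2\,dX+\mathrm{Per}_\sigma(F,B_r)$$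 for every function $\tilde v$ on $\mathbb{R}^{n+1}$ possessing a trace $\tilde v(\cdot,0)$ and every $F\subset\mathbb{R}^n$ such that - $F\setminus B_r=E\setminus B_r$, - $\tilde v-\overline u$ vanishes a.e. outside some compact subset of $\mathcal{U}$, - $\tilde v(x,0)\ge0$ for a.e. $x\in F$, and $\tilde v(x,0)\le0$ for a.e. $x\in\mathbb{R}^n\setminus F$. Here gradients are weak gradients in $\mathcal{U}$ (functions and gradients locally integrable in $\mathcal{U}$), both sides take values in $[0,+\infty]$, and an energy is $+\infty$ if there is no weak gradient. The trace $\tilde v(\cdot,0)$ is the function $g\in L^1_{\mathrm{loc}}(\mathbb{R}^n)$ with $\frac1{2\varepsilon}\int_{-\varepsilon}^{\varepsilon}\int_{B_R}|\tilde v(x,z)-g(x)|\,dx\,dz\to0$ as $\varepsilon\to0^+$, for every $R>0$. -/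

import Mathlib

open MeasureTheory Set Filter Topology
open scoped ENNReal ContDiff

noncomputable section

namespace FracFreeBdry

/-- The Euclidean space `ℝⁿ`. -/
abbrev Eucl (n : ℕ) : Type := EuclideanSpace ℝ (Fin n)

/-- The Gagliardo-type double integral of `|u(x) - u(y)|² / |x - y|^(n+2s)` over `Q ⊆ ℝⁿ × ℝⁿ`. -/
def gagliardo {n : ℕ} (s : ℝ) (Q : Set (Eucl n × Eucl n)) (u : Eucl n → ℝ) : ℝ≥0∞ :=
  ∫⁻ p in Q, ENNReal.ofReal (|u p.1 - u p.2| ^ 2 / ‖p.1 - p.2‖ ^ ((n : ℝ) + 2 * s))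

/-- `Q_Ω = (Ω × Ω) ∪ (Ωᶜ × Ω) ∪ (Ω × Ωᶜ)`. -/
def crossSet {n : ℕ} (Ω : Set (Eucl n)) : Set (Eucl n × Eucl n) :=
  (Ω ×ˢ Ω) ∪ (Ωᶜ ×ˢ Ω) ∪ (Ω ×ˢ Ωᶜ)

/-- The interaction `L(A, B) = ∬_{A × B} dx dy / |x - y|^(n+σ)`; only used for disjoint `A`, `B`. -/
def interaction {n : ℕ} (σ : ℝ) (A B : Set (Eucl n)) : ℝ≥0∞ :=
  ∫⁻ p in A ×ˢ B, ENNReal.ofReal (1 / ‖p.1 - p.2‖ ^ ((n : ℝ) + σ))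

/-- The fractional perimeter `Per_σ(E, Ω)`. -/
def fracPer {n : ℕ} (σ : ℝ) (E Ω : Set (Eucl n)) : ℝ≥0∞ :=
  interaction σ (E ∩ Ω) (Ω \ E) + interaction σ (E ∩ Ω) (Eᶜ \ Ω) + interaction σ (E \ Ω) (Ω \ E)

/-- The total energy `𝓕_Ω(u, E)`, with values in `[0, ∞]`. -/
def totalEnergy {n : ℕ} (s σ : ℝ) (Ω : Set (Eucl n)) (u : Eucl n → ℝ) (E : Set (Eucl n)) : ℝ≥0∞ :=
  gagliardo s (crossSet Ω) u + fracPer σ E Ω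

/-- Admissible pairs: `u ≥ 0` a.e. in `E`, `u ≤ 0` a.e. in the complement of `E`
(`u` and `E` Lebesgue measurable). -/
def IsAdmissible {n : ℕ} (u : Eucl n → ℝ) (E : Set (Eucl n)) : Prop :=
  AEMeasurable u ∧ NullMeasurableSet E ∧
    (∀ᵐ x, x ∈ E → 0 ≤ u x) ∧ (∀ᵐ x, x ∉ E → u x ≤ 0)

/-- The fractional Sobolev space `H^s(ℝⁿ)`. -/
def MemHs {n : ℕ} (s : ℝ) (w : Eucl n → ℝ) : Prop :=
  MemLp w 2 ∧ gagliardo s univ w < ⊤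

/-- Minimizing pairs in `Ω`: finite energy, not larger than that of any admissible pair with
the same exterior data. -/
def IsMinimizing {n : ℕ} (s σ : ℝ) (Ω : Set (Eucl n)) (u : Eucl n → ℝ) (E : Set (Eucl n)) : Prop :=
  AEMeasurable u ∧ NullMeasurableSet E ∧ totalEnergy s σ Ω u E < ⊤ ∧
    ∀ (v : Eucl n → ℝ) (F : Set (Eucl n)), IsAdmissible v F →
      MemHs s (fun x => u x - v x) →
      (∀ᵐ x, x ∉ Ω → u x = v x) →
      E \ Ω = F \ Ω →
      totalEnergy s σ Ω u E ≤ totalEnergy s σ Ω v F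

/-- The (unnormalized) extension
`ū(x, z) = ∫ |z|^(2s) u(y) / (|x - y|² + z²)^((n+2s)/2) dy`.
The formula is meaningful for `z ≠ 0`; the null set `{z = 0}` is never evaluated below. -/
def extend {n : ℕ} (s : ℝ) (u : Eucl n → ℝ) (X : Eucl n × ℝ) : ℝ :=
  ∫ y, |X.2| ^ (2 * s) * u y / (‖X.1 - y‖ ^ 2 + X.2 ^ 2) ^ (((n : ℝ) + 2 * s) / 2)

/-- The mass `κ = ∫ (1 + |y|²)^(-(n+2s)/2) dy` of the kernel in `extend`. -/
def kernelMass (n : ℕ) (s : ℝ) : ℝ :=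
  ∫ y : Eucl n, 1 / (1 + ‖y‖ ^ 2) ^ (((n : ℝ) + 2 * s) / 2)

/-- The normalizing constant `1 / (2 s κ)`. -/
def normConst (n : ℕ) (s : ℝ) : ℝ := 1 / (2 * s * kernelMass n s)

/-- Lipschitz domain of `ℝⁿ⁺¹ = ℝⁿ × ℝ`: open, connected, and near each boundary point it is, in
suitable orthonormal coordinates, the region below the graph of a Lipschitz function.
(`WithLp 2` puts the Euclidean norm on the product.) -/
def IsLipschitzDomain {n : ℕ} (U : Set (Eucl n × ℝ)) : Prop :=
  IsOpen U ∧ IsConnected U ∧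
    ∀ p ∈ frontier U,
      ∃ (T : WithLp 2 (Eucl n × ℝ) ≃ₗᵢ[ℝ] WithLp 2 (Eucl n × ℝ)) (g : Eucl n → ℝ) (K : NNReal),
        LipschitzWith K g ∧
        ∀ᶠ q in 𝓝 p, q ∈ U ↔ (T (WithLp.toLp 2 q)).snd < g (T (WithLp.toLp 2 q)).fst

/-- `G` is a weak gradient of `w` in the open set `U ⊆ ℝⁿ × ℝ`
(both locally integrable in `U`; `(G X).1` is the gradient in `x`, `(G X).2` that in `z`). -/
def HasWeakGradOn {n : ℕ} (U : Set (Eucl n × ℝ)) (w : Eucl n × ℝ → ℝ)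
    (G : Eucl n × ℝ → Eucl n × ℝ) : Prop :=
  LocallyIntegrableOn w U ∧ LocallyIntegrableOn G U ∧
    ∀ η : Eucl n × ℝ → ℝ, ContDiff ℝ ∞ η → HasCompactSupport η → tsupport η ⊆ U →
      ∀ e : Eucl n × ℝ,
        ∫ X, w X * fderiv ℝ η X e = - ∫ X, (inner ℝ (G X).1 e.1 + (G X).2 * e.2) * η X

/-- The weighted Dirichlet energy `∫_U |z|^a |∇w|² dX` in `[0, ∞]`. The weak gradient being unique
up to null sets, the infimum is over a single value, or over nothing, and then equal to `∞`, if `w`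
has no weak gradient in `U`. -/
def weightedEnergy {n : ℕ} (a : ℝ) (U : Set (Eucl n × ℝ)) (w : Eucl n × ℝ → ℝ) : ℝ≥0∞ :=
  ⨅ (G : Eucl n × ℝ → Eucl n × ℝ) (_ : HasWeakGradOn U w G),
    ∫⁻ X in U, ENNReal.ofReal (|X.2| ^ a * (‖(G X).1‖ ^ 2 + (G X).2 ^ 2))

/-- `g = w(·, 0)` in the sense of traces: `g` is locally integrable and the averages of
`|w(x, z) - g(x)|` over `|z| < ε` tend to zero in `L¹_loc(ℝⁿ)` as `ε → 0`. -/
def IsTrace {n : ℕ} (w : Eucl n × ℝ → ℝ) (g : Eucl n → ℝ) : Prop :=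
  LocallyIntegrable g ∧
    ∀ R : ℝ, 0 < R →
      Tendsto (fun ε : ℝ =>
          (∫⁻ X in Metric.ball (0 : Eucl n) R ×ˢ Ioo (-ε) ε, ‖w X - g X.1‖ₑ) /
            ENNReal.ofReal (2 * ε))
        (𝓝[>] 0) (𝓝 0)

end FracFreeBdry

end

open MeasureTheory Set Filter Topology
open scoped ENNReal ContDiff

noncomputable section

namespace FracFreeBdry

/-! Write `κ` for `kernelMass n s`, `c = 1/(2sκ)` for `normConst n s`, `ū` for the extension of `u`,
and `[u, w]` for `gagForm s u w`. For a competitor `(v, F)` the difference `φ = v - ū` has compact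
support in the domain and a trace `κ h`, where `κ (u + h)` is the trace of `v`. As `κ > 0`, the pair
`(u + h, F)` is admissible, and `h` vanishes outside a ball smaller than `B_r`. Minimality therefore
compares the Gagliardo energies of `u` and `u + h`, and the theorem reduces to `2[u, h] + [h, h] ≤ c
(2 ∫ |z|^a ∇ū·∇φ + ∫ |z|^a |∇φ|²)`, whose left side is the change of the Gagliardo energy and whose
right side is `c` times the change of the weighted energy on the support of `φ`
(`IsTracePair.gagliardo_add_le`).

Two facts give this. The first is the pairing identity `c ∫ |z|^a ∇ū·∇φ = [u, h]`
(`normConst_mul_integral_inner`). Up to the sign of `z`, the vector `|z|^a ∇ū` is the integral of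
`u` against fields that are divergence free off `{z = 0}` (`div_field`), so an integration by parts
leaves only the flux through `{z = 0}`. The vertical field tends there to `2s/|x - y|^(n+2s)`
(`tendsto_fieldZ`), and symmetrizing in `x`, `y` turns the flux against `κ h` into `sκ[u, h]` on
each side of the hyperplane. The second is `[h, h] ≤ c ∫ |z|^a |∇φ|²`: the pairing identity with `h`
in place of `u` gives `[h, h] = c ∫ |z|^a ∇h̄·∇φ`, the energy of `h̄` itself satisfies `c ∫ |z|^a
|∇h̄|² = [h, h]` (`IsTestFun.normConst_mul_integral_norm_sq`), and `2ab ≤ a² + b²` finishes.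

The trace is attained only in averaged `L¹`, too weak to be paired with the singular kernel. Hence
`φ` and its gradient are first convolved in `x` alone. This commutes with the weight, preserves the
integrated form of `∇φ = G` (`IsFieldPair`), and turns `L¹` smallness into smallness of a Lipschitz
constant (`abs_conv_sub_le`). As the mollification is removed, the weighted energies converge in
`L²`, while the Gagliardo energy is lower semicontinuous by Fatou. The finiteness of the energy of
`u + h`, and with it `h ∈ H^s`, comes out of this limit.

The preliminary facts on `ū` are that finite energy makes `u` integrable against the decay of the
kernel (`integrable_mul_decay`), that `ū` has trace `κ u` (`tendsto_lintegral_extend_sub`), and that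
it has a weak gradient across `{z = 0}` (`hasWeakGradOn_extend`) of locally finite weighted energy
(`memLp_wgt_extGrad`). -/

variable {n : ℕ}

/-! ### Integrals of negative powers of `‖x‖² + z²` over `ℝⁿ` -/

lemma integrable_one_add_norm_sq_rpow {p : ℝ} (hp : (n : ℝ) < p) :
    Integrable (fun x : Eucl n => (1 + ‖x‖ ^ 2) ^ (-(p / 2))) := by
  have := integrable_rpow_neg_one_add_norm_sq (E := Eucl n) (μ := volume) (r := p) (by simpa using hp)
  simpa [neg_div] using this

lemma norm_sq_add_rpow_scale {p : ℝ} {z : ℝ} (hz : z ≠ 0) (x : Eucl n) :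
    (‖x‖ ^ 2 + z ^ 2) ^ (-(p / 2)) = |z| ^ (-p) * (1 + ‖(|z|⁻¹ • x)‖ ^ 2) ^ (-(p / 2)) := by
  have hz' : 0 < |z| := abs_pos.2 hz
  have : ‖x‖ ^ 2 + z ^ 2 = |z| ^ 2 * (1 + ‖(|z|⁻¹ • x)‖ ^ 2) := by
    rw [norm_smul]; simp only [norm_inv, Real.norm_eq_abs, abs_abs]
    field_simp
    rw [sq_abs]; ring
  rw [this, Real.mul_rpow (by positivity) (by positivity), ← Real.rpow_natCast |z| 2,
    ← Real.rpow_mul hz'.le]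
  congr 2; push_cast; ring

lemma integrable_norm_sq_add_rpow {p : ℝ} (hp : (n : ℝ) < p) {z : ℝ} (hz : z ≠ 0) :
    Integrable (fun x : Eucl n => (‖x‖ ^ 2 + z ^ 2) ^ (-(p / 2))) := by
  simp_rw [norm_sq_add_rpow_scale hz]
  refine Integrable.const_mul ?_ _
  exact (integrable_comp_smul_iff volume (fun x : Eucl n => (1 + ‖x‖ ^ 2) ^ (-(p / 2)))
    (inv_ne_zero (abs_ne_zero.2 hz))).2 (integrable_one_add_norm_sq_rpow hp)

lemma integral_norm_sq_add_rpow (p : ℝ) {z : ℝ} (hz : z ≠ 0) :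
    ∫ x : Eucl n, (‖x‖ ^ 2 + z ^ 2) ^ (-(p / 2)) =
      |z| ^ ((n : ℝ) - p) * ∫ x : Eucl n, (1 + ‖x‖ ^ 2) ^ (-(p / 2)) := by
  have hz' : 0 < |z| := abs_pos.2 hz
  simp_rw [norm_sq_add_rpow_scale hz]
  rw [integral_const_mul,
    Measure.integral_comp_smul volume (fun x : Eucl n => (1 + ‖x‖ ^ 2) ^ (-(p / 2)))]
  simp only [finrank_euclideanSpace, Fintype.card_fin, inv_pow, inv_inv, abs_pow, abs_abs,
    smul_eq_mul]
  rw [sub_eq_add_neg, Real.rpow_add hz', Real.rpow_natCast]; ring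

lemma kernelMass_eq (n : ℕ) (s : ℝ) :
    kernelMass n s = ∫ x : Eucl n, (1 + ‖x‖ ^ 2) ^ (-(((n : ℝ) + 2 * s) / 2)) := by
  unfold kernelMass
  refine integral_congr_ae (Eventually.of_forall fun x => ?_)
  simp only
  rw [Real.rpow_neg (by positivity), one_div]

lemma integral_one_add_norm_sq_rpow_pos {p : ℝ} (hp : (n : ℝ) < p) :
    0 < ∫ x : Eucl n, (1 + ‖x‖ ^ 2) ^ (-(p / 2)) := by
  rw [integral_pos_iff_support_of_nonneg (fun x => by positivity)
    (integrable_one_add_norm_sq_rpow hp)]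
  have : Function.support (fun x : Eucl n => (1 + ‖x‖ ^ 2) ^ (-(p / 2))) = univ := by
    ext x; simp only [Function.mem_support, mem_univ, iff_true]; positivity
  rw [this]; exact isOpen_univ.measure_pos volume univ_nonempty

lemma kernelMass_pos {s : ℝ} (hs : 0 < s) : 0 < kernelMass n s := by
  rw [kernelMass_eq]; exact integral_one_add_norm_sq_rpow_pos (by linarith)

/-- The recursion `(p / 2) ∫ (1 + |x|²)^(-p/2 - 1) = (p - n)/2 ∫ (1 + |x|²)^(-p/2)`. -/
lemma integral_one_add_norm_sq_rpow_succ {p : ℝ} (hp : (n : ℝ) < p) :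
    p * ∫ x : Eucl n, (1 + ‖x‖ ^ 2) ^ (-((p + 2) / 2)) =
      (p - n) * ∫ x : Eucl n, (1 + ‖x‖ ^ 2) ^ (-(p / 2)) := by
  have hn : (0 : ℝ) ≤ n := n.cast_nonneg
  have hp0 : 0 < p := by linarith
  -- The dilation formula `integral_norm_sq_add_rpow` is differentiated in the height `t` at `t =
  -- 1`: once under the integral sign, once as the power `t ^ (n - p)`. On `1/2 < t < 2` the
  -- derivative is dominated by using `2t ≤ 4` and putting `t = 1/2` in the decreasing power.
  have key := hasDerivAt_integral_of_dominated_loc_of_deriv_le (μ := (volume : Measure (Eucl n)))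
    (F := fun t x => (‖x‖ ^ 2 + t ^ 2) ^ (-(p / 2)))
    (F' := fun t x => 2 * t * (-(p / 2)) * (‖x‖ ^ 2 + t ^ 2) ^ (-(p / 2) - 1))
    (x₀ := (1 : ℝ)) (s := Ioo (1 / 2) 2)
    (bound := fun x => 4 * (p / 2) * (‖x‖ ^ 2 + (1 / 2) ^ 2) ^ (-((p + 2) / 2)))
    (Ioo_mem_nhds (by norm_num) (by norm_num))
    (by
      filter_upwards [Ioo_mem_nhds (show (1 / 2 : ℝ) < 1 by norm_num) (show (1 : ℝ) < 2 by norm_num)]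
        with t ht
      exact (integrable_norm_sq_add_rpow hp (by have := ht.1; intro h; rw [h] at this; norm_num at this)).1)
    (integrable_norm_sq_add_rpow hp one_ne_zero)
    (by
      apply Measurable.aestronglyMeasurable
      fun_prop)
    (by
      refine Eventually.of_forall fun x t ht => ?_
      have h1 : (0 : ℝ) < t := by have := ht.1; linarith
      rw [Real.norm_eq_abs, abs_mul, abs_of_nonneg (a := (‖x‖ ^ 2 + t ^ 2) ^ (-(p / 2) - 1))
        (by positivity), show -(p / 2) - 1 = -((p + 2) / 2) by ring]
      gcongr ?_ * ?_
      · rw [abs_mul, abs_neg, abs_of_pos (by positivity), abs_of_pos (by positivity)]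
        have := ht.2
        gcongr; linarith
      · apply Real.rpow_le_rpow_of_nonpos (by positivity) _ (by linarith)
        have := ht.1
        gcongr)
    ((integrable_norm_sq_add_rpow (p := p + 2) (by linarith) (by norm_num)).const_mul _)
    (by
      refine Eventually.of_forall fun x t ht => ?_
      have h1 : (0 : ℝ) < t := by have := ht.1; linarith
      have := ((hasDerivAt_id t).pow 2).const_add (‖x‖ ^ 2)
      have := this.rpow_const (p := -(p / 2)) (Or.inl (by simp; positivity))
      simpa using this)
  have h2 : HasDerivAt (fun t : ℝ => ∫ x : Eucl n, (‖x‖ ^ 2 + t ^ 2) ^ (-(p / 2)))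
      (((n : ℝ) - p) * ∫ x : Eucl n, (1 + ‖x‖ ^ 2) ^ (-(p / 2))) 1 := by
    have h3 : HasDerivAt (fun t : ℝ => t ^ ((n : ℝ) - p) *
        ∫ x : Eucl n, (1 + ‖x‖ ^ 2) ^ (-(p / 2))) (((n : ℝ) - p) * ∫ x : Eucl n, (1 + ‖x‖ ^ 2) ^ (-(p / 2))) 1 := by
      have := (Real.hasDerivAt_rpow_const (x := (1 : ℝ)) (p := (n : ℝ) - p) (Or.inl one_ne_zero)).mul_const
        (∫ x : Eucl n, (1 + ‖x‖ ^ 2) ^ (-(p / 2)))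
      simpa using this
    refine h3.congr_of_eventuallyEq ?_
    filter_upwards [Ioi_mem_nhds (show (0 : ℝ) < 1 by norm_num)] with t ht
    rw [integral_norm_sq_add_rpow p (ne_of_gt ht), abs_of_pos ht]
  have h3 := key.2.unique h2
  rw [integral_const_mul] at h3
  have h4 : ∀ x : Eucl n, (‖x‖ ^ 2 + (1 : ℝ) ^ 2) ^ (-(p / 2) - 1) = (1 + ‖x‖ ^ 2) ^ (-((p + 2) / 2)) := by
    intro x; congr 1 <;> ring
  simp_rw [h4] at h3
  linarith

/-! ### The extension kernel and its weighted gradient field -/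

/-- The extension kernel `|z|^(2s) (|x|² + z²)^(-(n+2s)/2)`. -/
def extKer (s : ℝ) (x : Eucl n) (z : ℝ) : ℝ :=
  |z| ^ (2 * s) * (‖x‖ ^ 2 + z ^ 2) ^ (-(((n : ℝ) + 2 * s) / 2))

/-- The decay factor `(|x|² + z²)^(-(n+2s)/2)`. -/
def decay (s : ℝ) (x : Eucl n) (z : ℝ) : ℝ := (‖x‖ ^ 2 + z ^ 2) ^ (-(((n : ℝ) + 2 * s) / 2))

/-- Horizontal part of `sgn z |z|^(1-2s) ∇ extKer`. -/
def fieldX (s : ℝ) (x : Eucl n) (z : ℝ) : Eucl n :=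
  (-((n : ℝ) + 2 * s) * z * (‖x‖ ^ 2 + z ^ 2) ^ (-(((n : ℝ) + 2 * s) / 2 + 1))) • x

/-- Vertical part of `sgn z |z|^(1-2s) ∇ extKer`. -/
def fieldZ (s : ℝ) (x : Eucl n) (z : ℝ) : ℝ :=
  (2 * s * ‖x‖ ^ 2 - n * z ^ 2) * (‖x‖ ^ 2 + z ^ 2) ^ (-(((n : ℝ) + 2 * s) / 2 + 1))

lemma decay_nonneg (s : ℝ) (x : Eucl n) (z : ℝ) : 0 ≤ decay s x z := by unfold decay; positivity

lemma extKer_nonneg (s : ℝ) (x : Eucl n) (z : ℝ) : 0 ≤ extKer s x z := by unfold extKer; positivity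

lemma extKer_eq (s : ℝ) (x : Eucl n) (z : ℝ) : extKer s x z = |z| ^ (2 * s) * decay s x z := rfl

lemma extend_eq (s : ℝ) (u : Eucl n → ℝ) (X : Eucl n × ℝ) :
    extend s u X = ∫ y, u y * extKer s (X.1 - y) X.2 := by
  unfold extend extKer
  refine integral_congr_ae (Eventually.of_forall fun y => ?_)
  simp only
  rw [Real.rpow_neg (by positivity), div_eq_mul_inv]; ring

lemma norm_sq_add_sq_pos {z : ℝ} (hz : z ≠ 0) (x : Eucl n) : 0 < ‖x‖ ^ 2 + z ^ 2 := by positivity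

lemma decay_le_norm {s : ℝ} (hs : 0 ≤ s) (x : Eucl n) (hx : x ≠ 0) (z : ℝ) :
    decay s x z ≤ 1 / ‖x‖ ^ ((n : ℝ) + 2 * s) := by
  have hx' : 0 < ‖x‖ := norm_pos_iff.2 hx
  have h2 : (‖x‖ ^ 2) ^ (-(((n : ℝ) + 2 * s) / 2)) = 1 / ‖x‖ ^ ((n : ℝ) + 2 * s) := by
    rw [← Real.rpow_natCast ‖x‖ 2, ← Real.rpow_mul hx'.le, one_div, ← Real.rpow_neg hx'.le]
    congr 1; push_cast; ring
  rw [← h2]; unfold decay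
  apply Real.rpow_le_rpow_of_nonpos (by positivity) (by nlinarith [sq_nonneg z])
  have : (0 : ℝ) ≤ n := n.cast_nonneg
  linarith

lemma rpow_succ_mul {a : ℝ} (ha : 0 < a) (p : ℝ) : a * a ^ (-(p + 1)) = a ^ (-p) := by
  rw [show -p = 1 + -(p + 1) by ring, Real.rpow_add ha, Real.rpow_one]

/-- The inequality `|z| ‖x‖ ≤ ‖x‖² + z²` absorbs one power. Together with `abs_fieldZ_le` this
reduces integrability questions about the field to questions about `decay`. -/
lemma norm_fieldX_le {s : ℝ} (hs : 0 ≤ s) (x : Eucl n) {z : ℝ} (hz : z ≠ 0) :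
    ‖fieldX s x z‖ ≤ ((n : ℝ) + 2 * s) * decay s x z := by
  have hR := norm_sq_add_sq_pos hz x
  have hn : (0 : ℝ) ≤ n := n.cast_nonneg
  unfold fieldX decay
  rw [← rpow_succ_mul hR (((n : ℝ) + 2 * s) / 2), norm_smul, Real.norm_eq_abs, abs_mul, abs_mul, abs_neg,
    abs_of_nonneg (a := (n : ℝ) + 2 * s) (by positivity),
    abs_of_nonneg (a := (‖x‖ ^ 2 + z ^ 2) ^ _) (by positivity)]
  have : |z| * ‖x‖ ≤ ‖x‖ ^ 2 + z ^ 2 := by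
    rw [← sq_abs z]; nlinarith [sq_nonneg (|z| - ‖x‖), sq_nonneg |z|, sq_nonneg ‖x‖, norm_nonneg x, abs_nonneg z]
  calc _ = ((n : ℝ) + 2 * s) * ((|z| * ‖x‖) * (‖x‖ ^ 2 + z ^ 2) ^ (-(((n : ℝ) + 2 * s) / 2 + 1))) := by ring
    _ ≤ _ := by gcongr

lemma abs_fieldZ_le {s : ℝ} (hs : 0 ≤ s) (x : Eucl n) {z : ℝ} (hz : z ≠ 0) :
    |fieldZ s x z| ≤ ((n : ℝ) + 2 * s) * decay s x z := by
  have hR := norm_sq_add_sq_pos hz x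
  have hn : (0 : ℝ) ≤ n := n.cast_nonneg
  unfold fieldZ decay
  rw [← rpow_succ_mul hR (((n : ℝ) + 2 * s) / 2), abs_mul,
    abs_of_nonneg (a := (‖x‖ ^ 2 + z ^ 2) ^ _) (by positivity), ← mul_assoc]
  gcongr
  rw [abs_le]
  constructor <;> nlinarith [mul_nonneg hn (sq_nonneg ‖x‖), mul_nonneg hn (sq_nonneg z), mul_nonneg hs (sq_nonneg ‖x‖), mul_nonneg hs (sq_nonneg z)]

lemma integrable_decay {s : ℝ} (hs : 0 < s) {z : ℝ} (hz : z ≠ 0) :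
    Integrable (fun x : Eucl n => decay s x z) :=
  integrable_norm_sq_add_rpow (by linarith) hz

lemma integral_decay {s : ℝ} {z : ℝ} (hz : z ≠ 0) :
    ∫ x : Eucl n, decay s x z = |z| ^ (-(2 * s)) * kernelMass n s := by
  unfold decay
  rw [integral_norm_sq_add_rpow _ hz, kernelMass_eq]; congr 2; ring

lemma integrable_extKer {s : ℝ} (hs : 0 < s) {z : ℝ} (hz : z ≠ 0) :
    Integrable (fun x : Eucl n => extKer s x z) :=
  (integrable_decay hs hz).const_mul _

/-- The factor `|z|^(2s)` is what makes the mass independent of the height: `extKer` is an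
approximate identity of mass `κ`, not one. -/
lemma integral_extKer {s : ℝ} {z : ℝ} (hz : z ≠ 0) :
    ∫ x : Eucl n, extKer s x z = kernelMass n s := by
  simp_rw [extKer_eq]
  rw [integral_const_mul, integral_decay hz, ← mul_assoc, ← Real.rpow_add (abs_pos.2 hz)]
  simp

@[fun_prop]
lemma measurable_fieldX {α : Type*} [MeasurableSpace α] (s : ℝ) {f : α → Eucl n} {g : α → ℝ}
    (hf : Measurable f) (hg : Measurable g) : Measurable (fun a => fieldX s (f a) (g a)) := by
  unfold fieldX; fun_prop

@[fun_prop]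
lemma measurable_fieldZ {α : Type*} [MeasurableSpace α] (s : ℝ) {f : α → Eucl n} {g : α → ℝ}
    (hf : Measurable f) (hg : Measurable g) : Measurable (fun a => fieldZ s (f a) (g a)) := by
  unfold fieldZ; fun_prop

@[fun_prop]
lemma measurable_extKer {α : Type*} [MeasurableSpace α] (s : ℝ) {f : α → Eucl n} {g : α → ℝ}
    (hf : Measurable f) (hg : Measurable g) : Measurable (fun a => extKer s (f a) (g a)) := by
  unfold extKer; fun_prop

@[fun_prop]
lemma measurable_decay {α : Type*} [MeasurableSpace α] (s : ℝ) {f : α → Eucl n} {g : α → ℝ}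
    (hf : Measurable f) (hg : Measurable g) : Measurable (fun a => decay s (f a) (g a)) := by
  unfold decay; fun_prop

lemma integrable_fieldX {s : ℝ} (hs : 0 < s) {z : ℝ} (hz : z ≠ 0) :
    Integrable (fun x : Eucl n => fieldX s x z) :=
  ((integrable_decay hs hz).const_mul _).mono'
    (Measurable.aestronglyMeasurable (by fun_prop))
    (Eventually.of_forall fun x => norm_fieldX_le hs.le x hz)

lemma integrable_fieldZ {s : ℝ} (hs : 0 < s) {z : ℝ} (hz : z ≠ 0) :
    Integrable (fun x : Eucl n => fieldZ s x z) :=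
  ((integrable_decay hs hz).const_mul _).mono'
    (Measurable.aestronglyMeasurable (by fun_prop))
    (Eventually.of_forall fun x => abs_fieldZ_le hs.le x hz)

lemma fieldX_neg (s : ℝ) (x : Eucl n) (z : ℝ) : fieldX s (-x) z = -fieldX s x z := by
  simp [fieldX]

lemma fieldZ_neg (s : ℝ) (x : Eucl n) (z : ℝ) : fieldZ s (-x) z = fieldZ s x z := by
  simp [fieldZ]

lemma integral_fieldX (s : ℝ) (z : ℝ) : ∫ x : Eucl n, fieldX s x z = 0 := by
  have := integral_neg_eq_self (fun x : Eucl n => fieldX s x z) volume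
  simp_rw [fieldX_neg, integral_neg] at this
  have h : (2 : ℝ) • ∫ x : Eucl n, fieldX s x z = 0 := by
    rw [two_smul]; nth_rewrite 1 [← this]; simp
  exact (smul_eq_zero.1 h).resolve_left two_ne_zero

/-- Morally the `z`-derivative of the constant mass of `extKer`; in formulas, the recursion
`integral_one_add_norm_sq_rpow_succ`. The vanishing allows `u y` to be replaced by `u y - u x` in
every integral against the field. -/
lemma integral_fieldZ {s : ℝ} (hs : 0 < s) {z : ℝ} (hz : z ≠ 0) :
    ∫ x : Eucl n, fieldZ s x z = 0 := by
  set p : ℝ := (n : ℝ) + 2 * s with hp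
  have hnp : (n : ℝ) < p := by linarith
  have h1 : ∀ x : Eucl n, fieldZ s x z = 2 * s * (‖x‖ ^ 2 + z ^ 2) ^ (-(p / 2)) -
      p * z ^ 2 * (‖x‖ ^ 2 + z ^ 2) ^ (-((p + 2) / 2)) := by
    intro x
    rw [← rpow_succ_mul (norm_sq_add_sq_pos hz x) (p / 2), show (p + 2) / 2 = p / 2 + 1 by ring]
    unfold fieldZ; rw [← hp]
    ring
  simp_rw [h1]
  rw [integral_sub ((integrable_norm_sq_add_rpow hnp hz).const_mul _)
    ((integrable_norm_sq_add_rpow (by linarith) hz).const_mul _), integral_const_mul,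
    integral_const_mul, integral_norm_sq_add_rpow _ hz, integral_norm_sq_add_rpow _ hz]
  have h2 := integral_one_add_norm_sq_rpow_succ hnp
  have h3 : |z| ^ ((n : ℝ) - p) = z ^ 2 * |z| ^ ((n : ℝ) - (p + 2)) := by
    rw [← sq_abs z, ← Real.rpow_natCast |z| 2, ← Real.rpow_add (abs_pos.2 hz)]
    congr 1; push_cast; ring
  rw [h3]
  have h4 : 2 * s = p - n := by rw [hp]; ring
  rw [h4]
  linear_combination -(z ^ 2 * |z| ^ ((n : ℝ) - (p + 2))) * h2

/-- On `{|x| ≤ M, |z| ≥ ε}` the decay factor is controlled by the weight `(1 + |y|²)^(-(n+2s)/2)`. -/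
lemma exists_decay_le {s : ℝ} (hs : 0 ≤ s) (M : ℝ) {ε : ℝ} (hε : 0 < ε) :
    ∃ C : ℝ, 0 < C ∧ ∀ (x y : Eucl n) (z : ℝ), ‖x‖ ≤ M → ε ≤ |z| →
      decay s (x - y) z ≤ C * decay s y 1 := by
  set p : ℝ := (n : ℝ) + 2 * s with hp
  have hn : (0 : ℝ) ≤ n := n.cast_nonneg
  -- `A` is chosen so that `‖y‖² + 1 ≤ A (‖x - y‖² + z²)`, from `‖y‖² ≤ 2M² + 2‖x - y‖²` and `1 +
  -- 2M² ≤ (1 + 2M²) z²/ε²`.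
  set A : ℝ := (1 + 2 * M ^ 2) / ε ^ 2 + 2 with hA
  have hA0 : 0 < A := by positivity
  refine ⟨A ^ (p / 2), by positivity, fun x y z hx hz => ?_⟩
  have hz0 : 0 < z ^ 2 := by rw [← sq_abs]; have : 0 < |z| := hε.trans_le hz; positivity
  have hz2 : ε ^ 2 ≤ z ^ 2 := by rw [← sq_abs z]; gcongr
  have h1 : ‖y‖ ^ 2 + 1 ^ 2 ≤ A * (‖x - y‖ ^ 2 + z ^ 2) := by
    have h2 : ‖y‖ ≤ ‖x‖ + ‖x - y‖ := by
      have := norm_sub_le x (x - y); simpa using this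
    have h3 : ‖y‖ ^ 2 ≤ 2 * ‖x‖ ^ 2 + 2 * ‖x - y‖ ^ 2 := by
      nlinarith [norm_nonneg y, norm_nonneg x, norm_nonneg (x - y), sq_nonneg (‖x‖ - ‖x - y‖)]
    have h4 : ‖x‖ ^ 2 ≤ M ^ 2 := by gcongr
    have h5 : 1 + 2 * M ^ 2 ≤ (1 + 2 * M ^ 2) / ε ^ 2 * z ^ 2 := by
      rw [div_mul_eq_mul_div, le_div_iff₀ (by positivity)]; gcongr
    have h6 : 0 ≤ (1 + 2 * M ^ 2) / ε ^ 2 * ‖x - y‖ ^ 2 := by positivity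
    rw [hA]; nlinarith
  unfold decay
  rw [← hp]
  have h7 : (A * (‖x - y‖ ^ 2 + z ^ 2)) ^ (-(p / 2)) ≤ (‖y‖ ^ 2 + 1 ^ 2) ^ (-(p / 2)) :=
    Real.rpow_le_rpow_of_nonpos (by positivity) h1 (by rw [hp]; linarith)
  rw [Real.mul_rpow hA0.le (by positivity)] at h7
  calc (‖x - y‖ ^ 2 + z ^ 2) ^ (-(p / 2))
      = A ^ (p / 2) * (A ^ (-(p / 2)) * (‖x - y‖ ^ 2 + z ^ 2) ^ (-(p / 2))) := by
        rw [← mul_assoc, ← Real.rpow_add hA0]; simp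
    _ ≤ _ := by gcongr

/-! ### Continuity of translations in `Lᵖ` -/

section Translation

variable {G E : Type*} [NormedAddCommGroup G] [MeasurableSpace G] [BorelSpace G]
  [NormedAddCommGroup E] {μ : Measure G} [IsLocallyFiniteMeasure μ] [μ.InnerRegularCompactLTTop]
  [μ.IsAddLeftInvariant]

/-- Continuity of translations in `Lᵖ`, at the origin. -/
lemma tendsto_eLpNorm_translate_sub {p : ℝ≥0∞} (hp1 : 1 ≤ p) (hp : p ≠ ⊤) {f : G → E}
    (hf : MemLp f p μ) :
    Tendsto (fun t => eLpNorm (fun x => f (t + x) - f x) p μ) (𝓝 0) (𝓝 0) := by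
  have : Fact (1 ≤ p) := ⟨hp1⟩
  have : Fact (p ≠ ⊤) := ⟨hp⟩
  -- Translations act on `Lᵖ` through the domain action `DomAddAct`, which is continuous in the
  -- translation vector.
  have hc : Continuous fun t : G => DomAddAct.mk t +ᵥ hf.toLp f := by
    have h1 : Continuous fun t : G => (DomAddAct.mk t : Gᵈᵃᵃ) := DomAddAct.continuous_mk
    exact h1.vadd continuous_const
  have h2 : Tendsto (fun t : G => edist (DomAddAct.mk t +ᵥ hf.toLp f) (hf.toLp f)) (𝓝 0) (𝓝 0) := by
    have h3 : Continuous fun t : G => edist (DomAddAct.mk t +ᵥ hf.toLp f) (hf.toLp f) :=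
      hc.edist continuous_const
    have h4 := h3.tendsto 0
    simpa using h4
  refine h2.congr fun t => ?_
  rw [DomAddAct.mk_vadd_toLp, Lp.edist_toLp_toLp]
  rfl

end Translation

/-! ### Finite Gagliardo energy makes `u` integrable against the decay of the kernel -/

lemma measurableSet_crossSet {B : Set (Eucl n)} (hB : MeasurableSet B) :
    MeasurableSet (crossSet B) := by
  unfold crossSet
  exact ((hB.prod hB).union (hB.compl.prod hB)).union (hB.prod hB.compl)

/-- The integral of `|u x - u y|² / |x - y|^(n+2s)` in `y` alone. -/
def gagAt (s : ℝ) (u : Eucl n → ℝ) (x : Eucl n) : ℝ≥0∞ :=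
  ∫⁻ y, ENNReal.ofReal (|u x - u y| ^ 2 / ‖x - y‖ ^ ((n : ℝ) + 2 * s))

lemma measurable_gagAt (s : ℝ) {u : Eucl n → ℝ} (hu : Measurable u) : Measurable (gagAt s u) := by
  unfold gagAt
  apply Measurable.lintegral_prod_right'
    (f := fun q : Eucl n × Eucl n => ENNReal.ofReal (|u q.1 - u q.2| ^ 2 / ‖q.1 - q.2‖ ^ ((n : ℝ) + 2 * s)))
  fun_prop

lemma setLIntegral_gagAt_le (s : ℝ) {u : Eucl n → ℝ} (hu : Measurable u) (B : Set (Eucl n)) :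
    ∫⁻ x in B, gagAt s u x ≤ gagliardo s (crossSet B) u := by
  unfold gagliardo gagAt
  have h1 : B ×ˢ (univ : Set (Eucl n)) ⊆ crossSet B := by
    rintro ⟨x, y⟩ ⟨hx, -⟩
    by_cases hy : y ∈ B
    · exact Or.inl (Or.inl ⟨hx, hy⟩)
    · exact Or.inr ⟨hx, hy⟩
  refine le_trans (le_of_eq ?_) (lintegral_mono_set h1)
  rw [Measure.volume_eq_prod, ← Measure.prod_restrict, Measure.restrict_univ]
  rw [lintegral_prod _ (by fun_prop)]

/-- Rests on `‖x - y‖² ≤ 2 (1 + ‖x‖²)(1 + ‖y‖²)`. It carries integrability from the singular kernel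
centred at `x` over to the weight centred at the origin. -/
lemma decay_one_le {s : ℝ} (hs : 0 ≤ s) (x y : Eucl n) (hxy : x ≠ y) :
    decay s y 1 ≤ (2 * (1 + ‖x‖ ^ 2)) ^ (((n : ℝ) + 2 * s) / 2) * (1 / ‖x - y‖ ^ ((n : ℝ) + 2 * s)) := by
  set p : ℝ := (n : ℝ) + 2 * s with hp
  have hn : (0 : ℝ) ≤ n := n.cast_nonneg
  have hd : 0 < ‖x - y‖ := norm_pos_iff.2 (sub_ne_zero.2 hxy)
  set A : ℝ := 2 * (1 + ‖x‖ ^ 2) with hA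
  have hA0 : 0 < A := by positivity
  have h1 : ‖x - y‖ ^ 2 / A ≤ ‖y‖ ^ 2 + 1 ^ 2 := by
    rw [div_le_iff₀ hA0]
    have h2 := norm_sub_le x y
    have h3 : ‖x - y‖ ^ 2 ≤ (‖x‖ + ‖y‖) ^ 2 := by gcongr
    nlinarith [sq_nonneg (‖x‖ - ‖y‖), sq_nonneg (‖x‖ * ‖y‖), sq_nonneg ‖x‖, sq_nonneg ‖y‖]
  have h2 := Real.rpow_le_rpow_of_nonpos (by positivity) h1 (show -(p / 2) ≤ 0 by rw [hp]; linarith)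
  unfold decay
  rw [← hp]
  refine h2.trans (le_of_eq ?_)
  rw [Real.div_rpow (by positivity) hA0.le, ← Real.rpow_natCast ‖x - y‖ 2, ← Real.rpow_mul hd.le,
    Real.rpow_neg hA0.le, div_inv_eq_mul, one_div, ← Real.rpow_neg hd.le, mul_comm]
  congr 2; push_cast; ring

/-- A single point `x` with finite inner integral suffices, because `|t| ≤ t² + 1` bounds `|u y|` by
`|u x - u y|² + 1 + |u x|`. The excluded point `y = x` is null since `n ≥ 1`. -/
lemma integrable_mul_decay_of_gagAt {s : ℝ} (hs : 0 < s) {u : Eucl n → ℝ} (hu : Measurable u)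
    {x : Eucl n} (hn : 1 ≤ n) (hx : gagAt s u x < ⊤) : Integrable fun y => u y * decay s y 1 := by
  have : Nonempty (Fin n) := ⟨⟨0, hn⟩⟩
  set A : ℝ := (2 * (1 + ‖x‖ ^ 2)) ^ (((n : ℝ) + 2 * s) / 2) with hA
  have h1 : Integrable fun y => |u x - u y| ^ 2 / ‖x - y‖ ^ ((n : ℝ) + 2 * s) := by
    refine ⟨Measurable.aestronglyMeasurable (by fun_prop), ?_⟩
    rw [hasFiniteIntegral_iff_ofReal (Eventually.of_forall fun y => by positivity)]
    exact hx
  have h2 : Integrable fun y : Eucl n => decay s y 1 := integrable_decay hs one_ne_zero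
  refine ((h1.const_mul A).add (h2.const_mul (1 + |u x|))).mono'
    (Measurable.aestronglyMeasurable (by fun_prop)) ?_
  have h3 : ∀ᵐ y : Eucl n, y ≠ x := by
    rw [ae_iff]; simp
  filter_upwards [h3] with y hy
  have h4 := decay_one_le hs.le x y (Ne.symm hy)
  have h5 := decay_nonneg s y 1
  have h6 : |u y| ≤ |u x - u y| ^ 2 + 1 + |u x| := by
    have := abs_sub_abs_le_abs_sub (u y) (u x)
    rw [abs_sub_comm (u y)] at this
    nlinarith [sq_nonneg (|u x - u y| - 1), abs_nonneg (u x - u y)]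
  rw [Real.norm_eq_abs, abs_mul, abs_of_nonneg h5]
  calc |u y| * decay s y 1 ≤ (|u x - u y| ^ 2 + 1 + |u x|) * decay s y 1 := by gcongr
    _ = |u x - u y| ^ 2 * decay s y 1 + (1 + |u x|) * decay s y 1 := by ring
    _ ≤ |u x - u y| ^ 2 * (A * (1 / ‖x - y‖ ^ ((n : ℝ) + 2 * s))) + (1 + |u x|) * decay s y 1 := by
        gcongr
    _ = _ := by simp only [Pi.add_apply]; ring

/-- Finite energy makes `gagAt` finite almost everywhere on `B`, hence at some point. This is what
makes the integral defining the extension of a minimizer converge. -/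
lemma integrable_mul_decay {s : ℝ} (hs : 0 < s) {u : Eucl n → ℝ} (hu : Measurable u)
    (hn : 1 ≤ n) {B : Set (Eucl n)} (hB0 : volume B ≠ 0)
    (hfin : gagliardo s (crossSet B) u < ⊤) : Integrable fun y => u y * decay s y 1 := by
  have h1 := (setLIntegral_gagAt_le s hu B).trans_lt hfin
  have h2 := ae_lt_top (measurable_gagAt s hu) h1.ne
  have : NeBot (ae (volume.restrict B)) := by
    rw [ae_neBot]; simpa using hB0
  obtain ⟨x, hx⟩ := h2.exists
  exact integrable_mul_decay_of_gagAt hs hu hn hx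

/-! ### Measurability, local bounds and boundary values of the extension -/

/-- Functions in the weighted space `L¹((1 + |y|²)^(-(n+2s)/2) dy)` are locally integrable. -/
lemma integrableOn_ball_of_decay {s : ℝ} (hs : 0 ≤ s) {u : Eucl n → ℝ}
    (hu : Integrable fun y => u y * decay s y 1) (hum : Measurable u) (R : ℝ) :
    IntegrableOn u (Metric.ball 0 R) := by
  have hn : (0 : ℝ) ≤ n := n.cast_nonneg
  set c : ℝ := (R ^ 2 + 1 ^ 2) ^ (-(((n : ℝ) + 2 * s) / 2)) with hc
  have hc0 : 0 < c := by positivity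
  refine Integrable.mono' ((hu.norm.const_mul c⁻¹).integrableOn (s := Metric.ball 0 R))
    hum.aestronglyMeasurable ?_
  refine (ae_restrict_iff' measurableSet_ball).2 (Eventually.of_forall fun y hy => ?_)
  have hy' : ‖y‖ < R := by simpa using hy
  have h1 : c ≤ decay s y 1 := by
    unfold decay
    apply Real.rpow_le_rpow_of_nonpos (by positivity) (by gcongr) (by linarith)
  rw [norm_mul, Real.norm_eq_abs (decay s y 1), abs_of_nonneg (decay_nonneg s y 1),
    ← div_eq_inv_mul, le_div_iff₀ hc0]
  gcongr

lemma measurable_extend (s : ℝ) {u : Eucl n → ℝ} (hu : Measurable u) : Measurable (extend s u) := by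
  have : Measurable fun q : (Eucl n × ℝ) × Eucl n => u q.2 * extKer s (q.1.1 - q.2) q.1.2 := by
    fun_prop
  have h2 := (this.stronglyMeasurable.integral_prod_right' (ν := volume)).measurable
  have h3 : extend s u = fun X => ∫ y, u y * extKer s (X.1 - y) X.2 := by
    funext X; exact extend_eq s u X
  rw [h3]; exact h2

lemma integrable_mul_decay_sub {s : ℝ} (hs : 0 ≤ s) {u : Eucl n → ℝ} (hum : Measurable u)
    (hu : Integrable fun y => u y * decay s y 1) (x : Eucl n) {z : ℝ} (hz : z ≠ 0) :
    Integrable fun y => u y * decay s (x - y) z := by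
  obtain ⟨C, hC, h⟩ := exists_decay_le (n := n) hs ‖x‖ (abs_pos.2 hz)
  refine (hu.norm.const_mul C).mono' (Measurable.aestronglyMeasurable (by fun_prop))
    (Eventually.of_forall fun y => ?_)
  rw [norm_mul, norm_mul, Real.norm_eq_abs (decay _ _ _), Real.norm_eq_abs (decay _ _ _),
    abs_of_nonneg (decay_nonneg _ _ _), abs_of_nonneg (decay_nonneg _ _ _)]
  have := h x y z le_rfl le_rfl
  calc ‖u y‖ * decay s (x - y) z ≤ ‖u y‖ * (C * decay s y 1) := by gcongr
    _ = _ := by ring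

lemma integrable_mul_extKer_sub {s : ℝ} (hs : 0 ≤ s) {u : Eucl n → ℝ} (hum : Measurable u)
    (hu : Integrable fun y => u y * decay s y 1) (x : Eucl n) {z : ℝ} (hz : z ≠ 0) :
    Integrable fun y => u y * extKer s (x - y) z := by
  refine ((integrable_mul_decay_sub hs hum hu x hz).const_mul (|z| ^ (2 * s))).congr
    (Eventually.of_forall fun y => ?_)
  simp only [extKer_eq]; ring

lemma exists_abs_extend_le {s : ℝ} (hs : 0 < s) {u : Eucl n → ℝ}
    (hu : Integrable fun y => u y * decay s y 1) (M : ℝ) {ε : ℝ} (hε : 0 < ε) :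
    ∃ C : ℝ, 0 ≤ C ∧ ∀ X : Eucl n × ℝ, ‖X.1‖ ≤ M → ε ≤ |X.2| → |X.2| ≤ M → |extend s u X| ≤ C := by
  obtain ⟨C, hC, h⟩ := exists_decay_le (n := n) hs.le M hε
  refine ⟨|∫ y, M ^ (2 * s) * (C * ‖u y * decay s y 1‖)|, abs_nonneg _, fun X h1 h2 h3 => ?_⟩
  have hM : 0 ≤ M := (norm_nonneg _).trans h1
  refine le_trans ?_ (le_abs_self _)
  rw [extend_eq, ← Real.norm_eq_abs]
  refine norm_integral_le_of_norm_le ((hu.norm.const_mul C).const_mul _) (Eventually.of_forall fun y => ?_)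
  have h4 := h X.1 y X.2 h1 h2
  rw [extKer_eq, norm_mul, norm_mul, norm_mul, Real.norm_eq_abs (decay _ _ _),
    Real.norm_eq_abs (decay _ _ _), abs_of_nonneg (decay_nonneg _ _ _),
    abs_of_nonneg (decay_nonneg _ _ _), Real.norm_of_nonneg (by positivity : 0 ≤ |X.2| ^ (2 * s))]
  have h6 := decay_nonneg s (X.1 - y) X.2
  have h5 : |X.2| ^ (2 * s) ≤ M ^ (2 * s) := Real.rpow_le_rpow (abs_nonneg _) h3 (by linarith)
  calc ‖u y‖ * (|X.2| ^ (2 * s) * decay s (X.1 - y) X.2)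
      ≤ ‖u y‖ * (M ^ (2 * s) * (C * decay s y 1)) := by gcongr
    _ = _ := by ring

lemma extKer_neg (s : ℝ) (x : Eucl n) (z : ℝ) : extKer s (-x) z = extKer s x z := by
  simp [extKer]

lemma extKer_neg_snd (s : ℝ) (x : Eucl n) (z : ℝ) : extKer s x (-z) = extKer s x z := by
  simp [extKer]

lemma decay_neg (s : ℝ) (x : Eucl n) (z : ℝ) : decay s (-x) z = decay s x z := by
  simp [decay]

lemma extend_neg_snd (s : ℝ) (u : Eucl n → ℝ) (x : Eucl n) (z : ℝ) :
    extend s u (x, -z) = extend s u (x, z) := by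
  simp [extend_eq, extKer_neg_snd]

/-- Away from the origin the decay factor is controlled by its value at height one. -/
lemma exists_decay_le_of_le_norm {s : ℝ} (hs : 0 ≤ s) {d : ℝ} (hd : 0 < d) :
    ∃ C : ℝ, 0 < C ∧ ∀ (x : Eucl n) (z : ℝ), d ≤ ‖x‖ → decay s x z ≤ C * decay s x 1 := by
  have hn : (0 : ℝ) ≤ n := n.cast_nonneg
  set p : ℝ := (n : ℝ) + 2 * s with hp
  set A : ℝ := 1 + 1 / d ^ 2 with hA
  have hA0 : 0 < A := by positivity
  refine ⟨A ^ (p / 2), by positivity, fun x z hx => ?_⟩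
  have h0 : 0 < ‖x‖ := hd.trans_le hx
  have h1 : ‖x‖ ^ 2 + 1 ^ 2 ≤ A * (‖x‖ ^ 2 + z ^ 2) := by
    have h2 : 1 ≤ 1 / d ^ 2 * ‖x‖ ^ 2 := by
      rw [one_div_mul_eq_div, le_div_iff₀ (by positivity), one_mul]; gcongr
    have h3 : 0 ≤ A * z ^ 2 := by positivity
    rw [hA] at *; nlinarith
  unfold decay
  rw [← hp]
  have h7 : (A * (‖x‖ ^ 2 + z ^ 2)) ^ (-(p / 2)) ≤ (‖x‖ ^ 2 + 1 ^ 2) ^ (-(p / 2)) :=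
    Real.rpow_le_rpow_of_nonpos (by positivity) h1 (by rw [hp]; linarith)
  rw [Real.mul_rpow hA0.le (by positivity)] at h7
  calc (‖x‖ ^ 2 + z ^ 2) ^ (-(p / 2))
      = A ^ (p / 2) * (A ^ (-(p / 2)) * (‖x‖ ^ 2 + z ^ 2) ^ (-(p / 2))) := by
        rw [← mul_assoc, ← Real.rpow_add hA0]; simp
    _ ≤ _ := by gcongr

/-- As the kernel has mass `κ` at every height, the boundary error is an average of translation
differences of `u`. -/
lemma extend_sub_kernelMass_mul {s : ℝ} (hs : 0 < s) {u : Eucl n → ℝ} (hum : Measurable u)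
    (hu : Integrable fun y => u y * decay s y 1) (x : Eucl n) {z : ℝ} (hz : z ≠ 0) :
    extend s u (x, z) - kernelMass n s * u x = ∫ t, (u (x + t) - u x) * extKer s t z := by
  have h1 := integrable_mul_extKer_sub hs.le hum hu x hz
  have h2 : Integrable fun y => extKer s (x - y) z := (integrable_extKer hs hz).comp_sub_left x
  have h3 : ∫ y, extKer s (x - y) z = kernelMass n s := by
    rw [integral_sub_left_eq_self (fun y => extKer s y z) volume x, integral_extKer hz]
  rw [extend_eq, ← h3, mul_comm _ (u x), ← integral_const_mul,
    ← integral_sub h1 (h2.const_mul _), ← integral_add_left_eq_self _ x]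
  refine integral_congr_ae (Eventually.of_forall fun t => ?_)
  simp only [sub_add_cancel_left, extKer_neg]; ring

/-- Controls large translations, which continuity of translations does not see, in
`tendsto_lintegral_extend_sub`. -/
lemma setLIntegral_translate_lt_top {s : ℝ} (hs : 0 < s) {u : Eucl n → ℝ} (hum : Measurable u)
    (hu : Integrable fun y => u y * decay s y 1) (R : ℝ) :
    ∫⁻ x in Metric.ball (0 : Eucl n) R, ∫⁻ t, ‖u (x + t) - u x‖ₑ * ENNReal.ofReal (decay s t 1) < ⊤ := by
  obtain ⟨C, hC, h⟩ := exists_decay_le (n := n) hs.le R one_pos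
  set I : ℝ≥0∞ := ∫⁻ y, ‖u y * decay s y 1‖ₑ with hI
  set J : ℝ≥0∞ := ∫⁻ y : Eucl n, ENNReal.ofReal (decay s y 1) with hJ
  have hI' : I < ⊤ := hu.2
  have hJ' : J < ⊤ := by
    have := (integrable_decay (n := n) hs one_ne_zero).2
    rwa [hasFiniteIntegral_iff_ofReal (Eventually.of_forall fun y => decay_nonneg s y 1)] at this
  have hu1 : ∫⁻ x in Metric.ball (0 : Eucl n) R, ‖u x‖ₑ < ⊤ := (integrableOn_ball_of_decay hs.le hu hum R).2
  have hpt : ∀ x ∈ Metric.ball (0 : Eucl n) R,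
      ∫⁻ t, ‖u (x + t) - u x‖ₑ * ENNReal.ofReal (decay s t 1) ≤ ENNReal.ofReal C * I + ‖u x‖ₑ * J := by
    intro x hx
    have hx' : ‖x‖ ≤ R := by simpa using (Metric.mem_ball.1 hx).le
    calc ∫⁻ t, ‖u (x + t) - u x‖ₑ * ENNReal.ofReal (decay s t 1)
        ≤ ∫⁻ t, (‖u (x + t)‖ₑ * ENNReal.ofReal (decay s t 1) + ‖u x‖ₑ * ENNReal.ofReal (decay s t 1)) := by
          refine lintegral_mono fun t => ?_
          rw [← add_mul]; gcongr; exact enorm_sub_le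
      _ = (∫⁻ t, ‖u (x + t)‖ₑ * ENNReal.ofReal (decay s t 1)) + ‖u x‖ₑ * J := by
          rw [lintegral_add_right _ (by fun_prop), lintegral_const_mul _ (by fun_prop)]
      _ ≤ _ := by
          gcongr
          have h1 : ∫⁻ t, ‖u (x + t)‖ₑ * ENNReal.ofReal (decay s t 1) =
              ∫⁻ y, ‖u y‖ₑ * ENNReal.ofReal (decay s (x - y) 1) := by
            rw [← lintegral_add_left_eq_self (fun y => ‖u y‖ₑ * ENNReal.ofReal (decay s (x - y) 1)) x]
            refine lintegral_congr fun t => ?_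
            rw [sub_add_cancel_left, decay_neg]
          rw [h1, hI, ← lintegral_const_mul _ (by fun_prop)]
          refine lintegral_mono fun y => ?_
          rw [enorm_mul, Real.enorm_of_nonneg (decay_nonneg s y 1)]
          calc ‖u y‖ₑ * ENNReal.ofReal (decay s (x - y) 1)
              ≤ ‖u y‖ₑ * ENNReal.ofReal (C * decay s y 1) := by
                gcongr; exact h x y 1 hx' (by simp)
            _ = _ := by rw [ENNReal.ofReal_mul hC.le]; ring
  calc _ ≤ ∫⁻ x in Metric.ball (0 : Eucl n) R, (ENNReal.ofReal C * I + ‖u x‖ₑ * J) :=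
        setLIntegral_mono (by fun_prop) hpt
    _ < ⊤ := by
        rw [lintegral_add_left (by fun_prop), setLIntegral_const, lintegral_mul_const _ (by fun_prop)]
        exact ENNReal.add_lt_top.2 ⟨ENNReal.mul_lt_top (ENNReal.mul_lt_top ENNReal.ofReal_lt_top hI')
          measure_ball_lt_top, ENNReal.mul_lt_top hu1 hJ'⟩

/-- The extension attains the boundary values `kernelMass • u` in `L¹_loc`. -/
lemma tendsto_lintegral_extend_sub {s : ℝ} (hs : 0 < s) {u : Eucl n → ℝ} (hum : Measurable u)
    (hu : Integrable fun y => u y * decay s y 1) (R : ℝ) :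
    Tendsto (fun z => ∫⁻ x in Metric.ball (0 : Eucl n) R, ‖extend s u (x, z) - kernelMass n s * u x‖ₑ)
      (𝓝[≠] 0) (𝓝 0) := by
  have hκ := kernelMass_pos (n := n) hs
  -- The cut at radius `R + 1` puts `u` in `L¹` and is invisible on the ball of radius `R` for
  -- translations shorter than one.
  set ut : Eucl n → ℝ := (Metric.ball (0 : Eucl n) (R + 1)).indicator u with hut
  have hmem : MemLp ut 1 volume := by
    rw [memLp_one_iff_integrable, hut, integrable_indicator_iff measurableSet_ball]
    exact integrableOn_ball_of_decay hs.le hu hum _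
  have htr := tendsto_eLpNorm_translate_sub le_rfl ENNReal.one_ne_top hmem
  set Ω : Eucl n → ℝ≥0∞ := fun t => ∫⁻ x in Metric.ball (0 : Eucl n) R, ‖u (x + t) - u x‖ₑ with hΩ
  have hΩm : Measurable Ω := by
    apply Measurable.lintegral_prod_right' (f := fun q : Eucl n × Eucl n => ‖u (q.2 + q.1) - u q.2‖ₑ)
    fun_prop
  have hΩle : ∀ t : Eucl n, ‖t‖ < 1 → Ω t ≤ eLpNorm (fun x => ut (t + x) - ut x) 1 volume := by
    intro t ht
    rw [eLpNorm_one_eq_lintegral_enorm]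
    refine le_trans (le_of_eq ?_) (setLIntegral_le_lintegral (Metric.ball (0 : Eucl n) R) _)
    refine setLIntegral_congr_fun measurableSet_ball fun x hx => ?_
    have hx' : ‖x‖ < R := by simpa using hx
    have h1 : x ∈ Metric.ball (0 : Eucl n) (R + 1) := by simp; linarith
    have h2 : x + t ∈ Metric.ball (0 : Eucl n) (R + 1) := by
      have := norm_add_le x t
      simp; linarith
    simp only [hut]
    rw [add_comm t x, indicator_of_mem h1, indicator_of_mem h2]
  have hΩfin : ∫⁻ t, Ω t * ENNReal.ofReal (decay s t 1) < ⊤ := by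
    have h1 := setLIntegral_translate_lt_top hs hum hu R
    rw [lintegral_lintegral_swap (by fun_prop)] at h1
    convert h1 using 3 with t
    rw [lintegral_mul_const _ (by fun_prop)]
  have hmain : ∀ z : ℝ, z ≠ 0 →
      ∫⁻ x in Metric.ball (0 : Eucl n) R, ‖extend s u (x, z) - kernelMass n s * u x‖ₑ ≤
        ∫⁻ t, Ω t * ENNReal.ofReal (extKer s t z) := by
    intro z hz
    calc _ ≤ ∫⁻ x in Metric.ball (0 : Eucl n) R, ∫⁻ t, ‖u (x + t) - u x‖ₑ * ENNReal.ofReal (extKer s t z) := by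
          refine lintegral_mono fun x => ?_
          simp only
          rw [extend_sub_kernelMass_mul hs hum hu x hz]
          refine (enorm_integral_le_lintegral_enorm _).trans (lintegral_mono fun t => ?_)
          rw [enorm_mul, Real.enorm_of_nonneg (extKer_nonneg s t z)]
      _ = _ := by
          rw [lintegral_lintegral_swap (by fun_prop)]
          refine lintegral_congr fun t => ?_
          rw [lintegral_mul_const _ (by fun_prop)]
  have hK : ∀ z : ℝ, z ≠ 0 → ∫⁻ t : Eucl n, ENNReal.ofReal (extKer s t z) = ENNReal.ofReal (kernelMass n s) := by
    intro z hz
    rw [← ofReal_integral_eq_lintegral_ofReal (integrable_extKer hs hz)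
      (Eventually.of_forall fun t => extKer_nonneg s t z), integral_extKer hz]
  rw [ENNReal.tendsto_nhds_zero]
  intro ε hε
  obtain ⟨η, hη0, hη⟩ : ∃ η : ℝ≥0∞, 0 < η ∧ η * ENNReal.ofReal (kernelMass n s) ≤ ε / 2 := by
    refine ⟨ε / 2 / ENNReal.ofReal (kernelMass n s), ENNReal.div_pos (ENNReal.div_pos hε.ne' (by simp)).ne' (by simp), ?_⟩
    rw [ENNReal.div_mul_cancel (by simpa using hκ) (by simp)]
  obtain ⟨d, hd0, hd⟩ : ∃ d : ℝ, 0 < d ∧ ∀ t : Eucl n, ‖t‖ < d → Ω t ≤ η := by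
    have h1 := ENNReal.tendsto_nhds_zero.1 htr η hη0
    obtain ⟨d, hd0, hd⟩ := Metric.eventually_nhds_iff.1 h1
    refine ⟨min d 1, by positivity, fun t ht => ?_⟩
    exact (hΩle t (ht.trans_le (min_le_right _ _))).trans (hd (by simpa using ht.trans_le (min_le_left _ _)))
  obtain ⟨C, hC, hCle⟩ := exists_decay_le_of_le_norm (n := n) hs.le hd0
  set I : ℝ≥0∞ := ∫⁻ t, Ω t * ENNReal.ofReal (decay s t 1) with hI
  have hsmall : ∀ᶠ z : ℝ in 𝓝[≠] 0, ENNReal.ofReal (|z| ^ (2 * s) * C) * I ≤ ε / 2 := by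
    have h1 : Tendsto (fun z : ℝ => ENNReal.ofReal (|z| ^ (2 * s) * C) * I) (𝓝 0) (𝓝 0) := by
      have h2 : Continuous fun z : ℝ => |z| ^ (2 * s) * C :=
        (continuous_abs.rpow_const fun z => Or.inr (by positivity)).mul_const C
      have h3 := (ENNReal.continuous_ofReal.comp h2).tendsto 0
      have h4 := ENNReal.Tendsto.mul_const h3 (Or.inr hΩfin.ne)
      simpa [Real.zero_rpow (by positivity : 2 * s ≠ 0)] using h4
    exact (ENNReal.tendsto_nhds_zero.1 h1 (ε / 2) (ENNReal.div_pos hε.ne' (by simp))).filter_mono nhdsWithin_le_nhds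
  filter_upwards [hsmall, self_mem_nhdsWithin] with z hz1 hz
  refine (hmain z hz).trans ?_
  -- For `‖t‖ < d` the translation modulus `Ω` is at most `η` and the kernel has mass `κ`. For `‖t‖
  -- ≥ d` the kernel is at most `C |z|^(2s)` times the decay at height one, against which `Ω` is
  -- integrable.
  calc ∫⁻ t, Ω t * ENNReal.ofReal (extKer s t z)
      ≤ ∫⁻ t, (η * ENNReal.ofReal (extKer s t z) +
          ENNReal.ofReal (|z| ^ (2 * s) * C) * (Ω t * ENNReal.ofReal (decay s t 1))) := by
        refine lintegral_mono fun t => ?_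
        simp only
        by_cases ht : ‖t‖ < d
        · refine le_trans ?_ le_self_add
          gcongr; exact hd t ht
        · refine le_trans ?_ le_add_self
          rw [mul_left_comm, ← ENNReal.ofReal_mul (by positivity)]
          gcongr
          rw [extKer_eq, mul_assoc]
          gcongr; exact hCle t z (not_lt.1 ht)
    _ = η * ENNReal.ofReal (kernelMass n s) + ENNReal.ofReal (|z| ^ (2 * s) * C) * I := by
        rw [lintegral_add_left (by fun_prop), lintegral_const_mul _ (by fun_prop),
          lintegral_const_mul _ (by fun_prop), hK z hz]
    _ ≤ ε / 2 + ε / 2 := by gcongr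
    _ = ε := ENNReal.add_halves ε

/-- The extension is locally integrable in `ℝⁿ⁺¹`. -/
lemma locallyIntegrable_extend {s : ℝ} (hs : 0 < s) {u : Eucl n → ℝ} (hum : Measurable u)
    (hu : Integrable fun y => u y * decay s y 1) : LocallyIntegrable (extend s u) := by
  have hm := measurable_extend s hum
  have key : ∀ R : ℝ, 0 < R → IntegrableOn (extend s u) (Metric.ball (0 : Eucl n) R ×ˢ Ioo (-R) R) := by
    intro R hR
    have h1 := ENNReal.tendsto_nhds_zero.1 (tendsto_lintegral_extend_sub hs hum hu R) 1 one_pos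
    rw [eventually_nhdsWithin_iff, Metric.eventually_nhds_iff] at h1
    obtain ⟨d, hd0, hd⟩ := h1
    obtain ⟨C, hC0, hC⟩ := exists_abs_extend_le hs hu R (ε := min d R) (by positivity)
    refine ⟨hm.aestronglyMeasurable, ?_⟩
    unfold HasFiniteIntegral
    rw [Measure.volume_eq_prod, ← Measure.prod_restrict, lintegral_prod_symm _ (by fun_prop)]
    have hu1 : ∫⁻ x in Metric.ball (0 : Eucl n) R, ‖kernelMass n s * u x‖ₑ < ⊤ :=
      ((integrableOn_ball_of_decay hs.le hu hum R).const_mul _).2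
    set A := ∫⁻ x in Metric.ball (0 : Eucl n) R, ‖kernelMass n s * u x‖ₑ
    -- Slices with `|z| < d` are controlled by the `L¹` convergence to the boundary values, the
    -- others by the pointwise bound away from `z = 0`.
    have hb : ∀ z ∈ Ioo (-R) R, z ≠ 0 → ∫⁻ x in Metric.ball (0 : Eucl n) R, ‖extend s u (x, z)‖ₑ ≤
        (1 + A) + ENNReal.ofReal C * volume (Metric.ball (0 : Eucl n) R) := by
      intro z hz hz0
      by_cases hzd : |z| < d
      · refine le_trans ?_ le_self_add
        calc _ ≤ ∫⁻ x in Metric.ball (0 : Eucl n) R,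
              (‖extend s u (x, z) - kernelMass n s * u x‖ₑ + ‖kernelMass n s * u x‖ₑ) := by
              refine lintegral_mono fun x => ?_
              have := enorm_add_le (extend s u (x, z) - kernelMass n s * u x) (kernelMass n s * u x)
              simpa using this
          _ ≤ 1 + A := by
              rw [lintegral_add_right _ (by fun_prop)]
              gcongr
              exact hd (by simpa using hzd) hz0
      · refine le_trans ?_ le_add_self
        rw [← setLIntegral_const]
        refine setLIntegral_mono (by fun_prop) fun x hx => ?_
        have hx' : ‖x‖ ≤ R := by simpa using (Metric.mem_ball.1 hx).le
        rw [← ofReal_norm, Real.norm_eq_abs]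
        exact ENNReal.ofReal_le_ofReal (hC (x, z) hx' ((min_le_left _ _).trans (not_lt.1 hzd))
          (abs_le.2 ⟨hz.1.le, hz.2.le⟩))
    have hae : ∀ᵐ z ∂volume.restrict (Ioo (-R) R), ∫⁻ x in Metric.ball (0 : Eucl n) R, ‖extend s u (x, z)‖ₑ ≤
        (1 + A) + ENNReal.ofReal C * volume (Metric.ball (0 : Eucl n) R) := by
      have h0 : ∀ᵐ z : ℝ, z ≠ 0 := by rw [ae_iff]; simp
      filter_upwards [ae_restrict_mem measurableSet_Ioo, ae_restrict_of_ae h0] with z hz hz0 using hb z hz hz0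
    refine (lintegral_mono_ae hae).trans_lt ?_
    rw [setLIntegral_const]
    refine ENNReal.mul_lt_top ?_ (by simp)
    exact ENNReal.add_lt_top.2 ⟨ENNReal.add_lt_top.2 ⟨by simp, hu1⟩,
      ENNReal.mul_lt_top (by simp) measure_ball_lt_top⟩
  intro X
  have hR : 0 < ‖X‖ + 1 := by positivity
  refine ⟨Metric.ball (0 : Eucl n) (‖X‖ + 1) ×ˢ Ioo (-(‖X‖ + 1)) (‖X‖ + 1), ?_, key _ hR⟩
  refine (Metric.isOpen_ball.prod isOpen_Ioo).mem_nhds ⟨?_, ?_⟩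
  · have := norm_fst_le X
    simp; linarith
  · have := norm_snd_le X
    rw [Real.norm_eq_abs] at this
    have := abs_le.1 this
    constructor <;> linarith [this.1, this.2]

/-! ### One-dimensional integrals of `|z|^(α-1) (ρ² + z²)^(-b)` -/

lemma integrable_of_even {f : ℝ → ℝ} (heven : ∀ x, f (-x) = f x)
    (hf : IntegrableOn f (Ioi 0)) : Integrable f := by
  rw [← integrableOn_univ, ← Iic_union_Ioi (a := (0 : ℝ)), integrableOn_union]
  refine ⟨?_, hf⟩
  rw [integrableOn_Iic_iff_integrableOn_Iio]
  have h1 : IntegrableOn (fun x => f (-x)) (Iio 0) := by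
    have := IntegrableOn.comp_neg_Iio (c := (0 : ℝ)) (f := f) (by simpa using hf)
    simpa using this
  simpa only [heven] using h1

/-- Integrability at the origin comes from `α > 0`, at infinity from `α < 2b`. -/
lemma integrable_abs_rpow_mul {α b : ℝ} (hα : 0 < α) (hb : α < 2 * b) :
    Integrable (fun t : ℝ => |t| ^ (α - 1) * (1 + t ^ 2) ^ (-b)) := by
  have hb0 : 0 < b := by linarith
  refine integrable_of_even (by simp) ?_
  rw [← Ioc_union_Ioi_eq_Ioi (zero_le_one (α := ℝ)), integrableOn_union]
  constructor
  · have h1 : IntegrableOn (fun t : ℝ => t ^ (α - 1)) (Ioc 0 1) := by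
      rw [← intervalIntegrable_iff_integrableOn_Ioc_of_le zero_le_one]
      exact intervalIntegral.intervalIntegrable_rpow' (by linarith)
    refine Integrable.mono' h1 (Measurable.aestronglyMeasurable (by fun_prop)) ?_
    refine (ae_restrict_iff' measurableSet_Ioc).2 (Eventually.of_forall fun t ht => ?_)
    rw [Real.norm_of_nonneg (by positivity), abs_of_pos ht.1]
    have : (1 + t ^ 2) ^ (-b) ≤ 1 :=
      Real.rpow_le_one_of_one_le_of_nonpos (by nlinarith [sq_nonneg t]) (by linarith)
    have h0 : 0 ≤ t ^ (α - 1) := Real.rpow_nonneg ht.1.le _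
    nlinarith
  · have h1 : IntegrableOn (fun t : ℝ => t ^ (α - 1 - 2 * b)) (Ioi 1) :=
      integrableOn_Ioi_rpow_of_lt (by linarith) one_pos
    refine Integrable.mono' h1 (Measurable.aestronglyMeasurable (by fun_prop)) ?_
    refine (ae_restrict_iff' measurableSet_Ioi).2 (Eventually.of_forall fun t ht => ?_)
    have ht0 : 0 < t := one_pos.trans ht
    rw [Real.norm_of_nonneg (by positivity), abs_of_pos ht0]
    have h2 : (1 + t ^ 2) ^ (-b) ≤ (t ^ 2) ^ (-b) :=
      Real.rpow_le_rpow_of_nonpos (by positivity) (by linarith) (by linarith)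
    have h3 : t ^ (α - 1 - 2 * b) = t ^ (α - 1) * (t ^ 2) ^ (-b) := by
      rw [← Real.rpow_natCast t 2, ← Real.rpow_mul ht0.le, ← Real.rpow_add ht0]
      congr 1; push_cast; ring
    rw [h3]; gcongr

/-- `∫ |z|^(α-1) (ρ² + z²)^(-b) dz` is a multiple of `ρ^(α - 2b)`. -/
lemma exists_lintegral_abs_rpow_mul {α b : ℝ} (hα : 0 < α) (hb : α < 2 * b) :
    ∃ C : ℝ, 0 ≤ C ∧ ∀ ρ : ℝ, 0 < ρ →
      ∫⁻ z : ℝ, ENNReal.ofReal (|z| ^ (α - 1) * (ρ ^ 2 + z ^ 2) ^ (-b)) ≤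
        ENNReal.ofReal (C * ρ ^ (α - 2 * b)) := by
  have h0 := integrable_abs_rpow_mul hα hb
  refine ⟨∫ t : ℝ, |t| ^ (α - 1) * (1 + t ^ 2) ^ (-b), integral_nonneg fun t => by positivity,
    fun ρ hρ => ?_⟩
  have h1 : ∀ z : ℝ, |z| ^ (α - 1) * (ρ ^ 2 + z ^ 2) ^ (-b) =
      ρ ^ (α - 1 - 2 * b) * (|ρ⁻¹ * z| ^ (α - 1) * (1 + (ρ⁻¹ * z) ^ 2) ^ (-b)) := by
    intro z
    have h2 : ρ ^ 2 + z ^ 2 = ρ ^ 2 * (1 + (ρ⁻¹ * z) ^ 2) := by field_simp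
    have h3 : |z| = ρ * |ρ⁻¹ * z| := by
      rw [abs_mul, abs_of_pos (inv_pos.2 hρ)]; field_simp
    have h4 : ρ ^ (α - 1 - 2 * b) = ρ ^ (α - 1) * (ρ ^ 2) ^ (-b) := by
      rw [← Real.rpow_natCast ρ 2, ← Real.rpow_mul hρ.le, ← Real.rpow_add hρ]
      congr 1; push_cast; ring
    rw [h2, Real.mul_rpow (by positivity) (by positivity), h4]
    nth_rewrite 1 [h3]
    rw [Real.mul_rpow hρ.le (abs_nonneg _)]; ring
  simp_rw [h1]
  have h5 := (h0.comp_mul_left' (inv_ne_zero hρ.ne')).const_mul (ρ ^ (α - 1 - 2 * b))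
  rw [← ofReal_integral_eq_lintegral_ofReal h5 (Eventually.of_forall fun z => by positivity),
    integral_const_mul, Measure.integral_comp_inv_mul_left
      (fun t => |t| ^ (α - 1) * (1 + t ^ 2) ^ (-b)), abs_of_pos hρ, smul_eq_mul]
  refine le_of_eq ?_
  congr 1
  have h6 : ρ ^ (α - 2 * b) = ρ ^ (α - 1 - 2 * b) * ρ := by
    rw [← Real.rpow_add_one hρ.ne']; congr 1; ring
  rw [h6]; ring

/-! ### The gradient of the extension and its weighted energy -/

/-- `ℝⁿ × ℝ` with its Euclidean norm. -/
abbrev EuclProd (n : ℕ) : Type := WithLp 2 (Eucl n × ℝ)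

/-- The field `sgn z |z|^(1-2s) ∇ extKer`. -/
def field (s : ℝ) (x : Eucl n) (z : ℝ) : EuclProd n := WithLp.toLp 2 (fieldX s x z, fieldZ s x z)

lemma norm_toLp_le (a : Eucl n) (b : ℝ) : ‖(WithLp.toLp 2 (a, b) : EuclProd n)‖ ≤ ‖a‖ + |b| := by
  have h := WithLp.prod_norm_sq_eq_of_L2 (WithLp.toLp 2 (a, b) : EuclProd n)
  simp only [WithLp.toLp_fst, WithLp.toLp_snd, Real.norm_eq_abs] at h
  nlinarith [norm_nonneg a, abs_nonneg b, norm_nonneg (WithLp.toLp 2 (a, b) : EuclProd n)]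

@[fun_prop]
lemma measurable_field {α : Type*} [MeasurableSpace α] (s : ℝ) {f : α → Eucl n} {g : α → ℝ}
    (hf : Measurable f) (hg : Measurable g) : Measurable (fun a => field s (f a) (g a)) := by
  unfold field
  exact (WithLp.measurable_toLp 2 _).comp (by fun_prop)

lemma norm_field_le {s : ℝ} (hs : 0 ≤ s) (x : Eucl n) {z : ℝ} (hz : z ≠ 0) :
    ‖field s x z‖ ≤ 2 * ((n : ℝ) + 2 * s) * decay s x z := by
  refine (norm_toLp_le _ _).trans ?_
  have h1 := norm_fieldX_le hs x hz
  have h2 := abs_fieldZ_le hs x hz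
  linarith

lemma integrable_field {s : ℝ} (hs : 0 < s) {z : ℝ} (hz : z ≠ 0) :
    Integrable (fun x : Eucl n => field s x z) :=
  ((integrable_decay hs hz).const_mul _).mono' (Measurable.aestronglyMeasurable (by fun_prop))
    (Eventually.of_forall fun x => norm_field_le hs.le x hz)

lemma integral_toLp {α : Type*} [MeasurableSpace α] {μ : Measure α} {f : α → Eucl n} {g : α → ℝ}
    (hf : Integrable f μ) (hg : Integrable g μ) :
    ∫ a, (WithLp.toLp 2 (f a, g a) : EuclProd n) ∂μ = WithLp.toLp 2 (∫ a, f a ∂μ, ∫ a, g a ∂μ) := by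
  rw [← integral_pair hf hg]
  exact ContinuousLinearMap.integral_comp_comm
    ((WithLp.prodContinuousLinearEquiv 2 ℝ (Eucl n) ℝ).symm : (Eucl n × ℝ) →L[ℝ] EuclProd n)
    (hf.prodMk hg)

lemma integral_field {s : ℝ} (hs : 0 < s) {z : ℝ} (hz : z ≠ 0) :
    ∫ x : Eucl n, field s x z = 0 := by
  unfold field
  rw [integral_toLp (integrable_fieldX hs hz) (integrable_fieldZ hs hz), integral_fieldX,
    integral_fieldZ hs hz]
  rfl

/-- The integral of the field against `u`; equals `sgn z |z|^(1-2s) ∇ (extend s u)`. -/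
def extField (s : ℝ) (u : Eucl n → ℝ) (X : Eucl n × ℝ) : EuclProd n :=
  ∫ y, u y • field s (X.1 - y) X.2

lemma measurable_extField (s : ℝ) {u : Eucl n → ℝ} (hu : Measurable u) :
    Measurable (extField s u) := by
  have : Measurable fun q : (Eucl n × ℝ) × Eucl n => u q.2 • field s (q.1.1 - q.2) q.1.2 := by
    fun_prop
  exact (this.stronglyMeasurable.integral_prod_right' (ν := volume)).measurable

lemma integrable_smul_field_sub {s : ℝ} (hs : 0 ≤ s) {u : Eucl n → ℝ} (hum : Measurable u)
    (hu : Integrable fun y => u y * decay s y 1) (x : Eucl n) {z : ℝ} (hz : z ≠ 0) :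
    Integrable fun y => u y • field s (x - y) z := by
  refine ((integrable_mul_decay_sub hs hum hu x hz).norm.const_mul (2 * ((n : ℝ) + 2 * s))).mono'
    (Measurable.aestronglyMeasurable (by fun_prop)) (Eventually.of_forall fun y => ?_)
  rw [norm_smul, norm_mul, Real.norm_of_nonneg (decay_nonneg s (x - y) z)]
  calc ‖u y‖ * ‖field s (x - y) z‖ ≤ ‖u y‖ * (2 * ((n : ℝ) + 2 * s) * decay s (x - y) z) := by
        gcongr; exact norm_field_le hs _ hz
    _ = _ := by ring

/-- The field has zero integral over horizontal slices, so `u x` can be subtracted. Only through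
these differences can the Gagliardo energy bound the gradient. -/
lemma extField_eq_sub {s : ℝ} (hs : 0 < s) {u : Eucl n → ℝ} (hum : Measurable u)
    (hu : Integrable fun y => u y * decay s y 1) (x : Eucl n) {z : ℝ} (hz : z ≠ 0) :
    extField s u (x, z) = ∫ y, (u y - u x) • field s (x - y) z := by
  have h1 := integrable_smul_field_sub hs.le hum hu x hz
  have h2 : Integrable fun y => field s (x - y) z := (integrable_field hs hz).comp_sub_left x
  have h3 : ∫ y, field s (x - y) z = 0 := by
    rw [integral_sub_left_eq_self (fun y => field s y z) volume x, integral_field hs hz]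
  have h4 : Integrable fun y => u x • field s (x - y) z := h2.smul (u x)
  simp_rw [sub_smul]
  rw [integral_sub h1 h4, integral_smul, h3, smul_zero, sub_zero]
  rfl

lemma exists_norm_extField_le {s : ℝ} (hs : 0 < s) {u : Eucl n → ℝ}
    (hu : Integrable fun y => u y * decay s y 1) (M : ℝ) {ε : ℝ} (hε : 0 < ε) :
    ∃ C : ℝ, 0 ≤ C ∧ ∀ X : Eucl n × ℝ, ‖X.1‖ ≤ M → ε ≤ |X.2| → ‖extField s u X‖ ≤ C := by
  have hn : (0 : ℝ) ≤ n := n.cast_nonneg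
  obtain ⟨C, hC, h⟩ := exists_decay_le (n := n) hs.le M hε
  refine ⟨∫ y, 2 * ((n : ℝ) + 2 * s) * (C * ‖u y * decay s y 1‖),
    integral_nonneg fun y => by positivity, fun X h1 h2 => ?_⟩
  refine norm_integral_le_of_norm_le ((hu.norm.const_mul C).const_mul _) (Eventually.of_forall fun y => ?_)
  have h4 := h X.1 y X.2 h1 h2
  have hz : X.2 ≠ 0 := abs_pos.1 (hε.trans_le h2)
  have h5 := norm_field_le hs.le (X.1 - y) hz
  rw [norm_smul, norm_mul, Real.norm_of_nonneg (decay_nonneg s y 1)]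
  calc ‖u y‖ * ‖field s (X.1 - y) X.2‖
      ≤ ‖u y‖ * (2 * ((n : ℝ) + 2 * s) * (C * decay s y 1)) := by
        gcongr; exact h5.trans (by gcongr)
    _ = _ := by ring

lemma sq_lintegral_mul_le {α : Type*} [MeasurableSpace α] {μ : Measure α} {f g : α → ℝ≥0∞}
    (hf : AEMeasurable f μ) (hg : AEMeasurable g μ) :
    (∫⁻ a, f a * g a ∂μ) ^ 2 ≤ (∫⁻ a, f a ^ 2 ∂μ) * ∫⁻ a, g a ^ 2 ∂μ := by
  have h := ENNReal.lintegral_mul_le_Lp_mul_Lq μ Real.HolderConjugate.two_two hf hg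
  simp only [Pi.mul_apply, ENNReal.rpow_two] at h
  calc _ ≤ ((∫⁻ a, f a ^ 2 ∂μ) ^ (1 / (2 : ℝ)) * (∫⁻ a, g a ^ 2 ∂μ) ^ (1 / (2 : ℝ))) ^ 2 := by gcongr
    _ = _ := by
      rw [mul_pow, ← ENNReal.rpow_two, ← ENNReal.rpow_two, ← ENNReal.rpow_mul, ← ENNReal.rpow_mul]
      norm_num

/-- Cauchy-Schwarz bound of the field by a weighted square integral of differences of `u`. -/
lemma exists_enorm_extField_sq_le (n : ℕ) {s : ℝ} (hs : 0 < s) :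
    ∃ C : ℝ, 0 ≤ C ∧ ∀ (u : Eucl n → ℝ), Measurable u → Integrable (fun y => u y * decay s y 1) →
      ∀ (x : Eucl n) (z : ℝ), z ≠ 0 → ‖extField s u (x, z)‖ₑ ^ 2 ≤
        ENNReal.ofReal (C * |z| ^ (-s)) * ∫⁻ y, ENNReal.ofReal (|u x - u y| ^ 2) *
          ENNReal.ofReal ((‖x - y‖ ^ 2 + z ^ 2) ^ (-(((n : ℝ) + 3 * s) / 2))) := by
  have hn : (0 : ℝ) ≤ n := n.cast_nonneg
  set c : ℝ := 2 * ((n : ℝ) + 2 * s) with hc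
  have hc0 : 0 ≤ c := by positivity
  set κ : ℝ := ∫ x : Eucl n, (1 + ‖x‖ ^ 2) ^ (-(((n : ℝ) + s) / 2)) with hκ
  have hκ0 : 0 ≤ κ := integral_nonneg fun x => by positivity
  refine ⟨c ^ 2 * κ, by positivity, fun u hum hu x z hz => ?_⟩
  -- The decay exponent is split as `(n+2s)/2 = (n+3s)/4 + (n+s)/4`. The square of the second factor
  -- is still integrable over `ℝⁿ`, with integral a multiple of `|z|^(-s)`; the square of the first
  -- keeps the surplus needed for the later integration in `z`.
  set f : Eucl n → ℝ≥0∞ := fun y => ENNReal.ofReal (|u x - u y|) *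
    ENNReal.ofReal ((‖x - y‖ ^ 2 + z ^ 2) ^ (-(((n : ℝ) + 3 * s) / 4))) with hf
  set g : Eucl n → ℝ≥0∞ := fun y => ENNReal.ofReal ((‖x - y‖ ^ 2 + z ^ 2) ^ (-(((n : ℝ) + s) / 4))) with hg
  have hR : ∀ y : Eucl n, 0 < ‖x - y‖ ^ 2 + z ^ 2 := fun y => norm_sq_add_sq_pos hz _
  have h1 : ‖extField s u (x, z)‖ₑ ≤ ENNReal.ofReal c * ∫⁻ y, f y * g y := by
    rw [extField_eq_sub hs hum hu x hz, ← lintegral_const_mul _ (by fun_prop)]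
    refine (enorm_integral_le_lintegral_enorm _).trans (lintegral_mono fun y => ?_)
    simp only [hf, hg]
    rw [mul_assoc, ← ENNReal.ofReal_mul (by positivity), ← Real.rpow_add (hR y),
      ← ENNReal.ofReal_mul (by positivity), ← ENNReal.ofReal_mul hc0, ← ofReal_norm]
    apply ENNReal.ofReal_le_ofReal
    rw [norm_smul, Real.norm_eq_abs, abs_sub_comm]
    have := norm_field_le hs.le (x - y) hz
    have h2 : -(((n : ℝ) + 3 * s) / 4) + -(((n : ℝ) + s) / 4) = -(((n : ℝ) + 2 * s) / 2) := by ring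
    rw [h2]
    calc |u x - u y| * ‖field s (x - y) z‖ ≤ |u x - u y| * (c * decay s (x - y) z) := by gcongr
      _ = _ := by unfold decay; ring
  have h2 : ∫⁻ y, g y ^ 2 = ENNReal.ofReal (|z| ^ (-s) * κ) := by
    have h3 : ∀ y, g y ^ 2 = ENNReal.ofReal ((‖x - y‖ ^ 2 + z ^ 2) ^ (-(((n : ℝ) + s) / 2))) := by
      intro y
      rw [hg, ← ENNReal.ofReal_pow (by positivity), ← Real.rpow_natCast, ← Real.rpow_mul (hR y).le]
      congr 2; push_cast; ring
    simp_rw [h3]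
    have h4 : Integrable fun y : Eucl n => (‖x - y‖ ^ 2 + z ^ 2) ^ (-(((n : ℝ) + s) / 2)) :=
      (integrable_norm_sq_add_rpow (by linarith) hz).comp_sub_left x
    rw [← ofReal_integral_eq_lintegral_ofReal h4 (Eventually.of_forall fun y => by positivity),
      integral_sub_left_eq_self (fun y : Eucl n => (‖y‖ ^ 2 + z ^ 2) ^ (-(((n : ℝ) + s) / 2))) volume x,
      integral_norm_sq_add_rpow _ hz]
    congr 3; ring
  have h3 : ∀ y, f y ^ 2 = ENNReal.ofReal (|u x - u y| ^ 2) *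
          ENNReal.ofReal ((‖x - y‖ ^ 2 + z ^ 2) ^ (-(((n : ℝ) + 3 * s) / 2))) := by
    intro y
    rw [hf, mul_pow, ← ENNReal.ofReal_pow (by positivity), ← ENNReal.ofReal_pow (by positivity),
      ← Real.rpow_natCast (_ ^ _), ← Real.rpow_mul (hR y).le]
    congr 3; push_cast; ring
  calc ‖extField s u (x, z)‖ₑ ^ 2 ≤ (ENNReal.ofReal c * ∫⁻ y, f y * g y) ^ 2 := by gcongr
    _ = ENNReal.ofReal c ^ 2 * (∫⁻ y, f y * g y) ^ 2 := mul_pow _ _ _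
    _ ≤ ENNReal.ofReal c ^ 2 * ((∫⁻ y, f y ^ 2) * ∫⁻ y, g y ^ 2) := by
        gcongr
        exact sq_lintegral_mul_le (Measurable.aemeasurable (by fun_prop)) (Measurable.aemeasurable (by fun_prop))
    _ = _ := by
        rw [h2]
        simp_rw [h3]
        rw [← ENNReal.ofReal_pow hc0, mul_comm (∫⁻ y, _), ← mul_assoc,
          ← ENNReal.ofReal_mul (by positivity)]
        congr 2; ring

/-- The classical gradient of `extend s u` off `{z = 0}`. -/
def extGrad (s : ℝ) (u : Eucl n → ℝ) (X : Eucl n × ℝ) : Eucl n × ℝ :=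
  ((SignType.sign X.2 : ℝ) * |X.2| ^ (2 * s - 1)) • (extField s u X).ofLp

/-- The vector field `|z|^((1-2s)/2) G`, whose squared norm is the weighted energy density. -/
def wgt (s : ℝ) (G : Eucl n × ℝ → Eucl n × ℝ) (X : Eucl n × ℝ) : EuclProd n :=
  |X.2| ^ ((1 - 2 * s) / 2) • WithLp.toLp 2 (G X)

lemma measurable_extGrad (s : ℝ) {u : Eucl n → ℝ} (hu : Measurable u) :
    Measurable (extGrad s u) := by
  unfold extGrad
  have h1 := measurable_extField s hu
  have h2 : Measurable fun X : Eucl n × ℝ => (extField s u X).ofLp :=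
    (WithLp.measurable_ofLp 2 _).comp h1
  have h3 : Measurable fun X : Eucl n × ℝ => (SignType.sign X.2 : ℝ) := by
    have h4 : (fun X : Eucl n × ℝ => (SignType.sign X.2 : ℝ)) =
        fun X => if 0 < X.2 then 1 else if X.2 < 0 then -1 else 0 := by
      funext X; rw [sign_apply]; split_ifs <;> simp
    rw [h4]
    exact Measurable.ite (measurableSet_lt measurable_const measurable_snd) measurable_const
      (Measurable.ite (measurableSet_lt measurable_snd measurable_const) measurable_const measurable_const)
  fun_prop

lemma energy_density_eq (s : ℝ) (G : Eucl n × ℝ → Eucl n × ℝ) (X : Eucl n × ℝ) :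
    ENNReal.ofReal (|X.2| ^ (1 - 2 * s) * (‖(G X).1‖ ^ 2 + (G X).2 ^ 2)) = ‖wgt s G X‖ₑ ^ 2 := by
  rw [← ofReal_norm, ← ENNReal.ofReal_pow (norm_nonneg _)]
  congr 1
  unfold wgt
  rw [norm_smul, mul_pow, WithLp.prod_norm_sq_eq_of_L2, Real.norm_of_nonneg (by positivity),
    ← Real.rpow_natCast (_ ^ _), ← Real.rpow_mul (abs_nonneg _)]
  simp only [WithLp.toLp_fst, WithLp.toLp_snd, Real.norm_eq_abs, sq_abs]
  congr 2; push_cast; ring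

lemma abs_sign_of_ne_zero {z : ℝ} (hz : z ≠ 0) : |(SignType.sign z : ℝ)| = 1 := by
  rcases lt_or_gt_of_ne hz with h | h
  · simp [sign_neg h]
  · simp [sign_pos h]

lemma wgt_extGrad (s : ℝ) (u : Eucl n → ℝ) {X : Eucl n × ℝ} (hX : X.2 ≠ 0) :
    wgt s (extGrad s u) X = ((SignType.sign X.2 : ℝ) * |X.2| ^ (s - 1 / 2)) • extField s u X := by
  have h : 0 < |X.2| := abs_pos.2 hX
  unfold wgt extGrad
  rw [WithLp.toLp_smul, smul_smul]
  congr 1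
  rw [mul_left_comm, ← Real.rpow_add h]
  congr 2; ring

lemma enorm_wgt_extGrad_sq (s : ℝ) (u : Eucl n → ℝ) {X : Eucl n × ℝ} (hX : X.2 ≠ 0) :
    ‖wgt s (extGrad s u) X‖ₑ ^ 2 = ENNReal.ofReal (|X.2| ^ (2 * s - 1)) * ‖extField s u X‖ₑ ^ 2 := by
  rw [wgt_extGrad s u hX, enorm_smul, mul_pow, ← ofReal_norm, norm_mul, Real.norm_eq_abs,
    abs_sign_of_ne_zero hX, one_mul, Real.norm_of_nonneg (by positivity),
    ← ENNReal.ofReal_pow (by positivity), ← Real.rpow_natCast, ← Real.rpow_mul (abs_nonneg _)]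
  congr 3; push_cast; ring

lemma ae_snd_ne_zero : ∀ᵐ X : Eucl n × ℝ, X.2 ≠ 0 := by
  have h0 : ∀ᵐ z : ℝ, z ≠ 0 := by rw [ae_iff]; simp
  rw [Measure.volume_eq_prod]
  exact Measure.quasiMeasurePreserving_snd.ae h0

/-- On each vertical line the energy of the extension is controlled by the Gagliardo integral. -/
lemma exists_lintegral_wgt_extGrad_le (n : ℕ) {s : ℝ} (hs : 0 < s) :
    ∃ C : ℝ, 0 ≤ C ∧ ∀ (u : Eucl n → ℝ), Measurable u → Integrable (fun y => u y * decay s y 1) →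
      ∀ x : Eucl n, ∫⁻ z : ℝ, ‖wgt s (extGrad s u) (x, z)‖ₑ ^ 2 ≤ ENNReal.ofReal C * gagAt s u x := by
  have hn : (0 : ℝ) ≤ n := n.cast_nonneg
  obtain ⟨C, hC, h⟩ := exists_enorm_extField_sq_le n hs
  -- The weight `|z|^(2s-1)` times the loss `|z|^(-s)` is `|z|^(s-1)`, hence `α = s`. With `b =
  -- (n+3s)/2` the resulting power of `‖x - y‖` is `s - (n+3s) = -(n+2s)`, that of the Gagliardo
  -- kernel.
  obtain ⟨D, hD, h'⟩ := exists_lintegral_abs_rpow_mul (α := s) (b := ((n : ℝ) + 3 * s) / 2) hs (by linarith)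
  refine ⟨C * D, by positivity, fun u hum hu x => ?_⟩
  have h0 : ∀ᵐ z : ℝ, z ≠ 0 := by rw [ae_iff]; simp
  calc ∫⁻ z : ℝ, ‖wgt s (extGrad s u) (x, z)‖ₑ ^ 2
      ≤ ∫⁻ z : ℝ, ∫⁻ y, ENNReal.ofReal (C * |u x - u y| ^ 2) *
          ENNReal.ofReal (|z| ^ (s - 1) * (‖x - y‖ ^ 2 + z ^ 2) ^ (-(((n : ℝ) + 3 * s) / 2))) := by
        refine lintegral_mono_ae ?_
        filter_upwards [h0] with z hz
        rw [enorm_wgt_extGrad_sq s u (X := (x, z)) hz]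
        calc _ ≤ ENNReal.ofReal (|z| ^ (2 * s - 1)) * (ENNReal.ofReal (C * |z| ^ (-s)) *
              ∫⁻ y, ENNReal.ofReal (|u x - u y| ^ 2) *
              ENNReal.ofReal ((‖x - y‖ ^ 2 + z ^ 2) ^ (-(((n : ℝ) + 3 * s) / 2)))) := by
              gcongr; exact h u hum hu x z hz
          _ = _ := by
              rw [← mul_assoc, ← ENNReal.ofReal_mul (by positivity), ← lintegral_const_mul _ (by fun_prop)]
              refine lintegral_congr fun y => ?_
              rw [← ENNReal.ofReal_mul (by positivity), ← ENNReal.ofReal_mul (by positivity),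
                ← ENNReal.ofReal_mul (by positivity)]
              congr 1
              have : |z| ^ (s - 1) = |z| ^ (2 * s - 1) * |z| ^ (-s) := by
                rw [← Real.rpow_add (abs_pos.2 hz)]; congr 1; ring
              rw [this]; ring
    _ = ∫⁻ y, ENNReal.ofReal (C * |u x - u y| ^ 2) * ∫⁻ z : ℝ,
          ENNReal.ofReal (|z| ^ (s - 1) * (‖x - y‖ ^ 2 + z ^ 2) ^ (-(((n : ℝ) + 3 * s) / 2))) := by
        rw [lintegral_lintegral_swap (by fun_prop)]
        refine lintegral_congr fun y => ?_
        rw [lintegral_const_mul _ (by fun_prop)]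
    _ ≤ ∫⁻ y, ENNReal.ofReal (C * D) * ENNReal.ofReal (|u x - u y| ^ 2 / ‖x - y‖ ^ ((n : ℝ) + 2 * s)) := by
        refine lintegral_mono fun y => ?_
        simp only
        by_cases hxy : x = y
        · simp [hxy]
        have hρ : 0 < ‖x - y‖ := norm_pos_iff.2 (sub_ne_zero.2 hxy)
        calc _ ≤ ENNReal.ofReal (C * |u x - u y| ^ 2) * ENNReal.ofReal (D * ‖x - y‖ ^ (s - 2 * (((n : ℝ) + 3 * s) / 2))) := by
              gcongr; exact h' _ hρ
          _ = _ := by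
              rw [← ENNReal.ofReal_mul (by positivity), ← ENNReal.ofReal_mul (by positivity)]
              congr 1
              rw [show s - 2 * (((n : ℝ) + 3 * s) / 2) = -((n : ℝ) + 2 * s) by ring,
                Real.rpow_neg hρ.le]
              field_simp
    _ = _ := by
        rw [lintegral_const_mul _ (by fun_prop)]; rfl

lemma memLp_two_iff {α E : Type*} [MeasurableSpace α] [NormedAddCommGroup E] {μ : Measure α}
    {f : α → E} : MemLp f 2 μ ↔ AEStronglyMeasurable f μ ∧ ∫⁻ a, ‖f a‖ₑ ^ 2 ∂μ < ⊤ := by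
  unfold MemLp
  rw [eLpNorm_lt_top_iff_lintegral_rpow_enorm_lt_top (by norm_num) (by norm_num)]
  simp

lemma aestronglyMeasurable_wgt (s : ℝ) {G : Eucl n × ℝ → Eucl n × ℝ} {μ : Measure (Eucl n × ℝ)}
    (hG : AEStronglyMeasurable G μ) : AEStronglyMeasurable (wgt s G) μ := by
  unfold wgt
  have h : Measurable fun X : Eucl n × ℝ => |X.2| ^ ((1 - 2 * s) / 2) := by fun_prop
  refine AEStronglyMeasurable.smul h.aestronglyMeasurable ?_
  exact (WithLp.prod_continuous_toLp 2 (Eucl n) ℝ).comp_aestronglyMeasurable hG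

lemma exists_le_abs_snd {K : Set (Eucl n × ℝ)} (hK : IsCompact K) (h : ∀ X ∈ K, X.2 ≠ 0) :
    ∃ ε : ℝ, 0 < ε ∧ ∀ X ∈ K, ε ≤ |X.2| := by
  rcases K.eq_empty_or_nonempty with rfl | hne
  · exact ⟨1, one_pos, by simp⟩
  · obtain ⟨X0, hX0, hmin⟩ := hK.exists_isMinOn hne (f := fun X => |X.2|) (by fun_prop)
    exact ⟨|X0.2|, abs_pos.2 (h X0 hX0), fun X hX => hmin hX⟩

/-- The extension has finite weighted energy on `B × ℝ`. -/
lemma lintegral_wgt_extGrad_prod_lt_top {s : ℝ} (hs : 0 < s) {u : Eucl n → ℝ} (hum : Measurable u)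
    (hu : Integrable fun y => u y * decay s y 1) {B : Set (Eucl n)}
    (hfin : gagliardo s (crossSet B) u < ⊤) :
    ∫⁻ X in B ×ˢ (univ : Set ℝ), ‖wgt s (extGrad s u) X‖ₑ ^ 2 < ⊤ := by
  obtain ⟨C, hC, h⟩ := exists_lintegral_wgt_extGrad_le n hs
  have hm : Measurable (wgt s (extGrad s u)) := by
    have := measurable_extGrad s hum
    unfold wgt
    have h : Measurable fun X : Eucl n × ℝ => |X.2| ^ ((1 - 2 * s) / 2) := by fun_prop
    exact Measurable.smul h ((WithLp.measurable_toLp 2 _).comp this)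
  rw [Measure.volume_eq_prod, ← Measure.prod_restrict, Measure.restrict_univ,
    lintegral_prod _ (by fun_prop)]
  calc _ ≤ ∫⁻ x in B, ENNReal.ofReal C * gagAt s u x := lintegral_mono fun x => h u hum hu x
    _ = ENNReal.ofReal C * ∫⁻ x in B, gagAt s u x := lintegral_const_mul _ (measurable_gagAt s hum)
    _ < ⊤ := ENNReal.mul_lt_top ENNReal.ofReal_lt_top ((setLIntegral_gagAt_le s hum B).trans_lt hfin)

/-- The extension has finite weighted energy on compact sets touching `{z = 0}` only inside `B`. -/
lemma memLp_wgt_extGrad {s : ℝ} (hs : 0 < s) {u : Eucl n → ℝ} (hum : Measurable u)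
    (hu : Integrable fun y => u y * decay s y 1) {B : Set (Eucl n)} (hB : IsOpen B)
    (hfin : gagliardo s (crossSet B) u < ⊤) {K : Set (Eucl n × ℝ)} (hK : IsCompact K)
    (hKB : ∀ X ∈ K, X.2 = 0 → X.1 ∈ B) : MemLp (wgt s (extGrad s u)) 2 (volume.restrict K) := by
  rw [memLp_two_iff]
  refine ⟨aestronglyMeasurable_wgt s (measurable_extGrad s hum).aestronglyMeasurable, ?_⟩
  -- Over `B` the energy is finite by the bound on vertical lines. What remains of `K` is compact
  -- and stays away from `{z = 0}`, where the field is bounded.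
  set K' : Set (Eucl n × ℝ) := K \ B ×ˢ univ with hK'
  have hK'c : IsCompact K' := hK.diff (hB.prod isOpen_univ)
  obtain ⟨ε, hε, hεK⟩ := exists_le_abs_snd hK'c (fun X hX h0 => hX.2 ⟨hKB X hX.1 h0, mem_univ _⟩)
  obtain ⟨M, hM⟩ := hK.isBounded.exists_norm_le
  obtain ⟨C, hC, hCK⟩ := exists_norm_extField_le hs hu M hε
  have h1 : ∫⁻ X in K', ‖wgt s (extGrad s u) X‖ₑ ^ 2 < ⊤ := by
    have hb : ∀ X ∈ K', ‖wgt s (extGrad s u) X‖ₑ ^ 2 ≤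
        ENNReal.ofReal ((ε ^ (2 * s - 1) + M ^ (2 * s - 1)) * C ^ 2) := by
      intro X hX
      have hz := hεK X hX
      have hz0 : 0 < |X.2| := hε.trans_le hz
      have hzM : |X.2| ≤ M := (norm_snd_le X).trans (hM X hX.1)
      have hX1 := hCK X ((norm_fst_le X).trans (hM X hX.1)) hz
      rw [enorm_wgt_extGrad_sq s u (abs_pos.1 hz0), ← ofReal_norm,
        ← ENNReal.ofReal_pow (norm_nonneg _), ← ENNReal.ofReal_mul (by positivity)]
      apply ENNReal.ofReal_le_ofReal
      have h2 : |X.2| ^ (2 * s - 1) ≤ ε ^ (2 * s - 1) + M ^ (2 * s - 1) := by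
        have hM0 : 0 < M := hz0.trans_le hzM
        rcases le_total 0 (2 * s - 1) with h | h
        · have := Real.rpow_le_rpow hz0.le hzM h
          have := Real.rpow_nonneg hε.le (2 * s - 1)
          linarith
        · have := Real.rpow_le_rpow_of_nonpos hε hz h
          have := Real.rpow_nonneg hM0.le (2 * s - 1)
          linarith
      gcongr
      exact (Real.rpow_nonneg (abs_nonneg _) _).trans h2
    refine (setLIntegral_mono measurable_const hb).trans_lt ?_
    rw [setLIntegral_const]
    exact ENNReal.mul_lt_top ENNReal.ofReal_lt_top hK'c.measure_lt_top
  have h2 := lintegral_wgt_extGrad_prod_lt_top hs hum hu hfin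
  have hsub : K ⊆ B ×ˢ univ ∪ K' := by
    intro X hX
    by_cases h : X ∈ B ×ˢ (univ : Set ℝ)
    · exact Or.inl h
    · exact Or.inr ⟨hX, h⟩
  calc _ ≤ _ := lintegral_mono_set hsub
    _ ≤ _ := lintegral_union_le _ _ _
    _ < ⊤ := ENNReal.add_lt_top.2 ⟨h2, h1⟩

lemma integrableOn_abs_snd_rpow {α : ℝ} (hα : -1 < α) {K : Set (Eucl n × ℝ)} (hK : IsCompact K) :
    IntegrableOn (fun X => |X.2| ^ α) K := by
  obtain ⟨M, hM⟩ := hK.isBounded.exists_norm_le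
  have h1 : IntegrableOn (fun z : ℝ => |z| ^ α) (Icc (-M) M) := by
    have h2 : IntegrableOn (fun z : ℝ => |z| ^ (α + 1 - 1) * (1 + z ^ 2) ^ (-(α + 2))) (Icc (-M) M) :=
      (integrable_abs_rpow_mul (α := α + 1) (b := α + 2) (by linarith) (by linarith)).integrableOn
    refine Integrable.mono' (h2.const_mul ((1 + M ^ 2) ^ (α + 2)))
      (Measurable.aestronglyMeasurable (by fun_prop)) ?_
    refine (ae_restrict_iff' measurableSet_Icc).2 (Eventually.of_forall fun z hz => ?_)
    have hz' : |z| ≤ M := abs_le.2 hz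
    rw [Real.norm_of_nonneg (by positivity), add_sub_cancel_right, mul_left_comm]
    refine le_mul_of_one_le_right (by positivity) ?_
    rw [Real.rpow_neg (by positivity), ← div_eq_mul_inv, one_le_div (by positivity)]
    apply Real.rpow_le_rpow (by positivity) _ (by linarith)
    rw [← sq_abs z]; gcongr
  have h2 : IntegrableOn (fun X : Eucl n × ℝ => |X.2| ^ α) (Metric.closedBall 0 M ×ˢ Icc (-M) M) := by
    unfold IntegrableOn
    rw [Measure.volume_eq_prod, ← Measure.prod_restrict]
    have : IsFiniteMeasure ((volume : Measure (Eucl n)).restrict (Metric.closedBall 0 M)) :=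
      ⟨by simpa using measure_closedBall_lt_top⟩
    exact h1.comp_snd _
  refine h2.mono_set fun X hX => ⟨?_, ?_⟩
  · simpa using (norm_fst_le X).trans (hM X hX)
  · exact abs_le.1 ((norm_snd_le X).trans (hM X hX))

/-- Finite weighted energy on a compact set implies integrability. -/
lemma integrableOn_of_memLp_wgt {s : ℝ} (hs : 0 < s) {G : Eucl n × ℝ → Eucl n × ℝ}
    {K : Set (Eucl n × ℝ)} (hK : IsCompact K) (hGm : AEStronglyMeasurable G (volume.restrict K))
    (hG : MemLp (wgt s G) 2 (volume.restrict K)) : IntegrableOn G K := by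
  -- Cauchy-Schwarz with `‖G‖ ≤ |z|^(s-1/2) ‖wgt s G‖`: the square `|z|^(2s-1)` of the first factor
  -- is locally integrable because `s > 0`.
  have h1 : MemLp (fun X : Eucl n × ℝ => |X.2| ^ (s - 1 / 2)) 2 (volume.restrict K) := by
    refine (memLp_two_iff_integrable_sq (Measurable.aestronglyMeasurable (by fun_prop))).2 ?_
    refine (integrableOn_abs_snd_rpow (α := 2 * s - 1) (by linarith) hK).congr
      (Eventually.of_forall fun X => ?_)
    simp only
    rw [← Real.rpow_natCast, ← Real.rpow_mul (abs_nonneg _)]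
    congr 1; push_cast; ring
  have h2 : Integrable (fun X => |X.2| ^ (s - 1 / 2) * ‖wgt s G X‖) (volume.restrict K) :=
    h1.integrable_mul hG.norm
  refine h2.mono' hGm ?_
  filter_upwards [ae_restrict_of_ae ae_snd_ne_zero] with X hX
  have hX' : 0 < |X.2| := abs_pos.2 hX
  unfold wgt
  rw [norm_smul, ← mul_assoc, Real.norm_of_nonneg (by positivity), ← Real.rpow_add hX',
    show s - 1 / 2 + (1 - 2 * s) / 2 = 0 by ring, Real.rpow_zero, one_mul]
  have h3 := WithLp.prod_norm_sq_eq_of_L2 (WithLp.toLp 2 (G X) : EuclProd n)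
  simp only [WithLp.toLp_fst, WithLp.toLp_snd] at h3
  rw [Prod.norm_def]
  apply max_le <;> refine abs_le_of_sq_le_sq' ?_ (norm_nonneg _) |>.2 <;> rw [h3] <;> nlinarith [sq_nonneg ‖(G X).1‖, sq_nonneg ‖(G X).2‖]

lemma locallyIntegrableOn_extGrad {s : ℝ} (hs : 0 < s) {u : Eucl n → ℝ} (hum : Measurable u)
    (hu : Integrable fun y => u y * decay s y 1) {B : Set (Eucl n)} (hB : IsOpen B)
    (hfin : gagliardo s (crossSet B) u < ⊤) {U : Set (Eucl n × ℝ)} (hU : IsOpen U)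
    (hUB : ∀ X ∈ U, X.2 = 0 → X.1 ∈ B) : LocallyIntegrableOn (extGrad s u) U := by
  rw [locallyIntegrableOn_iff hU.isLocallyClosed]
  intro K hKU hK
  exact integrableOn_of_memLp_wgt hs hK (measurable_extGrad s hum).aestronglyMeasurable
    (memLp_wgt_extGrad hs hum hu hB hfin hK fun X hX => hUB X (hKU hX))

/-! ### Cutoffs in the vertical variable -/

/-- Smooth even cutoff, `0` for `|z| ≤ 1/2` and `1` for `|z| ≥ 1`. -/
def evenCut (z : ℝ) : ℝ := Real.smoothTransition (2 * z - 1) + Real.smoothTransition (-(2 * z) - 1)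

/-- Smooth odd cutoff, `0` for `|z| ≤ 1/2` and `sgn z` for `|z| ≥ 1`. -/
def oddCut (z : ℝ) : ℝ := Real.smoothTransition (2 * z - 1) - Real.smoothTransition (-(2 * z) - 1)

lemma contDiff_evenCut : ContDiff ℝ ∞ evenCut := by
  unfold evenCut
  exact (Real.smoothTransition.contDiff.comp (by fun_prop)).add
    (Real.smoothTransition.contDiff.comp (by fun_prop))

lemma contDiff_oddCut : ContDiff ℝ ∞ oddCut := by
  unfold oddCut
  exact (Real.smoothTransition.contDiff.comp (by fun_prop)).sub
    (Real.smoothTransition.contDiff.comp (by fun_prop))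

lemma evenCut_neg (z : ℝ) : evenCut (-z) = evenCut z := by
  unfold evenCut; rw [add_comm]; congr 2 <;> ring

lemma evenCut_of_le {z : ℝ} (hz : |z| ≤ 1 / 2) : evenCut z = 0 := by
  have h := abs_le.1 hz
  unfold evenCut
  rw [Real.smoothTransition.zero_of_nonpos (by linarith), Real.smoothTransition.zero_of_nonpos (by linarith)]
  simp

lemma oddCut_of_le {z : ℝ} (hz : |z| ≤ 1 / 2) : oddCut z = 0 := by
  have h := abs_le.1 hz
  unfold oddCut
  rw [Real.smoothTransition.zero_of_nonpos (by linarith), Real.smoothTransition.zero_of_nonpos (by linarith)]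
  simp

lemma evenCut_of_ge {z : ℝ} (hz : 1 ≤ |z|) : evenCut z = 1 := by
  unfold evenCut
  rcases le_abs.1 hz with h | h
  · rw [Real.smoothTransition.one_of_one_le (by linarith), Real.smoothTransition.zero_of_nonpos (by linarith)]
    simp
  · rw [Real.smoothTransition.zero_of_nonpos (by linarith), Real.smoothTransition.one_of_one_le (by linarith)]
    simp

lemma oddCut_of_one_le {z : ℝ} (hz : 1 ≤ z) : oddCut z = 1 := by
  unfold oddCut
  rw [Real.smoothTransition.one_of_one_le (by linarith), Real.smoothTransition.zero_of_nonpos (by linarith)]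
  simp

lemma oddCut_of_le_neg_one {z : ℝ} (hz : z ≤ -1) : oddCut z = -1 := by
  unfold oddCut
  rw [Real.smoothTransition.zero_of_nonpos (by linarith), Real.smoothTransition.one_of_one_le (by linarith)]
  simp

lemma oddCut_of_ge {z : ℝ} (hz : 1 ≤ |z|) : oddCut z = SignType.sign z := by
  rcases le_abs.1 hz with h | h
  · rw [oddCut_of_one_le h, sign_pos (by linarith)]; simp
  · rw [oddCut_of_le_neg_one (by linarith), sign_neg (by linarith)]; simp

lemma abs_evenCut_le (z : ℝ) : |evenCut z| ≤ 1 := by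
  unfold evenCut
  have h1 := Real.smoothTransition.nonneg (2 * z - 1)
  have h2 := Real.smoothTransition.nonneg (-(2 * z) - 1)
  have h3 := Real.smoothTransition.le_one (2 * z - 1)
  have h4 := Real.smoothTransition.le_one (-(2 * z) - 1)
  rcases le_total 0 z with h | h
  · have : Real.smoothTransition (-(2 * z) - 1) = 0 := Real.smoothTransition.zero_of_nonpos (by linarith)
    rw [abs_le]; constructor <;> linarith
  · have : Real.smoothTransition (2 * z - 1) = 0 := Real.smoothTransition.zero_of_nonpos (by linarith)
    rw [abs_le]; constructor <;> linarith

lemma abs_oddCut_le (z : ℝ) : |oddCut z| ≤ 1 := by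
  unfold oddCut
  have h1 := Real.smoothTransition.nonneg (2 * z - 1)
  have h2 := Real.smoothTransition.nonneg (-(2 * z) - 1)
  have h3 := Real.smoothTransition.le_one (2 * z - 1)
  have h4 := Real.smoothTransition.le_one (-(2 * z) - 1)
  rw [abs_le]; constructor <;> linarith

lemma hasCompactSupport_deriv_of_const {f : ℝ → ℝ} {a b : ℝ} (h1 : ∀ z, 1 ≤ z → f z = a)
    (h2 : ∀ z, z ≤ -1 → f z = b) {z : ℝ} (hz : 1 < |z|) : deriv f z = 0 := by
  rcases lt_abs.1 hz with h | h
  · have : f =ᶠ[𝓝 z] fun _ => a := by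
      filter_upwards [Ioi_mem_nhds h] with t ht using h1 t (le_of_lt ht)
    rw [this.deriv_eq]; simp
  · have : f =ᶠ[𝓝 z] fun _ => b := by
      filter_upwards [Iio_mem_nhds (show z < -1 by linarith)] with t ht using h2 t (le_of_lt ht)
    rw [this.deriv_eq]; simp

lemma deriv_evenCut_of_gt {z : ℝ} (hz : 1 < |z|) : deriv evenCut z = 0 :=
  hasCompactSupport_deriv_of_const (a := 1) (b := 1)
    (fun t ht => evenCut_of_ge (ht.trans (le_abs_self t)))
    (fun t ht => evenCut_of_ge (by rw [le_abs]; right; linarith)) hz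

lemma deriv_oddCut_of_gt {z : ℝ} (hz : 1 < |z|) : deriv oddCut z = 0 :=
  hasCompactSupport_deriv_of_const (fun _ => oddCut_of_one_le) (fun _ => oddCut_of_le_neg_one) hz

lemma deriv_evenCut_neg (z : ℝ) : deriv evenCut (-z) = -deriv evenCut z := by
  have h : (fun t => evenCut (-t)) = evenCut := funext evenCut_neg
  have h2 := deriv_comp_neg evenCut z
  rw [h] at h2; linarith

lemma exists_bound_of_deriv_eq_zero {f : ℝ → ℝ} (hf : ContDiff ℝ ∞ f)
    (h : ∀ z, 1 < |z| → deriv f z = 0) : ∃ C : ℝ, 0 ≤ C ∧ ∀ z, |deriv f z| ≤ C := by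
  have hc : Continuous (deriv f) := hf.continuous_deriv (by simp)
  obtain ⟨C, hC⟩ := (isCompact_Icc (a := (-1 : ℝ)) (b := 1)).exists_bound_of_continuousOn hc.continuousOn
  have hC0 : 0 ≤ C := (norm_nonneg _).trans (hC 0 (by simp))
  refine ⟨C, hC0, fun z => ?_⟩
  by_cases hz : 1 < |z|
  · rw [h z hz]; simpa using hC0
  · exact hC z (abs_le.1 (not_lt.1 hz))

lemma exists_abs_deriv_evenCut_le : ∃ C : ℝ, 0 ≤ C ∧ ∀ z, |deriv evenCut z| ≤ C :=
  exists_bound_of_deriv_eq_zero contDiff_evenCut fun _ => deriv_evenCut_of_gt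

lemma exists_abs_deriv_oddCut_le : ∃ C : ℝ, 0 ≤ C ∧ ∀ z, |deriv oddCut z| ≤ C :=
  exists_bound_of_deriv_eq_zero contDiff_oddCut fun _ => deriv_oddCut_of_gt

/-- A cutoff vanishing near `z = 0` removes a singularity on `{z = 0}`. -/
lemma contDiff_cut_mul {c : ℝ → ℝ} (hc : ContDiff ℝ ∞ c) {d : ℝ} (hd : 0 < d)
    (hc0 : ∀ z, |z| ≤ d → c z = 0) {f : Eucl n × ℝ → ℝ}
    (hf : ∀ X : Eucl n × ℝ, X.2 ≠ 0 → ContDiffAt ℝ ∞ f X) :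
    ContDiff ℝ ∞ fun X : Eucl n × ℝ => c X.2 * f X := by
  rw [contDiff_iff_contDiffAt]
  intro X
  by_cases hX : X.2 = 0
  · have : (fun X : Eucl n × ℝ => c X.2 * f X) =ᶠ[𝓝 X] fun _ => 0 := by
      have h1 : ∀ᶠ Y : Eucl n × ℝ in 𝓝 X, |Y.2| < d :=
        (continuous_abs.comp continuous_snd).continuousAt.eventually_lt continuousAt_const (by simpa [hX] using hd)
      filter_upwards [h1] with Y hY
      rw [hc0 _ hY.le, zero_mul]
    exact contDiffAt_const.congr_of_eventuallyEq this
  · exact (hc.contDiffAt.comp X contDiffAt_snd).mul (hf X hX)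

/-! ### The weak gradient of the extension across `{z = 0}` -/

lemma contDiffAt_normSq_rpow (y : Eucl n) (q : ℝ) {X : Eucl n × ℝ} (hX : X.2 ≠ 0) :
    ContDiffAt ℝ ∞ (fun X : Eucl n × ℝ => (‖X.1 - y‖ ^ 2 + X.2 ^ 2) ^ q) X := by
  refine ContDiffAt.rpow_const_of_ne ?_ (norm_sq_add_sq_pos hX _).ne'
  have h1 : ContDiff ℝ ∞ fun X : Eucl n × ℝ => X.1 - y := contDiff_fst.sub contDiff_const
  exact ((h1.norm_sq ℝ).add (contDiff_snd.pow 2)).contDiffAt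

lemma contDiffAt_extKer (s : ℝ) (y : Eucl n) {X : Eucl n × ℝ} (hX : X.2 ≠ 0) :
    ContDiffAt ℝ ∞ (fun X : Eucl n × ℝ => extKer s (X.1 - y) X.2) X := by
  unfold extKer
  refine ContDiffAt.mul ?_ (contDiffAt_normSq_rpow y _ hX)
  refine ContDiffAt.rpow_const_of_ne ?_ (abs_ne_zero.2 hX)
  exact (contDiffAt_abs hX).comp X contDiffAt_snd

lemma hasDerivAt_abs_rpow {z : ℝ} (hz : z ≠ 0) (p : ℝ) :
    HasDerivAt (fun z : ℝ => |z| ^ p) (p * SignType.sign z * |z| ^ (p - 1)) z := by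
  have h := (hasDerivAt_abs hz).rpow_const (p := p) (Or.inl (abs_ne_zero.2 hz))
  convert h using 1; ring

/-- Explains the shape of `fieldX` and `fieldZ`: once `sgn z |z|^(2s-1)` is taken out of the
gradient, the remaining field is smooth away from the pole, even at `z = 0`. -/
lemma fderiv_extKer (s : ℝ) (y : Eucl n) {X : Eucl n × ℝ} (hX : X.2 ≠ 0) (e : Eucl n × ℝ) :
    fderiv ℝ (fun X : Eucl n × ℝ => extKer s (X.1 - y) X.2) X e =
      SignType.sign X.2 * |X.2| ^ (2 * s - 1) *
        (inner ℝ (fieldX s (X.1 - y) X.2) e.1 + fieldZ s (X.1 - y) X.2 * e.2) := by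
  set p : ℝ := (n : ℝ) + 2 * s with hp
  have hR := norm_sq_add_sq_pos hX (X.1 - y)
  have hz : 0 < |X.2| := abs_pos.2 hX
  have h1 : HasFDerivAt (fun X : Eucl n × ℝ => X.1 - y) (ContinuousLinearMap.fst ℝ (Eucl n) ℝ) X :=
    (hasFDerivAt_fst (𝕜 := ℝ) (E := Eucl n) (F := ℝ)).sub_const y
  have h2 := h1.norm_sq
  have h3 : HasFDerivAt (fun X : Eucl n × ℝ => X.2) (ContinuousLinearMap.snd ℝ (Eucl n) ℝ) X := hasFDerivAt_snd
  have h4 := (h2.add (h3.pow 2)).rpow_const (p := -(p / 2)) (Or.inl hR.ne')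
  have h5 := (hasDerivAt_abs_rpow hX (2 * s)).comp_hasFDerivAt X h3
  have h6 := h5.mul h4
  have h7 : fderiv ℝ (fun X : Eucl n × ℝ => extKer s (X.1 - y) X.2) X = _ := HasFDerivAt.fderiv h6
  have hR2 : (‖X.1 - y‖ ^ 2 + X.2 ^ 2) ^ (-(p / 2)) =
      (‖X.1 - y‖ ^ 2 + X.2 ^ 2) * (‖X.1 - y‖ ^ 2 + X.2 ^ 2) ^ (-(p / 2 + 1)) := (rpow_succ_mul hR _).symm
  have hz2 : |X.2| ^ (2 * s) = SignType.sign X.2 * X.2 * |X.2| ^ (2 * s - 1) := by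
    rw [sign_mul_self]
    nth_rewrite 2 [← Real.rpow_one |X.2|]
    rw [← Real.rpow_add hz]; congr 1; ring
  rw [h7]
  simp only [fieldX, fieldZ, inner_smul_left, ← hp]
  simp [-sign_mul_self]
  rw [show -(p / 2) - 1 = -(p / 2 + 1) by ring, hR2, hz2, hp]
  simp [-sign_mul_self, inner_sub_left]
  ring

instance : (volume : Measure (Eucl n × ℝ)).IsAddHaarMeasure := by
  rw [Measure.volume_eq_prod]; infer_instance

lemma deriv_eq_zero_of_const {f : ℝ → ℝ} (h : ∀ z, |z| ≤ 1 / 2 → f z = 0) {z : ℝ} (hz : |z| < 1 / 2) :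
    deriv f z = 0 := by
  have : f =ᶠ[𝓝 z] fun _ => 0 := by
    filter_upwards [continuous_abs.continuousAt.eventually_lt continuousAt_const hz] with t ht
      using h t ht.le
  rw [this.deriv_eq]; simp

lemma deriv_evenCut_of_lt {z : ℝ} (hz : |z| < 1 / 2) : deriv evenCut z = 0 :=
  deriv_eq_zero_of_const (fun _ => evenCut_of_le) hz

lemma deriv_oddCut_of_lt {z : ℝ} (hz : |z| < 1 / 2) : deriv oddCut z = 0 :=
  deriv_eq_zero_of_const (fun _ => oddCut_of_le) hz

lemma rpow_le_add_rpow {ε t M : ℝ} (hε : 0 < ε) (h1 : ε ≤ t) (h2 : t ≤ M) (q : ℝ) :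
    t ^ q ≤ ε ^ q + M ^ q := by
  have ht : 0 < t := hε.trans_le h1
  have hM0 : 0 < M := ht.trans_le h2
  rcases le_total 0 q with h | h
  · have := Real.rpow_le_rpow ht.le h2 h
    have := Real.rpow_nonneg hε.le q
    linarith
  · have := Real.rpow_le_rpow_of_nonpos hε h1 h
    have := Real.rpow_nonneg hM0.le q
    linarith

lemma inner_toLp (a b : Eucl n × ℝ) :
    inner ℝ (WithLp.toLp 2 a : EuclProd n) (WithLp.toLp 2 b) = inner ℝ a.1 b.1 + a.2 * b.2 := by
  rw [WithLp.prod_inner_apply]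
  simp [mul_comm]

/-- Products of the decay factor and a weighted integrable function are jointly integrable. -/
lemma integrable_prod_of_decay {s : ℝ} {u : Eucl n → ℝ} (hum : Measurable u)
    (hu : Integrable fun y => u y * decay s y 1) {b : (Eucl n × ℝ) × Eucl n → ℝ}
    (hb : AEStronglyMeasurable b (volume.prod volume)) {A : Eucl n × ℝ → ℝ} (hA : Integrable A)
    (hle : ∀ᵐ X : Eucl n × ℝ, ∀ y, |b (X, y)| ≤ A X * decay s y 1) :
    Integrable (fun q : (Eucl n × ℝ) × Eucl n => u q.2 * b q) (volume.prod volume) := by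
  have h1 := hA.mul_prod hu.norm
  have h2 : Measurable fun q : (Eucl n × ℝ) × Eucl n => u q.2 := by fun_prop
  refine h1.mono' (h2.aestronglyMeasurable.mul hb) ?_
  have h3 := (Measure.quasiMeasurePreserving_fst (μ := (volume : Measure (Eucl n × ℝ)))
    (ν := (volume : Measure (Eucl n)))).ae hle
  filter_upwards [h3] with q hq
  have h4 := hq q.2
  rw [norm_mul, norm_mul, Real.norm_of_nonneg (decay_nonneg s q.2 1)]
  calc ‖u q.2‖ * ‖b q‖ ≤ ‖u q.2‖ * (A q.1 * decay s q.2 1) := by gcongr; exact h4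
    _ = _ := by ring

lemma inner_extGrad {s : ℝ} (hs : 0 ≤ s) {u : Eucl n → ℝ} (hum : Measurable u)
    (hu : Integrable fun y => u y * decay s y 1) {X : Eucl n × ℝ} (hX : X.2 ≠ 0) (e : Eucl n × ℝ) :
    inner ℝ (extGrad s u X).1 e.1 + (extGrad s u X).2 * e.2 =
      ∫ y, u y * (SignType.sign X.2 * |X.2| ^ (2 * s - 1) *
        (inner ℝ (fieldX s (X.1 - y) X.2) e.1 + fieldZ s (X.1 - y) X.2 * e.2)) := by
  set c : ℝ := SignType.sign X.2 * |X.2| ^ (2 * s - 1) with hc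
  have h1 : inner ℝ (extGrad s u X).1 e.1 + (extGrad s u X).2 * e.2 =
      c * inner ℝ (WithLp.toLp 2 e : EuclProd n) (extField s u X) := by
    rw [← inner_toLp, real_inner_comm, ← real_inner_smul_right]
    rfl
  have h2 := integral_inner (𝕜 := ℝ) (integrable_smul_field_sub hs hum hu X.1 hX) (WithLp.toLp 2 e : EuclProd n)
  rw [h1]
  unfold extField
  rw [← h2, ← integral_const_mul]
  refine integral_congr_ae (Eventually.of_forall fun y => ?_)
  simp only
  rw [real_inner_smul_right, real_inner_comm, field, inner_toLp]
  ring

/-- The cutoff removes the singularity of the kernel on `{z = 0}`, so classical integration by parts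
applies for each pole `y`, and Fubini integrates the result against `u`. Fubini is licensed by
bounds of the form `A X * decay s y 1` on the supports of `η` and of the cutoff. The price is the
term with `deriv evenCut`, the flux through the layer `|z| ≤ ε`. -/
lemma integral_evenCut_extend_mul_fderiv {s : ℝ} (hs : 0 < s) {u : Eucl n → ℝ} (hum : Measurable u)
    (hu : Integrable fun y => u y * decay s y 1) {η : Eucl n × ℝ → ℝ} (hη : ContDiff ℝ ∞ η)
    (hηc : HasCompactSupport η) (e : Eucl n × ℝ) {ε : ℝ} (hε : 0 < ε) :
    ∫ X : Eucl n × ℝ, evenCut (X.2 / ε) * extend s u X * fderiv ℝ η X e =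
      -∫ X : Eucl n × ℝ, (evenCut (X.2 / ε) * (inner ℝ (extGrad s u X).1 e.1 + (extGrad s u X).2 * e.2) +
        deriv evenCut (X.2 / ε) / ε * extend s u X * e.2) * η X := by
  have hn : (0 : ℝ) ≤ n := n.cast_nonneg
  set c : ℝ → ℝ := fun z => evenCut (z / ε) with hc
  have hcs : ContDiff ℝ ∞ c := contDiff_evenCut.comp (by fun_prop)
  have hc0 : ∀ z, |z| ≤ ε / 2 → c z = 0 := by
    intro z hz
    apply evenCut_of_le
    rw [abs_div, abs_of_pos hε, div_le_iff₀ hε]; linarith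
  have hcd : ∀ z, HasDerivAt c (deriv evenCut (z / ε) / ε) z := by
    intro z
    have h1 := (contDiff_evenCut.differentiable (by simp) (z / ε)).hasDerivAt
    have h2 : HasDerivAt (fun z : ℝ => z / ε) (1 / ε) z := (hasDerivAt_id z).div_const ε
    have h3 := h1.comp z h2
    exact h3.congr_deriv (by ring)
  have hcd0 : ∀ z, |z| < ε / 2 → deriv evenCut (z / ε) = 0 := by
    intro z hz
    apply deriv_evenCut_of_lt
    rw [abs_div, abs_of_pos hε, div_lt_iff₀ hε]; linarith
  obtain ⟨C1, hC1, hC1le⟩ := exists_abs_deriv_evenCut_le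
  have hηcont : Continuous η := hη.continuous
  have hdη : Continuous fun X => fderiv ℝ η X e := (hη.continuous_fderiv (by simp)).clm_apply continuous_const
  have hdηc : HasCompactSupport fun X => fderiv ℝ η X e := hηc.fderiv_apply (𝕜 := ℝ) e
  have hint1 : Integrable η := hηcont.integrable_of_hasCompactSupport hηc
  have hint2 : Integrable fun X => fderiv ℝ η X e := hdη.integrable_of_hasCompactSupport hdηc
  obtain ⟨M, hM⟩ := hηc.isCompact.isBounded.exists_norm_le
  obtain ⟨C, hC, hCle⟩ := exists_decay_le (n := n) hs.le M (half_pos hε)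
  -- bound of the kernel on the support
  have hK : ∀ X : Eucl n × ℝ, ‖X‖ ≤ M → ε / 2 ≤ |X.2| → ∀ y,
      extKer s (X.1 - y) X.2 ≤ M ^ (2 * s) * C * decay s y 1 := by
    intro X hX hz y
    have h1 := hCle X.1 y X.2 ((norm_fst_le X).trans hX) hz
    have h2 : |X.2| ^ (2 * s) ≤ M ^ (2 * s) :=
      Real.rpow_le_rpow (abs_nonneg _) ((norm_snd_le X).trans hX) (by linarith)
    have h3 := decay_nonneg s (X.1 - y) X.2
    have h4 := decay_nonneg s y 1
    have hM0 : 0 ≤ M := (norm_nonneg _).trans hX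
    rw [extKer_eq, mul_assoc]
    gcongr
  have hzero : ∀ X : Eucl n × ℝ, ¬ ‖X‖ ≤ M → η X = 0 ∧ fderiv ℝ η X e = 0 := by
    intro X hX
    have h1 : X ∉ tsupport η := fun h => hX (hM X h)
    refine ⟨image_eq_zero_of_notMem_tsupport h1, ?_⟩
    rw [(notMem_tsupport_iff_eventuallyEq.1 h1).fderiv_eq]; simp
  set D : (Eucl n × ℝ) × Eucl n → ℝ := fun q =>
    (c q.1.2 * (SignType.sign q.1.2 * |q.1.2| ^ (2 * s - 1) *
        (inner ℝ (fieldX s (q.1.1 - q.2) q.1.2) e.1 + fieldZ s (q.1.1 - q.2) q.1.2 * e.2)) +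
      deriv evenCut (q.1.2 / ε) / ε * extKer s (q.1.1 - q.2) q.1.2 * e.2) * η q.1 with hD
  set N : (Eucl n × ℝ) × Eucl n → ℝ := fun q =>
    c q.1.2 * extKer s (q.1.1 - q.2) q.1.2 * fderiv ℝ η q.1 e with hN
  have hsign : Measurable fun z : ℝ => (SignType.sign z : ℝ) := by
    have h4 : (fun z : ℝ => (SignType.sign z : ℝ)) =
        fun z => if 0 < z then 1 else if z < 0 then -1 else 0 := by
      funext z; rw [sign_apply]; split_ifs <;> simp
    rw [h4]
    exact Measurable.ite (measurableSet_lt measurable_const measurable_id) measurable_const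
      (Measurable.ite (measurableSet_lt measurable_id measurable_const) measurable_const measurable_const)
  have hcm : Measurable c := hcs.continuous.measurable
  have hηm : Measurable η := hηcont.measurable
  have hdηm : Measurable fun X => fderiv ℝ η X e := hdη.measurable
  have hcdm : Measurable fun z => deriv evenCut z := measurable_deriv _
  have hDm : Measurable D := by
    have h1 : Measurable fun q : (Eucl n × ℝ) × Eucl n => inner ℝ (fieldX s (q.1.1 - q.2) q.1.2) e.1 :=
      Measurable.inner_const (by fun_prop)
    have h2 : Measurable fun q : (Eucl n × ℝ) × Eucl n => (SignType.sign q.1.2 : ℝ) :=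
      hsign.comp (by fun_prop)
    have h3 : Measurable fun q : (Eucl n × ℝ) × Eucl n => c q.1.2 := hcm.comp (by fun_prop)
    have h4 : Measurable fun q : (Eucl n × ℝ) × Eucl n => η q.1 := hηm.comp (by fun_prop)
    have h5 : Measurable fun q : (Eucl n × ℝ) × Eucl n => deriv evenCut (q.1.2 / ε) := hcdm.comp (by fun_prop)
    rw [hD]
    fun_prop
  have hNm : Measurable N := by
    have h3 : Measurable fun q : (Eucl n × ℝ) × Eucl n => c q.1.2 := hcm.comp (by fun_prop)
    have h4 : Measurable fun q : (Eucl n × ℝ) × Eucl n => fderiv ℝ η q.1 e := hdηm.comp (by fun_prop)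
    rw [hN]
    fun_prop
  have hNle : ∀ X y, |N (X, y)| ≤ (M ^ (2 * s) * C) * |fderiv ℝ η X e| * decay s y 1 := by
    intro X y
    by_cases hX : ‖X‖ ≤ M
    · have hM0 : 0 ≤ M := (norm_nonneg _).trans hX
      have h4 := decay_nonneg s y 1
      by_cases hz : ε / 2 ≤ |X.2|
      · have h1 := hK X hX hz y
        have h2 := extKer_nonneg s (X.1 - y) X.2
        have h3 : |c X.2| ≤ 1 := abs_evenCut_le _
        simp only [hN]
        rw [abs_mul, abs_mul, abs_of_nonneg h2]
        calc |c X.2| * extKer s (X.1 - y) X.2 * |fderiv ℝ η X e|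
            ≤ 1 * (M ^ (2 * s) * C * decay s y 1) * |fderiv ℝ η X e| := by gcongr
          _ = _ := by ring
      · simp only [hN]
        rw [hc0 _ (not_le.1 hz).le, zero_mul, zero_mul, abs_zero]; positivity
    · simp [hN, (hzero X hX).2]
  -- Since `2s - 1` may have either sign, `|z|^(2s-1)` is bounded by the sum of its values at the
  -- two ends of `[ε/2, M]`.
  set A : ℝ := ((ε / 2) ^ (2 * s - 1) + M ^ (2 * s - 1)) * (((n : ℝ) + 2 * s) * C * (‖e.1‖ + |e.2|)) +
    C1 / ε * (M ^ (2 * s) * C) * |e.2| with hA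
  have hDle : ∀ X : Eucl n × ℝ, X.2 ≠ 0 → ∀ y, |D (X, y)| ≤ A * |η X| * decay s y 1 := by
    intro X hX0 y
    by_cases hX : ‖X‖ ≤ M
    · have hM0 : 0 ≤ M := (norm_nonneg _).trans hX
      have h4 := decay_nonneg s y 1
      have hA0 : 0 ≤ A := by rw [hA]; positivity
      by_cases hz : ε / 2 ≤ |X.2|
      · have h1 := hK X hX hz y
        have h2 := extKer_nonneg s (X.1 - y) X.2
        have h3 : |c X.2| ≤ 1 := abs_evenCut_le _
        have h5 := norm_fieldX_le hs.le (X.1 - y) hX0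
        have h6 := abs_fieldZ_le hs.le (X.1 - y) hX0
        have h7 := hCle X.1 y X.2 ((norm_fst_le X).trans hX) hz
        have h8 := rpow_le_add_rpow (half_pos hε) hz ((norm_snd_le X).trans hX) (2 * s - 1)
        have h9 := abs_real_inner_le_norm (fieldX s (X.1 - y) X.2) e.1
        have h10 : |inner ℝ (fieldX s (X.1 - y) X.2) e.1 + fieldZ s (X.1 - y) X.2 * e.2| ≤
            ((n : ℝ) + 2 * s) * C * (‖e.1‖ + |e.2|) * decay s y 1 := by
          refine (abs_add_le _ _).trans ?_
          rw [abs_mul]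
          calc _ ≤ ‖fieldX s (X.1 - y) X.2‖ * ‖e.1‖ + |fieldZ s (X.1 - y) X.2| * |e.2| := by gcongr
            _ ≤ (((n : ℝ) + 2 * s) * (C * decay s y 1)) * ‖e.1‖ + (((n : ℝ) + 2 * s) * (C * decay s y 1)) * |e.2| := by
                gcongr
                · exact h5.trans (by gcongr)
                · exact h6.trans (by gcongr)
            _ = _ := by ring
        simp only [hD]
        rw [abs_mul]
        have h11 : |c X.2 * (SignType.sign X.2 * |X.2| ^ (2 * s - 1) *
            (inner ℝ (fieldX s (X.1 - y) X.2) e.1 + fieldZ s (X.1 - y) X.2 * e.2)) +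
            deriv evenCut (X.2 / ε) / ε * extKer s (X.1 - y) X.2 * e.2| ≤ A * decay s y 1 := by
          refine (abs_add_le _ _).trans ?_
          rw [abs_mul, abs_mul, abs_mul, abs_mul, abs_mul, abs_of_nonneg h2, abs_div, abs_of_pos hε,
            abs_sign_of_ne_zero hX0, abs_of_nonneg (Real.rpow_nonneg (abs_nonneg X.2) _)]
          calc _ ≤ 1 * (1 * ((ε / 2) ^ (2 * s - 1) + M ^ (2 * s - 1)) *
                (((n : ℝ) + 2 * s) * C * (‖e.1‖ + |e.2|) * decay s y 1)) +
                C1 / ε * (M ^ (2 * s) * C * decay s y 1) * |e.2| := by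
                gcongr
                exact hC1le _
            _ = _ := by rw [hA]; ring
        calc _ ≤ (A * decay s y 1) * |η X| := by gcongr
          _ = _ := by ring
      · simp only [hD]
        rw [hc0 _ (not_le.1 hz).le, hcd0 _ (not_le.1 hz)]
        simp; positivity
    · simp [hD, (hzero X hX).1]
  have hNint := integrable_prod_of_decay hum hu hNm.aestronglyMeasurable
    (hint2.abs.const_mul (M ^ (2 * s) * C)) (Eventually.of_forall hNle)
  have hDint := integrable_prod_of_decay hum hu hDm.aestronglyMeasurable
    (hint1.abs.const_mul A) (ae_snd_ne_zero.mono hDle)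
  -- integration by parts for each pole
  have hpole : ∀ y, ∫ X, N (X, y) = -∫ X, D (X, y) := by
    intro y
    have hf : ContDiff ℝ ∞ fun X : Eucl n × ℝ => c X.2 * extKer s (X.1 - y) X.2 :=
      contDiff_cut_mul hcs (half_pos hε) hc0 (fun X hX => contDiffAt_extKer s y hX)
    have hfd : Continuous fun X => fderiv ℝ (fun X : Eucl n × ℝ => c X.2 * extKer s (X.1 - y) X.2) X e :=
      (hf.continuous_fderiv (by simp)).clm_apply continuous_const
    have h1 := integral_mul_fderiv_eq_neg_fderiv_mul_of_integrable (μ := (volume : Measure (Eucl n × ℝ)))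
      (f := fun X : Eucl n × ℝ => c X.2 * extKer s (X.1 - y) X.2) (g := η) (v := e)
      ((hfd.mul hηcont).integrable_of_hasCompactSupport hηc.mul_left)
      ((hf.continuous.mul hdη).integrable_of_hasCompactSupport hdηc.mul_left)
      ((hf.continuous.mul hηcont).integrable_of_hasCompactSupport hηc.mul_left)
      (fun X _ => (hf.differentiable (by simp)) X) (fun X _ => (hη.differentiable (by simp)) X)
    simp only [hN]
    rw [h1]
    congr 1
    refine integral_congr_ae ?_
    filter_upwards [ae_snd_ne_zero] with X hX
    have h2 : HasFDerivAt (fun X : Eucl n × ℝ => c X.2)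
        ((deriv evenCut (X.2 / ε) / ε) • ContinuousLinearMap.snd ℝ (Eucl n) ℝ) X :=
      (hcd X.2).comp_hasFDerivAt X hasFDerivAt_snd
    have h3 := ((contDiffAt_extKer s y hX).differentiableAt (by simp)).hasFDerivAt
    have h4 : fderiv ℝ (fun X : Eucl n × ℝ => c X.2 * extKer s (X.1 - y) X.2) X = _ := (h2.mul h3).fderiv
    simp only [hD]
    rw [h4]
    simp only [_root_.add_apply, _root_.smul_apply, smul_eq_mul,
      ContinuousLinearMap.coe_snd', fderiv_extKer s y hX e]
    ring
  have h5 := integral_integral_swap (f := fun X y => u y * N (X, y)) hNint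
  have h6 := integral_integral_swap (f := fun X y => u y * D (X, y)) hDint
  have h7 : ∫ X : Eucl n × ℝ, evenCut (X.2 / ε) * extend s u X * fderiv ℝ η X e = ∫ X, ∫ y, u y * N (X, y) := by
    refine integral_congr_ae (Eventually.of_forall fun X => ?_)
    simp only [hN]
    rw [extend_eq, mul_right_comm, ← integral_const_mul]
    refine integral_congr_ae (Eventually.of_forall fun y => ?_)
    simp only [hc]; ring
  have h8 : ∫ X : Eucl n × ℝ, (evenCut (X.2 / ε) * (inner ℝ (extGrad s u X).1 e.1 + (extGrad s u X).2 * e.2) +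
        deriv evenCut (X.2 / ε) / ε * extend s u X * e.2) * η X = ∫ X, ∫ y, u y * D (X, y) := by
    refine integral_congr_ae ?_
    filter_upwards [ae_snd_ne_zero] with X hX
    simp only [hD]
    have i1 := integrable_mul_extKer_sub hs.le hum hu X.1 hX
    have i2 : Integrable fun y => u y * (SignType.sign X.2 * |X.2| ^ (2 * s - 1) *
        (inner ℝ (fieldX s (X.1 - y) X.2) e.1 + fieldZ s (X.1 - y) X.2 * e.2)) := by
      have i3 := (integrable_smul_field_sub hs.le hum hu X.1 hX).const_inner (𝕜 := ℝ) (WithLp.toLp 2 e : EuclProd n)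
      refine (i3.const_mul (SignType.sign X.2 * |X.2| ^ (2 * s - 1))).congr (Eventually.of_forall fun y => ?_)
      simp only
      rw [real_inner_smul_right, real_inner_comm, field, inner_toLp]
      ring
    rw [inner_extGrad hs.le hum hu hX e, extend_eq, mul_right_comm _ _ e.2, ← integral_const_mul,
      ← integral_const_mul, ← integral_add (i2.const_mul _) (i1.const_mul _), ← integral_mul_const]
    refine integral_congr_ae (Eventually.of_forall fun y => ?_)
    simp only [hc]; ring
  rw [h7, h8, h5, h6, ← integral_neg]
  refine integral_congr_ae (Eventually.of_forall fun y => ?_)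
  simp only
  rw [integral_const_mul, integral_const_mul, hpole y]; ring

lemma integral_reflect (f : Eucl n × ℝ → ℝ) : ∫ X : Eucl n × ℝ, f (X.1, -X.2) = ∫ X, f X := by
  have h1 : MeasurePreserving (Prod.map id Neg.neg : Eucl n × ℝ → Eucl n × ℝ)
      (volume.prod volume) (volume.prod volume) :=
    (MeasurePreserving.id _).prod (Measure.measurePreserving_neg volume)
  have h2 : MeasurableEmbedding (Prod.map id Neg.neg : Eucl n × ℝ → Eucl n × ℝ) :=
    ((MeasurableEquiv.refl (Eucl n)).prodCongr (MeasurableEquiv.neg ℝ)).measurableEmbedding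
  exact h1.integral_comp h2 f

lemma integrable_mul_of_integrableOn {f η : Eucl n × ℝ → ℝ} (hη : Continuous η)
    (hηc : HasCompactSupport η) (hf : IntegrableOn f (tsupport η)) :
    Integrable (fun X => f X * η X) := by
  have h1 := hf.mul_continuousOn hη.continuousOn hηc.isCompact
  refine (integrableOn_iff_integrable_of_support_subset ?_).1 h1
  intro X hX
  apply subset_tsupport
  intro h0
  exact hX (by simp [h0])

lemma eventually_le_abs {z : ℝ} (hz : z ≠ 0) : ∀ᶠ ε : ℝ in 𝓝[>] 0, 0 < ε ∧ ε < |z| := by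
  have h1 : Iio |z| ∈ 𝓝 (0 : ℝ) := Iio_mem_nhds (abs_pos.2 hz)
  filter_upwards [self_mem_nhdsWithin, mem_nhdsWithin_of_mem_nhds h1] with ε h2 h3 using ⟨h2, h3⟩

lemma one_lt_abs_div {z ε : ℝ} (hε : 0 < ε) (h : ε < |z|) : 1 < |z / ε| := by
  rwa [abs_div, abs_of_pos hε, one_lt_div hε]

lemma tendsto_evenCut_div {z : ℝ} (hz : z ≠ 0) :
    Tendsto (fun ε : ℝ => evenCut (z / ε)) (𝓝[>] 0) (𝓝 1) := by
  refine tendsto_const_nhds.congr' ?_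
  filter_upwards [eventually_le_abs hz] with ε hε
  rw [evenCut_of_ge (one_lt_abs_div hε.1 hε.2).le]

lemma tendsto_integral_evenCut_mul {f : Eucl n × ℝ → ℝ} (hf : Integrable f) :
    Tendsto (fun ε : ℝ => ∫ X, evenCut (X.2 / ε) * f X) (𝓝[>] 0) (𝓝 (∫ X, f X)) := by
  have hm := contDiff_evenCut.continuous.measurable
  refine tendsto_integral_filter_of_dominated_convergence (fun X => ‖f X‖) ?_ ?_ hf.norm ?_
  · refine Eventually.of_forall fun ε => ?_
    have : Measurable fun X : Eucl n × ℝ => evenCut (X.2 / ε) := hm.comp (by fun_prop)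
    exact this.aestronglyMeasurable.mul hf.1
  · refine Eventually.of_forall fun ε => Eventually.of_forall fun X => ?_
    rw [norm_mul]
    exact mul_le_of_le_one_left (norm_nonneg _) (abs_evenCut_le _)
  · filter_upwards [ae_snd_ne_zero] with X hX
    simpa using (tendsto_evenCut_div hX).mul_const (f X)

/-- Even functions have no flux through `{z = 0}`. -/
lemma tendsto_integral_deriv_evenCut_mul {w η : Eucl n × ℝ → ℝ} (hw : LocallyIntegrable w)
    (heven : ∀ x z, w (x, -z) = w (x, z)) (hη : ContDiff ℝ ∞ η) (hηc : HasCompactSupport η) :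
    Tendsto (fun ε : ℝ => ∫ X : Eucl n × ℝ, deriv evenCut (X.2 / ε) / ε * (w X * η X)) (𝓝[>] 0) (𝓝 0) := by
  obtain ⟨C, hC, hCle⟩ := exists_abs_deriv_evenCut_le
  obtain ⟨L, hL⟩ := hη.lipschitzWith_of_hasCompactSupport hηc (by simp)
  set η' : Eucl n × ℝ → ℝ := fun X => η (X.1, -X.2) with hη'
  have hη's : ContDiff ℝ ∞ η' := hη.comp (contDiff_fst.prodMk contDiff_snd.neg)
  have hη'c : HasCompactSupport η' :=
    hηc.comp_homeomorph ((Homeomorph.refl (Eucl n)).prodCongr (Homeomorph.neg ℝ))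
  set S : Set (Eucl n × ℝ) := tsupport η ∪ tsupport η' with hS
  have hSc : IsCompact S := hηc.isCompact.union hη'c.isCompact
  have hwS : IntegrableOn w S := hw.integrableOn_isCompact hSc
  have hmd := measurable_deriv evenCut
  -- `deriv evenCut` is odd and `w` is even in `z`, so only the odd part of `η` contributes. That
  -- part is `O(|z|)`, which compensates the factor `1/ε` on the layer `|z| ≤ ε` and permits
  -- dominated convergence.
  have hrefl : ∀ ε : ℝ, 0 < ε → ∫ X : Eucl n × ℝ, deriv evenCut (X.2 / ε) / ε * (w X * η X) =
      ∫ X : Eucl n × ℝ, 2⁻¹ * (deriv evenCut (X.2 / ε) / ε * (w X * (η X - η' X))) := by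
    intro ε hε
    have h1 := integral_reflect (fun X : Eucl n × ℝ => deriv evenCut (X.2 / ε) / ε * (w X * η X))
    have h2 : ∀ X : Eucl n × ℝ, deriv evenCut (-X.2 / ε) / ε * (w (X.1, -X.2) * η (X.1, -X.2)) =
        -(deriv evenCut (X.2 / ε) / ε * (w X * η' X)) := by
      intro X; rw [neg_div, deriv_evenCut_neg, heven]; simp only [hη', Prod.mk.eta]; ring
    simp only [h2] at h1
    rw [integral_neg] at h1
    have i0 : ∀ ζ : Eucl n × ℝ → ℝ, Continuous ζ → HasCompactSupport ζ →
        Integrable fun X : Eucl n × ℝ => deriv evenCut (X.2 / ε) / ε * (w X * ζ X) := by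
      intro ζ hζ hζc
      have h3 := integrable_mul_of_integrableOn hζ hζc (hw.integrableOn_isCompact hζc.isCompact)
      refine h3.bdd_mul (c := C / ε) ?_ (Eventually.of_forall fun X => ?_)
      · exact Measurable.aestronglyMeasurable ((hmd.comp (by fun_prop)).div_const _)
      · rw [norm_div, Real.norm_of_nonneg hε.le]; gcongr; exact hCle _
    have i1 := i0 η hη.continuous hηc
    have i2 := i0 η' hη's.continuous hη'c
    rw [integral_const_mul]
    simp_rw [mul_sub]
    rw [integral_sub i1 i2]; linarith
  have hlim : Tendsto (fun ε : ℝ => ∫ X : Eucl n × ℝ,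
      2⁻¹ * (deriv evenCut (X.2 / ε) / ε * (w X * (η X - η' X)))) (𝓝[>] 0) (𝓝 (∫ _ : Eucl n × ℝ, (0 : ℝ))) := by
    have hb : Integrable (S.indicator fun X => C * L * ‖w X‖) :=
      (integrable_indicator_iff hSc.measurableSet).2 (hwS.norm.const_mul _)
    refine tendsto_integral_filter_of_dominated_convergence _ ?_ ?_ hb ?_
    · refine Eventually.of_forall fun ε => ?_
      have h1 : Measurable fun X : Eucl n × ℝ => deriv evenCut (X.2 / ε) / ε :=
        (hmd.comp (by fun_prop)).div_const _
      exact (h1.aestronglyMeasurable.mul (hw.aestronglyMeasurable.mul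
        (hη.continuous.sub hη's.continuous).aestronglyMeasurable)).const_mul _
    · filter_upwards [self_mem_nhdsWithin] with ε hε
      refine Eventually.of_forall fun X => ?_
      have hε : 0 < ε := hε
      by_cases hX : X ∈ S
      · rw [indicator_of_mem hX]
        have h1 : |η X - η' X| ≤ L * (2 * |X.2|) := by
          have := hL.dist_le_mul X (X.1, -X.2)
          rw [Real.dist_eq] at this
          refine this.trans (le_of_eq ?_)
          congr 1
          rw [Prod.dist_eq]; simp [Real.dist_eq]
          rw [← two_mul, abs_mul]; simp
        have h2 : |deriv evenCut (X.2 / ε) / ε| * |X.2| ≤ C := by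
          by_cases h3 : 1 < |X.2 / ε|
          · rw [deriv_evenCut_of_gt h3]; simpa using hC
          · rw [abs_div, abs_of_pos hε, not_lt, div_le_one hε] at h3
            rw [abs_div, abs_of_pos hε, div_mul_eq_mul_div, div_le_iff₀ hε]
            exact mul_le_mul (hCle _) h3 (abs_nonneg _) hC
        rw [norm_mul, norm_mul, norm_mul]
        simp only [Real.norm_eq_abs] at *
        calc |2⁻¹| * (|deriv evenCut (X.2 / ε) / ε| * (|w X| * |η X - η' X|))
            ≤ |2⁻¹| * (|deriv evenCut (X.2 / ε) / ε| * (|w X| * (L * (2 * |X.2|)))) := by gcongr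
          _ = L * |w X| * (|deriv evenCut (X.2 / ε) / ε| * |X.2|) := by
              rw [abs_of_pos (by norm_num : (0 : ℝ) < 2⁻¹)]; ring
          _ ≤ L * |w X| * C := by gcongr
          _ = _ := by ring
      · rw [indicator_of_notMem hX]
        have h1 : η X = 0 := image_eq_zero_of_notMem_tsupport fun h => hX (Or.inl h)
        have h2 : η' X = 0 := image_eq_zero_of_notMem_tsupport fun h => hX (Or.inr h)
        simp [h1, h2]
    · filter_upwards [ae_snd_ne_zero] with X hX
      refine tendsto_const_nhds.congr' ?_
      filter_upwards [eventually_le_abs hX] with ε hε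
      rw [deriv_evenCut_of_gt (one_lt_abs_div hε.1 hε.2)]; simp
  rw [integral_zero] at hlim
  refine hlim.congr' ?_
  filter_upwards [self_mem_nhdsWithin] with ε hε using (hrefl ε hε).symm

/-- The extension has the weak gradient `extGrad s u`, across `{z = 0}`, wherever the
Gagliardo energy of `u` is finite. -/
lemma hasWeakGradOn_extend {s : ℝ} (hs : 0 < s) {u : Eucl n → ℝ} (hum : Measurable u)
    (hu : Integrable fun y => u y * decay s y 1) {B : Set (Eucl n)} (hB : IsOpen B)
    (hfin : gagliardo s (crossSet B) u < ⊤) {U : Set (Eucl n × ℝ)} (hU : IsOpen U)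
    (hUB : ∀ X ∈ U, X.2 = 0 → X.1 ∈ B) : HasWeakGradOn U (extend s u) (extGrad s u) := by
  have hloc := locallyIntegrable_extend hs hum hu
  have hG := locallyIntegrableOn_extGrad hs hum hu hB hfin hU hUB
  refine ⟨hloc.locallyIntegrableOn U, hG, fun η hη hηc hηU e => ?_⟩
  have hdη : Continuous fun X => fderiv ℝ η X e := (hη.continuous_fderiv (by simp)).clm_apply continuous_const
  have hdηc : HasCompactSupport fun X => fderiv ℝ η X e := hηc.fderiv_apply (𝕜 := ℝ) e
  have i1 : Integrable fun X => extend s u X * fderiv ℝ η X e :=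
    integrable_mul_of_integrableOn hdη hdηc (hloc.integrableOn_isCompact hdηc.isCompact)
  have hGe : IntegrableOn (fun X => inner ℝ (extGrad s u X).1 e.1 + (extGrad s u X).2 * e.2) (tsupport η) := by
    have h1 : IntegrableOn (extGrad s u) (tsupport η) := hG.integrableOn_compact_subset hηU hηc.isCompact
    exact (Integrable.inner_const (𝕜 := ℝ) h1.fst e.1).add (h1.snd.mul_const e.2)
  have i2 := integrable_mul_of_integrableOn hη.continuous hηc hGe
  have i3 : Integrable fun X => extend s u X * η X :=
    integrable_mul_of_integrableOn hη.continuous hηc (hloc.integrableOn_isCompact hηc.isCompact)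
  have t1 := tendsto_integral_evenCut_mul i1
  have t2 := tendsto_integral_evenCut_mul i2
  -- The flux term disappears in the limit because the extension is even in `z`.
  have t3 := (tendsto_integral_deriv_evenCut_mul hloc (extend_neg_snd s u) hη hηc).const_mul e.2
  have t4 := (t2.add t3).neg
  rw [mul_zero, add_zero] at t4
  refine tendsto_nhds_unique t1 (t4.congr' ?_)
  filter_upwards [self_mem_nhdsWithin] with ε hε
  have hε : 0 < ε := hε
  have h1 := integral_evenCut_extend_mul_fderiv hs hum hu hη hηc e hε
  have hm := contDiff_evenCut.continuous.measurable
  have hmd := measurable_deriv evenCut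
  obtain ⟨C, hC, hCle⟩ := exists_abs_deriv_evenCut_le
  have j2 : Integrable fun X : Eucl n × ℝ => evenCut (X.2 / ε) *
      ((inner ℝ (extGrad s u X).1 e.1 + (extGrad s u X).2 * e.2) * η X) :=
    i2.bdd_mul (c := 1) (Measurable.aestronglyMeasurable (hm.comp (by fun_prop)))
      (Eventually.of_forall fun X => abs_evenCut_le _)
  have j3 : Integrable fun X : Eucl n × ℝ => deriv evenCut (X.2 / ε) / ε * (extend s u X * η X) := by
    refine i3.bdd_mul (c := C / ε) (Measurable.aestronglyMeasurable ((hmd.comp (by fun_prop)).div_const _))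
      (Eventually.of_forall fun X => ?_)
    rw [norm_div, Real.norm_of_nonneg hε.le]; gcongr; exact hCle _
  rw [← integral_const_mul, ← integral_add j2 (j3.const_mul _)]
  have h2 : ∀ X : Eucl n × ℝ, evenCut (X.2 / ε) * (extend s u X * fderiv ℝ η X e) =
      evenCut (X.2 / ε) * extend s u X * fderiv ℝ η X e := fun X => by ring
  simp_rw [h2]
  rw [h1]
  congr 1
  refine integral_congr_ae (Eventually.of_forall fun X => ?_)
  simp only; ring

/-! ### The divergence-free field and weak gradients tested against it -/

lemma exists_cutoff {E : Type*} [NormedAddCommGroup E] [NormedSpace ℝ E] [FiniteDimensional ℝ E]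
    {K U : Set E} (hK : IsCompact K) (hU : IsOpen U) (hKU : K ⊆ U) :
    ∃ ξ : E → ℝ, ContDiff ℝ ∞ ξ ∧ HasCompactSupport ξ ∧ tsupport ξ ⊆ U ∧
      (∀ x ∈ K, ∀ᶠ y in 𝓝 x, ξ y = 1) ∧ ∀ x, ξ x ∈ Icc (0 : ℝ) 1 := by
  have : SigmaCompactSpace E := by
    have := FiniteDimensional.proper_real E
    infer_instance
  obtain ⟨L, hL, hKL, hLU⟩ := exists_compact_between hK hU hKU
  obtain ⟨f, h1, h2, h3⟩ := exists_contMDiffMap_one_nhds_of_subset_interior (n := ⊤)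
    (modelWithCornersSelf ℝ E) hK.isClosed hKL
  have hs : tsupport f ⊆ L := closure_minimal (fun x hx => by
    by_contra h; exact hx (h2 x h)) hL.isClosed
  exact ⟨f, f.contMDiff.contDiff, hL.of_isClosed_subset (isClosed_tsupport _) hs, hs.trans hLU,
    fun x hx => (eventually_nhdsSet_iff_forall.1 h1) x hx, h3⟩

lemma inner_fieldX (s : ℝ) (e x : Eucl n) (z : ℝ) :
    inner ℝ e (fieldX s x z) =
      -((n : ℝ) + 2 * s) * z * (‖x‖ ^ 2 + z ^ 2) ^ (-(((n : ℝ) + 2 * s) / 2 + 1)) * inner ℝ e x := by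
  unfold fieldX; rw [real_inner_smul_right]

lemma hasFDerivAt_normSq_rpow (y : Eucl n) (q : ℝ) {X : Eucl n × ℝ} (hX : X.2 ≠ 0) :
    HasFDerivAt (fun X : Eucl n × ℝ => (‖X.1 - y‖ ^ 2 + X.2 ^ 2) ^ q)
      ((q * (‖X.1 - y‖ ^ 2 + X.2 ^ 2) ^ (q - 1)) •
        (2 • (innerSL ℝ (X.1 - y)).comp (ContinuousLinearMap.fst ℝ (Eucl n) ℝ) +
          (2 * X.2) • ContinuousLinearMap.snd ℝ (Eucl n) ℝ)) X := by
  have hR := norm_sq_add_sq_pos hX (X.1 - y)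
  have h1 : HasFDerivAt (fun X : Eucl n × ℝ => X.1 - y) (ContinuousLinearMap.fst ℝ (Eucl n) ℝ) X :=
    (hasFDerivAt_fst (𝕜 := ℝ) (E := Eucl n) (F := ℝ)).sub_const y
  have h3 : HasFDerivAt (fun X : Eucl n × ℝ => X.2) (ContinuousLinearMap.snd ℝ (Eucl n) ℝ) X := hasFDerivAt_snd
  have h4 := (h1.norm_sq.add (h3.pow 2)).rpow_const (p := q) (Or.inl hR.ne')
  simpa using h4

lemma fderiv_inner_fieldX (s : ℝ) (y e : Eucl n) {X : Eucl n × ℝ} (hX : X.2 ≠ 0) :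
    fderiv ℝ (fun X : Eucl n × ℝ => inner ℝ e (fieldX s (X.1 - y) X.2)) X (e, 0) =
      -((n : ℝ) + 2 * s) * X.2 * (‖e‖ ^ 2 * (‖X.1 - y‖ ^ 2 + X.2 ^ 2) ^ (-(((n : ℝ) + 2 * s) / 2 + 1)) -
        ((n : ℝ) + 2 * s + 2) * inner ℝ e (X.1 - y) ^ 2 *
          (‖X.1 - y‖ ^ 2 + X.2 ^ 2) ^ (-(((n : ℝ) + 2 * s) / 2 + 2))) := by
  set p : ℝ := (n : ℝ) + 2 * s with hp
  have h1 : HasFDerivAt (fun X : Eucl n × ℝ => X.1 - y) (ContinuousLinearMap.fst ℝ (Eucl n) ℝ) X :=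
    (hasFDerivAt_fst (𝕜 := ℝ) (E := Eucl n) (F := ℝ)).sub_const y
  have h3 : HasFDerivAt (fun X : Eucl n × ℝ => X.2) (ContinuousLinearMap.snd ℝ (Eucl n) ℝ) X := hasFDerivAt_snd
  have h2 : HasFDerivAt (fun X : Eucl n × ℝ => inner ℝ e (X.1 - y))
      ((innerSL ℝ e).comp (ContinuousLinearMap.fst ℝ (Eucl n) ℝ)) X :=
    (innerSL ℝ e).hasFDerivAt.comp X h1
  have h4 := ((h3.const_mul (-p)).mul (hasFDerivAt_normSq_rpow y (-(p / 2 + 1)) hX)).mul h2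
  have h5 : (fun X : Eucl n × ℝ => inner ℝ e (fieldX s (X.1 - y) X.2)) = fun X =>
      -p * X.2 * (‖X.1 - y‖ ^ 2 + X.2 ^ 2) ^ (-(p / 2 + 1)) * inner ℝ e (X.1 - y) := by
    funext X; rw [inner_fieldX]
  rw [h5]
  have h6 : fderiv ℝ (fun X : Eucl n × ℝ =>
      -p * X.2 * (‖X.1 - y‖ ^ 2 + X.2 ^ 2) ^ (-(p / 2 + 1)) * inner ℝ e (X.1 - y)) X = _ := h4.fderiv
  rw [h6]
  simp
  rw [show -1 + -(p / 2) - 1 = -(p / 2 + 2) by ring, real_inner_comm e X.1, real_inner_comm e y]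
  simp only [inner_sub_right]
  ring

lemma fderiv_fieldZ (s : ℝ) (y : Eucl n) {X : Eucl n × ℝ} (hX : X.2 ≠ 0) :
    fderiv ℝ (fun X : Eucl n × ℝ => fieldZ s (X.1 - y) X.2) X (0, 1) =
      -(2 * n * X.2) * (‖X.1 - y‖ ^ 2 + X.2 ^ 2) ^ (-(((n : ℝ) + 2 * s) / 2 + 1)) -
        ((n : ℝ) + 2 * s + 2) * X.2 * (2 * s * ‖X.1 - y‖ ^ 2 - n * X.2 ^ 2) *
          (‖X.1 - y‖ ^ 2 + X.2 ^ 2) ^ (-(((n : ℝ) + 2 * s) / 2 + 2)) := by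
  set p : ℝ := (n : ℝ) + 2 * s with hp
  have h1 : HasFDerivAt (fun X : Eucl n × ℝ => X.1 - y) (ContinuousLinearMap.fst ℝ (Eucl n) ℝ) X :=
    (hasFDerivAt_fst (𝕜 := ℝ) (E := Eucl n) (F := ℝ)).sub_const y
  have h3 : HasFDerivAt (fun X : Eucl n × ℝ => X.2) (ContinuousLinearMap.snd ℝ (Eucl n) ℝ) X := hasFDerivAt_snd
  have h2 := (h1.norm_sq.const_mul (2 * s)).sub ((h3.pow 2).const_mul (n : ℝ))
  have h4 := h2.mul (hasFDerivAt_normSq_rpow y (-(p / 2 + 1)) hX)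
  have h6 : fderiv ℝ (fun X : Eucl n × ℝ => fieldZ s (X.1 - y) X.2) X = _ := h4.fderiv
  rw [h6]
  simp
  rw [show -1 + -(p / 2) - 1 = -(p / 2 + 2) by ring]
  ring

/-- The field is divergence free off `{z = 0}`. -/
lemma div_field (s : ℝ) (y : Eucl n) {X : Eucl n × ℝ} (hX : X.2 ≠ 0) :
    ∑ i, fderiv ℝ (fun X : Eucl n × ℝ => inner ℝ (EuclideanSpace.basisFun (Fin n) ℝ i)
        (fieldX s (X.1 - y) X.2)) X (EuclideanSpace.basisFun (Fin n) ℝ i, 0) +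
      fderiv ℝ (fun X : Eucl n × ℝ => fieldZ s (X.1 - y) X.2) X (0, 1) = 0 := by
  set b := EuclideanSpace.basisFun (Fin n) ℝ
  have hR := norm_sq_add_sq_pos hX (X.1 - y)
  have h1 : ∑ i, inner ℝ (b i) (X.1 - y) ^ 2 = ‖X.1 - y‖ ^ 2 := by
    rw [← b.sum_sq_norm_inner_right]; simp
  simp_rw [fderiv_inner_fieldX s y _ hX, fderiv_fieldZ s y hX, b.norm_eq_one]
  rw [← Finset.mul_sum, Finset.sum_sub_distrib, ← Finset.sum_mul, ← Finset.sum_mul, ← Finset.mul_sum, h1]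
  have h2 := rpow_succ_mul hR (((n : ℝ) + 2 * s) / 2 + 1)
  rw [show ((n : ℝ) + 2 * s) / 2 + 1 + 1 = ((n : ℝ) + 2 * s) / 2 + 2 by ring] at h2
  rw [← h2]
  simp
  ring

/-- `(φ, G)` satisfies the weak form of `∇φ = G` against all fields of the extension kernel,
truncated near `{z = 0}`. -/
def IsFieldPair (s : ℝ) (φ : Eucl n × ℝ → ℝ) (G : Eucl n × ℝ → Eucl n × ℝ) : Prop :=
  ∀ (c : ℝ → ℝ) (d : ℝ), ContDiff ℝ ∞ c → 0 < d → (∀ z, |z| ≤ d → c z = 0) → ∀ y : Eucl n,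
    ∫ X : Eucl n × ℝ, c X.2 * inner ℝ (WithLp.toLp 2 (G X) : EuclProd n) (field s (X.1 - y) X.2) =
      -∫ X : Eucl n × ℝ, φ X * (deriv c X.2 * fieldZ s (X.1 - y) X.2)

lemma contDiffAt_inner_fieldX (s : ℝ) (y e : Eucl n) {X : Eucl n × ℝ} (hX : X.2 ≠ 0) :
    ContDiffAt ℝ ∞ (fun X : Eucl n × ℝ => inner ℝ e (fieldX s (X.1 - y) X.2)) X := by
  simp_rw [inner_fieldX]
  have h1 : ContDiff ℝ ∞ fun X : Eucl n × ℝ => inner ℝ e (X.1 - y) :=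
    contDiff_const.inner ℝ (contDiff_fst.sub contDiff_const)
  exact (((contDiff_const.mul contDiff_snd).contDiffAt).mul (contDiffAt_normSq_rpow y _ hX)).mul h1.contDiffAt

lemma contDiffAt_fieldZ (s : ℝ) (y : Eucl n) {X : Eucl n × ℝ} (hX : X.2 ≠ 0) :
    ContDiffAt ℝ ∞ (fun X : Eucl n × ℝ => fieldZ s (X.1 - y) X.2) X := by
  unfold fieldZ
  have h1 : ContDiff ℝ ∞ fun X : Eucl n × ℝ => X.1 - y := contDiff_fst.sub contDiff_const
  have h2 : ContDiff ℝ ∞ fun X : Eucl n × ℝ => 2 * s * ‖X.1 - y‖ ^ 2 - n * X.2 ^ 2 :=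
    (contDiff_const.mul (h1.norm_sq ℝ)).sub (contDiff_const.mul (contDiff_snd.pow 2))
  exact h2.contDiffAt.mul (contDiffAt_normSq_rpow y _ hX)

/-- The components of `c` times the field, cut off by a function `ξ` equal to one near `K`, are
legitimate test functions. Summed over an orthonormal basis, the derivatives of the field cancel by
`div_field`, and only the derivative falling on `c`, which is vertical, survives. The resulting
identity no longer mentions `U` and passes to horizontal mollifications. -/
lemma isFieldPair_of_hasWeakGradOn (s : ℝ) {φ : Eucl n × ℝ → ℝ} {G : Eucl n × ℝ → Eucl n × ℝ}
    {U K : Set (Eucl n × ℝ)} (hU : IsOpen U) (hw : HasWeakGradOn U φ G) (hK : IsCompact K)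
    (hKU : K ⊆ U) (hφK : ∀ᵐ X, X ∉ K → φ X = 0) (hGK : ∀ᵐ X, X ∉ K → G X = 0) :
    IsFieldPair s φ G := by
  intro c d hc hd hc0 y
  obtain ⟨ξ, hξ, hξc, hξU, hξ1, -⟩ := exists_cutoff hK hU hKU
  set b := EuclideanSpace.basisFun (Fin n) ℝ with hb
  obtain ⟨hφl, hGl, hwk⟩ := hw
  -- the truncated test functions
  have key : ∀ f : Eucl n × ℝ → ℝ, (∀ X : Eucl n × ℝ, X.2 ≠ 0 → ContDiffAt ℝ ∞ f X) → ∀ e : Eucl n × ℝ,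
      Integrable (fun X => φ X * fderiv ℝ (fun X => c X.2 * f X) X e) ∧
      Integrable (fun X => (inner ℝ (G X).1 e.1 + (G X).2 * e.2) * (c X.2 * f X)) ∧
      ∫ X, φ X * fderiv ℝ (fun X => c X.2 * f X) X e =
        -∫ X, (inner ℝ (G X).1 e.1 + (G X).2 * e.2) * (c X.2 * f X) := by
    intro f hf e
    have hcf := contDiff_cut_mul hc hd hc0 hf
    have hη : ContDiff ℝ ∞ fun X => ξ X * (c X.2 * f X) := hξ.mul hcf
    have hηc : HasCompactSupport fun X => ξ X * (c X.2 * f X) := hξc.mul_right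
    have hηU : tsupport (fun X => ξ X * (c X.2 * f X)) ⊆ U := (tsupport_mul_subset_left).trans hξU
    have h1 := hwk _ hη hηc hηU e
    have e1 : (fun X => φ X * fderiv ℝ (fun X => ξ X * (c X.2 * f X)) X e) =ᵐ[volume]
        fun X => φ X * fderiv ℝ (fun X => c X.2 * f X) X e := by
      filter_upwards [hφK] with X hX
      by_cases hXK : X ∈ K
      · have : (fun X => ξ X * (c X.2 * f X)) =ᶠ[𝓝 X] fun X => c X.2 * f X := by
          filter_upwards [hξ1 X hXK] with Y hY
          rw [hY, one_mul]
        rw [this.fderiv_eq]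
      · rw [hX hXK]; simp
    have e2 : (fun X => (inner ℝ (G X).1 e.1 + (G X).2 * e.2) * (ξ X * (c X.2 * f X))) =ᵐ[volume]
        fun X => (inner ℝ (G X).1 e.1 + (G X).2 * e.2) * (c X.2 * f X) := by
      filter_upwards [hGK] with X hX
      by_cases hXK : X ∈ K
      · rw [(hξ1 X hXK).self_of_nhds, one_mul]
      · rw [hX hXK]; simp
    have hdη : Continuous fun X => fderiv ℝ (fun X => ξ X * (c X.2 * f X)) X e :=
      (hη.continuous_fderiv (by simp)).clm_apply continuous_const
    have hdηc : HasCompactSupport fun X => fderiv ℝ (fun X => ξ X * (c X.2 * f X)) X e :=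
      hηc.fderiv_apply (𝕜 := ℝ) e
    have hsub : tsupport (fun X => fderiv ℝ (fun X => ξ X * (c X.2 * f X)) X e) ⊆ U :=
      (tsupport_fderiv_apply_subset ℝ e).trans hηU
    refine ⟨?_, ?_, ?_⟩
    · refine (integrable_mul_of_integrableOn hdη hdηc ?_).congr e1
      exact hφl.integrableOn_compact_subset hsub hdηc.isCompact
    · refine (integrable_mul_of_integrableOn hη.continuous hηc ?_).congr e2
      have h2 : IntegrableOn G (tsupport fun X => ξ X * (c X.2 * f X)) :=
        hGl.integrableOn_compact_subset hηU hηc.isCompact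
      exact (Integrable.inner_const (𝕜 := ℝ) h2.fst e.1).add (h2.snd.mul_const e.2)
    · rw [← integral_congr_ae e1, ← integral_congr_ae e2]; exact h1
  have kx := fun i => key (fun X => inner ℝ (b i) (fieldX s (X.1 - y) X.2))
    (fun X hX => contDiffAt_inner_fieldX s y (b i) hX) (b i, 0)
  have kz := key (fun X => fieldZ s (X.1 - y) X.2) (fun X hX => contDiffAt_fieldZ s y hX) (0, 1)
  have hsum : ∑ i, (∫ X, φ X * fderiv ℝ (fun X : Eucl n × ℝ => c X.2 * inner ℝ (b i) (fieldX s (X.1 - y) X.2)) X (b i, 0)) +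
      ∫ X, φ X * fderiv ℝ (fun X : Eucl n × ℝ => c X.2 * fieldZ s (X.1 - y) X.2) X (0, 1) =
      -(∑ i, (∫ X, (inner ℝ (G X).1 (b i) + (G X).2 * 0) * (c X.2 * inner ℝ (b i) (fieldX s (X.1 - y) X.2))) +
        ∫ X, (inner ℝ (G X).1 0 + (G X).2 * 1) * (c X.2 * fieldZ s (X.1 - y) X.2)) := by
    rw [neg_add, ← Finset.sum_neg_distrib, kz.2.2]
    congr 1
    exact Finset.sum_congr rfl fun i _ => (kx i).2.2
  rw [← integral_finsetSum _ (fun i _ => (kx i).1), ← integral_finsetSum _ (fun i _ => (kx i).2.1),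
    ← integral_add (integrable_finsetSum _ fun i _ => (kx i).1) kz.1,
    ← integral_add (integrable_finsetSum _ fun i _ => (kx i).2.1) kz.2.1] at hsum
  have l1 : ∫ X : Eucl n × ℝ, c X.2 * inner ℝ (WithLp.toLp 2 (G X) : EuclProd n) (field s (X.1 - y) X.2) =
      ∫ X, (∑ i, (inner ℝ (G X).1 (b i) + (G X).2 * 0) * (c X.2 * inner ℝ (b i) (fieldX s (X.1 - y) X.2)) +
        (inner ℝ (G X).1 0 + (G X).2 * 1) * (c X.2 * fieldZ s (X.1 - y) X.2)) := by
    refine integral_congr_ae (Eventually.of_forall fun X => ?_)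
    simp only
    rw [field, inner_toLp, ← b.sum_inner_mul_inner, mul_add, Finset.mul_sum]
    simp only [mul_zero, add_zero, inner_zero_right, zero_add, mul_one]
    congr 1
    · exact Finset.sum_congr rfl fun i _ => by ring
    · ring
  have l2 : ∫ X : Eucl n × ℝ, φ X * (deriv c X.2 * fieldZ s (X.1 - y) X.2) =
      ∫ X, (∑ i, φ X * fderiv ℝ (fun X : Eucl n × ℝ => c X.2 * inner ℝ (b i) (fieldX s (X.1 - y) X.2)) X (b i, 0) +
        φ X * fderiv ℝ (fun X : Eucl n × ℝ => c X.2 * fieldZ s (X.1 - y) X.2) X (0, 1)) := by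
    refine integral_congr_ae ?_
    filter_upwards [ae_snd_ne_zero] with X hX
    have hcd : HasFDerivAt (fun X : Eucl n × ℝ => c X.2)
        ((deriv c X.2) • ContinuousLinearMap.snd ℝ (Eucl n) ℝ) X :=
      ((hc.differentiable (by simp) X.2).hasDerivAt).comp_hasFDerivAt X hasFDerivAt_snd
    have d1 : ∀ (f : Eucl n × ℝ → ℝ), ContDiffAt ℝ ∞ f X → ∀ e : Eucl n × ℝ,
        fderiv ℝ (fun X => c X.2 * f X) X e = c X.2 * fderiv ℝ f X e + f X * (deriv c X.2 * e.2) := by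
      intro f hf e
      have h3 := (hf.differentiableAt (by simp)).hasFDerivAt
      have h4 : fderiv ℝ (fun X : Eucl n × ℝ => c X.2 * f X) X = _ := (hcd.mul h3).fderiv
      rw [h4]; simp
    have hdiv := div_field s y hX
    simp_rw [fun i => d1 _ (contDiffAt_inner_fieldX s y (b i) hX), d1 _ (contDiffAt_fieldZ s y hX)]
    rw [← Finset.mul_sum, ← mul_add]
    simp only [mul_zero, add_zero, mul_one]
    rw [← Finset.mul_sum, ← add_assoc, ← mul_add, hdiv, mul_zero, zero_add, mul_comm (deriv c X.2)]
  rw [l1, l2, hsum, neg_neg]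

/-! ### The Gagliardo form as the limit of pairings with the vertical field -/

lemma integrable_min_sq_div (hn : 1 ≤ n) {s : ℝ} (hs : s ∈ Ioo (0 : ℝ) 1) :
    Integrable fun t : Eucl n => min 1 ‖t‖ ^ 2 / ‖t‖ ^ ((n : ℝ) + 2 * s) := by
  obtain ⟨h0, h1⟩ := hs
  have : Nontrivial (Eucl n) := by
    have : Nonempty (Fin n) := ⟨⟨0, hn⟩⟩
    infer_instance
  have key := (integrable_fun_norm_addHaar (volume : Measure (Eucl n))
    (f := fun r : ℝ => min 1 r ^ 2 / r ^ ((n : ℝ) + 2 * s)))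
  refine key.2 ?_
  rw [finrank_euclideanSpace_fin]
  have hpow : ∀ r : ℝ, 0 < r → r ^ (n - 1) = r ^ ((n : ℝ) - 1) := fun r hr => by
    rw [← Real.rpow_natCast, Nat.cast_sub hn, Nat.cast_one]
  rw [← Ioc_union_Ioi_eq_Ioi (zero_le_one (α := ℝ)), integrableOn_union]
  -- In polar coordinates the integrand is `r^(1-2s)` near the origin, integrable since `s < 1`, and
  -- `r^(-1-2s)` at infinity, integrable since `s > 0`.
  constructor
  · have h2 : IntegrableOn (fun r : ℝ => r ^ (1 - 2 * s)) (Ioc 0 1) := by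
      rw [← intervalIntegrable_iff_integrableOn_Ioc_of_le zero_le_one]
      exact intervalIntegral.intervalIntegrable_rpow' (by linarith)
    refine h2.congr_fun (fun r hr => ?_) measurableSet_Ioc
    have hr0 : 0 < r := hr.1
    simp only [smul_eq_mul]
    rw [hpow r hr0, min_eq_right hr.2, ← Real.rpow_natCast r 2, ← Real.rpow_sub hr0, ← Real.rpow_add hr0]
    congr 1; push_cast; ring
  · have h2 : IntegrableOn (fun r : ℝ => r ^ (-1 - 2 * s)) (Ioi 1) :=
      integrableOn_Ioi_rpow_of_lt (by linarith) one_pos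
    refine h2.congr_fun (fun r hr => ?_) measurableSet_Ioi
    have hr0 : 0 < r := one_pos.trans hr
    have hr1 : 1 ≤ r := le_of_lt hr
    simp only [smul_eq_mul]
    rw [hpow r hr0, min_eq_left hr1, one_pow, one_div, ← Real.rpow_neg hr0.le, ← Real.rpow_add hr0]
    congr 1; ring

lemma integrableOn_fst_comp_sub {f : Eucl n → ℝ} (hf : Integrable f) {B : Set (Eucl n)}
    (hBf : volume B ≠ ⊤) :
    IntegrableOn (fun q : Eucl n × Eucl n => f (q.1 - q.2)) (B ×ˢ univ) := by
  have hB' : IsFiniteMeasure (volume.restrict B) := ⟨by simpa using hBf.lt_top⟩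
  have h1 : Integrable (fun q : Eucl n × Eucl n => (fun _ => (1 : ℝ)) q.1 * f q.2)
      ((volume.restrict B).prod volume) := (integrable_const (1 : ℝ)).mul_prod hf
  have h2 : MeasurePreserving (fun q : Eucl n × Eucl n => (q.1, q.1 - q.2))
      ((volume.restrict B).prod volume) ((volume.restrict B).prod volume) :=
    (MeasurePreserving.id _).skew_product (g := fun x y => x - y) (by fun_prop)
      (Eventually.of_forall fun x => (Measure.measurePreserving_sub_left volume x).map_eq)
  have h3 := h2.integrable_comp_of_integrable h1
  rw [IntegrableOn, Measure.volume_eq_prod, ← Measure.prod_restrict, Measure.restrict_univ]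
  simpa [Function.comp_def] using h3

lemma integrableOn_crossSet_comp_sub {f : Eucl n → ℝ} (hf : Integrable f) (hf' : ∀ t, f (-t) = f t)
    {B : Set (Eucl n)} (hBf : volume B ≠ ⊤) :
    IntegrableOn (fun q : Eucl n × Eucl n => f (q.1 - q.2)) (crossSet B) := by
  have h1 := integrableOn_fst_comp_sub hf hBf
  have h2 : IntegrableOn (fun q : Eucl n × Eucl n => f (q.1 - q.2)) (univ ×ˢ B) := by
    have h3 := (Measure.measurePreserving_swap (μ := (volume : Measure (Eucl n)))
      (ν := (volume : Measure (Eucl n)))).integrableOn_comp_preimage (s := B ×ˢ univ)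
      (f := fun q : Eucl n × Eucl n => f (q.1 - q.2)) MeasurableEquiv.prodComm.measurableEmbedding
    have h4 := h3.2 h1
    rw [Set.preimage_swap_prod] at h4
    refine Integrable.congr h4 (Eventually.of_forall fun q => ?_)
    simp only [Function.comp_apply, Prod.fst_swap, Prod.snd_swap]
    rw [← hf', neg_sub]
  refine (h1.union h2).mono_set ?_
  rintro ⟨x, y⟩ ((⟨hx, hy⟩ | ⟨hx, hy⟩) | ⟨hx, hy⟩)
  · exact Or.inl ⟨hx, mem_univ _⟩
  · exact Or.inr ⟨mem_univ _, hy⟩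
  · exact Or.inl ⟨hx, mem_univ _⟩

lemma integrableOn_gagliardo {s : ℝ} {Q : Set (Eucl n × Eucl n)} {u : Eucl n → ℝ} (hum : Measurable u)
    (hfin : gagliardo s Q u < ⊤) :
    IntegrableOn (fun q : Eucl n × Eucl n => |u q.1 - u q.2| ^ 2 / ‖q.1 - q.2‖ ^ ((n : ℝ) + 2 * s)) Q := by
  refine ⟨Measurable.aestronglyMeasurable (by fun_prop), ?_⟩
  rw [hasFiniteIntegral_iff_ofReal (Eventually.of_forall fun q => by positivity)]
  exact hfin

/-- By `ab ≤ a² + b²` between `min 1 ‖x - y‖` and `|u x - u y|`. This is the common dominating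
function, uniform in the height `z`, for pairing `u` with bounded Lipschitz functions vanishing
outside `B`. -/
lemma integrableOn_min_mul_sub_div (hn : 1 ≤ n) {s : ℝ} (hs : s ∈ Ioo (0 : ℝ) 1) {u : Eucl n → ℝ}
    (hum : Measurable u) {B : Set (Eucl n)} (hBf : volume B ≠ ⊤)
    (hfin : gagliardo s (crossSet B) u < ⊤) :
    IntegrableOn (fun q : Eucl n × Eucl n => min 1 ‖q.1 - q.2‖ * |u q.1 - u q.2| /
      ‖q.1 - q.2‖ ^ ((n : ℝ) + 2 * s)) (crossSet B) := by
  have h1 := integrableOn_crossSet_comp_sub (integrable_min_sq_div hn hs) (by simp) hBf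
  have h2 := integrableOn_gagliardo hum hfin
  refine Integrable.mono' (Integrable.add h1 h2) (Measurable.aestronglyMeasurable (by fun_prop))
    (Eventually.of_forall fun q => ?_)
  rw [Real.norm_of_nonneg (by positivity), Pi.add_apply, ← add_div]
  gcongr
  nlinarith [sq_nonneg (min 1 ‖q.1 - q.2‖ - |u q.1 - u q.2|), sq_nonneg (min 1 ‖q.1 - q.2‖),
    sq_nonneg (|u q.1 - u q.2|)]

/-- The symmetrized form of the pairing of `f` with the vertical field of `u` at height `z`. -/
lemma integral_mul_integral_fieldZ {s : ℝ} (hs : 0 < s) {u : Eucl n → ℝ} (hum : Measurable u)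
    (hu : Integrable fun y => u y * decay s y 1) {f : Eucl n → ℝ} (hfm : Measurable f) {M C : ℝ}
    (hfM : ∀ x, M < ‖x‖ → f x = 0) (hfC : ∀ x, |f x| ≤ C) {z : ℝ} (hz : z ≠ 0)
    (huM : IntegrableOn u (Metric.closedBall 0 M)) :
    ∫ x, f x * ∫ y, u y * fieldZ s (x - y) z =
      -(1 / 2) * ∫ q : Eucl n × Eucl n, (u q.1 - u q.2) * (f q.1 - f q.2) * fieldZ s (q.1 - q.2) z := by
  have hn : (0 : ℝ) ≤ n := n.cast_nonneg
  obtain ⟨D, hD, hDle⟩ := exists_decay_le (n := n) hs.le M (abs_pos.2 hz)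
  have hfi : Integrable f := by
    have h1 : IntegrableOn (fun _ : Eucl n => C) (Metric.closedBall 0 M) :=
      integrableOn_const (measure_closedBall_lt_top).ne
    have h2 : IntegrableOn f (Metric.closedBall 0 M) :=
      h1.mono' hfm.aestronglyMeasurable (Eventually.of_forall fun x => hfC x)
    refine (integrableOn_iff_integrable_of_support_subset fun x hx => ?_).1 h2
    rw [mem_closedBall_zero_iff]; by_contra h; exact hx (hfM x (not_le.1 h))
  have hfu : Integrable fun x => f x * u x := by
    have h2 : IntegrableOn (fun x => f x * u x) (Metric.closedBall 0 M) :=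
      huM.bdd_mul (c := C) hfm.aestronglyMeasurable (Eventually.of_forall fun x => hfC x)
    refine (integrableOn_iff_integrable_of_support_subset fun x hx => ?_).1 h2
    rw [mem_closedBall_zero_iff]; by_contra h; exact hx (by simp [hfM x (not_le.1 h)])
  have hsk : MeasurePreserving (fun q : Eucl n × Eucl n => (q.1, q.1 - q.2))
      (volume.prod volume) (volume.prod volume) :=
    (MeasurePreserving.id _).skew_product (g := fun x y => x - y) (by fun_prop)
      (Eventually.of_forall fun x => (Measure.measurePreserving_sub_left volume x).map_eq)
  have i1 : Integrable (fun q : Eucl n × Eucl n => f q.1 * u q.1 * fieldZ s (q.1 - q.2) z) (volume.prod volume) :=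
    hsk.integrable_comp_of_integrable (hfu.mul_prod (integrable_fieldZ hs hz))
  have i2 : Integrable (fun q : Eucl n × Eucl n => f q.1 * u q.2 * fieldZ s (q.1 - q.2) z) (volume.prod volume) := by
    refine ((hfi.mul_prod hu).norm.const_mul (((n : ℝ) + 2 * s) * D)).mono'
      (Measurable.aestronglyMeasurable (by fun_prop)) (Eventually.of_forall fun q => ?_)
    by_cases hq : ‖q.1‖ ≤ M
    · have h1 := abs_fieldZ_le hs.le (q.1 - q.2) hz
      have h2 := hDle q.1 q.2 z hq le_rfl
      have h3 := decay_nonneg s q.2 1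
      rw [norm_mul, norm_mul, norm_mul, norm_mul, Real.norm_eq_abs (fieldZ _ _ _), Real.norm_of_nonneg h3]
      calc ‖f q.1‖ * ‖u q.2‖ * |fieldZ s (q.1 - q.2) z|
          ≤ ‖f q.1‖ * ‖u q.2‖ * (((n : ℝ) + 2 * s) * (D * decay s q.2 1)) := by
            gcongr; exact h1.trans (by gcongr)
        _ = _ := by ring
    · simp [hfM _ (not_le.1 hq)]
  have i3 : Integrable (fun q : Eucl n × Eucl n => f q.1 * (u q.2 - u q.1) * fieldZ s (q.1 - q.2) z) (volume.prod volume) := by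
    refine (i2.sub i1).congr (Eventually.of_forall fun q => ?_)
    simp only [Pi.sub_apply]; ring
  -- Since `fieldZ` has mean zero, `u x` may be subtracted. Exchanging the two variables, under
  -- which `fieldZ` is invariant, gives a second copy of the integral, and averaging the two
  -- produces the factor `1/2`.
  have e1 : ∫ x, f x * ∫ y, u y * fieldZ s (x - y) z =
      ∫ q : Eucl n × Eucl n, f q.1 * (u q.2 - u q.1) * fieldZ s (q.1 - q.2) z := by
    rw [Measure.volume_eq_prod, integral_prod _ i3]
    refine integral_congr_ae (Eventually.of_forall fun x => ?_)
    simp only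
    have j1 : Integrable fun y => u y * fieldZ s (x - y) z := by
      refine ((integrable_mul_decay_sub hs.le hum hu x hz).norm.const_mul ((n : ℝ) + 2 * s)).mono'
        (Measurable.aestronglyMeasurable (by fun_prop)) (Eventually.of_forall fun y => ?_)
      have h1 := abs_fieldZ_le hs.le (x - y) hz
      rw [norm_mul, norm_mul, Real.norm_of_nonneg (decay_nonneg s (x - y) z), Real.norm_eq_abs (fieldZ _ _ _)]
      calc _ ≤ ‖u y‖ * (((n : ℝ) + 2 * s) * decay s (x - y) z) := by gcongr
        _ = _ := by ring
    have j2 : Integrable fun y => fieldZ s (x - y) z := (integrable_fieldZ hs hz).comp_sub_left x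
    have j3 : ∫ y, fieldZ s (x - y) z = 0 := by
      rw [integral_sub_left_eq_self (fun t => fieldZ s t z) volume x, integral_fieldZ hs hz]
    have j4 : ∫ y, (u y * fieldZ s (x - y) z - u x * fieldZ s (x - y) z) = ∫ y, u y * fieldZ s (x - y) z := by
      rw [integral_sub j1 (j2.const_mul _), integral_const_mul, j3]; ring
    rw [← j4, ← integral_const_mul]
    refine integral_congr_ae (Eventually.of_forall fun y => ?_)
    simp only; ring
  have i4 := i3.swap
  have e2 : ∫ q : Eucl n × Eucl n, f q.2 * (u q.1 - u q.2) * fieldZ s (q.1 - q.2) z =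
      ∫ q : Eucl n × Eucl n, f q.1 * (u q.2 - u q.1) * fieldZ s (q.1 - q.2) z := by
    rw [Measure.volume_eq_prod, ← integral_prod_swap]
    refine integral_congr_ae (Eventually.of_forall fun q => ?_)
    simp only [Prod.fst_swap, Prod.snd_swap]
    rw [← fieldZ_neg, neg_sub]
  have i5 : Integrable (fun q : Eucl n × Eucl n => f q.2 * (u q.1 - u q.2) * fieldZ s (q.1 - q.2) z) := by
    refine i4.congr (Eventually.of_forall fun q => ?_)
    simp only [Function.comp_apply, Prod.fst_swap, Prod.snd_swap]
    rw [← fieldZ_neg, neg_sub]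
  have e3 : ∫ q : Eucl n × Eucl n, (u q.1 - u q.2) * (f q.1 - f q.2) * fieldZ s (q.1 - q.2) z =
      -(∫ q : Eucl n × Eucl n, f q.1 * (u q.2 - u q.1) * fieldZ s (q.1 - q.2) z) -
        ∫ q : Eucl n × Eucl n, f q.2 * (u q.1 - u q.2) * fieldZ s (q.1 - q.2) z := by
    rw [← integral_neg]
    have i6 := i3.neg
    rw [Measure.volume_eq_prod] at i5 ⊢
    have := integral_sub (f := fun q : Eucl n × Eucl n => -(f q.1 * (u q.2 - u q.1) * fieldZ s (q.1 - q.2) z)) i6 i5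
    rw [← this]
    refine integral_congr_ae (Eventually.of_forall fun q => ?_)
    simp only; ring
  rw [e3, e2, e1]; ring

lemma tendsto_average_of_tendsto {f : ℝ → ℝ≥0∞} (hf : Tendsto f (𝓝[≠] 0) (𝓝 0)) :
    Tendsto (fun ε : ℝ => (∫⁻ z in Ioo (-ε) ε, f z) / ENNReal.ofReal (2 * ε)) (𝓝[>] 0) (𝓝 0) := by
  rw [ENNReal.tendsto_nhds_zero] at hf ⊢
  intro δ hδ
  obtain ⟨ρ, hρ, h⟩ := Metric.mem_nhdsWithin_iff.1 (hf δ hδ)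
  have h1 : Iio ρ ∈ 𝓝 (0 : ℝ) := Iio_mem_nhds hρ
  filter_upwards [self_mem_nhdsWithin, mem_nhdsWithin_of_mem_nhds h1] with ε hε hερ
  have hε : 0 < ε := hε
  have hερ : ε < ρ := hερ
  have h2 : ∫⁻ z in Ioo (-ε) ε, f z ≤ ∫⁻ _ in Ioo (-ε) ε, δ := by
    refine lintegral_mono_ae ?_
    have h0 : ∀ᵐ z : ℝ, z ≠ 0 := by rw [ae_iff]; simp
    filter_upwards [ae_restrict_of_ae h0, ae_restrict_mem measurableSet_Ioo] with z hz hz'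
    refine h ⟨?_, hz⟩
    rw [mem_ball_zero_iff, Real.norm_eq_abs]
    exact (abs_lt.2 hz').trans hερ
  rw [setLIntegral_const, Real.volume_Ioo, show ε - -ε = 2 * ε by ring] at h2
  refine ENNReal.div_le_of_le_mul h2

lemma abs_sub_fst_snd_mul_le {B : Set (Eucl n)} {u D : Eucl n → ℝ} {m : ℝ}
    (hD : ∀ x y, |D x - D y| ≤ m * min 1 ‖x - y‖) (hDB : ∀ x, x ∉ B → D x = 0) (s : ℝ)
    (q : Eucl n × Eucl n) :
    |(u q.1 - u q.2) * (D q.1 - D q.2)| / ‖q.1 - q.2‖ ^ ((n : ℝ) + 2 * s) ≤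
      m * (crossSet B).indicator (fun q : Eucl n × Eucl n => min 1 ‖q.1 - q.2‖ * |u q.1 - u q.2| /
      ‖q.1 - q.2‖ ^ ((n : ℝ) + 2 * s)) q := by
  by_cases hq : q ∈ crossSet B
  · rw [indicator_of_mem hq, abs_mul, ← mul_div_assoc]
    refine div_le_div_of_nonneg_right ?_ (by positivity)
    calc |u q.1 - u q.2| * |D q.1 - D q.2| ≤ |u q.1 - u q.2| * (m * min 1 ‖q.1 - q.2‖) := by
          gcongr; exact hD _ _
      _ = m * (min 1 ‖q.1 - q.2‖ * |u q.1 - u q.2|) := by ring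
  · have h1 : q.1 ∉ B ∧ q.2 ∉ B := by
      by_contra h
      apply hq
      simp only [crossSet, mem_union, mem_prod, mem_compl_iff]
      tauto
    rw [indicator_of_notMem hq, hDB _ h1.1, hDB _ h1.2]; simp

lemma abs_fieldZ_le_div {s : ℝ} (hs : 0 ≤ s) {x : Eucl n} (hx : x ≠ 0) {z : ℝ} (hz : z ≠ 0) :
    |fieldZ s x z| ≤ ((n : ℝ) + 2 * s) / ‖x‖ ^ ((n : ℝ) + 2 * s) := by
  have h1 := abs_fieldZ_le hs x hz
  have h2 := decay_le_norm hs x hx z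
  calc _ ≤ ((n : ℝ) + 2 * s) * (1 / ‖x‖ ^ ((n : ℝ) + 2 * s)) := h1.trans (by gcongr)
    _ = _ := by ring

lemma abs_mul_fieldZ_le {s : ℝ} (hs : 0 ≤ s) {B : Set (Eucl n)} {u D : Eucl n → ℝ} {m : ℝ}
    (hD : ∀ x y, |D x - D y| ≤ m * min 1 ‖x - y‖) (hDB : ∀ x, x ∉ B → D x = 0) {z : ℝ} (hz : z ≠ 0)
    (q : Eucl n × Eucl n) :
    |(u q.1 - u q.2) * (D q.1 - D q.2) * fieldZ s (q.1 - q.2) z| ≤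
      ((n : ℝ) + 2 * s) * (m * (crossSet B).indicator (fun q : Eucl n × Eucl n =>
        min 1 ‖q.1 - q.2‖ * |u q.1 - u q.2| / ‖q.1 - q.2‖ ^ ((n : ℝ) + 2 * s)) q) := by
  have hn : (0 : ℝ) ≤ n := n.cast_nonneg
  have h1 := abs_sub_fst_snd_mul_le (u := u) hD hDB s q
  by_cases hq : q.1 = q.2
  · rw [hq, sub_self, zero_mul, zero_mul, abs_zero]
    have : 0 ≤ m * (crossSet B).indicator (fun q : Eucl n × Eucl n =>
        min 1 ‖q.1 - q.2‖ * |u q.1 - u q.2| / ‖q.1 - q.2‖ ^ ((n : ℝ) + 2 * s)) q :=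
      le_trans (by positivity) h1
    positivity
  · have h2 := abs_fieldZ_le_div hs (sub_ne_zero.2 hq) hz
    rw [abs_mul]
    calc _ ≤ |(u q.1 - u q.2) * (D q.1 - D q.2)| * (((n : ℝ) + 2 * s) / ‖q.1 - q.2‖ ^ ((n : ℝ) + 2 * s)) := by
          gcongr
      _ = ((n : ℝ) + 2 * s) * (|(u q.1 - u q.2) * (D q.1 - D q.2)| / ‖q.1 - q.2‖ ^ ((n : ℝ) + 2 * s)) := by ring
      _ ≤ _ := by gcongr

/-- The bilinear form of the Gagliardo seminorm. -/
def gagForm (s : ℝ) (u w : Eucl n → ℝ) : ℝ :=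
  ∫ q : Eucl n × Eucl n, (u q.1 - u q.2) * (w q.1 - w q.2) / ‖q.1 - q.2‖ ^ ((n : ℝ) + 2 * s)

/-- At height zero the vertical field is `2s` times the Gagliardo kernel: the flux of the extension
through `{z = 0}` is a fractional Laplacian. This is the origin of the factor `s` in `normConst`. -/
lemma tendsto_fieldZ {s : ℝ} {x : Eucl n} (hx : x ≠ 0) :
    Tendsto (fun z => fieldZ s x z) (𝓝 0) (𝓝 (2 * s / ‖x‖ ^ ((n : ℝ) + 2 * s))) := by
  have hx' : 0 < ‖x‖ := norm_pos_iff.2 hx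
  have h1 : ContinuousAt (fun z => fieldZ s x z) 0 := by
    unfold fieldZ
    refine ContinuousAt.mul (by fun_prop) (ContinuousAt.rpow_const (by fun_prop) (Or.inl ?_))
    positivity
  have h2 : fieldZ s x 0 = 2 * s / ‖x‖ ^ ((n : ℝ) + 2 * s) := by
    unfold fieldZ
    have h3 : (‖x‖ ^ 2 + 0 ^ 2) ^ (-(((n : ℝ) + 2 * s) / 2 + 1)) =
        1 / (‖x‖ ^ 2 * ‖x‖ ^ ((n : ℝ) + 2 * s)) := by
      rw [zero_pow two_ne_zero, add_zero, ← Real.rpow_natCast ‖x‖ 2, ← Real.rpow_mul hx'.le,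
        ← Real.rpow_add hx', one_div, ← Real.rpow_neg hx'.le]
      congr 1; push_cast; ring
    rw [h3]
    field_simp
    ring
  rw [← h2]; exact h1

lemma tendsto_integral_mul_fieldZ (hn : 1 ≤ n) {s : ℝ} (hs : s ∈ Ioo (0 : ℝ) 1) {u : Eucl n → ℝ}
    (hum : Measurable u) {B : Set (Eucl n)} (hB : MeasurableSet B) (hBf : volume B ≠ ⊤)
    (hfin : gagliardo s (crossSet B) u < ⊤) {w : Eucl n → ℝ} (hwm : Measurable w) {C : ℝ}
    (hw : ∀ x y, |w x - w y| ≤ C * min 1 ‖x - y‖) (hwB : ∀ x, x ∉ B → w x = 0) :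
    Tendsto (fun z : ℝ => ∫ q : Eucl n × Eucl n, (u q.1 - u q.2) * (w q.1 - w q.2) * fieldZ s (q.1 - q.2) z)
      (𝓝[≠] 0) (𝓝 (2 * s * gagForm s u w)) := by
  have hA := (integrable_indicator_iff (measurableSet_crossSet hB)).2
    (integrableOn_min_mul_sub_div hn hs hum hBf hfin)
  have h1 : 2 * s * gagForm s u w = ∫ q : Eucl n × Eucl n, (u q.1 - u q.2) * (w q.1 - w q.2) *
      (2 * s / ‖q.1 - q.2‖ ^ ((n : ℝ) + 2 * s)) := by
    unfold gagForm
    rw [← integral_const_mul]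
    refine integral_congr_ae (Eventually.of_forall fun q => ?_)
    simp only; ring
  rw [h1]
  refine tendsto_integral_filter_of_dominated_convergence _ (Eventually.of_forall fun z => ?_)
    ?_ ((hA.const_mul C).const_mul ((n : ℝ) + 2 * s)) (Eventually.of_forall fun q => ?_)
  · exact Measurable.aestronglyMeasurable (by fun_prop)
  · filter_upwards [self_mem_nhdsWithin] with z hz
    exact Eventually.of_forall fun q => abs_mul_fieldZ_le hs.1.le hw hwB hz q
  · by_cases hq : q.1 = q.2
    · simp only [hq, sub_self, zero_mul]; exact tendsto_const_nhds
    · exact ((tendsto_fieldZ (sub_ne_zero.2 hq)).mono_left nhdsWithin_le_nhds).const_mul _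

/-- Meant for `D = φ(·, z) - κ w`: the bound is linear in the modulus `m` and does not depend on the
height, so it suffices that `m` becomes small on average. -/
lemma abs_integral_mul_fieldZ_le (hn : 1 ≤ n) {s : ℝ} (hs : s ∈ Ioo (0 : ℝ) 1) {u : Eucl n → ℝ}
    (hum : Measurable u) {B : Set (Eucl n)} (hB : MeasurableSet B) (hBf : volume B ≠ ⊤)
    (hfin : gagliardo s (crossSet B) u < ⊤) {D : Eucl n → ℝ} {m : ℝ}
    (hD : ∀ x y, |D x - D y| ≤ m * min 1 ‖x - y‖) (hDB : ∀ x, x ∉ B → D x = 0) {z : ℝ} (hz : z ≠ 0) :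
    |∫ q : Eucl n × Eucl n, (u q.1 - u q.2) * (D q.1 - D q.2) * fieldZ s (q.1 - q.2) z| ≤
      ((n : ℝ) + 2 * s) * (m * ∫ q in crossSet B, min 1 ‖q.1 - q.2‖ * |u q.1 - u q.2| /
        ‖q.1 - q.2‖ ^ ((n : ℝ) + 2 * s)) := by
  have hA := (integrable_indicator_iff (measurableSet_crossSet hB)).2
    (integrableOn_min_mul_sub_div hn hs hum hBf hfin)
  rw [← integral_indicator (measurableSet_crossSet hB), ← integral_const_mul, ← integral_const_mul,
    ← Real.norm_eq_abs]
  exact norm_integral_le_of_norm_le ((hA.const_mul m).const_mul ((n : ℝ) + 2 * s))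
    (Eventually.of_forall fun q => abs_mul_fieldZ_le (u := u) hs.1.le hD hDB hz q)

lemma integrable_mul_fieldZ (hn : 1 ≤ n) {s : ℝ} (hs : s ∈ Ioo (0 : ℝ) 1) {u : Eucl n → ℝ}
    (hum : Measurable u) {B : Set (Eucl n)} (hB : MeasurableSet B) (hBf : volume B ≠ ⊤)
    (hfin : gagliardo s (crossSet B) u < ⊤) {D : Eucl n → ℝ} (hDm : Measurable D) {m : ℝ}
    (hD : ∀ x y, |D x - D y| ≤ m * min 1 ‖x - y‖) (hDB : ∀ x, x ∉ B → D x = 0) {z : ℝ} (hz : z ≠ 0) :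
    Integrable fun q : Eucl n × Eucl n => (u q.1 - u q.2) * (D q.1 - D q.2) * fieldZ s (q.1 - q.2) z := by
  have hA := (integrable_indicator_iff (measurableSet_crossSet hB)).2
    (integrableOn_min_mul_sub_div hn hs hum hBf hfin)
  exact ((hA.const_mul m).const_mul _).mono' (Measurable.aestronglyMeasurable (by fun_prop))
    (Eventually.of_forall fun q => abs_mul_fieldZ_le hs.1.le hD hDB hz q)

/-- The odd cutoff climbs from `-1` to `1`; the total rise counts the flux from both sides of `{z =
0}`. -/
lemma integral_deriv_oddCut_div {ε : ℝ} (hε : 0 < ε) :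
    ∫ z in Ioo (-ε) ε, deriv oddCut (z / ε) / ε = 2 := by
  have hd : ∀ z : ℝ, HasDerivAt (fun z : ℝ => oddCut (z / ε)) (deriv oddCut (z / ε) / ε) z := by
    intro z
    have h1 := (contDiff_oddCut.differentiable (by simp) (z / ε)).hasDerivAt
    have h2 : HasDerivAt (fun z : ℝ => z / ε) (1 / ε) z := (hasDerivAt_id z).div_const ε
    have h3 := h1.comp z h2
    exact h3.congr_deriv (by ring)
  have hc : Continuous fun z : ℝ => deriv oddCut (z / ε) / ε := by
    have h1 : Continuous (deriv oddCut) := contDiff_oddCut.continuous_deriv (by simp)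
    exact (h1.comp (by fun_prop)).div_const _
  rw [← integral_Ioc_eq_integral_Ioo, ← intervalIntegral.integral_of_le (by linarith),
    intervalIntegral.integral_eq_sub_of_hasDerivAt (fun z _ => hd z) (hc.intervalIntegrable _ _),
    neg_div, div_self hε.ne', oddCut_of_one_le le_rfl, oddCut_of_le_neg_one le_rfl]
  norm_num

/-- The kernels `deriv oddCut (z / ε) / ε` have mass two and are bounded by `C / ε` on `|z| < ε`, so
convergence of averages of `|H - h|` suffices. Hence a trace in the averaged sense is enough. -/
lemma tendsto_integral_deriv_oddCut_mul {H : ℝ → ℝ} {h : ℝ}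
    (hH : ∀ ε : ℝ, 0 < ε → Integrable fun z => deriv oddCut (z / ε) / ε * H z)
    (hlim : Tendsto (fun ε : ℝ => (∫⁻ z in Ioo (-ε) ε, ‖H z - h‖ₑ) / ENNReal.ofReal (2 * ε))
      (𝓝[>] 0) (𝓝 0)) :
    Tendsto (fun ε : ℝ => ∫ z, deriv oddCut (z / ε) / ε * H z) (𝓝[>] 0) (𝓝 (2 * h)) := by
  obtain ⟨C, hC, hCle⟩ := exists_abs_deriv_oddCut_le
  rw [tendsto_iff_edist_tendsto_0]
  have h3 : Tendsto (fun ε : ℝ => ENNReal.ofReal (2 * C) *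
      ((∫⁻ z in Ioo (-ε) ε, ‖H z - h‖ₑ) / ENNReal.ofReal (2 * ε))) (𝓝[>] 0) (𝓝 0) := by
    have := ENNReal.Tendsto.const_mul hlim (Or.inr (ENNReal.ofReal_ne_top (r := 2 * C)))
    rwa [mul_zero] at this
  refine tendsto_of_tendsto_of_tendsto_of_le_of_le' tendsto_const_nhds h3
    (Eventually.of_forall fun _ => zero_le) ?_
  filter_upwards [self_mem_nhdsWithin] with ε hε
  have hε : 0 < ε := hε
  have hcm : Measurable fun z : ℝ => deriv oddCut (z / ε) / ε :=
    ((measurable_deriv oddCut).comp (by fun_prop)).div_const _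
  have hb : ∀ z : ℝ, |deriv oddCut (z / ε) / ε| ≤ C / ε := fun z => by
    rw [abs_div, abs_of_pos hε]; gcongr; exact hCle _
  have h0 : ∫ z, deriv oddCut (z / ε) / ε * H z = ∫ z in Ioo (-ε) ε, deriv oddCut (z / ε) / ε * H z := by
    have hz0 : ∀ᵐ z : ℝ, z ≠ ε ∧ z ≠ -ε := by
      have h1 : ∀ᵐ z : ℝ, z ≠ ε := by rw [ae_iff]; simp
      have h2 : ∀ᵐ z : ℝ, z ≠ -ε := by rw [ae_iff]; simp
      filter_upwards [h1, h2] with z h1 h2 using ⟨h1, h2⟩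
    rw [← integral_indicator measurableSet_Ioo]
    refine integral_congr_ae ?_
    filter_upwards [hz0] with z hz
    by_cases hzε : z ∈ Ioo (-ε) ε
    · rw [indicator_of_mem hzε]
    · rw [indicator_of_notMem hzε, deriv_oddCut_of_gt, zero_div, zero_mul]
      refine one_lt_abs_div hε ?_
      rcases le_or_gt z (-ε) with h | h
      · rw [abs_of_neg (by linarith)]
        have := lt_of_le_of_ne h hz.2; linarith
      · have h4 : ε ≤ z := by
          by_contra h5; exact hzε ⟨h, not_le.1 h5⟩
        exact (lt_of_le_of_ne h4 (Ne.symm hz.1)).trans_le (le_abs_self _)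
  have hci : IntegrableOn (fun z : ℝ => deriv oddCut (z / ε) / ε) (Ioo (-ε) ε) :=
    (integrableOn_const (C := C / ε) (by simp)).mono' hcm.aestronglyMeasurable
      (Eventually.of_forall hb)
  have h1 : 2 * h = ∫ z in Ioo (-ε) ε, deriv oddCut (z / ε) / ε * h := by
    rw [integral_mul_const, integral_deriv_oddCut_div hε]
  rw [h0, h1, edist_eq_enorm_sub, ← integral_sub (hH ε hε).integrableOn (hci.mul_const h)]
  calc _ ≤ ∫⁻ z in Ioo (-ε) ε, ‖deriv oddCut (z / ε) / ε * H z - deriv oddCut (z / ε) / ε * h‖ₑ :=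
        enorm_integral_le_lintegral_enorm _
    _ ≤ ∫⁻ z in Ioo (-ε) ε, ENNReal.ofReal (C / ε) * ‖H z - h‖ₑ := by
        refine lintegral_mono fun z => ?_
        rw [← mul_sub, enorm_mul]
        gcongr
        rw [← ofReal_norm]
        exact ENNReal.ofReal_le_ofReal (hb z)
    _ = ENNReal.ofReal (C / ε) * ∫⁻ z in Ioo (-ε) ε, ‖H z - h‖ₑ := by
        rw [lintegral_const_mul' _ _ ENNReal.ofReal_ne_top]
    _ = _ := by
        rw [show C / ε = (2 * C) / (2 * ε) by field_simp, ENNReal.ofReal_div_of_pos (by positivity),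
          div_eq_mul_inv, div_eq_mul_inv]
        ring

/-! ### The pairing identity -/

/-- Integration by parts against the truncated extension field of `u`. -/
lemma integral_oddCut_mul_inner {s : ℝ} (hs : 0 < s) {u : Eucl n → ℝ} (hum : Measurable u)
    (hu : Integrable fun y => u y * decay s y 1) {φ : Eucl n × ℝ → ℝ} {G : Eucl n × ℝ → Eucl n × ℝ}
    (hφm : Measurable φ) (hφ : Integrable φ) (hGm : Measurable G) (hG : Integrable G)
    {K : Set (Eucl n × ℝ)} (hK : IsCompact K) (hφK : ∀ X ∉ K, φ X = 0) (hGK : ∀ X ∉ K, G X = 0)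
    (hfp : IsFieldPair s φ G) {ε : ℝ} (hε : 0 < ε) :
    (Integrable fun z => deriv oddCut (z / ε) / ε * ∫ x, φ (x, z) * ∫ y, u y * fieldZ s (x - y) z) ∧
    ∫ X : Eucl n × ℝ, oddCut (X.2 / ε) * inner ℝ (WithLp.toLp 2 (G X) : EuclProd n) (extField s u X) =
      -∫ z, deriv oddCut (z / ε) / ε * ∫ x, φ (x, z) * ∫ y, u y * fieldZ s (x - y) z := by
  have hn : (0 : ℝ) ≤ n := n.cast_nonneg
  set c : ℝ → ℝ := fun z => oddCut (z / ε) with hc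
  have hcs : ContDiff ℝ ∞ c := contDiff_oddCut.comp (by fun_prop)
  have hc0 : ∀ z, |z| ≤ ε / 2 → c z = 0 := by
    intro z hz
    apply oddCut_of_le
    rw [abs_div, abs_of_pos hε, div_le_iff₀ hε]; linarith
  have hcd : ∀ z, deriv c z = deriv oddCut (z / ε) / ε := by
    intro z
    have h1 := (contDiff_oddCut.differentiable (by simp) (z / ε)).hasDerivAt
    have h2 : HasDerivAt (fun z : ℝ => z / ε) (1 / ε) z := (hasDerivAt_id z).div_const ε
    have h3 := h1.comp z h2
    have h4 : deriv c z = deriv oddCut (z / ε) * (1 / ε) := h3.deriv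
    rw [h4]; ring
  have hcd0 : ∀ z, |z| < ε / 2 → deriv c z = 0 := by
    intro z hz
    rw [hcd, deriv_oddCut_of_lt, zero_div]
    rw [abs_div, abs_of_pos hε, div_lt_iff₀ hε]; linarith
  obtain ⟨C1, hC1, hC1le⟩ := exists_abs_deriv_oddCut_le
  have hcdle : ∀ z, |deriv c z| ≤ C1 / ε := fun z => by
    rw [hcd, abs_div, abs_of_pos hε]; gcongr; exact hC1le _
  obtain ⟨M, hM⟩ := hK.isBounded.exists_norm_le
  obtain ⟨C, hC, hCle⟩ := exists_decay_le (n := n) hs.le M (half_pos hε)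
  have hcm : Measurable c := hcs.continuous.measurable
  have hcdm : Measurable (deriv c) := measurable_deriv _
  set b1 : (Eucl n × ℝ) × Eucl n → ℝ := fun q =>
    c q.1.2 * inner ℝ (WithLp.toLp 2 (G q.1) : EuclProd n) (field s (q.1.1 - q.2) q.1.2) with hb1
  set b2 : (Eucl n × ℝ) × Eucl n → ℝ := fun q =>
    φ q.1 * (deriv c q.1.2 * fieldZ s (q.1.1 - q.2) q.1.2) with hb2
  have hGm' : Measurable fun X => (WithLp.toLp 2 (G X) : EuclProd n) := (WithLp.measurable_toLp 2 _).comp hGm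
  have hb1m : Measurable b1 := by
    have h1 : Measurable fun q : (Eucl n × ℝ) × Eucl n => c q.1.2 := hcm.comp (by fun_prop)
    have h2 : Measurable fun q : (Eucl n × ℝ) × Eucl n => (WithLp.toLp 2 (G q.1) : EuclProd n) :=
      hGm'.comp measurable_fst
    exact h1.mul (h2.inner (by fun_prop))
  have hb2m : Measurable b2 := by
    have h1 : Measurable fun q : (Eucl n × ℝ) × Eucl n => deriv c q.1.2 := hcdm.comp (by fun_prop)
    have h2 : Measurable fun q : (Eucl n × ℝ) × Eucl n => φ q.1 := hφm.comp measurable_fst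
    rw [hb2]; fun_prop
  have hb1le : ∀ X : Eucl n × ℝ, X.2 ≠ 0 → ∀ y, |b1 (X, y)| ≤
      (2 * ((n : ℝ) + 2 * s) * C * ‖(WithLp.toLp 2 (G X) : EuclProd n)‖) * decay s y 1 := by
    intro X hX y
    have h4 := decay_nonneg s y 1
    by_cases hXK : X ∈ K
    · by_cases hz : ε / 2 ≤ |X.2|
      · have h1 := abs_real_inner_le_norm (WithLp.toLp 2 (G X) : EuclProd n) (field s (X.1 - y) X.2)
        have h2 := norm_field_le hs.le (X.1 - y) hX
        have h3 := hCle X.1 y X.2 ((norm_fst_le X).trans (hM X hXK)) hz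
        have h5 : |c X.2| ≤ 1 := abs_oddCut_le _
        simp only [hb1]
        rw [abs_mul]
        calc _ ≤ 1 * (‖(WithLp.toLp 2 (G X) : EuclProd n)‖ * (2 * ((n : ℝ) + 2 * s) * (C * decay s y 1))) := by
              gcongr
              refine h1.trans ?_
              gcongr
              exact h2.trans (by gcongr)
          _ = _ := by ring
      · simp only [hb1]
        rw [hc0 _ (not_le.1 hz).le, zero_mul, abs_zero]; positivity
    · simp only [hb1]
      rw [hGK X hXK]; simp
  have hb2le : ∀ X : Eucl n × ℝ, X.2 ≠ 0 → ∀ y, |b2 (X, y)| ≤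
      (C1 / ε * ((n : ℝ) + 2 * s) * C * ‖φ X‖) * decay s y 1 := by
    intro X hX y
    have h4 := decay_nonneg s y 1
    by_cases hXK : X ∈ K
    · by_cases hz : ε / 2 ≤ |X.2|
      · have h2 := abs_fieldZ_le hs.le (X.1 - y) hX
        have h3 := hCle X.1 y X.2 ((norm_fst_le X).trans (hM X hXK)) hz
        simp only [hb2]
        rw [abs_mul, abs_mul]
        calc |φ X| * (|deriv c X.2| * |fieldZ s (X.1 - y) X.2|)
            ≤ ‖φ X‖ * (C1 / ε * (((n : ℝ) + 2 * s) * (C * decay s y 1))) := by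
              rw [← Real.norm_eq_abs (φ X)]
              gcongr
              · exact hcdle _
              · exact h2.trans (by gcongr)
          _ = _ := by ring
      · simp only [hb2]
        rw [hcd0 _ (not_le.1 hz), zero_mul, mul_zero, abs_zero]; positivity
    · simp only [hb2]
      rw [hφK X hXK]; simp
  have hG' : Integrable fun X => (WithLp.toLp 2 (G X) : EuclProd n) :=
    ((WithLp.prodContinuousLinearEquiv 2 ℝ (Eucl n) ℝ).symm : (Eucl n × ℝ) →L[ℝ] EuclProd n).integrable_comp hG
  have i1 := integrable_prod_of_decay hum hu hb1m.aestronglyMeasurable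
    (hG'.norm.const_mul _) (ae_snd_ne_zero.mono hb1le)
  have i2 := integrable_prod_of_decay hum hu hb2m.aestronglyMeasurable
    (hφ.norm.const_mul _) (ae_snd_ne_zero.mono hb2le)
  have s1 := integral_integral_swap (f := fun X y => u y * b1 (X, y)) i1
  have s2 := integral_integral_swap (f := fun X y => u y * b2 (X, y)) i2
  have e1 : ∫ X : Eucl n × ℝ, oddCut (X.2 / ε) * inner ℝ (WithLp.toLp 2 (G X) : EuclProd n) (extField s u X) =
      ∫ X, ∫ y, u y * b1 (X, y) := by
    refine integral_congr_ae ?_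
    filter_upwards [ae_snd_ne_zero] with X hX
    unfold extField
    rw [← integral_inner (𝕜 := ℝ) (integrable_smul_field_sub hs.le hum hu X.1 hX) (WithLp.toLp 2 (G X) : EuclProd n),
      ← integral_const_mul]
    refine integral_congr_ae (Eventually.of_forall fun y => ?_)
    simp only [hb1, hc]
    rw [real_inner_smul_right]; ring
  have e2 : ∀ X : Eucl n × ℝ, ∫ y, u y * b2 (X, y) =
      deriv oddCut (X.2 / ε) / ε * (φ X * ∫ y, u y * fieldZ s (X.1 - y) X.2) := by
    intro X
    rw [← mul_assoc, ← integral_const_mul]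
    refine integral_congr_ae (Eventually.of_forall fun y => ?_)
    simp only [hb2, hcd]; ring
  have i3 : Integrable (fun X : Eucl n × ℝ => deriv oddCut (X.2 / ε) / ε * (φ X * ∫ y, u y * fieldZ s (X.1 - y) X.2))
      (volume.prod volume) := by
    have := i2.integral_prod_left
    simp only at this
    simp_rw [e2] at this
    exact this
  have e3 : ∀ z, ∫ x : Eucl n, deriv oddCut (z / ε) / ε * (φ (x, z) * ∫ y, u y * fieldZ s (x - y) z) =
      deriv oddCut (z / ε) / ε * ∫ x, φ (x, z) * ∫ y, u y * fieldZ s (x - y) z := fun z => integral_const_mul _ _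
  refine ⟨?_, ?_⟩
  · have := i3.integral_prod_right
    simp only at this
    simp_rw [e3] at this
    exact this
  · have e4 : ∫ X : Eucl n × ℝ, ∫ y, u y * b2 (X, y) =
        ∫ z, deriv oddCut (z / ε) / ε * ∫ x, φ (x, z) * ∫ y, u y * fieldZ s (x - y) z := by
      simp_rw [e2]
      rw [Measure.volume_eq_prod, integral_prod_symm _ i3]
      simp_rw [e3]
    rw [e1, s1, ← e4, s2, ← integral_neg]
    refine integral_congr_ae (Eventually.of_forall fun y => ?_)
    simp only
    rw [integral_const_mul, integral_const_mul]
    -- After Fubini the field-pair identity is used separately for each pole `y`, with the odd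
    -- cutoff at scale `ε`.
    have := hfp c (ε / 2) hcs (half_pos hε) hc0 y
    simp only [hb1, hb2]
    rw [this]; ring

lemma integrable_inner_of_memLp {α E : Type*} [MeasurableSpace α] [NormedAddCommGroup E]
    [InnerProductSpace ℝ E] {μ : Measure α} {f g : α → E} (hf : MemLp f 2 μ) (hg : MemLp g 2 μ) :
    Integrable (fun a => inner ℝ (f a) (g a)) μ :=
  (hf.norm.integrable_mul hg.norm).mono' (hf.1.inner hg.1)
    (Eventually.of_forall fun a => norm_inner_le_norm (f a) (g a))

lemma tendsto_oddCut_div {z : ℝ} (hz : z ≠ 0) :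
    Tendsto (fun ε : ℝ => oddCut (z / ε)) (𝓝[>] 0) (𝓝 (SignType.sign z)) := by
  refine tendsto_const_nhds.congr' ?_
  filter_upwards [eventually_le_abs hz] with ε hε
  rw [oddCut_of_ge (one_lt_abs_div hε.1 hε.2).le]
  rcases lt_or_gt_of_ne hz with h | h
  · rw [sign_neg h, sign_neg (div_neg_of_neg_of_pos h hε.1)]
  · rw [sign_pos h, sign_pos (div_pos h hε.1)]

/-- The powers of `|z|` in the two factors cancel and only the sign of `z` remains. This is why the
truncation uses `oddCut`, whose dilates converge to that sign. -/
lemma inner_wgt_extGrad (s : ℝ) (u : Eucl n → ℝ) (G : Eucl n × ℝ → Eucl n × ℝ) {X : Eucl n × ℝ}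
    (hX : X.2 ≠ 0) : inner ℝ (wgt s (extGrad s u) X) (wgt s G X) =
      SignType.sign X.2 * inner ℝ (WithLp.toLp 2 (G X) : EuclProd n) (extField s u X) := by
  rw [wgt_extGrad s u hX, wgt, real_inner_smul_left, real_inner_smul_right, real_inner_comm]
  have h : |X.2| ^ (s - 1 / 2) * |X.2| ^ ((1 - 2 * s) / 2) = 1 := by
    rw [← Real.rpow_add (abs_pos.2 hX), show s - 1 / 2 + (1 - 2 * s) / 2 = 0 by ring, Real.rpow_zero]
  linear_combination (SignType.sign X.2 * inner ℝ (WithLp.toLp 2 (G X) : EuclProd n) (extField s u X)) * h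

/-- The weighted Dirichlet pairing of the extension of `u` with a weak gradient pair `(φ, G)` of
trace `κ w` is the Gagliardo pairing of `u` and `w`. -/
lemma normConst_mul_integral_inner (hn : 1 ≤ n) {s : ℝ} (hs : s ∈ Ioo (0 : ℝ) 1) {u : Eucl n → ℝ}
    (hum : Measurable u) (hu : Integrable fun y => u y * decay s y 1) {B : Set (Eucl n)}
    (hB : MeasurableSet B) (hBf : volume B ≠ ⊤) (hBne : ∃ y, y ∉ B)
    (hfin : gagliardo s (crossSet B) u < ⊤)
    {φ : Eucl n × ℝ → ℝ} {G : Eucl n × ℝ → Eucl n × ℝ}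
    (hφm : Measurable φ) (hφ : Integrable φ) (hGm : Measurable G) (hG : Integrable G)
    {K : Set (Eucl n × ℝ)} (hK : IsCompact K) (hφK : ∀ X ∉ K, φ X = 0) (hGK : ∀ X ∉ K, G X = 0)
    (hGw : MemLp (wgt s G) 2) (huw : MemLp (wgt s (extGrad s u)) 2 (volume.restrict K))
    (hfp : IsFieldPair s φ G) {w : Eucl n → ℝ} (hwm : Measurable w) {C : ℝ}
    (hw : ∀ x y, |w x - w y| ≤ C * min 1 ‖x - y‖) (hwB : ∀ x, x ∉ B → w x = 0)
    {ε₀ : ℝ} (hε₀ : 0 < ε₀) (hφB : ∀ᵐ z : ℝ, |z| < ε₀ → ∀ x, x ∉ B → φ (x, z) = 0) {m : ℝ → ℝ}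
    (hφw : ∀ᵐ z : ℝ, |z| < ε₀ → ∀ x y, |(φ (x, z) - kernelMass n s * w x) -
      (φ (y, z) - kernelMass n s * w y)| ≤ m z * min 1 ‖x - y‖)
    (hm : Tendsto (fun ε : ℝ => (∫⁻ z in Ioo (-ε) ε, ‖m z‖ₑ) / ENNReal.ofReal (2 * ε)) (𝓝[>] 0) (𝓝 0)) :
    normConst n s * ∫ X, inner ℝ (wgt s (extGrad s u) X) (wgt s G X) = gagForm s u w := by
  have hn0 : (0 : ℝ) ≤ n := n.cast_nonneg
  set κ := kernelMass n s with hκ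
  have hκ0 : 0 < κ := kernelMass_pos hs.1
  obtain ⟨M, hM⟩ := hK.isBounded.exists_norm_le
  obtain ⟨y₀, hy₀⟩ := hBne
  set H : ℝ → ℝ := fun z => ∫ x, φ (x, z) * ∫ y, u y * fieldZ s (x - y) z with hH
  set P := gagForm s u w with hP
  set A : ℝ := ∫ q in crossSet B, min 1 ‖q.1 - q.2‖ * |u q.1 - u q.2| / ‖q.1 - q.2‖ ^ ((n : ℝ) + 2 * s) with hA
  set T : ℝ → ℝ := fun z => ∫ q : Eucl n × Eucl n, (u q.1 - u q.2) * (w q.1 - w q.2) * fieldZ s (q.1 - q.2) z with hT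
  have hA0 : 0 ≤ A := setIntegral_nonneg (measurableSet_crossSet hB) fun q _ => by positivity
  have huM : IntegrableOn u (Metric.closedBall 0 M) :=
    (integrableOn_ball_of_decay hs.1.le hu hum (M + 1)).mono_set (Metric.closedBall_subset_ball (by linarith))
  -- slices
  have hslice : ∀ᵐ z : ℝ, |z| < ε₀ → ‖H z - -(s * κ * P)‖ₑ ≤
      ENNReal.ofReal (κ / 2) * ‖T z - 2 * s * P‖ₑ + ENNReal.ofReal (1 / 2 * ((n : ℝ) + 2 * s) * A) * ‖m z‖ₑ := by
    have h0 : ∀ᵐ z : ℝ, z ≠ 0 := by rw [ae_iff]; simp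
    filter_upwards [hφB, hφw, h0] with z h1 h2 hz hzε
    specialize h1 hzε
    specialize h2 hzε
    have hDB : ∀ x, x ∉ B → φ (x, z) - κ * w x = 0 := fun x hx => by rw [h1 x hx, hwB x hx]; simp
    have hm0 : ∀ x, |φ (x, z) - κ * w x| ≤ |m z| := fun x => by
      have h3 := h2 x y₀
      rw [hDB y₀ hy₀, sub_zero] at h3
      refine h3.trans ((le_abs_self _).trans ?_)
      rw [abs_mul, abs_of_nonneg (a := min 1 _) (by positivity)]
      exact mul_le_of_le_one_right (abs_nonneg _) (min_le_left _ _)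
    have hw0 : ∀ x, |w x| ≤ |C| := fun x => by
      have h3 := hw x y₀
      rw [hwB y₀ hy₀, sub_zero] at h3
      refine h3.trans ((le_abs_self _).trans ?_)
      rw [abs_mul, abs_of_nonneg (a := min 1 _) (by positivity)]
      exact mul_le_of_le_one_right (abs_nonneg _) (min_le_left _ _)
    have hφz : Measurable fun x => φ (x, z) := hφm.comp (by fun_prop)
    have e1 := integral_mul_integral_fieldZ hs.1 hum hu (f := fun x => φ (x, z)) hφz (M := M) (C := |m z| + κ * |C|)
      (fun x hx => hφK _ fun h => absurd ((norm_fst_le (x, z)).trans (hM _ h)) (not_le.2 hx))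
      (fun x => by
        have : φ (x, z) = (φ (x, z) - κ * w x) + κ * w x := by ring
        rw [this]
        refine (abs_add_le _ _).trans (add_le_add (hm0 x) ?_)
        rw [abs_mul, abs_of_pos hκ0]
        exact mul_le_mul_of_nonneg_left (hw0 x) hκ0.le) hz huM
    have j1 := integrable_mul_fieldZ hn hs hum hB hBf hfin hwm hw hwB hz
    have j2 := integrable_mul_fieldZ hn hs hum hB hBf hfin (D := fun x => φ (x, z) - κ * w x)
      (hφz.sub (hwm.const_mul κ)) h2 hDB hz
    have e2 : ∫ q : Eucl n × Eucl n, (u q.1 - u q.2) * (φ (q.1, z) - φ (q.2, z)) * fieldZ s (q.1 - q.2) z =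
        κ * T z + ∫ q : Eucl n × Eucl n, (u q.1 - u q.2) * ((φ (q.1, z) - κ * w q.1) -
          (φ (q.2, z) - κ * w q.2)) * fieldZ s (q.1 - q.2) z := by
      rw [hT, ← integral_const_mul, ← integral_add (j1.const_mul κ) j2]
      refine integral_congr_ae (Eventually.of_forall fun q => ?_)
      simp only; ring
    have e3 := abs_integral_mul_fieldZ_le hn hs hum hB hBf hfin (D := fun x => φ (x, z) - κ * w x) h2 hDB hz
    have e4 : |H z - -(s * κ * P)| ≤ κ / 2 * |T z - 2 * s * P| + 1 / 2 * ((n : ℝ) + 2 * s) * A * |m z| := by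
      simp only [hH]
      rw [e1, e2]
      set Y := ∫ q : Eucl n × Eucl n, (u q.1 - u q.2) * ((φ (q.1, z) - κ * w q.1) -
          (φ (q.2, z) - κ * w q.2)) * fieldZ s (q.1 - q.2) z
      rw [show -(1 / 2) * (κ * T z + Y) - -(s * κ * P) = -(κ / 2) * (T z - 2 * s * P) + -(1 / 2) * Y by ring]
      refine (abs_add_le _ _).trans ?_
      rw [abs_mul, abs_mul, abs_neg, abs_neg, abs_of_pos (by positivity : 0 < κ / 2),
        abs_of_pos (by norm_num : (0 : ℝ) < 1 / 2)]
      have h5 : m z * A ≤ |m z| * A := by gcongr; exact le_abs_self _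
      have h6 : |Y| ≤ ((n : ℝ) + 2 * s) * (|m z| * A) := e3.trans (mul_le_mul_of_nonneg_left h5 (by linarith [hs.1]))
      nlinarith
    have hs0 := hs.1
    rw [← ofReal_norm, ← ofReal_norm, ← ofReal_norm, ← ENNReal.ofReal_mul (by positivity),
      ← ENNReal.ofReal_mul (by positivity), ← ENNReal.ofReal_add (by positivity) (by positivity)]
    exact ENNReal.ofReal_le_ofReal e4
  have hTlim : Tendsto (fun z => ‖T z - 2 * s * P‖ₑ) (𝓝[≠] 0) (𝓝 0) := by
    have := tendsto_integral_mul_fieldZ hn hs hum hB hBf hfin hwm hw hwB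
    rw [tendsto_iff_edist_tendsto_0] at this
    simpa only [edist_eq_enorm_sub] using this
  have hlim : Tendsto (fun ε : ℝ => (∫⁻ z in Ioo (-ε) ε, ‖H z - -(s * κ * P)‖ₑ) / ENNReal.ofReal (2 * ε))
      (𝓝[>] 0) (𝓝 0) := by
    have l1 := ENNReal.Tendsto.const_mul (tendsto_average_of_tendsto hTlim)
      (Or.inr (ENNReal.ofReal_ne_top (r := κ / 2)))
    have l2 := ENNReal.Tendsto.const_mul hm
      (Or.inr (ENNReal.ofReal_ne_top (r := 1 / 2 * ((n : ℝ) + 2 * s) * A)))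
    have l3 := l1.add l2
    simp only [mul_zero, add_zero] at l3
    refine tendsto_of_tendsto_of_tendsto_of_le_of_le' tendsto_const_nhds l3
      (Eventually.of_forall fun _ => zero_le) ?_
    have hε₀' : Iio ε₀ ∈ 𝓝 (0 : ℝ) := Iio_mem_nhds hε₀
    filter_upwards [self_mem_nhdsWithin, mem_nhdsWithin_of_mem_nhds hε₀'] with ε hε hεε
    have hTm : Measurable fun z => ‖T z - 2 * s * P‖ₑ := by
      have : Measurable T := by
        have h1 : Measurable fun q : ℝ × (Eucl n × Eucl n) =>
            (u q.2.1 - u q.2.2) * (w q.2.1 - w q.2.2) * fieldZ s (q.2.1 - q.2.2) q.1 := by fun_prop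
        exact (h1.stronglyMeasurable.integral_prod_right' (ν := volume)).measurable
      fun_prop
    have h1 : ∫⁻ z in Ioo (-ε) ε, ‖H z - -(s * κ * P)‖ₑ ≤
        ∫⁻ z in Ioo (-ε) ε, (ENNReal.ofReal (κ / 2) * ‖T z - 2 * s * P‖ₑ +
          ENNReal.ofReal (1 / 2 * ((n : ℝ) + 2 * s) * A) * ‖m z‖ₑ) := by
      refine lintegral_mono_ae ?_
      filter_upwards [ae_restrict_of_ae hslice, ae_restrict_mem measurableSet_Ioo] with z hz hz'
      exact hz ((abs_lt.2 hz').trans hεε)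
    rw [lintegral_add_left (hTm.const_mul _), lintegral_const_mul' _ _ ENNReal.ofReal_ne_top,
      lintegral_const_mul' _ _ ENNReal.ofReal_ne_top] at h1
    calc _ ≤ _ := ENNReal.div_le_div_right h1 _
      _ = _ := by rw [ENNReal.add_div, mul_div_assoc, mul_div_assoc]
  have t1 := (tendsto_integral_deriv_oddCut_mul
    (fun ε hε => (integral_oddCut_mul_inner hs.1 hum hu hφm hφ hGm hG hK hφK hGK hfp hε).1) hlim).neg
  -- the left-hand side
  have hin : Integrable fun X => inner ℝ (wgt s (extGrad s u) X) (wgt s G X) := by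
    have h1 : IntegrableOn (fun X => inner ℝ (wgt s (extGrad s u) X) (wgt s G X)) K :=
      integrable_inner_of_memLp huw (hGw.restrict K)
    refine (integrableOn_iff_integrable_of_support_subset fun X hX => ?_).1 h1
    by_contra h
    exact hX (by simp only [wgt, hGK X h]; simp)
  have t2 : Tendsto (fun ε : ℝ => ∫ X : Eucl n × ℝ, oddCut (X.2 / ε) *
      inner ℝ (WithLp.toLp 2 (G X) : EuclProd n) (extField s u X)) (𝓝[>] 0)
      (𝓝 (∫ X, inner ℝ (wgt s (extGrad s u) X) (wgt s G X))) := by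
    have hom := contDiff_oddCut.continuous.measurable
    have hGm' : Measurable fun X => (WithLp.toLp 2 (G X) : EuclProd n) := (WithLp.measurable_toLp 2 _).comp hGm
    have hem := measurable_extField s hum
    refine tendsto_integral_filter_of_dominated_convergence
      (fun X => ‖inner ℝ (wgt s (extGrad s u) X) (wgt s G X)‖) ?_ ?_ hin.norm ?_
    · refine Eventually.of_forall fun ε => Measurable.aestronglyMeasurable ?_
      have : Measurable fun X : Eucl n × ℝ => oddCut (X.2 / ε) := hom.comp (by fun_prop)
      exact this.mul (hGm'.inner hem)
    · refine Eventually.of_forall fun ε => ?_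
      filter_upwards [ae_snd_ne_zero] with X hX
      rw [inner_wgt_extGrad s u G hX, norm_mul, norm_mul, Real.norm_eq_abs (SignType.sign X.2 : ℝ),
        abs_sign_of_ne_zero hX]
      gcongr
      exact abs_oddCut_le _
    · filter_upwards [ae_snd_ne_zero] with X hX
      rw [inner_wgt_extGrad s u G hX]
      exact (tendsto_oddCut_div hX).mul_const _
  -- The mass two of the approximate identity meets the limit `-sκP`; the product `2sκ` is what
  -- `normConst` inverts.
  have h9 : ∫ X, inner ℝ (wgt s (extGrad s u) X) (wgt s G X) = -(2 * -(s * κ * P)) := by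
    refine tendsto_nhds_unique t2 (t1.congr' ?_)
    filter_upwards [self_mem_nhdsWithin] with ε hε
    exact (integral_oddCut_mul_inner hs.1 hum hu hφm hφ hGm hG hK hφK hGK hfp hε).2.symm
  have hs0 := hs.1
  rw [h9, normConst, ← hκ]
  field_simp

/-! ### Mollification in the horizontal variables -/

/-- Nonnegative Lipschitz kernels of mass one supported in the ball of radius `δ`. -/
structure IsMollifier (ρ : Eucl n → ℝ) (L δ : ℝ) : Prop where
  measurable : Measurable ρ
  nonneg : ∀ t, 0 ≤ ρ t
  le : ∀ t, ρ t ≤ L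
  lip : ∀ x y, |ρ x - ρ y| ≤ L * min 1 ‖x - y‖
  lip_sub : ∀ x y t, |ρ (x + t) - ρ x - (ρ (y + t) - ρ y)| ≤ L * min 1 ‖x - y‖ * min 1 ‖t‖
  eq_zero : ∀ t, δ ≤ ‖t‖ → ρ t = 0
  integrable : Integrable ρ
  integral_eq : ∫ t, ρ t = 1

/-- Convolution in the horizontal variables. -/
def mollify {E : Type*} [NormedAddCommGroup E] [NormedSpace ℝ E] (ρ : Eucl n → ℝ)
    (f : Eucl n × ℝ → E) (X : Eucl n × ℝ) : E :=
  ∫ t, ρ t • f (X.1 - t, X.2)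

variable {E : Type*} [NormedAddCommGroup E] [NormedSpace ℝ E]

lemma measurePreserving_shear :
    MeasurePreserving (fun q : Eucl n × (Eucl n × ℝ) => (q.1, (q.2.1 - q.1, q.2.2)))
      (volume.prod volume) (volume.prod volume) := by
  refine (MeasurePreserving.id _).skew_product (g := fun t (X : Eucl n × ℝ) => (X.1 - t, X.2)) (by fun_prop)
    (Eventually.of_forall fun t => ?_)
  have h := measurePreserving_sub_right (volume : Measure (Eucl n × ℝ)) (t, 0)
  have h2 : (fun X : Eucl n × ℝ => X - (t, (0 : ℝ))) = fun X => (X.1 - t, X.2) := by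
    funext X; ext <;> simp
  rw [h2] at h
  exact h.map_eq

lemma integrable_smul_shear {ρ : Eucl n → ℝ} (hρ : Integrable ρ) {f : Eucl n × ℝ → E}
    (hf : Integrable f) :
    Integrable (fun q : Eucl n × (Eucl n × ℝ) => ρ q.1 • f (q.2.1 - q.1, q.2.2)) (volume.prod volume) :=
  measurePreserving_shear.integrable_comp_of_integrable (hρ.smul_prod hf)

lemma integrable_mollify {ρ : Eucl n → ℝ} (hρ : Integrable ρ) {f : Eucl n × ℝ → E} (hf : Integrable f) :
    Integrable (mollify ρ f) :=
  (integrable_smul_shear hρ hf).integral_prod_right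

lemma ae_integrable_smul_shear {ρ : Eucl n → ℝ} (hρ : Integrable ρ) {f : Eucl n × ℝ → E}
    (hf : Integrable f) : ∀ᵐ X : Eucl n × ℝ, Integrable fun t => ρ t • f (X.1 - t, X.2) :=
  (integrable_smul_shear hρ hf).prod_left_ae

lemma measurable_mollify [MeasurableSpace E] [BorelSpace E] [SecondCountableTopology E]
    {ρ : Eucl n → ℝ} (hρ : Measurable ρ) {f : Eucl n × ℝ → E} (hf : Measurable f) :
    Measurable (mollify ρ f) := by
  have : Measurable fun q : (Eucl n × ℝ) × Eucl n => ρ q.2 • f (q.1.1 - q.2, q.1.2) := by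
    have h1 : Measurable fun q : (Eucl n × ℝ) × Eucl n => f (q.1.1 - q.2, q.1.2) := hf.comp (by fun_prop)
    fun_prop
  exact (this.stronglyMeasurable.integral_prod_right' (ν := volume)).measurable

/-- The horizontal `δ`-neighbourhood of `K`. -/
def hthicken (δ : ℝ) (K : Set (Eucl n × ℝ)) : Set (Eucl n × ℝ) :=
  (fun q : (Eucl n × ℝ) × Eucl n => (q.1.1 + q.2, q.1.2)) '' (K ×ˢ Metric.closedBall 0 δ)

lemma isCompact_hthicken {δ : ℝ} {K : Set (Eucl n × ℝ)} (hK : IsCompact K) : IsCompact (hthicken δ K) :=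
  (hK.prod (isCompact_closedBall 0 δ)).image (by fun_prop)

lemma mollify_eq_zero {ρ : Eucl n → ℝ} {L δ : ℝ} (hρ : IsMollifier ρ L δ) {f : Eucl n × ℝ → E}
    {K : Set (Eucl n × ℝ)} (hf : ∀ X ∉ K, f X = 0) : ∀ X ∉ hthicken δ K, mollify ρ f X = 0 := by
  intro X hX
  refine integral_eq_zero_of_ae (Eventually.of_forall fun t => ?_)
  simp only [Pi.zero_apply]
  rcases le_or_gt δ ‖t‖ with h | h
  · rw [hρ.eq_zero t h, zero_smul]
  · rw [hf, smul_zero]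
    intro hK
    exact hX ⟨((X.1 - t, X.2), t), ⟨hK, mem_closedBall_zero_iff.2 h.le⟩, by simp⟩

lemma toLp_mollify (ρ : Eucl n → ℝ) (G : Eucl n × ℝ → Eucl n × ℝ) (X : Eucl n × ℝ) :
    (WithLp.toLp 2 (mollify ρ G X) : EuclProd n) = mollify ρ (fun X => (WithLp.toLp 2 (G X) : EuclProd n)) X := by
  have h := ((WithLp.prodContinuousLinearEquiv 2 ℝ (Eucl n) ℝ).symm).integral_comp_comm
    (μ := volume) (fun t => ρ t • G (X.1 - t, X.2))
  exact h.symm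

/-- The weight depends on `z` alone and commutes with horizontal convolution. Approximation in the
weighted energy becomes approximation in plain `L²`. -/
lemma wgt_mollify (s : ℝ) (ρ : Eucl n → ℝ) (G : Eucl n × ℝ → Eucl n × ℝ) (X : Eucl n × ℝ) :
    wgt s (mollify ρ G) X = mollify ρ (wgt s G) X := by
  rw [wgt, toLp_mollify, mollify, ← integral_smul]
  refine integral_congr_ae (Eventually.of_forall fun t => ?_)
  simp only [wgt]
  rw [smul_comm]

/-- Jensen's inequality for the probability density `ρ`, obtained from Cauchy-Schwarz through `ρ =
ρ^(1/2) ρ^(1/2)`, followed by Fubini. -/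
lemma lintegral_enorm_mollify_sub_sq_le {ρ : Eucl n → ℝ} {L δ : ℝ} (hρ : IsMollifier ρ L δ)
    [MeasurableSpace E] [BorelSpace E] [SecondCountableTopology E] [CompleteSpace E]
    {f : Eucl n × ℝ → E} (hfm : Measurable f) (hf : Integrable f) {η : ℝ≥0∞}
    (hη : ∀ t : Eucl n, ‖t‖ < δ → ∫⁻ X : Eucl n × ℝ, ‖f (X.1 - t, X.2) - f X‖ₑ ^ 2 ≤ η) :
    ∫⁻ X, ‖mollify ρ f X - f X‖ₑ ^ 2 ≤ η := by
  have hρm := hρ.measurable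
  have hmass : ∫⁻ t, ‖ρ t‖ₑ = 1 := by
    have h := ofReal_integral_eq_lintegral_ofReal hρ.integrable (Eventually.of_forall hρ.nonneg)
    rw [hρ.integral_eq, ENNReal.ofReal_one] at h
    rw [h]
    refine lintegral_congr fun t => ?_
    rw [← ofReal_norm, Real.norm_of_nonneg (hρ.nonneg t)]
  have hfm2 : Measurable fun q : (Eucl n × ℝ) × Eucl n => ‖f (q.1.1 - q.2, q.1.2) - f q.1‖ₑ := by
    have h1 : Measurable fun q : (Eucl n × ℝ) × Eucl n => f (q.1.1 - q.2, q.1.2) := hfm.comp (by fun_prop)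
    have h2 : Measurable fun q : (Eucl n × ℝ) × Eucl n => f q.1 := hfm.comp (by fun_prop)
    fun_prop
  have h1 : ∀ᵐ X : Eucl n × ℝ, ‖mollify ρ f X - f X‖ₑ ^ 2 ≤
      ∫⁻ t, ‖ρ t‖ₑ * ‖f (X.1 - t, X.2) - f X‖ₑ ^ 2 := by
    filter_upwards [ae_integrable_smul_shear hρ.integrable hf] with X hX
    have e1 : mollify ρ f X - f X = ∫ t, ρ t • (f (X.1 - t, X.2) - f X) := by
      simp_rw [smul_sub]
      rw [integral_sub hX (hρ.integrable.smul_const _), integral_smul_const, hρ.integral_eq, one_smul]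
      rfl
    have hgm : Measurable fun t => ‖f (X.1 - t, X.2) - f X‖ₑ := hfm2.comp (by fun_prop : Measurable fun t => (X, t))
    have hq : ∀ a : ℝ≥0∞, (a ^ (1 / 2 : ℝ)) ^ 2 = a := fun a => by
      rw [← ENNReal.rpow_natCast, ← ENNReal.rpow_mul]; norm_num
    have e2 := sq_lintegral_mul_le (μ := (volume : Measure (Eucl n))) (f := fun t => ‖ρ t‖ₑ ^ (1 / 2 : ℝ))
      (g := fun t => ‖ρ t‖ₑ ^ (1 / 2 : ℝ) * ‖f (X.1 - t, X.2) - f X‖ₑ) (by fun_prop) (by fun_prop)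
    simp only [mul_pow, hq, hmass, one_mul] at e2
    refine le_trans ?_ e2
    rw [e1]
    gcongr
    refine (enorm_integral_le_lintegral_enorm _).trans (lintegral_mono fun t => ?_)
    rw [enorm_smul, ← mul_assoc, ← sq, hq]
  refine (lintegral_mono_ae h1).trans ?_
  rw [lintegral_lintegral_swap (by
    have : Measurable fun q : (Eucl n × ℝ) × Eucl n => ‖ρ q.2‖ₑ * ‖f (q.1.1 - q.2, q.1.2) - f q.1‖ₑ ^ 2 := by
      fun_prop
    exact this.aemeasurable)]
  calc _ ≤ ∫⁻ t, ‖ρ t‖ₑ * η := by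
        refine lintegral_mono fun t => ?_
        have hgm : Measurable fun X : Eucl n × ℝ => ‖f (X.1 - t, X.2) - f X‖ₑ ^ 2 :=
          (hfm2.comp (by fun_prop : Measurable fun X : Eucl n × ℝ => (X, t))).pow_const 2
        simp only
        rw [lintegral_const_mul _ hgm]
        rcases le_or_gt δ ‖t‖ with h | h
        · simp [hρ.eq_zero t h]
        · gcongr; exact hη t h
    _ = η := by rw [lintegral_mul_const _ (by fun_prop), hmass, one_mul]

lemma exists_lintegral_enorm_mollify_sub_sq_le [MeasurableSpace E] [BorelSpace E]
    [SecondCountableTopology E] [CompleteSpace E] {f : Eucl n × ℝ → E} (hfm : Measurable f)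
    (hf : Integrable f) (hf2 : MemLp f 2) {η : ℝ≥0∞} (hη : 0 < η) :
    ∃ δ : ℝ, 0 < δ ∧ ∀ (ρ : Eucl n → ℝ) (L δ' : ℝ), IsMollifier ρ L δ' → δ' ≤ δ →
      ∫⁻ X, ‖mollify ρ f X - f X‖ₑ ^ 2 ≤ η := by
  have h1 := tendsto_eLpNorm_translate_sub (μ := (volume : Measure (Eucl n × ℝ))) (p := 2) (by norm_num)
    (by norm_num) hf2
  have h2 : Tendsto (fun t : Eucl n => ((-t, 0) : Eucl n × ℝ)) (𝓝 0) (𝓝 0) := by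
    have : Continuous fun t : Eucl n => ((-t, 0) : Eucl n × ℝ) := by fun_prop
    have h := this.tendsto 0
    simp only [neg_zero] at h
    exact h
  have h3 := h1.comp h2
  have h4 : ∀ t : Eucl n, ∫⁻ X : Eucl n × ℝ, ‖f (X.1 - t, X.2) - f X‖ₑ ^ 2 =
      eLpNorm (fun X => f ((-t, 0) + X) - f X) 2 volume ^ 2 := by
    intro t
    rw [eLpNorm_eq_lintegral_rpow_enorm_toReal (by norm_num) (by norm_num)]
    simp only [ENNReal.toReal_ofNat, ENNReal.rpow_two]
    rw [← ENNReal.rpow_natCast, ← ENNReal.rpow_mul]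
    norm_num
    refine lintegral_congr fun X => ?_
    congr 4
    ext <;> simp [sub_eq_neg_add]
  have h5 : Tendsto (fun t : Eucl n => ∫⁻ X : Eucl n × ℝ, ‖f (X.1 - t, X.2) - f X‖ₑ ^ 2) (𝓝 0) (𝓝 0) := by
    simp_rw [h4]
    have := ENNReal.Tendsto.pow (n := 2) h3
    simpa using this
  have h6 := (ENNReal.tendsto_nhds_zero.1 h5) η hη
  obtain ⟨δ, hδ, h7⟩ := Metric.eventually_nhds_iff.1 h6
  refine ⟨δ, hδ, fun ρ L δ' hρ hδ' => ?_⟩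
  refine lintegral_enorm_mollify_sub_sq_le hρ hfm hf fun t ht => h7 ?_
  rw [dist_zero_right]; linarith

lemma integral_inner_mollify {E : Type*} [NormedAddCommGroup E] [InnerProductSpace ℝ E] [CompleteSpace E]
    [MeasurableSpace E] [BorelSpace E] [SecondCountableTopology E]
    {ρ : Eucl n → ℝ} (hρ : Integrable ρ) {f k : Eucl n × ℝ → E}
    (hf : Integrable f) {M C : ℝ} (hfM : ∀ X, M < |X.2| → f X = 0) (hkm : Measurable k)
    (hk : ∀ X, X.2 ≠ 0 → |X.2| ≤ M → ‖k X‖ ≤ C) :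
    ∫ X, inner ℝ (k X) (mollify ρ f X) = ∫ t, ρ t * ∫ X : Eucl n × ℝ, inner ℝ (k (X.1 + t, X.2)) (f X) := by
  have h1 := integrable_smul_shear hρ hf
  have hz : ∀ᵐ q : Eucl n × (Eucl n × ℝ) ∂(volume.prod volume), q.2.2 ≠ 0 :=
    Measure.quasiMeasurePreserving_snd.ae ae_snd_ne_zero
  have h2 : Integrable (fun q : Eucl n × (Eucl n × ℝ) => inner ℝ (k q.2) (ρ q.1 • f (q.2.1 - q.1, q.2.2)))
      (volume.prod volume) := by
    refine (h1.norm.const_mul C).mono' ?_ ?_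
    · exact AEStronglyMeasurable.inner (hkm.comp measurable_snd).aestronglyMeasurable h1.1
    · filter_upwards [hz] with q hq
      refine (norm_inner_le_norm _ _).trans ?_
      rcases lt_or_ge M |q.2.2| with h | h
      · rw [hfM (q.2.1 - q.1, q.2.2) h]; simp
      · gcongr; exact hk _ hq h
  have e1 : ∫ X, inner ℝ (k X) (mollify ρ f X) =
      ∫ X : Eucl n × ℝ, ∫ t, inner ℝ (k X) (ρ t • f (X.1 - t, X.2)) := by
    refine integral_congr_ae ?_
    filter_upwards [ae_integrable_smul_shear hρ hf] with X hX
    exact (integral_inner (𝕜 := ℝ) hX (k X)).symm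
  rw [e1, ← integral_integral_swap h2]
  refine integral_congr_ae (Eventually.of_forall fun t => ?_)
  simp only
  rw [← integral_const_mul, ← integral_add_right_eq_self _ ((t, 0) : Eucl n × ℝ)]
  refine integral_congr_ae (Eventually.of_forall fun X => ?_)
  simp only [Prod.fst_add, Prod.snd_add, add_zero, add_sub_cancel_right]
  rw [real_inner_smul_right, show X + (t, 0) = (X.1 + t, X.2) by ext <;> simp]

lemma decay_le_rpow {s : ℝ} (hs : 0 ≤ s) (x : Eucl n) {z d : ℝ} (hd : 0 < d) (hz : d ≤ |z|) :
    decay s x z ≤ (d ^ 2) ^ (-(((n : ℝ) + 2 * s) / 2)) := by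
  have hn : (0 : ℝ) ≤ n := n.cast_nonneg
  unfold decay
  refine Real.rpow_le_rpow_of_nonpos (by positivity) ?_ (by linarith)
  rw [← sq_abs z]
  nlinarith [sq_nonneg ‖x‖]

/-- Moving the convolution to the test side translates the pole from `y` to `y - t`, and the
hypothesis holds for every pole. The cutoff depends on `z` only and is untouched. -/
lemma IsFieldPair.mollify {s : ℝ} (hs : 0 ≤ s) {φ : Eucl n × ℝ → ℝ} {G : Eucl n × ℝ → Eucl n × ℝ}
    (h : IsFieldPair s φ G) (hφ : Integrable φ) (hG : Integrable G) {K : Set (Eucl n × ℝ)}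
    (hK : IsCompact K) (hφK : ∀ X ∉ K, φ X = 0) (hGK : ∀ X ∉ K, G X = 0) {ρ : Eucl n → ℝ}
    (hρ : Integrable ρ) : IsFieldPair s (mollify ρ φ) (FracFreeBdry.mollify ρ G) := by
  intro c d hc hd hc0 y
  have hn : (0 : ℝ) ≤ n := n.cast_nonneg
  obtain ⟨M, hM⟩ := hK.isBounded.exists_norm_le
  have hcc : Continuous c := hc.continuous
  have hdc : Continuous (deriv c) := hc.continuous_deriv (by simp)
  obtain ⟨C1, hC1⟩ := (isCompact_Icc (a := -M) (b := M)).exists_bound_of_continuousOn hcc.continuousOn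
  obtain ⟨C2, hC2⟩ := (isCompact_Icc (a := -M) (b := M)).exists_bound_of_continuousOn hdc.continuousOn
  have hd0 : ∀ z, |z| < d → deriv c z = 0 := by
    intro z hz
    have : c =ᶠ[𝓝 z] fun _ => 0 := by
      filter_upwards [continuous_abs.continuousAt.eventually_lt continuousAt_const hz] with t ht
        using hc0 t ht.le
    rw [this.deriv_eq]; simp
  have hout : ∀ X : Eucl n × ℝ, M < |X.2| → X ∉ K := fun X hX hXK =>
    absurd ((norm_snd_le X).trans (hM X hXK)) (not_le.2 hX)
  set D : ℝ := (d ^ 2) ^ (-(((n : ℝ) + 2 * s) / 2)) with hD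
  have hD0 : 0 ≤ D := by positivity
  have hcm : Measurable c := hcc.measurable
  have hdm : Measurable (deriv c) := hdc.measurable
  have hG' : Integrable fun X => (WithLp.toLp 2 (G X) : EuclProd n) :=
    ((WithLp.prodContinuousLinearEquiv 2 ℝ (Eucl n) ℝ).symm : (Eucl n × ℝ) →L[ℝ] EuclProd n).integrable_comp hG
  have k1 := integral_inner_mollify hρ hG' (M := M) (C := C1 * (2 * ((n : ℝ) + 2 * s) * D))
    (k := fun X => c X.2 • field s (X.1 - y) X.2)
    (fun X hX => by rw [hGK X (hout X hX)]; simp)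
    ((hcm.comp measurable_snd).smul (by fun_prop))
    (fun X hX0 hX => by
      have h0 : ‖c X.2‖ ≤ C1 := hC1 _ (abs_le.1 hX)
      have h00 : 0 ≤ C1 := (norm_nonneg _).trans h0
      rcases le_or_gt |X.2| d with h1 | h1
      · rw [hc0 _ h1, zero_smul, norm_zero]; positivity
      · rw [norm_smul]
        gcongr
        exact (norm_field_le hs _ hX0).trans (by gcongr; exact decay_le_rpow hs _ hd h1.le))
  have k2 := integral_inner_mollify hρ hφ (M := M) (C := C2 * (((n : ℝ) + 2 * s) * D))
    (k := fun X => deriv c X.2 * fieldZ s (X.1 - y) X.2)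
    (fun X hX => hφK X (hout X hX))
    ((hdm.comp measurable_snd).mul (by fun_prop))
    (fun X hX0 hX => by
      have h0 : ‖deriv c X.2‖ ≤ C2 := hC2 _ (abs_le.1 hX)
      have h00 : 0 ≤ C2 := (norm_nonneg _).trans h0
      rcases lt_or_ge |X.2| d with h1 | h1
      · rw [hd0 _ h1, zero_mul, norm_zero]; positivity
      · rw [norm_mul]
        gcongr
        rw [Real.norm_eq_abs]
        exact (abs_fieldZ_le hs _ hX0).trans (by gcongr; exact decay_le_rpow hs _ hd h1))
  have e1 : ∫ X : Eucl n × ℝ, c X.2 * inner ℝ (WithLp.toLp 2 (FracFreeBdry.mollify ρ G X) : EuclProd n)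
      (field s (X.1 - y) X.2) = ∫ X : Eucl n × ℝ, inner ℝ (c X.2 • field s (X.1 - y) X.2)
        (FracFreeBdry.mollify ρ (fun X => (WithLp.toLp 2 (G X) : EuclProd n)) X) := by
    refine integral_congr_ae (Eventually.of_forall fun X => ?_)
    simp only
    rw [toLp_mollify, real_inner_smul_left, real_inner_comm]
  have e2 : ∫ X : Eucl n × ℝ, FracFreeBdry.mollify ρ φ X * (deriv c X.2 * fieldZ s (X.1 - y) X.2) =
      ∫ X : Eucl n × ℝ, inner ℝ (deriv c X.2 * fieldZ s (X.1 - y) X.2) (FracFreeBdry.mollify ρ φ X) := by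
    refine integral_congr_ae (Eventually.of_forall fun X => ?_)
    simp
  rw [e1, e2, k1, k2, ← integral_neg]
  refine integral_congr_ae (Eventually.of_forall fun t => ?_)
  simp only
  rw [← mul_neg]
  congr 1
  have h3 := h c d hc hd hc0 (y - t)
  have h4 : ∀ X : Eucl n × ℝ, X.1 + t - y = X.1 - (y - t) := fun X => by abel
  simp only [h4]
  have e3 : ∫ X : Eucl n × ℝ, inner ℝ (c X.2 • field s (X.1 - (y - t)) X.2) (WithLp.toLp 2 (G X) : EuclProd n) =
      ∫ X : Eucl n × ℝ, c X.2 * inner ℝ (WithLp.toLp 2 (G X) : EuclProd n) (field s (X.1 - (y - t)) X.2) := by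
    refine integral_congr_ae (Eventually.of_forall fun X => ?_)
    simp only
    rw [real_inner_smul_left, real_inner_comm]
  rw [e3, h3]
  congr 1

/-- Convolution on `ℝⁿ`. -/
def conv (ρ h : Eucl n → ℝ) (x : Eucl n) : ℝ := ∫ t, ρ t * h (x - t)

lemma measurable_conv {ρ h : Eucl n → ℝ} (hρ : Measurable ρ) (hh : Measurable h) : Measurable (conv ρ h) := by
  have : Measurable fun q : Eucl n × Eucl n => ρ q.2 * h (q.1 - q.2) := by fun_prop
  exact (this.stronglyMeasurable.integral_prod_right' (ν := volume)).measurable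

lemma conv_eq (ρ h : Eucl n → ℝ) (x : Eucl n) : conv ρ h x = ∫ t, ρ (x - t) * h t := by
  rw [conv, ← integral_sub_left_eq_self _ volume x]
  simp

lemma conv_eq_zero {ρ : Eucl n → ℝ} {L δ r' r : ℝ} (hρ : IsMollifier ρ L δ) (hδ : δ ≤ r - r')
    {h : Eucl n → ℝ} (hh : ∀ x, r' < ‖x‖ → h x = 0) {x : Eucl n} (hx : r ≤ ‖x‖) : conv ρ h x = 0 := by
  refine integral_eq_zero_of_ae (Eventually.of_forall fun t => ?_)
  simp only [Pi.zero_apply]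
  rcases le_or_gt δ ‖t‖ with h1 | h1
  · rw [hρ.eq_zero t h1, zero_mul]
  · rw [hh, mul_zero]
    have := norm_sub_norm_le x t
    linarith

lemma integrable_comp_sub_mul {ρ : Eucl n → ℝ} {L δ : ℝ} (hρ : IsMollifier ρ L δ) {h : Eucl n → ℝ}
    (hh : Integrable h) (x : Eucl n) : Integrable fun t => ρ (x - t) * h t := by
  have hm := hρ.measurable
  refine hh.bdd_mul (c := L) (Measurable.aestronglyMeasurable (by fun_prop)) (Eventually.of_forall fun t => ?_)
  rw [Real.norm_of_nonneg (hρ.nonneg _)]; exact hρ.le _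

/-- The modulus is proportional to the `L¹` norm of `h`. This is the purpose of mollifying: slices
close to the trace in `L¹` become close to it in the Lipschitz sense that the singular kernel
requires. -/
lemma abs_conv_sub_le {ρ : Eucl n → ℝ} {L δ : ℝ} (hρ : IsMollifier ρ L δ) {h : Eucl n → ℝ}
    (hh : Integrable h) (x y : Eucl n) :
    |conv ρ h x - conv ρ h y| ≤ (L * ∫ t, |h t|) * min 1 ‖x - y‖ := by
  rw [conv_eq, conv_eq, ← integral_sub (integrable_comp_sub_mul hρ hh x) (integrable_comp_sub_mul hρ hh y),
    ← Real.norm_eq_abs, mul_right_comm, ← integral_const_mul]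
  refine norm_integral_le_of_norm_le (hh.abs.const_mul _) (Eventually.of_forall fun t => ?_)
  rw [← sub_mul, norm_mul, Real.norm_eq_abs, Real.norm_eq_abs]
  gcongr
  have := hρ.lip (x - t) (y - t)
  rwa [sub_sub_sub_cancel_right] at this

lemma conv_sub_const_mul {ρ : Eucl n → ℝ} {L δ : ℝ} (hρ : IsMollifier ρ L δ) {f h : Eucl n → ℝ} (c : ℝ)
    (hf : Integrable f) (hh : Integrable h) (x : Eucl n) :
    conv ρ f x - c * conv ρ h x = conv ρ (fun x => f x - c * h x) x := by
  rw [conv_eq, conv_eq, conv_eq, ← integral_const_mul,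
    ← integral_sub (integrable_comp_sub_mul hρ hf x) ((integrable_comp_sub_mul hρ hh x).const_mul c)]
  refine integral_congr_ae (Eventually.of_forall fun t => ?_)
  simp only; ring

lemma enorm_sub_sq_le {E : Type*} [NormedAddCommGroup E] (a b : E) :
    ‖a - b‖ₑ ^ 2 ≤ 2 * ‖a‖ₑ ^ 2 + 2 * ‖b‖ₑ ^ 2 := by
  have h1 : ‖a - b‖ ^ 2 ≤ 2 * ‖a‖ ^ 2 + 2 * ‖b‖ ^ 2 := by
    have := norm_sub_le a b
    nlinarith [sq_nonneg (‖a‖ - ‖b‖), norm_nonneg (a - b), norm_nonneg a, norm_nonneg b]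
  simp only [← ofReal_norm, ← ENNReal.ofReal_pow (norm_nonneg _)]
  rw [show (2 : ℝ≥0∞) = ENNReal.ofReal 2 by simp, ← ENNReal.ofReal_mul (by norm_num),
    ← ENNReal.ofReal_mul (by norm_num), ← ENNReal.ofReal_add (by positivity) (by positivity)]
  exact ENNReal.ofReal_le_ofReal h1

lemma memLp_mollify {E : Type*} [NormedAddCommGroup E] [NormedSpace ℝ E]
    [MeasurableSpace E] [BorelSpace E] [SecondCountableTopology E] [CompleteSpace E]
    {ρ : Eucl n → ℝ} {L δ : ℝ} (hρ : IsMollifier ρ L δ)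
    {f : Eucl n × ℝ → E} (hfm : Measurable f) (hf : Integrable f) (hf2 : MemLp f 2) :
    MemLp (mollify ρ f) 2 := by
  have h0 := (memLp_two_iff.1 hf2).2
  have hm := measurable_mollify hρ.measurable hfm
  have h1 : MemLp (fun X => mollify ρ f X - f X) 2 := by
    rw [memLp_two_iff]
    refine ⟨(hm.sub hfm).aestronglyMeasurable, ?_⟩
    refine (lintegral_enorm_mollify_sub_sq_le hρ hfm hf (η := 4 * ∫⁻ X, ‖f X‖ₑ ^ 2) fun t _ => ?_).trans_lt
      (ENNReal.mul_lt_top (by norm_num) h0)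
    have hg : Measurable fun X => ‖f X‖ₑ ^ 2 := by fun_prop
    calc _ ≤ ∫⁻ X : Eucl n × ℝ, (2 * ‖f (X.1 - t, X.2)‖ₑ ^ 2 + 2 * ‖f X‖ₑ ^ 2) :=
          lintegral_mono fun X => enorm_sub_sq_le _ _
      _ = 2 * (∫⁻ X : Eucl n × ℝ, ‖f (X.1 - t, X.2)‖ₑ ^ 2) + 2 * ∫⁻ X, ‖f X‖ₑ ^ 2 := by
          rw [lintegral_add_right _ (hg.const_mul 2), lintegral_const_mul' _ _ (by norm_num),
            lintegral_const_mul' _ _ (by norm_num)]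
      _ = 2 * (∫⁻ X : Eucl n × ℝ, ‖f X‖ₑ ^ 2) + 2 * ∫⁻ X, ‖f X‖ₑ ^ 2 := by
          congr 2
          rw [← lintegral_sub_right_eq_self (fun X : Eucl n × ℝ => ‖f X‖ₑ ^ 2) (t, 0)]
          refine lintegral_congr fun X => ?_
          congr 3; ext <;> simp
      _ = _ := by ring
  simpa [Pi.add_def] using h1.add hf2

lemma integrable_of_memLp_of_compact {E : Type*} [NormedAddCommGroup E] {f : Eucl n × ℝ → E}
    (hf : MemLp f 2) {K : Set (Eucl n × ℝ)} (hK : IsCompact K) (h : ∀ X ∉ K, f X = 0) : Integrable f := by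
  have : IsFiniteMeasure (volume.restrict K) := ⟨by simpa using hK.measure_lt_top⟩
  have h1 : IntegrableOn f K := (hf.restrict K).integrable one_le_two
  refine (integrableOn_iff_integrable_of_support_subset fun X hX => ?_).1 h1
  by_contra hc; exact hX (h X hc)

lemma measurable_wgt (s : ℝ) {G : Eucl n × ℝ → Eucl n × ℝ} (hG : Measurable G) : Measurable (wgt s G) := by
  have h : Measurable fun X => (WithLp.toLp 2 (G X) : EuclProd n) := (WithLp.measurable_toLp 2 _).comp hG
  unfold wgt
  fun_prop

lemma wgt_eq_zero {s : ℝ} {G : Eucl n × ℝ → Eucl n × ℝ} {X : Eucl n × ℝ} (h : G X = 0) : wgt s G X = 0 := by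
  simp [wgt, h]

/-- The pairing identity for the horizontal mollification of a pair with trace `κ h`. -/
lemma normConst_mul_integral_inner_mollify (hn : 1 ≤ n) {s : ℝ} (hs : s ∈ Ioo (0 : ℝ) 1) {u : Eucl n → ℝ}
    (hum : Measurable u) (hu : Integrable fun y => u y * decay s y 1) {r : ℝ}
    (hfin : gagliardo s (crossSet (Metric.ball 0 r)) u < ⊤)
    {φ : Eucl n × ℝ → ℝ} {G : Eucl n × ℝ → Eucl n × ℝ}
    (hφm : Measurable φ) (hφ : Integrable φ) (hGm : Measurable G) (hG : Integrable G)
    {K : Set (Eucl n × ℝ)} (hK : IsCompact K) (hφK : ∀ X ∉ K, φ X = 0) (hGK : ∀ X ∉ K, G X = 0)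
    (hGw : MemLp (wgt s G) 2) (hfp : IsFieldPair s φ G) {h : Eucl n → ℝ} (hhm : Measurable h)
    (hh : Integrable h) {r' : ℝ} (hhr : ∀ x, r' < ‖x‖ → h x = 0) {ε₀ : ℝ} (hε₀ : 0 < ε₀)
    (hφr : ∀ X : Eucl n × ℝ, |X.2| < ε₀ → r' < ‖X.1‖ → φ X = 0) (hKr : ∀ X ∈ K, X.2 = 0 → ‖X.1‖ ≤ r')
    (htr : Tendsto (fun ε : ℝ => (∫⁻ z in Ioo (-ε) ε, ∫⁻ x, ‖φ (x, z) - kernelMass n s * h x‖ₑ) /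
      ENNReal.ofReal (2 * ε)) (𝓝[>] 0) (𝓝 0)) {ρ : Eucl n → ℝ} {L δ : ℝ} (hρ : IsMollifier ρ L δ)
    (hδ : δ < r - r') :
    normConst n s * ∫ X, inner ℝ (wgt s (extGrad s u) X) (wgt s (mollify ρ G) X) =
      gagForm s u (conv ρ h) := by
  have hwi : Integrable (wgt s G) := integrable_of_memLp_of_compact hGw hK fun X hX => wgt_eq_zero (hGK X hX)
  have hslice : ∀ᵐ z : ℝ, Integrable fun x => φ (x, z) := by
    rw [Measure.volume_eq_prod] at hφ
    exact hφ.prod_left_ae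
  refine normConst_mul_integral_inner hn hs hum hu (B := Metric.ball 0 r) measurableSet_ball
    (measure_ball_lt_top).ne ?_ hfin (measurable_mollify hρ.measurable hφm)
    (integrable_mollify hρ.integrable hφ) (measurable_mollify hρ.measurable hGm)
    (integrable_mollify hρ.integrable hG) (isCompact_hthicken (δ := δ) hK) (mollify_eq_zero hρ hφK)
    (mollify_eq_zero hρ hGK) ?_ ?_ (hfp.mollify hs.1.le hφ hG hK hφK hGK hρ.integrable)
    (measurable_conv hρ.measurable hhm) (abs_conv_sub_le hρ hh) ?_ hε₀ ?_
    -- `m z` is `L` times the `L¹` distance of the slice from `κ h`, so its averages tend to zero by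
    -- the trace hypothesis.
    (m := fun z => L * ∫ x, |φ (x, z) - kernelMass n s * h x|) ?_ ?_
  · have : Nonempty (Fin n) := ⟨⟨0, hn⟩⟩
    obtain ⟨y, hy⟩ := exists_norm_eq (Eucl n) (abs_nonneg r)
    exact ⟨y, by rw [mem_ball_zero_iff, hy]; exact not_lt.2 (le_abs_self r)⟩
  · have h1 : wgt s (mollify ρ G) = mollify ρ (wgt s G) := funext (wgt_mollify s ρ G)
    rw [h1]
    exact memLp_mollify hρ (measurable_wgt s hGm) hwi hGw
  · refine memLp_wgt_extGrad hs.1 hum hu Metric.isOpen_ball hfin (isCompact_hthicken hK) ?_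
    rintro X ⟨⟨Y, t⟩, ⟨hY, ht⟩, rfl⟩ hX
    have h1 := hKr Y hY hX
    have h2 := mem_closedBall_zero_iff.1 ht
    have h3 := norm_add_le Y.1 t
    rw [mem_ball_zero_iff]
    simp only at h1 h2 h3 ⊢
    linarith
  · intro x hx
    rw [mem_ball_zero_iff, not_lt] at hx
    exact conv_eq_zero hρ hδ.le hhr hx
  · refine Eventually.of_forall fun z hz x hx => ?_
    rw [mem_ball_zero_iff, not_lt] at hx
    have h1 : mollify ρ φ (x, z) = conv ρ (fun x => φ (x, z)) x := by simp [mollify, conv]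
    rw [h1]
    exact conv_eq_zero hρ hδ.le (fun x hx => hφr (x, z) hz hx) hx
  · filter_upwards [hslice] with z hz _ x y
    have h1 : ∀ x, mollify ρ φ (x, z) = conv ρ (fun x => φ (x, z)) x := fun x => by simp [mollify, conv]
    rw [h1, h1, conv_sub_const_mul hρ _ hz hh, conv_sub_const_mul hρ _ hz hh]
    exact abs_conv_sub_le hρ (hz.sub (hh.const_mul _)) x y
  · have h1 := ENNReal.Tendsto.const_mul htr (Or.inr (ENNReal.ofReal_ne_top (r := |L|)))
    rw [mul_zero] at h1
    refine h1.congr fun ε => ?_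
    rw [← mul_div_assoc, ← lintegral_const_mul' _ _ ENNReal.ofReal_ne_top]
    congr 1
    refine lintegral_congr_ae (ae_restrict_of_ae ?_)
    filter_upwards [hslice] with z hz
    have h2 := ofReal_integral_norm_eq_lintegral_enorm (hz.sub (hh.const_mul (kernelMass n s)))
    have h3 : 0 ≤ ∫ x, |φ (x, z) - kernelMass n s * h x| := integral_nonneg fun x => abs_nonneg _
    simp only [Pi.sub_apply, Real.norm_eq_abs] at h2
    rw [← h2, ← ofReal_norm, norm_mul, Real.norm_eq_abs, Real.norm_of_nonneg h3,
      ENNReal.ofReal_mul (abs_nonneg _)]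

/-! ### Test functions and their extensions -/

/-- Functions with bounded first and second differences supported in a ball. -/
structure IsTestFun (w : Eucl n → ℝ) (C r : ℝ) : Prop where
  measurable : Measurable w
  lip : ∀ x y, |w x - w y| ≤ C * min 1 ‖x - y‖
  lip_sub : ∀ x y t, |w (x + t) - w x - (w (y + t) - w y)| ≤ C * min 1 ‖x - y‖ * min 1 ‖t‖
  eq_zero : ∀ x, r ≤ ‖x‖ → w x = 0

lemma IsMollifier.isTestFun_conv {ρ : Eucl n → ℝ} {L δ r' r : ℝ} (hρ : IsMollifier ρ L δ) (hδ : δ ≤ r - r')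
    {h : Eucl n → ℝ} (hhm : Measurable h) (hhi : Integrable h) (hh : ∀ x, r' < ‖x‖ → h x = 0) :
    IsTestFun (conv ρ h) (L * ∫ t, |h t|) r where
  measurable := measurable_conv hρ.measurable hhm
  lip := abs_conv_sub_le hρ hhi
  lip_sub x y t := by
    have i := integrable_comp_sub_mul hρ hhi
    have e : conv ρ h (x + t) - conv ρ h x - (conv ρ h (y + t) - conv ρ h y) =
        ∫ a, (ρ (x - a + t) - ρ (x - a) - (ρ (y - a + t) - ρ (y - a))) * h a := by
      simp only [conv_eq]
      have i2 : ∀ x, Integrable fun a => ρ (x + t - a) * h a - ρ (x - a) * h a := fun x => (i _).sub (i _)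
      rw [← integral_sub (i _) (i _), ← integral_sub (i _) (i _), ← integral_sub (i2 x) (i2 y)]
      refine integral_congr_ae (Eventually.of_forall fun a => ?_)
      simp only
      rw [add_sub_right_comm x t a, add_sub_right_comm y t a]; ring
    rw [e, ← Real.norm_eq_abs, show L * (∫ t, |h t|) * min 1 ‖x - y‖ * min 1 ‖t‖ =
      (L * min 1 ‖x - y‖ * min 1 ‖t‖) * ∫ t, |h t| by ring, ← integral_const_mul]
    refine norm_integral_le_of_norm_le (hhi.abs.const_mul _) (Eventually.of_forall fun a => ?_)
    rw [norm_mul, Real.norm_eq_abs, Real.norm_eq_abs]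
    gcongr
    have := hρ.lip_sub (x - a) (y - a) t
    rwa [sub_sub_sub_cancel_right] at this
  eq_zero x hx := conv_eq_zero hρ hδ hh hx

namespace IsTestFun

variable {w : Eucl n → ℝ} {C r : ℝ}

lemma abs_le (hw : IsTestFun w C r) (hn : 1 ≤ n) (x : Eucl n) : |w x| ≤ C := by
  have : Nonempty (Fin n) := ⟨⟨0, hn⟩⟩
  obtain ⟨y, hy⟩ := exists_norm_eq (Eucl n) (c := |r| + ‖x‖ + 1) (by positivity)
  have h1 := hw.lip x y
  have h2 : (1 : ℝ) ≤ ‖x - y‖ := by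
    have := norm_sub_norm_le y x
    rw [norm_sub_rev] at this
    linarith [abs_nonneg r]
  rw [hw.eq_zero y (by linarith [le_abs_self r, norm_nonneg x]), sub_zero, min_eq_left h2, mul_one] at h1
  exact h1

lemma nonneg (hw : IsTestFun w C r) (hn : 1 ≤ n) : 0 ≤ C := (abs_nonneg _).trans (hw.abs_le hn 0)

lemma integrable (hw : IsTestFun w C r) (hn : 1 ≤ n) : Integrable w := by
  have h1 : IntegrableOn w (Metric.closedBall 0 r) :=
    (integrableOn_const (C := C) (measure_closedBall_lt_top).ne).mono' hw.measurable.aestronglyMeasurable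
      (Eventually.of_forall fun x => hw.abs_le hn x)
  refine (integrableOn_iff_integrable_of_support_subset fun x hx => ?_).1 h1
  rw [mem_closedBall_zero_iff]; by_contra h; exact hx (hw.eq_zero x (not_le.1 h).le)

lemma integrable_mul_decay (hw : IsTestFun w C r) (hn : 1 ≤ n) {s : ℝ} (hs : 0 < s) :
    Integrable fun y => w y * decay s y 1 :=
  (integrable_decay hs one_ne_zero).bdd_mul (c := C) hw.measurable.aestronglyMeasurable
    (Eventually.of_forall fun x => hw.abs_le hn x)

lemma gagliardo_lt_top (hw : IsTestFun w C r) (hn : 1 ≤ n) {s : ℝ} (hs : s ∈ Ioo (0 : ℝ) 1) :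
    gagliardo s univ w < ⊤ := by
  have h1 := integrableOn_crossSet_comp_sub (integrable_min_sq_div hn hs) (by simp)
    (measure_ball_lt_top (μ := (volume : Measure (Eucl n))) (x := 0) (r := r)).ne
  have h2 := (integrable_indicator_iff (measurableSet_crossSet measurableSet_ball)).2 h1
  have h3 : Integrable fun q : Eucl n × Eucl n => |w q.1 - w q.2| ^ 2 / ‖q.1 - q.2‖ ^ ((n : ℝ) + 2 * s) := by
    have hm := hw.measurable
    refine (h2.const_mul (C ^ 2)).mono' (Measurable.aestronglyMeasurable (by fun_prop))
      (Eventually.of_forall fun q => ?_)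
    rw [Real.norm_of_nonneg (by positivity)]
    by_cases hq : q ∈ crossSet (Metric.ball (0 : Eucl n) r)
    · rw [indicator_of_mem hq, ← mul_div_assoc, ← mul_pow]
      gcongr
      exact hw.lip _ _
    · have h1 : q.1 ∉ Metric.ball (0 : Eucl n) r ∧ q.2 ∉ Metric.ball (0 : Eucl n) r := by
        by_contra h
        apply hq
        simp only [crossSet, mem_union, mem_prod, mem_compl_iff]
        tauto
      simp only [mem_ball_zero_iff, not_lt] at h1
      rw [indicator_of_notMem hq, hw.eq_zero _ h1.1, hw.eq_zero _ h1.2]; simp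
  have h4 := h3.2
  rw [hasFiniteIntegral_iff_ofReal (Eventually.of_forall fun q => by positivity)] at h4
  unfold gagliardo
  rwa [Measure.restrict_univ]

/-- The extension differs from its boundary values by a function with small differences. -/
lemma exists_extend_sub_le (hw : IsTestFun w C r) (hn : 1 ≤ n) {s : ℝ} (hs : 0 < s) :
    ∃ m : ℝ → ℝ, (∀ z, 0 ≤ m z) ∧ Tendsto m (𝓝[≠] 0) (𝓝 0) ∧ ∀ z, z ≠ 0 →
      (∀ x, |extend s w (x, z) - kernelMass n s * w x| ≤ m z) ∧
      ∀ x y, |(extend s w (x, z) - kernelMass n s * w x) - (extend s w (y, z) - kernelMass n s * w y)| ≤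
        m z * min 1 ‖x - y‖ := by
  have hC := hw.nonneg hn
  have hK : ∀ z : ℝ, z ≠ 0 → Integrable fun t : Eucl n => min 1 ‖t‖ * extKer s t z := fun z hz => by
    refine (integrable_extKer hs hz).bdd_mul (c := 1) (Measurable.aestronglyMeasurable (by fun_prop))
      (Eventually.of_forall fun t => ?_)
    rw [Real.norm_of_nonneg (by positivity)]; exact min_le_left _ _
  have hm0 : ∀ z, 0 ≤ C * ∫ t : Eucl n, min 1 ‖t‖ * extKer s t z := fun z =>
    mul_nonneg hC (integral_nonneg fun t => mul_nonneg (by positivity) (extKer_nonneg s t z))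
  refine ⟨fun z => C * ∫ t : Eucl n, min 1 ‖t‖ * extKer s t z, hm0, ?_, ?_⟩
  · have hlim : Tendsto (fun z => ∫ t : Eucl n, min 1 ‖t‖ * extKer s t z) (𝓝[≠] 0) (𝓝 0) := by
      have hκ := kernelMass_pos (n := n) hs
      rw [Metric.tendsto_nhds]
      intro e he
      -- Translations shorter than `e / (2κ)` contribute at most `e / 2`, the kernel having mass
      -- `κ`; the longer ones carry a factor `|z|^(2s)`.
      have hd : 0 < e / 2 / kernelMass n s := by positivity
      obtain ⟨D, hD, hDle⟩ := exists_decay_le_of_le_norm (n := n) hs.le hd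
      have h1 : Tendsto (fun z : ℝ => |z| ^ (2 * s) * (D * ∫ t : Eucl n, decay s t 1)) (𝓝[≠] 0) (𝓝 0) := by
        have h2 : Continuous fun z : ℝ => |z| ^ (2 * s) * (D * ∫ t : Eucl n, decay s t 1) :=
          (continuous_abs.rpow_const fun z => Or.inr (by positivity)).mul_const _
        have h3 := h2.tendsto 0
        simp only [abs_zero, Real.zero_rpow (by positivity : 2 * s ≠ 0), zero_mul] at h3
        exact h3.mono_left nhdsWithin_le_nhds
      filter_upwards [h1.eventually_lt_const (half_pos he), self_mem_nhdsWithin] with z hz1 hz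
      rw [dist_zero_right, Real.norm_of_nonneg (integral_nonneg fun t =>
        mul_nonneg (by positivity) (extKer_nonneg s t z))]
      have h4 : ∫ t : Eucl n, min 1 ‖t‖ * extKer s t z ≤
          ∫ t : Eucl n, (e / 2 / kernelMass n s * extKer s t z + |z| ^ (2 * s) * (D * decay s t 1)) := by
        refine integral_mono (hK z hz) (((integrable_extKer hs hz).const_mul _).add
          (((integrable_decay hs one_ne_zero).const_mul D).const_mul _)) fun t => ?_
        have k1 := extKer_nonneg s t z
        have k2 := decay_nonneg s t 1
        simp only
        rcases lt_or_ge ‖t‖ (e / 2 / kernelMass n s) with ht | ht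
        · have : min 1 ‖t‖ * extKer s t z ≤ e / 2 / kernelMass n s * extKer s t z := by
            gcongr; exact (min_le_right _ _).trans ht.le
          have : 0 ≤ |z| ^ (2 * s) * (D * decay s t 1) := by positivity
          linarith
        · have h5 : min 1 ‖t‖ * extKer s t z ≤ 1 * extKer s t z := by gcongr; exact min_le_left _ _
          have h6 : extKer s t z ≤ |z| ^ (2 * s) * (D * decay s t 1) := by
            rw [extKer_eq]; gcongr; exact hDle t z ht
          have : 0 ≤ e / 2 / kernelMass n s * extKer s t z := by positivity
          linarith
      rw [integral_add ((integrable_extKer hs hz).const_mul _)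
          (((integrable_decay hs one_ne_zero).const_mul D).const_mul _), integral_const_mul, integral_const_mul,
          integral_const_mul, integral_extKer hz, div_mul_cancel₀ _ hκ.ne'] at h4
      linarith
    have := hlim.const_mul C
    rwa [mul_zero] at this
  · intro z hz
    have hu := hw.integrable_mul_decay hn hs
    have hm := hw.measurable
    have i : ∀ x, Integrable fun t => (w (x + t) - w x) * extKer s t z := fun x =>
      (integrable_extKer hs hz).bdd_mul (c := C) (Measurable.aestronglyMeasurable (by fun_prop))
        (Eventually.of_forall fun t => (hw.lip _ _).trans (mul_le_of_le_one_right hC (min_le_left _ _)))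
    refine ⟨fun x => ?_, fun x y => ?_⟩
    · change _ ≤ C * ∫ t : Eucl n, min 1 ‖t‖ * extKer s t z
      rw [extend_sub_kernelMass_mul hs hm hu x hz, ← Real.norm_eq_abs, ← integral_const_mul]
      refine norm_integral_le_of_norm_le ((hK z hz).const_mul C) (Eventually.of_forall fun t => ?_)
      rw [norm_mul, Real.norm_of_nonneg (extKer_nonneg s t z), Real.norm_eq_abs, ← mul_assoc]
      have h1 := hw.lip (x + t) x
      rw [add_sub_cancel_left] at h1
      have := extKer_nonneg s t z
      gcongr
    · change _ ≤ (C * ∫ t : Eucl n, min 1 ‖t‖ * extKer s t z) * min 1 ‖x - y‖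
      rw [extend_sub_kernelMass_mul hs hm hu x hz, extend_sub_kernelMass_mul hs hm hu y hz,
        ← integral_sub (i x) (i y), ← Real.norm_eq_abs, mul_right_comm, ← integral_const_mul]
      refine norm_integral_le_of_norm_le ((hK z hz).const_mul _) (Eventually.of_forall fun t => ?_)
      rw [← sub_mul, norm_mul, Real.norm_of_nonneg (extKer_nonneg s t z), Real.norm_eq_abs, ← mul_assoc]
      have := extKer_nonneg s t z
      gcongr
      -- Second differences enter here: the error is itself an average of first differences, and its
      -- Lipschitz bound in `x` must still be small as `t` tends to zero.
      exact hw.lip_sub x y t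

/-- The support of `w` is bounded. In the maximum norm either `|z| = ‖X‖`, or `‖x‖ = ‖X‖` and the
poles `y` in the support satisfy `‖x - y‖ ≥ ‖X‖ / 2`. -/
lemma exists_abs_extend_le_rpow (hw : IsTestFun w C r) (hn : 1 ≤ n) {s : ℝ} (hs : 0 < s) :
    ∃ D : ℝ, 0 ≤ D ∧ ∀ X : Eucl n × ℝ, 2 * r ≤ ‖X‖ → 0 < ‖X‖ →
      |extend s w X| ≤ D * |X.2| ^ (2 * s) * ‖X‖ ^ (-((n : ℝ) + 2 * s)) := by
  have hn0 : (0 : ℝ) ≤ n := n.cast_nonneg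
  refine ⟨2 ^ ((n : ℝ) + 2 * s) * ∫ y, |w y|, by positivity, fun X hX hX0 => ?_⟩
  have hi := hw.integrable hn
  have h1 : 2 ^ ((n : ℝ) + 2 * s) * (∫ y, |w y|) * |X.2| ^ (2 * s) * ‖X‖ ^ (-((n : ℝ) + 2 * s)) =
      ∫ y, |w y| * (|X.2| ^ (2 * s) * (2 ^ ((n : ℝ) + 2 * s) * ‖X‖ ^ (-((n : ℝ) + 2 * s)))) := by
    rw [integral_mul_const]; ring
  rw [h1, extend_eq, ← Real.norm_eq_abs]
  refine norm_integral_le_of_norm_le (hi.abs.mul_const _) (Eventually.of_forall fun y => ?_)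
  rw [norm_mul, Real.norm_eq_abs, Real.norm_of_nonneg (extKer_nonneg _ _ _)]
  rcases le_or_gt r ‖y‖ with hy | hy
  · rw [hw.eq_zero y hy]; simp
  · gcongr
    rw [extKer_eq]
    gcongr
    unfold decay
    have h2 : (‖X‖ / 2) ^ 2 ≤ ‖X.1 - y‖ ^ 2 + X.2 ^ 2 := by
      rcases le_total ‖X.1‖ ‖X.2‖ with h | h
      · have h3 : ‖X‖ = |X.2| := by rw [Prod.norm_def, max_eq_right h, Real.norm_eq_abs]
        rw [← sq_abs X.2, ← h3]
        nlinarith [sq_nonneg ‖X.1 - y‖]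
      · have h3 : ‖X‖ = ‖X.1‖ := by rw [Prod.norm_def, max_eq_left h]
        have h4 := norm_sub_norm_le X.1 y
        have h5 : ‖X‖ / 2 ≤ ‖X.1 - y‖ := by rw [h3] at hX ⊢; linarith
        nlinarith [sq_nonneg X.2]
    calc (‖X.1 - y‖ ^ 2 + X.2 ^ 2) ^ (-(((n : ℝ) + 2 * s) / 2)) ≤ ((‖X‖ / 2) ^ 2) ^ (-(((n : ℝ) + 2 * s) / 2)) :=
          Real.rpow_le_rpow_of_nonpos (by positivity) h2 (by linarith)
      _ = (‖X‖ / 2) ^ (-((n : ℝ) + 2 * s)) := by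
          rw [← Real.rpow_natCast, ← Real.rpow_mul (by positivity)]
          congr 1; push_cast; ring
      _ = _ := by
          rw [Real.div_rpow hX0.le (by norm_num), Real.rpow_neg (by norm_num : (0 : ℝ) ≤ 2), div_inv_eq_mul, mul_comm]

end IsTestFun

/-! ### Products with smooth functions, cutoffs at infinity, and the energy of an extension -/

/-- The gradient as an element of `ℝⁿ × ℝ`. -/
def gradOf (ξ : Eucl n × ℝ → ℝ) (X : Eucl n × ℝ) : Eucl n × ℝ :=
  ((InnerProductSpace.toDual ℝ (Eucl n)).symm ((fderiv ℝ ξ X).comp (ContinuousLinearMap.inl ℝ (Eucl n) ℝ)),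
    fderiv ℝ ξ X (0, 1))

lemma inner_gradOf (ξ : Eucl n × ℝ → ℝ) (X e : Eucl n × ℝ) :
    inner ℝ (gradOf ξ X).1 e.1 + (gradOf ξ X).2 * e.2 = fderiv ℝ ξ X e := by
  have h : e = (e.1, 0) + e.2 • ((0, 1) : Eucl n × ℝ) := by ext <;> simp
  conv_rhs => rw [h, map_add, map_smul]
  unfold gradOf
  rw [InnerProductSpace.toDual_symm_apply]
  simp [mul_comm]

lemma continuous_gradOf {ξ : Eucl n × ℝ → ℝ} (hξ : ContDiff ℝ ∞ ξ) : Continuous (gradOf ξ) := by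
  have h := hξ.continuous_fderiv (by simp)
  unfold gradOf
  refine Continuous.prodMk ?_ (h.clm_apply continuous_const)
  exact (InnerProductSpace.toDual ℝ (Eucl n)).symm.continuous.comp (h.clm_comp continuous_const)

lemma norm_toLp_gradOf_le (ξ : Eucl n × ℝ → ℝ) (X : Eucl n × ℝ) :
    ‖(WithLp.toLp 2 (gradOf ξ X) : EuclProd n)‖ ≤ 2 * ‖fderiv ℝ ξ X‖ := by
  have h1 := norm_toLp_le (gradOf ξ X).1 (gradOf ξ X).2
  have h2 : ‖(gradOf ξ X).1‖ ≤ ‖fderiv ℝ ξ X‖ := by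
    unfold gradOf
    rw [LinearIsometryEquiv.norm_map]
    refine (ContinuousLinearMap.opNorm_comp_le _ _).trans ?_
    exact mul_le_of_le_one_right (norm_nonneg _) (ContinuousLinearMap.norm_inl_le_one ℝ (Eucl n) ℝ)
  have h3 : |(gradOf ξ X).2| ≤ ‖fderiv ℝ ξ X‖ := by
    unfold gradOf
    have := (fderiv ℝ ξ X).le_opNorm (0, 1)
    simpa using this
  linarith

lemma HasWeakGradOn.mul_contDiff {U : Set (Eucl n × ℝ)} (hU : IsOpen U) {f ξ : Eucl n × ℝ → ℝ}
    {G : Eucl n × ℝ → Eucl n × ℝ} (h : HasWeakGradOn U f G) (hξ : ContDiff ℝ ∞ ξ) :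
    HasWeakGradOn U (fun X => ξ X * f X) (fun X => ξ X • G X + f X • gradOf ξ X) := by
  obtain ⟨h1, h2, h3⟩ := h
  refine ⟨h1.continuousOn_mul hξ.continuous.continuousOn hU.isLocallyClosed,
    (h2.continuousOn_smul hU.isLocallyClosed hξ.continuous.continuousOn).add
      (h1.smul_continuousOn hU.isLocallyClosed (continuous_gradOf hξ).continuousOn), ?_⟩
  intro η hη hηc hηU e
  have hc : HasCompactSupport fun X => ξ X * η X := hηc.mul_left
  have hs : tsupport (fun X => ξ X * η X) ⊆ U := tsupport_mul_subset_right.trans hηU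
  have k := h3 (fun X => ξ X * η X) (hξ.mul hη) hc hs e
  have hd : ∀ X, fderiv ℝ (fun X => ξ X * η X) X e = ξ X * fderiv ℝ η X e + η X * fderiv ℝ ξ X e := by
    intro X
    have h4 : fderiv ℝ (fun X => ξ X * η X) X = _ :=
      ((hξ.differentiable (by simp) X).hasFDerivAt.mul (hη.differentiable (by simp) X).hasFDerivAt).fderiv
    rw [h4]; simp
  have hdη : Continuous fun X => fderiv ℝ η X e := (hη.continuous_fderiv (by simp)).clm_apply continuous_const
  have hdξ : Continuous fun X => fderiv ℝ ξ X e := (hξ.continuous_fderiv (by simp)).clm_apply continuous_const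
  have hdηc : HasCompactSupport fun X => fderiv ℝ η X e := hηc.fderiv_apply (𝕜 := ℝ) e
  have i1 : Integrable fun X => f X * (ξ X * fderiv ℝ η X e) := by
    refine integrable_mul_of_integrableOn (hξ.continuous.mul hdη) hdηc.mul_left
      (h1.integrableOn_compact_subset (tsupport_mul_subset_right.trans ?_) hdηc.mul_left.isCompact)
    exact (tsupport_fderiv_apply_subset ℝ e).trans hηU
  have i2 : Integrable fun X => f X * (η X * fderiv ℝ ξ X e) :=
    integrable_mul_of_integrableOn (hη.continuous.mul hdξ) hηc.mul_right
      (h1.integrableOn_compact_subset (tsupport_mul_subset_left.trans hηU) hηc.mul_right.isCompact)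
  have i3 : Integrable fun X => (inner ℝ (G X).1 e.1 + (G X).2 * e.2) * (ξ X * η X) := by
    have h5 : IntegrableOn G (tsupport fun X => ξ X * η X) := h2.integrableOn_compact_subset hs hc.isCompact
    exact integrable_mul_of_integrableOn (hξ.continuous.mul hη.continuous) hc
      ((Integrable.inner_const (𝕜 := ℝ) h5.fst e.1).add (h5.snd.mul_const e.2))
  have e1 : ∀ X, f X * fderiv ℝ (fun X => ξ X * η X) X e =
      f X * (ξ X * fderiv ℝ η X e) + f X * (η X * fderiv ℝ ξ X e) := fun X => by rw [hd]; ring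
  simp_rw [e1] at k
  rw [integral_add i1 i2] at k
  have e2 : ∀ X, ξ X * f X * fderiv ℝ η X e = f X * (ξ X * fderiv ℝ η X e) := fun X => by ring
  have e3 : ∀ X, (inner ℝ (ξ X • G X + f X • gradOf ξ X).1 e.1 + (ξ X • G X + f X • gradOf ξ X).2 * e.2) * η X =
      (inner ℝ (G X).1 e.1 + (G X).2 * e.2) * (ξ X * η X) + f X * (η X * fderiv ℝ ξ X e) := by
    intro X
    rw [← inner_gradOf ξ X e]
    simp only [Prod.fst_add, Prod.snd_add, Prod.smul_fst, Prod.smul_snd, inner_add_left, real_inner_smul_left,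
      smul_eq_mul]
    ring
  simp_rw [e2, e3]
  rw [integral_add i3 i2]
  linarith

lemma wgt_add (s : ℝ) (G H : Eucl n × ℝ → Eucl n × ℝ) (X : Eucl n × ℝ) :
    wgt s (fun X => G X + H X) X = wgt s G X + wgt s H X := by
  simp [wgt, WithLp.toLp_add, smul_add]

lemma wgt_smul (s : ℝ) (c : Eucl n × ℝ → ℝ) (G : Eucl n × ℝ → Eucl n × ℝ) (X : Eucl n × ℝ) :
    wgt s (fun X => c X • G X) X = c X • wgt s G X := by
  simp only [wgt, WithLp.toLp_smul]
  rw [smul_comm]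

lemma integrable_of_locallyIntegrableOn_univ {E : Type*} [NormedAddCommGroup E] {f : Eucl n × ℝ → E}
    (hf : LocallyIntegrableOn f univ) {K : Set (Eucl n × ℝ)} (hK : IsCompact K) (h : ∀ X ∉ K, f X = 0) :
    Integrable f := by
  refine (integrableOn_iff_integrable_of_support_subset fun X hX => ?_).1
    (hf.integrableOn_compact_subset (subset_univ K) hK)
  by_contra hc; exact hX (h X hc)

lemma gagliardo_mono {s : ℝ} {Q Q' : Set (Eucl n × Eucl n)} (h : Q ⊆ Q') (u : Eucl n → ℝ) :
    gagliardo s Q u ≤ gagliardo s Q' u := lintegral_mono_set h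

/-- Dilations of one fixed cutoff. The gradient gains `1/R`, which makes the energy of the
transition region vanish; the Lipschitz bound is only needed uniformly in `R ≥ 1`. -/
lemma exists_scaled_cutoff (n : ℕ) : ∃ C : ℝ, 0 ≤ C ∧ ∀ R : ℝ, 1 ≤ R → ∃ ξ : Eucl n × ℝ → ℝ,
    ContDiff ℝ ∞ ξ ∧ (∀ X, ‖X‖ ≤ R → ξ X = 1) ∧ (∀ X, 2 * R < ‖X‖ → ξ X = 0) ∧ (∀ X, ξ X ∈ Icc (0 : ℝ) 1) ∧
    (∀ X, ‖X‖ < R → fderiv ℝ ξ X = 0) ∧ (∀ X, 2 * R < ‖X‖ → fderiv ℝ ξ X = 0) ∧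
    (∀ X, ‖fderiv ℝ ξ X‖ ≤ C / R) ∧ ∀ X Y, |ξ X - ξ Y| ≤ C * ‖X - Y‖ := by
  obtain ⟨ξ, h1, h2, h3, h4, h5⟩ := exists_cutoff (isCompact_closedBall (0 : Eucl n × ℝ) 1)
    (Metric.isOpen_ball (x := (0 : Eucl n × ℝ)) (ε := 2)) (Metric.closedBall_subset_ball (by norm_num))
  obtain ⟨C, hC⟩ := (h2.fderiv ℝ).exists_bound_of_continuous (h1.continuous_fderiv (by simp))
  obtain ⟨L, hL⟩ := ContDiff.lipschitzWith_of_hasCompactSupport h2 h1 (by simp)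
  refine ⟨max C L, le_max_of_le_right L.2, fun R hR => ⟨fun X => ξ (R⁻¹ • X), ?_⟩⟩
  have hR0 : 0 < R := by linarith
  have hnorm : ∀ X : Eucl n × ℝ, ‖R⁻¹ • X‖ = ‖X‖ / R := fun X => by
    rw [norm_smul, norm_inv, Real.norm_of_nonneg hR0.le]; ring
  have hone : ∀ X : Eucl n × ℝ, ‖X‖ ≤ R → ξ (R⁻¹ • X) = 1 := fun X hX =>
    (h4 _ (by rw [mem_closedBall_zero_iff, hnorm, div_le_one hR0]; exact hX)).self_of_nhds
  have hzero : ∀ X : Eucl n × ℝ, 2 * R < ‖X‖ → ξ (R⁻¹ • X) = 0 := fun X hX => by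
    refine image_eq_zero_of_notMem_tsupport fun h => ?_
    have := mem_ball_zero_iff.1 (h3 h)
    rw [hnorm, div_lt_iff₀ hR0] at this
    linarith
  have hsm : ContDiff ℝ ∞ fun X : Eucl n × ℝ => ξ (R⁻¹ • X) := h1.comp (contDiff_const_smul _)
  refine ⟨hsm, hone, hzero, fun X => h5 _, fun X hX => ?_, fun X hX => ?_, fun X => ?_, fun X Y => ?_⟩
  · have : (fun X : Eucl n × ℝ => ξ (R⁻¹ • X)) =ᶠ[𝓝 X] fun _ => 1 := by
      filter_upwards [continuous_norm.continuousAt.eventually_lt continuousAt_const hX] with Y hY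
        using hone Y (le_of_lt hY)
    rw [this.fderiv_eq]; simp
  · have : (fun X : Eucl n × ℝ => ξ (R⁻¹ • X)) =ᶠ[𝓝 X] fun _ => 0 := by
      filter_upwards [continuousAt_const.eventually_lt continuous_norm.continuousAt hX] with Y hY
        using hzero Y hY
    rw [this.fderiv_eq]; simp
  · have h6 : HasFDerivAt (fun X : Eucl n × ℝ => ξ (R⁻¹ • X)) ((fderiv ℝ ξ (R⁻¹ • X)).comp
        (R⁻¹ • ContinuousLinearMap.id ℝ (Eucl n × ℝ))) X :=
      (h1.differentiable (by simp) _).hasFDerivAt.comp X ((hasFDerivAt_id X).const_smul R⁻¹)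
    rw [h6.fderiv, ContinuousLinearMap.comp_smul, ContinuousLinearMap.comp_id, norm_smul, norm_inv,
      Real.norm_of_nonneg hR0.le, inv_mul_eq_div]
    gcongr
    exact (hC _).trans (le_max_left _ _)
  · have h7 := hL.dist_le_mul (R⁻¹ • X) (R⁻¹ • Y)
    rw [Real.dist_eq, dist_eq_norm, ← smul_sub, hnorm] at h7
    refine h7.trans ?_
    gcongr
    · exact le_max_right _ _
    · exact div_le_self (norm_nonneg _) hR

namespace IsTestFun

variable {w : Eucl n → ℝ} {C r : ℝ}

lemma memLp_wgt_extGrad (hw : IsTestFun w C r) (hn : 1 ≤ n) {s : ℝ} (hs : s ∈ Ioo (0 : ℝ) 1) :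
    MemLp (wgt s (extGrad s w)) 2 := by
  refine memLp_two_iff.2 ⟨aestronglyMeasurable_wgt s (measurable_extGrad s hw.measurable).aestronglyMeasurable, ?_⟩
  have h := lintegral_wgt_extGrad_prod_lt_top hs.1 hw.measurable (hw.integrable_mul_decay hn hs.1)
    (B := univ) ((gagliardo_mono (subset_univ _) w).trans_lt (hw.gagliardo_lt_top hn hs))
  rwa [univ_prod_univ, Measure.restrict_univ] at h

/-- The pairing identity requires compact support, so it is applied to the truncated extension `ξ
w̄` with its product-rule gradient. As `ξ = 1` near the support of `w` on `{z = 0}`, the trace is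
still `κ w`. -/
lemma normConst_mul_integral_cutoff (hw : IsTestFun w C r) (hn : 1 ≤ n) {s : ℝ} (hs : s ∈ Ioo (0 : ℝ) 1)
    {ξ : Eucl n × ℝ → ℝ} {R D : ℝ} (hR : 1 ≤ R) (hrR : r ≤ R) (hξ : ContDiff ℝ ∞ ξ)
    (hξ1 : ∀ X, ‖X‖ ≤ R → ξ X = 1) (hξ0 : ∀ X, 2 * R < ‖X‖ → ξ X = 0) (hξI : ∀ X, ξ X ∈ Icc (0 : ℝ) 1)
    (hdξ : ∀ X, 2 * R < ‖X‖ → fderiv ℝ ξ X = 0) (hξL : ∀ X Y, |ξ X - ξ Y| ≤ D * ‖X - Y‖)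
    (hW : MemLp (fun X => extend s w X • wgt s (gradOf ξ) X) 2) :
    normConst n s * ((∫ X, ξ X * ‖wgt s (extGrad s w) X‖ ^ 2) +
      ∫ X, inner ℝ (wgt s (extGrad s w) X) (extend s w X • wgt s (gradOf ξ) X)) = gagForm s w w := by
  have hm := hw.measurable
  have hu := hw.integrable_mul_decay hn hs.1
  have hC := hw.nonneg hn
  have hV := hw.memLp_wgt_extGrad hn hs
  have hfin := hw.gagliardo_lt_top hn hs
  have hwk := (hasWeakGradOn_extend hs.1 hm hu isOpen_univ ((gagliardo_mono (subset_univ _) w).trans_lt hfin)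
    isOpen_univ (fun X _ _ => mem_univ _)).mul_contDiff isOpen_univ hξ
  set φ : Eucl n × ℝ → ℝ := fun X => ξ X * extend s w X with hφ
  set G : Eucl n × ℝ → Eucl n × ℝ := fun X => ξ X • extGrad s w X + extend s w X • gradOf ξ X with hG
  have hξm : Measurable ξ := hξ.continuous.measurable
  have hem := measurable_extend s hm
  have hgm := measurable_extGrad s hm
  have hgξm : Measurable (gradOf ξ) := (continuous_gradOf hξ).measurable
  have hK := isCompact_closedBall (0 : Eucl n × ℝ) (2 * R)
  have hout : ∀ X : Eucl n × ℝ, X ∉ Metric.closedBall (0 : Eucl n × ℝ) (2 * R) → 2 * R < ‖X‖ := fun X hX => by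
    rwa [mem_closedBall_zero_iff, not_le] at hX
  have hφK : ∀ X ∉ Metric.closedBall (0 : Eucl n × ℝ) (2 * R), φ X = 0 := fun X hX => by
    simp only [hφ]; rw [hξ0 X (hout X hX), zero_mul]
  have hGK : ∀ X ∉ Metric.closedBall (0 : Eucl n × ℝ) (2 * R), G X = 0 := fun X hX => by
    have h1 : gradOf ξ X = 0 := by unfold gradOf; rw [hdξ X (hout X hX)]; simp
    simp only [hG]; rw [hξ0 X (hout X hX), h1]; simp
  have hwG : ∀ X, wgt s G X = ξ X • wgt s (extGrad s w) X + extend s w X • wgt s (gradOf ξ) X := fun X => by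
    rw [hG, wgt_add, wgt_smul, wgt_smul]
  have hξV : MemLp (fun X => ξ X • wgt s (extGrad s w) X) 2 := by
    refine hV.mono (hξm.aestronglyMeasurable.smul hV.1) (Eventually.of_forall fun X => ?_)
    rw [norm_smul, Real.norm_of_nonneg (hξI X).1]
    exact mul_le_of_le_one_left (norm_nonneg _) (hξI X).2
  have hGw : MemLp (wgt s G) 2 := by
    have : wgt s G = (fun X => ξ X • wgt s (extGrad s w) X) + fun X => extend s w X • wgt s (gradOf ξ) X :=
      funext hwG
    rw [this]; exact hξV.add hW
  obtain ⟨m, hm0, hmlim, hmle⟩ := hw.exists_extend_sub_le hn hs.1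
  have hκ := kernelMass_pos (n := n) hs.1
  have hprod : ∀ z : ℝ, |z| < 1 → ∀ x, ξ (x, z) * w x = w x := by
    intro z hz x
    rcases le_or_gt r ‖x‖ with h | h
    · rw [hw.eq_zero x h, mul_zero]
    · rw [hξ1, one_mul]
      rw [Prod.norm_def, max_le_iff, Real.norm_eq_abs]
      exact ⟨by linarith, by linarith⟩
  have key := normConst_mul_integral_inner hn hs hm hu (B := Metric.closedBall (0 : Eucl n) (2 * R))
    measurableSet_closedBall (measure_closedBall_lt_top).ne ?_
    ((gagliardo_mono (subset_univ _) w).trans_lt hfin) (show Measurable φ from hξm.mul hem)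
    (integrable_of_locallyIntegrableOn_univ hwk.1 hK hφK)
    (show Measurable G from (hξm.smul hgm).add (hem.smul hgξm))
    (integrable_of_locallyIntegrableOn_univ hwk.2.1 hK hGK) hK hφK hGK hGw (hV.restrict _)
    (isFieldPair_of_hasWeakGradOn s isOpen_univ hwk hK (subset_univ _) (Eventually.of_forall fun X => hφK X)
      (Eventually.of_forall fun X => hGK X)) hm hw.lip ?_ one_pos ?_ (m := fun z => (1 + max 1 D) * m z) ?_ ?_
  · rw [← key]
    congr 1
    have i1 : Integrable fun X => ξ X * ‖wgt s (extGrad s w) X‖ ^ 2 := by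
      refine (integrable_inner_of_memLp hV hξV).congr (Eventually.of_forall fun X => ?_)
      simp only
      rw [real_inner_smul_right, real_inner_self_eq_norm_sq]
    rw [← integral_add i1 (integrable_inner_of_memLp hV hW)]
    refine integral_congr_ae (Eventually.of_forall fun X => ?_)
    simp only
    rw [hwG, inner_add_right, real_inner_smul_right _ _ (ξ X), real_inner_self_eq_norm_sq]
  · have : Nonempty (Fin n) := ⟨⟨0, hn⟩⟩
    obtain ⟨y, hy⟩ := exists_norm_eq (Eucl n) (c := 2 * R + 1) (by linarith)
    exact ⟨y, by rw [mem_closedBall_zero_iff, hy]; linarith⟩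
  · intro x hx
    rw [mem_closedBall_zero_iff, not_le] at hx
    exact hw.eq_zero x (by linarith)
  · refine Eventually.of_forall fun z _ x hx => ?_
    rw [mem_closedBall_zero_iff, not_le] at hx
    change ξ (x, z) * extend s w (x, z) = 0
    rw [hξ0 (x, z) (hx.trans_le (norm_fst_le (x, z))), zero_mul]
  · have h0 : ∀ᵐ z : ℝ, z ≠ 0 := by rw [ae_iff]; simp
    filter_upwards [h0] with z hz0 hz x y
    obtain ⟨b1, b2⟩ := hmle z hz0
    set d : Eucl n → ℝ := fun x => extend s w (x, z) - kernelMass n s * w x with hd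
    have e1 : ∀ x, ξ (x, z) * extend s w (x, z) - kernelMass n s * w x = ξ (x, z) * d x := fun x => by
      have := hprod z hz x
      simp only [hd]
      linear_combination (kernelMass n s) * this
    change |(ξ (x, z) * extend s w (x, z) - kernelMass n s * w x) -
      (ξ (y, z) * extend s w (y, z) - kernelMass n s * w y)| ≤ _
    rw [e1, e1, show ξ (x, z) * d x - ξ (y, z) * d y = ξ (x, z) * (d x - d y) + (ξ (x, z) - ξ (y, z)) * d y by ring]
    -- The cutoff takes values in `[0, 1]` and is `D`-Lipschitz, so multiplication by it enlarges
    -- the modulus `m z` of the boundary error by the factor `1 + max 1 D` only.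
    have h3 : |ξ (x, z) - ξ (y, z)| ≤ max 1 D * min 1 ‖x - y‖ := by
      rcases le_total 1 ‖x - y‖ with h | h
      · rw [min_eq_left h, mul_one]
        refine le_max_of_le_left (_root_.abs_le.2 ⟨?_, ?_⟩) <;>
          linarith [(hξI (x, z)).1, (hξI (x, z)).2, (hξI (y, z)).1, (hξI (y, z)).2]
      · rw [min_eq_right h]
        have h4 := hξL (x, z) (y, z)
        have h5 : ‖((x, z) : Eucl n × ℝ) - (y, z)‖ = ‖x - y‖ := by simp [Prod.norm_def]
        rw [h5] at h4
        exact h4.trans (by gcongr; exact le_max_right _ _)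
    refine (abs_add_le _ _).trans ?_
    rw [abs_mul, abs_mul, abs_of_nonneg (hξI (x, z)).1]
    have h6 := hm0 z
    calc ξ (x, z) * |d x - d y| + |ξ (x, z) - ξ (y, z)| * |d y|
        ≤ 1 * (m z * min 1 ‖x - y‖) + max 1 D * min 1 ‖x - y‖ * m z := by
          gcongr
          · exact (hξI (x, z)).2
          · exact b2 x y
          · exact b1 y
      _ = _ := by ring
  · refine tendsto_average_of_tendsto (f := fun z => ‖(1 + max 1 D) * m z‖ₑ) ?_
    have h1 := (hmlim.const_mul (1 + max 1 D)).enorm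
    simpa using h1

end IsTestFun

namespace IsTestFun

variable {w : Eucl n → ℝ} {C r : ℝ}

/-- Decay of the part of the truncated extension where the cutoff varies. -/
lemma lintegral_extend_smul_gradOf_le (hw : IsTestFun w C r) (hn : 1 ≤ n) {s : ℝ} (hs : s ∈ Ioo (0 : ℝ) 1)
    {C₁ : ℝ} (hC₁ : 0 ≤ C₁) : ∃ D : ℝ, 0 ≤ D ∧ ∀ (R : ℝ) (ξ : Eucl n × ℝ → ℝ), 1 ≤ R → 2 * r ≤ R →
      (∀ X, ‖X‖ < R → fderiv ℝ ξ X = 0) → (∀ X, 2 * R < ‖X‖ → fderiv ℝ ξ X = 0) →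
      (∀ X, ‖fderiv ℝ ξ X‖ ≤ C₁ / R) →
      ∫⁻ X, ‖extend s w X • wgt s (gradOf ξ) X‖ₑ ^ 2 ≤ ENNReal.ofReal (D * R ^ (-((n : ℝ) + 2 * s))) := by
  obtain ⟨D, hD, hDle⟩ := hw.exists_abs_extend_le_rpow hn hs.1
  have hn0 : (0 : ℝ) ≤ n := n.cast_nonneg
  have hs0 := hs.1
  set V : ℝ := volume.real (Metric.closedBall (0 : Eucl n × ℝ) 1) with hV
  set c : ℝ := D * 2 ^ (s + 1 / 2) * (2 * C₁) with hc
  have hc0 : 0 ≤ c := by positivity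
  refine ⟨c ^ 2 * 2 ^ (n + 1) * V, by positivity, fun R ξ hR hrR h1 h2 h3 => ?_⟩
  have hR0 : 0 < R := by linarith
  -- On the shell `R ≤ ‖X‖ ≤ 2R` the product is at most a multiple of `|z|^(2s) R^(-(n+2s))
  -- |z|^((1-2s)/2) R^(-1)`, hence of `R^(-(n+s+1/2))`. Its square times the volume, of order
  -- `R^(n+1)`, is of order `R^(-(n+2s))`.
  have hb : ∀ X : Eucl n × ℝ, X.2 ≠ 0 → ‖extend s w X • wgt s (gradOf ξ) X‖ₑ ^ 2 ≤
      (Metric.closedBall (0 : Eucl n × ℝ) (2 * R)).indicator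
        (fun _ => ENNReal.ofReal ((c * R ^ (-((n : ℝ) + s + 1 / 2))) ^ 2)) X := by
    intro X hX
    have h0 : fderiv ℝ ξ X = 0 → ‖extend s w X • wgt s (gradOf ξ) X‖ₑ ^ 2 = 0 := fun h => by
      have h1 : gradOf ξ X = 0 := by unfold gradOf; rw [h]; simp
      rw [wgt_eq_zero h1]; simp
    rcases lt_or_ge ‖X‖ R with h4 | h4
    · rw [h0 (h1 X h4)]; exact zero_le
    rcases lt_or_ge (2 * R) ‖X‖ with h5 | h5
    · rw [h0 (h2 X h5)]; exact zero_le
    rw [indicator_of_mem (mem_closedBall_zero_iff.2 h5), ← ofReal_norm, ← ENNReal.ofReal_pow (norm_nonneg _)]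
    refine ENNReal.ofReal_le_ofReal ?_
    gcongr
    have hz0 : 0 < |X.2| := abs_pos.2 hX
    have hz : |X.2| ≤ 2 * R := (norm_snd_le X).trans h5
    have h6 := hDle X (hrR.trans h4) (hR0.trans_le h4)
    have h7 : ‖X‖ ^ (-((n : ℝ) + 2 * s)) ≤ R ^ (-((n : ℝ) + 2 * s)) :=
      Real.rpow_le_rpow_of_nonpos hR0 h4 (by linarith)
    have h8 := norm_toLp_gradOf_le ξ X
    have h9 : ‖(WithLp.toLp 2 (gradOf ξ X) : EuclProd n)‖ ≤ 2 * (C₁ / R) := h8.trans (by gcongr; exact h3 X)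
    rw [norm_smul, wgt, norm_smul, Real.norm_of_nonneg (Real.rpow_nonneg (abs_nonneg X.2) _), Real.norm_eq_abs]
    calc |extend s w X| * (|X.2| ^ ((1 - 2 * s) / 2) * ‖(WithLp.toLp 2 (gradOf ξ X) : EuclProd n)‖)
        ≤ (D * |X.2| ^ (2 * s) * R ^ (-((n : ℝ) + 2 * s))) * (|X.2| ^ ((1 - 2 * s) / 2) * (2 * (C₁ / R))) := by
          gcongr
          exact h6.trans (by gcongr)
      _ = D * (2 * C₁) * (|X.2| ^ (2 * s) * |X.2| ^ ((1 - 2 * s) / 2)) * (R ^ (-((n : ℝ) + 2 * s)) * R ^ (-1 : ℝ)) := by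
          rw [Real.rpow_neg_one]; ring
      _ = D * (2 * C₁) * |X.2| ^ (s + 1 / 2) * R ^ (-((n : ℝ) + 2 * s) + -1) := by
          rw [← Real.rpow_add hz0, ← Real.rpow_add hR0]
          congr 3; ring
      _ ≤ D * (2 * C₁) * (2 * R) ^ (s + 1 / 2) * R ^ (-((n : ℝ) + 2 * s) + -1) := by gcongr
      _ = c * (R ^ (s + 1 / 2) * R ^ (-((n : ℝ) + 2 * s) + -1)) := by
          rw [Real.mul_rpow (by norm_num) hR0.le]; ring
      _ = _ := by
          rw [← Real.rpow_add hR0]; congr 2; ring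
  calc _ ≤ ∫⁻ X, (Metric.closedBall (0 : Eucl n × ℝ) (2 * R)).indicator
        (fun _ => ENNReal.ofReal ((c * R ^ (-((n : ℝ) + s + 1 / 2))) ^ 2)) X :=
        lintegral_mono_ae (ae_snd_ne_zero.mono hb)
    _ = ENNReal.ofReal ((c * R ^ (-((n : ℝ) + s + 1 / 2))) ^ 2) *
          volume (Metric.closedBall (0 : Eucl n × ℝ) (2 * R)) := by
        rw [lintegral_indicator measurableSet_closedBall, setLIntegral_const]
    _ = ENNReal.ofReal ((c * R ^ (-((n : ℝ) + s + 1 / 2))) ^ 2 * ((2 * R) ^ (n + 1) * V)) := by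
        rw [Measure.addHaar_closedBall' _ _ (by positivity), ENNReal.ofReal_mul (by positivity),
          ENNReal.ofReal_mul (by positivity), hV, Measure.real,
          ENNReal.ofReal_toReal (measure_closedBall_lt_top).ne]
        congr 4
        simp
    _ = _ := by
        congr 1
        rw [mul_pow, mul_pow]
        have : (R ^ (-((n : ℝ) + s + 1 / 2))) ^ 2 * R ^ (n + 1) = R ^ (-((n : ℝ) + 2 * s)) := by
          rw [← Real.rpow_natCast, ← Real.rpow_natCast, ← Real.rpow_mul hR0.le, ← Real.rpow_add hR0]
          congr 1; push_cast; ring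
        linear_combination (c ^ 2 * 2 ^ (n + 1) * V) * this

/-- The energy of the extension is the Gagliardo energy. -/
lemma normConst_mul_integral_norm_sq (hw : IsTestFun w C r) (hn : 1 ≤ n) {s : ℝ} (hs : s ∈ Ioo (0 : ℝ) 1) :
    normConst n s * ∫ X, ‖wgt s (extGrad s w) X‖ ^ 2 = gagForm s w w := by
  have hn0 : (0 : ℝ) ≤ n := n.cast_nonneg
  have hs0 := hs.1
  obtain ⟨C₁, hC₁, hcut⟩ := exists_scaled_cutoff n
  obtain ⟨D, hD, hDle⟩ := hw.lintegral_extend_smul_gradOf_le hn hs hC₁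
  have hR : ∀ k : ℕ, 1 ≤ (k : ℝ) + 1 + 2 * |r| := fun k => by
    have := abs_nonneg r
    have : (0 : ℝ) ≤ k := k.cast_nonneg
    linarith
  choose ξ h1 h2 h3 h4 h5 h6 h7 h8 using fun k : ℕ => hcut _ (hR k)
  have hV := hw.memLp_wgt_extGrad hn hs
  have hr1 : ∀ k : ℕ, r ≤ (k : ℝ) + 1 + 2 * |r| ∧ 2 * r ≤ (k : ℝ) + 1 + 2 * |r| := fun k => by
    have := abs_nonneg r
    have := le_abs_self r
    have : (0 : ℝ) ≤ k := k.cast_nonneg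
    constructor <;> linarith
  have hle : ∀ k, ∫⁻ X, ‖extend s w X • wgt s (gradOf (ξ k)) X‖ₑ ^ 2 ≤
      ENNReal.ofReal (D * ((k : ℝ) + 1 + 2 * |r|) ^ (-((n : ℝ) + 2 * s))) := fun k =>
    hDle _ (ξ k) (hR k) (hr1 k).2 (h5 k) (h6 k) (h7 k)
  have hW : ∀ k, MemLp (fun X => extend s w X • wgt s (gradOf (ξ k)) X) 2 := fun k => by
    rw [memLp_two_iff]
    refine ⟨Measurable.aestronglyMeasurable ?_, (hle k).trans_lt ENNReal.ofReal_lt_top⟩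
    exact (measurable_extend s hw.measurable).smul (measurable_wgt s (continuous_gradOf (h1 k)).measurable)
  have hid := fun k => hw.normConst_mul_integral_cutoff hn hs (hR k) (hr1 k).1 (h1 k) (h2 k) (h3 k) (h4 k)
    (h6 k) (h8 k) (hW k)
  have hV2 : Integrable fun X => ‖wgt s (extGrad s w) X‖ ^ 2 := hV.integrable_norm_pow (by norm_num)
  have hatTop : Tendsto (fun k : ℕ => (k : ℝ) + 1 + 2 * |r|) atTop atTop :=
    tendsto_atTop_add_const_right _ _ (tendsto_atTop_add_const_right _ _ tendsto_natCast_atTop_atTop)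
  have t1 : Tendsto (fun k => ∫ X, ξ k X * ‖wgt s (extGrad s w) X‖ ^ 2) atTop
      (𝓝 (∫ X, ‖wgt s (extGrad s w) X‖ ^ 2)) := by
    refine tendsto_integral_of_dominated_convergence _ (fun k => ?_) hV2 (fun k => ?_) ?_
    · exact (h1 k).continuous.aestronglyMeasurable.mul hV2.1
    · refine Eventually.of_forall fun X => ?_
      rw [norm_mul, Real.norm_of_nonneg (h4 k X).1, Real.norm_of_nonneg (by positivity)]
      exact mul_le_of_le_one_left (by positivity) (h4 k X).2
    · refine Eventually.of_forall fun X => ?_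
      refine tendsto_const_nhds.congr' ?_
      filter_upwards [hatTop.eventually_ge_atTop ‖X‖] with k hk
      rw [h2 k X hk, one_mul]
  have t2 : Tendsto (fun k => ∫ X, inner ℝ (wgt s (extGrad s w) X) (extend s w X • wgt s (gradOf (ξ k)) X))
      atTop (𝓝 0) := by
    have hbig : Tendsto (fun k : ℕ => (∫⁻ X, ‖wgt s (extGrad s w) X‖ₑ ^ 2) *
        ENNReal.ofReal (D * ((k : ℝ) + 1 + 2 * |r|) ^ (-((n : ℝ) + 2 * s)))) atTop (𝓝 0) := by
      have h9 : Tendsto (fun k : ℕ => D * ((k : ℝ) + 1 + 2 * |r|) ^ (-((n : ℝ) + 2 * s))) atTop (𝓝 0) := by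
        have := ((tendsto_rpow_neg_atTop (by linarith : 0 < (n : ℝ) + 2 * s)).comp hatTop).const_mul D
        rwa [mul_zero] at this
      have h10 := ENNReal.Tendsto.const_mul (ENNReal.tendsto_ofReal h9) (Or.inr (memLp_two_iff.1 hV).2.ne)
      simpa using h10
    -- Cauchy-Schwarz against the finite total energy of the extension; the transition terms vanish
    -- as the cutoff radius grows.
    have hsq : Tendsto (fun k => ‖∫ X, inner ℝ (wgt s (extGrad s w) X) (extend s w X • wgt s (gradOf (ξ k)) X)‖ₑ ^ 2)
        atTop (𝓝 0) := by
      refine tendsto_of_tendsto_of_tendsto_of_le_of_le tendsto_const_nhds hbig (fun _ => zero_le) fun k => ?_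
      calc _ ≤ (∫⁻ X, ‖wgt s (extGrad s w) X‖ₑ * ‖extend s w X • wgt s (gradOf (ξ k)) X‖ₑ) ^ 2 := by
            gcongr
            refine (enorm_integral_le_lintegral_enorm _).trans (lintegral_mono fun X => ?_)
            simp only [← ofReal_norm]
            rw [← ENNReal.ofReal_mul (norm_nonneg _)]
            exact ENNReal.ofReal_le_ofReal (norm_inner_le_norm _ _)
        _ ≤ _ := sq_lintegral_mul_le hV.1.enorm (hW k).1.enorm
        _ ≤ _ := by gcongr; exact hle k
    have hsq2 := (ENNReal.continuous_rpow_const (y := 1 / 2)).tendsto 0 |>.comp hsq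
    simp only [Function.comp_def] at hsq2
    rw [ENNReal.zero_rpow_of_pos (by norm_num)] at hsq2
    rw [tendsto_iff_edist_tendsto_0]
    refine hsq2.congr fun k => ?_
    rw [edist_zero_right, ← ENNReal.rpow_natCast, ← ENNReal.rpow_mul]
    norm_num
  have t3 := (t1.add t2).const_mul (normConst n s)
  rw [add_zero] at t3
  refine tendsto_nhds_unique t3 (tendsto_const_nhds.congr fun k => ?_)
  exact (hid k).symm

end IsTestFun

/-! ### A sequence of mollifiers and `L²` limits -/

lemma exists_isMollifier {ρ : Eucl n → ℝ} (hρ : ContDiff ℝ ∞ ρ) (hρc : HasCompactSupport ρ)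
    (h0 : ∀ t, 0 ≤ ρ t) (h1 : ∫ t, ρ t = 1) {δ : ℝ} (hδ : ∀ t, δ ≤ ‖t‖ → ρ t = 0) :
    ∃ L, IsMollifier ρ L δ := by
  obtain ⟨A, hA⟩ := hρc.exists_bound_of_continuous hρ.continuous
  obtain ⟨B, hB⟩ := ContDiff.lipschitzWith_of_hasCompactSupport hρc hρ (by simp)
  obtain ⟨D, hD⟩ := ContDiff.lipschitzWith_of_hasCompactSupport (hρc.fderiv ℝ)
    (hρ.fderiv_right (m := ∞) (by rfl)) (by simp)
  have hA0 : 0 ≤ A := (norm_nonneg _).trans (hA 0)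
  have hB0 : (0 : ℝ) ≤ B := B.2
  have hD0 : (0 : ℝ) ≤ D := D.2
  have hle : ∀ x, |ρ x| ≤ A := hA
  have hlip : ∀ x y, |ρ x - ρ y| ≤ B * ‖x - y‖ := fun x y => by
    have := hB.dist_le_mul x y
    rwa [Real.dist_eq, dist_eq_norm] at this
  have hsub : ∀ x y t, |ρ (x + t) - ρ x - (ρ (y + t) - ρ y)| ≤ D * ‖t‖ * ‖x - y‖ := by
    intro x y t
    have hd : ∀ z, HasFDerivAt (fun z => ρ (z + t) - ρ z) (fderiv ℝ ρ (z + t) - fderiv ℝ ρ z) z := fun z =>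
      ((hasFDerivAt_comp_add_right t).2 (hρ.differentiable (by simp) (z + t)).hasFDerivAt).sub
        (hρ.differentiable (by simp) z).hasFDerivAt
    have := Convex.norm_image_sub_le_of_norm_hasFDerivWithin_le (C := D * ‖t‖)
      (fun z _ => (hd z).hasFDerivWithinAt (s := univ)) (fun z _ => by
        have := hD.dist_le_mul (z + t) z
        rwa [dist_eq_norm, dist_eq_norm, add_sub_cancel_left] at this) convex_univ (mem_univ y) (mem_univ x)
    rwa [Real.norm_eq_abs] at this
  -- The second difference is at most `4A` by size, `2B` times one increment by the Lipschitz bound,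
  -- and `D` times the product of both increments by the Lipschitz bound of the derivative. Which
  -- one is used depends on the increments that exceed one.
  refine ⟨4 * A + 2 * B + D, hρ.continuous.measurable, h0,
    fun t => (le_abs_self _).trans ((hle t).trans (by linarith)), fun x y => ?_, fun x y t => ?_, hδ,
    hρ.continuous.integrable_of_hasCompactSupport hρc, h1⟩
  · rcases le_total 1 ‖x - y‖ with h | h
    · rw [min_eq_left h]
      have := abs_sub (ρ x) (ρ y)
      linarith [hle x, hle y]
    · rw [min_eq_right h]
      refine (hlip x y).trans ?_
      gcongr; linarith
  · rcases le_total 1 ‖x - y‖ with h | h <;> rcases le_total 1 ‖t‖ with h' | h'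
    · rw [min_eq_left h, min_eq_left h']
      have k1 := abs_sub (ρ (x + t) - ρ x) (ρ (y + t) - ρ y)
      have k2 := abs_sub (ρ (x + t)) (ρ x)
      have k3 := abs_sub (ρ (y + t)) (ρ y)
      linarith [hle (x + t), hle x, hle (y + t), hle y]
    · rw [min_eq_left h, min_eq_right h']
      have k1 := abs_sub (ρ (x + t) - ρ x) (ρ (y + t) - ρ y)
      have k2 := hlip (x + t) x
      have k3 := hlip (y + t) y
      rw [add_sub_cancel_left] at k2 k3
      have : 0 ≤ (4 * A + D) * ‖t‖ := by positivity
      nlinarith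
    · rw [min_eq_right h, min_eq_left h']
      have k1 := abs_sub (ρ (x + t) - ρ (y + t)) (ρ x - ρ y)
      have k2 := hlip (x + t) (y + t)
      have k3 := hlip x y
      rw [add_sub_add_right_eq_sub] at k2
      have : 0 ≤ (4 * A + D) * ‖x - y‖ := by positivity
      rw [show ρ (x + t) - ρ x - (ρ (y + t) - ρ y) = ρ (x + t) - ρ (y + t) - (ρ x - ρ y) by ring]
      nlinarith
    · rw [min_eq_right h, min_eq_right h']
      have k1 := hsub x y t
      have : 0 ≤ (4 * A + 2 * B) * (‖x - y‖ * ‖t‖) := by positivity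
      nlinarith

/-- A sequence of mollifiers along which convolutions converge almost everywhere. -/
lemma exists_isMollifier_seq (n : ℕ) {δ₀ : ℝ} (hδ₀ : 0 < δ₀) :
    ∃ (ρ : ℕ → Eucl n → ℝ) (L δ : ℕ → ℝ), (∀ k, IsMollifier (ρ k) (L k) (δ k)) ∧ (∀ k, δ k ≤ δ₀) ∧
      Tendsto δ atTop (𝓝 0) ∧ ∀ h : Eucl n → ℝ, LocallyIntegrable h →
        ∀ᵐ x, Tendsto (fun k => conv (ρ k) h x) atTop (𝓝 (h x)) := by
  have hpos : ∀ k : ℕ, 0 < δ₀ / ((k : ℝ) + 1) := fun k => by positivity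
  set φ : ℕ → ContDiffBump (0 : Eucl n) := fun k =>
    ⟨δ₀ / ((k : ℝ) + 1) / 2, δ₀ / ((k : ℝ) + 1), half_pos (hpos k), half_lt_self (hpos k)⟩ with hφ
  have hm : ∀ k, ∃ L, IsMollifier ((φ k).normed volume) L (δ₀ / ((k : ℝ) + 1)) := fun k => by
    refine exists_isMollifier (φ k).contDiff_normed ((φ k).hasCompactSupport_normed)
      (fun t => (φ k).nonneg_normed t) ((φ k).integral_normed) fun t ht => ?_
    have h1 : t ∉ Function.support ((φ k).normed volume) := by
      rw [(φ k).support_normed_eq, mem_ball_zero_iff, not_lt]; exact ht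
    simpa using h1
  choose L hL using hm
  have hlim : Tendsto (fun k : ℕ => δ₀ / ((k : ℝ) + 1)) atTop (𝓝 0) :=
    tendsto_const_nhds.div_atTop (tendsto_atTop_add_const_right _ _ tendsto_natCast_atTop_atTop)
  refine ⟨fun k => (φ k).normed volume, L, fun k => δ₀ / ((k : ℝ) + 1), hL, fun k => ?_, hlim, fun h hh => ?_⟩
  · refine div_le_self hδ₀.le ?_
    have : (0 : ℝ) ≤ k := k.cast_nonneg
    linarith
  -- `K = 2` is the ratio of outer to inner radius of the bumps; its boundedness is what Lebesgue
  -- differentiation needs.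
  · exact ContDiffBump.ae_convolution_tendsto_right_of_locallyIntegrable (φ := φ) (K := 2) hlim
      (Eventually.of_forall fun k => by simp only [hφ]; linarith) hh

lemma tendsto_integral_inner_of_L2 {α E : Type*} [MeasurableSpace α] [NormedAddCommGroup E]
    [InnerProductSpace ℝ E] {μ : Measure α} {f g : ℕ → α → E} {f' g' : α → E}
    (hf : ∀ k, MemLp (f k) 2 μ) (hg : ∀ k, MemLp (g k) 2 μ) (hf' : MemLp f' 2 μ) (hg' : MemLp g' 2 μ)
    (h1 : Tendsto (fun k => ∫⁻ a, ‖f k a - f' a‖ₑ ^ 2 ∂μ) atTop (𝓝 0))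
    (h2 : Tendsto (fun k => ∫⁻ a, ‖g k a - g' a‖ₑ ^ 2 ∂μ) atTop (𝓝 0)) :
    Tendsto (fun k => ∫ a, inner ℝ (f k a) (g k a) ∂μ) atTop (𝓝 (∫ a, inner ℝ (f' a) (g' a) ∂μ)) := by
  have key : ∀ {f : ℕ → α → E} {f' : α → E} (hf : ∀ k, MemLp (f k) 2 μ) (hf' : MemLp f' 2 μ),
      Tendsto (fun k => ∫⁻ a, ‖f k a - f' a‖ₑ ^ 2 ∂μ) atTop (𝓝 0) →
      Tendsto (fun k => (hf k).toLp (f k)) atTop (𝓝 (hf'.toLp f')) := by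
    intro f f' hf hf' h
    rw [Lp.tendsto_Lp_iff_tendsto_eLpNorm'']
    have h3 := (ENNReal.continuous_rpow_const (y := 1 / 2)).tendsto 0 |>.comp h
    simp only [Function.comp_def] at h3
    rw [ENNReal.zero_rpow_of_pos (by norm_num)] at h3
    refine h3.congr fun k => ?_
    rw [eLpNorm_eq_lintegral_rpow_enorm_toReal (by norm_num) (by norm_num)]
    simp
  have h4 := (key hf hf' h1).inner (𝕜 := ℝ) (key hg hg' h2)
  have h5 : ∀ {f g : α → E} (hf : MemLp f 2 μ) (hg : MemLp g 2 μ),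
      inner ℝ (hf.toLp f) (hg.toLp g) = ∫ a, inner ℝ (f a) (g a) ∂μ := by
    intro f g hf hg
    rw [L2.inner_def]
    refine integral_congr_ae ?_
    filter_upwards [hf.coeFn_toLp, hg.coeFn_toLp] with a h6 h7
    rw [h6, h7]
  simp_rw [h5] at h4
  exact h4

/-! ### The energy cost of adding a trace to `u` -/

lemma eq_zero_of_notMem_crossSet {B : Set (Eucl n)} {w : Eucl n → ℝ} (hwB : ∀ x, x ∉ B → w x = 0)
    {q : Eucl n × Eucl n} (hq : q ∉ crossSet B) : w q.1 = 0 ∧ w q.2 = 0 := by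
  have h1 : q.1 ∉ B ∧ q.2 ∉ B := by
    by_contra h
    apply hq
    simp only [crossSet, mem_union, mem_prod, mem_compl_iff]
    tauto
  exact ⟨hwB _ h1.1, hwB _ h1.2⟩

lemma gagliardo_eq_ofReal {s : ℝ} {Q : Set (Eucl n × Eucl n)} {u : Eucl n → ℝ} (hum : Measurable u)
    (hfin : gagliardo s Q u < ⊤) :
    gagliardo s Q u = ENNReal.ofReal (∫ q in Q, |u q.1 - u q.2| ^ 2 / ‖q.1 - q.2‖ ^ ((n : ℝ) + 2 * s)) :=
  (ofReal_integral_eq_lintegral_ofReal (integrableOn_gagliardo hum hfin)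
    (Eventually.of_forall fun q => by positivity)).symm

/-- Polarization. The bilinear forms may be taken over the whole space because differences of `w`
vanish off `crossSet B`. Nonnegativity is recorded separately, since `ENNReal.ofReal` would hide a
negative value. -/
lemma gagliardo_add {s : ℝ} {B : Set (Eucl n)} {u w : Eucl n → ℝ} (hum : Measurable u)
    (hwm : Measurable w) (hu : gagliardo s (crossSet B) u < ⊤) (hw : gagliardo s (crossSet B) w < ⊤)
    (hwB : ∀ x, x ∉ B → w x = 0) :
    gagliardo s (crossSet B) (fun x => u x + w x) =
      ENNReal.ofReal ((gagliardo s (crossSet B) u).toReal + 2 * gagForm s u w + gagForm s w w) ∧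
    0 ≤ (gagliardo s (crossSet B) u).toReal + 2 * gagForm s u w + gagForm s w w := by
  set Q := crossSet B
  have i1 := integrableOn_gagliardo hum hu
  have i2 := integrableOn_gagliardo hwm hw
  have i3 : IntegrableOn (fun q : Eucl n × Eucl n => (u q.1 - u q.2) * (w q.1 - w q.2) /
      ‖q.1 - q.2‖ ^ ((n : ℝ) + 2 * s)) Q := by
    refine Integrable.mono' (Integrable.add i1 i2) (Measurable.aestronglyMeasurable (by fun_prop))
      (Eventually.of_forall fun q => ?_)
    rw [Pi.add_apply, ← add_div, norm_div, Real.norm_of_nonneg (r := _ ^ _) (Real.rpow_nonneg (norm_nonneg _) _), norm_mul,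
      Real.norm_eq_abs, Real.norm_eq_abs]
    gcongr
    nlinarith [sq_nonneg (|u q.1 - u q.2| - |w q.1 - w q.2|), sq_nonneg (|u q.1 - u q.2|),
      sq_nonneg (|w q.1 - w q.2|)]
  have e2 : gagForm s w w = ∫ q in Q, |w q.1 - w q.2| ^ 2 / ‖q.1 - q.2‖ ^ ((n : ℝ) + 2 * s) := by
    unfold gagForm
    rw [setIntegral_eq_integral_of_forall_compl_eq_zero]
    · refine integral_congr_ae (Eventually.of_forall fun q => ?_)
      simp only
      rw [sq_abs, sq]
    · intro q hq
      obtain ⟨h1, h2⟩ := eq_zero_of_notMem_crossSet hwB hq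
      rw [h1, h2]; simp
  have e3 : gagForm s u w = ∫ q in Q, (u q.1 - u q.2) * (w q.1 - w q.2) / ‖q.1 - q.2‖ ^ ((n : ℝ) + 2 * s) := by
    unfold gagForm
    rw [setIntegral_eq_integral_of_forall_compl_eq_zero]
    intro q hq
    obtain ⟨h1, h2⟩ := eq_zero_of_notMem_crossSet hwB hq
    rw [h1, h2]; simp
  have e1 : (gagliardo s Q u).toReal = ∫ q in Q, |u q.1 - u q.2| ^ 2 / ‖q.1 - q.2‖ ^ ((n : ℝ) + 2 * s) := by
    rw [gagliardo_eq_ofReal hum hu, ENNReal.toReal_ofReal (integral_nonneg fun q => by positivity)]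
  have hid : ∀ q : Eucl n × Eucl n, |u q.1 + w q.1 - (u q.2 + w q.2)| ^ 2 / ‖q.1 - q.2‖ ^ ((n : ℝ) + 2 * s) =
      |u q.1 - u q.2| ^ 2 / ‖q.1 - q.2‖ ^ ((n : ℝ) + 2 * s) +
      2 * ((u q.1 - u q.2) * (w q.1 - w q.2) / ‖q.1 - q.2‖ ^ ((n : ℝ) + 2 * s)) +
      |w q.1 - w q.2| ^ 2 / ‖q.1 - q.2‖ ^ ((n : ℝ) + 2 * s) := fun q => by
    simp only [sq_abs]; ring
  have i5 : IntegrableOn (fun q : Eucl n × Eucl n => |u q.1 - u q.2| ^ 2 / ‖q.1 - q.2‖ ^ ((n : ℝ) + 2 * s) +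
      2 * ((u q.1 - u q.2) * (w q.1 - w q.2) / ‖q.1 - q.2‖ ^ ((n : ℝ) + 2 * s))) Q := i1.add (i3.const_mul 2)
  have i4 : IntegrableOn (fun q : Eucl n × Eucl n => |u q.1 + w q.1 - (u q.2 + w q.2)| ^ 2 /
      ‖q.1 - q.2‖ ^ ((n : ℝ) + 2 * s)) Q := by
    simp_rw [hid]
    exact i5.add i2
  rw [e1, e2, e3, ← integral_const_mul, ← integral_add i1 (i3.const_mul 2), ← integral_add i5 i2]
  simp_rw [← hid]
  exact ⟨(ofReal_integral_eq_lintegral_ofReal i4 (Eventually.of_forall fun q => by positivity)).symm,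
    integral_nonneg fun q => by positivity⟩

/-- A compactly supported function on `ℝⁿ⁺¹` with finite weighted energy, its gradient, and the
function `h` with trace `κ h`. -/
structure IsTracePair (s r' : ℝ) (K : Set (Eucl n × ℝ)) (φ : Eucl n × ℝ → ℝ)
    (G : Eucl n × ℝ → Eucl n × ℝ) (h : Eucl n → ℝ) : Prop where
  isCompact : IsCompact K
  measurable_fun : Measurable φ
  integrable_fun : Integrable φ
  fun_eq_zero : ∀ X ∉ K, φ X = 0
  measurable_grad : Measurable G
  integrable_grad : Integrable G
  grad_eq_zero : ∀ X ∉ K, G X = 0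
  memLp : MemLp (wgt s G) 2
  isFieldPair : IsFieldPair s φ G
  measurable_trace : Measurable h
  integrable_trace : Integrable h
  trace_eq_zero : ∀ x, r' < ‖x‖ → h x = 0
  slab_eq_zero : ∃ ε₀ : ℝ, 0 < ε₀ ∧ ∀ X : Eucl n × ℝ, |X.2| < ε₀ → r' < ‖X.1‖ → φ X = 0
  slice : ∀ X ∈ K, X.2 = 0 → ‖X.1‖ ≤ r'
  tendsto_trace : Tendsto (fun ε : ℝ => (∫⁻ z in Ioo (-ε) ε, ∫⁻ x, ‖φ (x, z) - kernelMass n s * h x‖ₑ) /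
      ENNReal.ofReal (2 * ε)) (𝓝[>] 0) (𝓝 0)

namespace IsTracePair

variable {s r' r : ℝ} {K : Set (Eucl n × ℝ)} {φ : Eucl n × ℝ → ℝ} {G : Eucl n × ℝ → Eucl n × ℝ} {h : Eucl n → ℝ}

lemma integral_inner_mollify (T : IsTracePair s r' K φ G h) (hn : 1 ≤ n) (hs : s ∈ Ioo (0 : ℝ) 1)
    {u : Eucl n → ℝ} (hum : Measurable u) (hu : Integrable fun y => u y * decay s y 1)
    (hfin : gagliardo s (crossSet (Metric.ball 0 r)) u < ⊤) {ρ : Eucl n → ℝ} {L δ : ℝ}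
    (hρ : IsMollifier ρ L δ) (hδ : δ < r - r') :
    normConst n s * ∫ X, inner ℝ (wgt s (extGrad s u) X) (wgt s (mollify ρ G) X) = gagForm s u (conv ρ h) := by
  obtain ⟨ε₀, hε₀, hslab⟩ := T.slab_eq_zero
  exact normConst_mul_integral_inner_mollify hn hs hum hu hfin T.measurable_fun T.integrable_fun
    T.measurable_grad T.integrable_grad T.isCompact T.fun_eq_zero T.grad_eq_zero T.memLp T.isFieldPair
    T.measurable_trace T.integrable_trace T.trace_eq_zero hε₀ hslab T.slice T.tendsto_trace hρ hδ

lemma integrable_wgt (T : IsTracePair s r' K φ G h) : Integrable (wgt s G) :=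
  integrable_of_memLp_of_compact T.memLp T.isCompact fun X hX => wgt_eq_zero (T.grad_eq_zero X hX)

lemma memLp_mollify (T : IsTracePair s r' K φ G h) {ρ : Eucl n → ℝ} {L δ : ℝ} (hρ : IsMollifier ρ L δ) :
    MemLp (wgt s (mollify ρ G)) 2 := by
  rw [show wgt s (mollify ρ G) = mollify ρ (wgt s G) from funext (wgt_mollify s ρ G)]
  exact FracFreeBdry.memLp_mollify hρ (measurable_wgt s T.measurable_grad) T.integrable_wgt T.memLp

/-- The extension minimizes the weighted energy for given trace. -/
lemma gagForm_conv_le (T : IsTracePair s r' K φ G h) (hn : 1 ≤ n) (hs : s ∈ Ioo (0 : ℝ) 1)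
    {ρ : Eucl n → ℝ} {L δ : ℝ} (hρ : IsMollifier ρ L δ) (hδ : δ < r - r') :
    gagForm s (conv ρ h) (conv ρ h) ≤
      normConst n s * ∫ X, inner ℝ (wgt s (mollify ρ G) X) (wgt s (mollify ρ G) X) := by
  have hw := hρ.isTestFun_conv hδ.le T.measurable_trace T.integrable_trace T.trace_eq_zero
  have h1 := T.integral_inner_mollify hn hs hw.measurable (hw.integrable_mul_decay hn hs.1)
    ((gagliardo_mono (subset_univ _) _).trans_lt (hw.gagliardo_lt_top hn hs)) hρ hδ
  have h2 := hw.normConst_mul_integral_norm_sq hn hs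
  have hV := hw.memLp_wgt_extGrad hn hs
  have hG := T.memLp_mollify hρ
  have hκ := kernelMass_pos (n := n) hs.1
  have hs0 := hs.1
  have hc : 0 < normConst n s := by unfold normConst; positivity
  -- `2ab ≤ a² + b²`, where `normConst` times the cross term and `normConst` times the energy of the
  -- extension both equal `gagForm` of the mollified trace with itself; one copy of it remains on
  -- the left.
  have h3 : 2 * ∫ X, inner ℝ (wgt s (extGrad s (conv ρ h)) X) (wgt s (mollify ρ G) X) ≤
      (∫ X, ‖wgt s (extGrad s (conv ρ h)) X‖ ^ 2) +
        ∫ X, inner ℝ (wgt s (mollify ρ G) X) (wgt s (mollify ρ G) X) := by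
    rw [← integral_const_mul, ← integral_add (hV.integrable_norm_pow (by norm_num)) (integrable_inner_of_memLp hG hG)]
    refine integral_mono ((integrable_inner_of_memLp hV hG).const_mul 2)
      ((hV.integrable_norm_pow (by norm_num)).add (integrable_inner_of_memLp hG hG)) fun X => ?_
    simp only
    rw [real_inner_self_eq_norm_sq]
    have h4 := real_inner_le_norm (wgt s (extGrad s (conv ρ h)) X) (wgt s (mollify ρ G) X)
    nlinarith [sq_nonneg (‖wgt s (extGrad s (conv ρ h)) X‖ - ‖wgt s (mollify ρ G) X‖)]
  have h5 := mul_le_mul_of_nonneg_left h3 hc.le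
  rw [mul_add, h2, mul_left_comm, h1] at h5
  linarith

lemma gagliardo_add_conv_le (T : IsTracePair s r' K φ G h) (hn : 1 ≤ n) (hs : s ∈ Ioo (0 : ℝ) 1)
    {u : Eucl n → ℝ} (hum : Measurable u) (hu : Integrable fun y => u y * decay s y 1)
    (hfin : gagliardo s (crossSet (Metric.ball 0 r)) u < ⊤) {ρ : Eucl n → ℝ} {L δ : ℝ}
    (hρ : IsMollifier ρ L δ) (hδ : δ < r - r') :
    gagliardo s (crossSet (Metric.ball 0 r)) (fun x => u x + conv ρ h x) ≤
      ENNReal.ofReal ((gagliardo s (crossSet (Metric.ball 0 r)) u).toReal + normConst n s *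
        (2 * (∫ X, inner ℝ (wgt s (extGrad s u) X) (wgt s (mollify ρ G) X)) +
          ∫ X, inner ℝ (wgt s (mollify ρ G) X) (wgt s (mollify ρ G) X))) ∧
    0 ≤ (gagliardo s (crossSet (Metric.ball 0 r)) u).toReal + normConst n s *
        (2 * (∫ X, inner ℝ (wgt s (extGrad s u) X) (wgt s (mollify ρ G) X)) +
          ∫ X, inner ℝ (wgt s (mollify ρ G) X) (wgt s (mollify ρ G) X)) := by
  have hw := hρ.isTestFun_conv hδ.le T.measurable_trace T.integrable_trace T.trace_eq_zero
  obtain ⟨e1, e2⟩ := gagliardo_add hum hw.measurable hfin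
    ((gagliardo_mono (subset_univ _) _).trans_lt (hw.gagliardo_lt_top hn hs))
    fun x hx => hw.eq_zero x (not_lt.1 fun h => hx (mem_ball_zero_iff.2 h))
  rw [e1]
  have h1 := T.integral_inner_mollify hn hs hum hu hfin hρ hδ
  have h2 := T.gagForm_conv_le hn hs hρ hδ
  rw [mul_add, mul_left_comm, h1]
  exact ⟨ENNReal.ofReal_le_ofReal (by linarith), by linarith⟩

/-- Adding the trace to `u` costs at most the energy of the corresponding perturbation of the
extension. -/
lemma gagliardo_add_le (T : IsTracePair s r' K φ G h) (hn : 1 ≤ n) (hs : s ∈ Ioo (0 : ℝ) 1)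
    {u : Eucl n → ℝ} (hum : Measurable u) (hu : Integrable fun y => u y * decay s y 1)
    (hfin : gagliardo s (crossSet (Metric.ball 0 r)) u < ⊤) (hr : r' < r) :
    gagliardo s (crossSet (Metric.ball 0 r)) (fun x => u x + h x) ≤
      ENNReal.ofReal ((gagliardo s (crossSet (Metric.ball 0 r)) u).toReal + normConst n s *
        (2 * (∫ X, inner ℝ (wgt s (extGrad s u) X) (wgt s G X)) + ∫ X, ‖wgt s G X‖ ^ 2)) ∧
    0 ≤ (gagliardo s (crossSet (Metric.ball 0 r)) u).toReal + normConst n s *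
        (2 * (∫ X, inner ℝ (wgt s (extGrad s u) X) (wgt s G X)) + ∫ X, ‖wgt s G X‖ ^ 2) := by
  set Q := crossSet (Metric.ball (0 : Eucl n) r)
  set δ₀ : ℝ := (r - r') / 2 with hδ₀
  have hδ₀0 : 0 < δ₀ := by rw [hδ₀]; linarith
  obtain ⟨ρ, L, δ, hρ, hδle, hδlim, hconv⟩ := exists_isMollifier_seq n hδ₀0
  have hδ : ∀ k, δ k < r - r' := fun k => (hδle k).trans_lt (by rw [hδ₀]; linarith)
  have hle := fun k => T.gagliardo_add_conv_le hn hs hum hu hfin (hρ k) (hδ k)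
  -- convergence of the energies
  have hL2 : Tendsto (fun k => ∫⁻ X, ‖wgt s (mollify (ρ k) G) X - wgt s G X‖ₑ ^ 2) atTop (𝓝 0) := by
    rw [ENNReal.tendsto_nhds_zero]
    intro η hη
    obtain ⟨d, hd, hdle⟩ := exists_lintegral_enorm_mollify_sub_sq_le (measurable_wgt s T.measurable_grad)
      T.integrable_wgt T.memLp hη
    filter_upwards [hδlim.eventually_le_const hd] with k hk
    simp_rw [wgt_mollify]
    exact hdle (ρ k) (L k) (δ k) (hρ k) hk
  have hGk := fun k => T.memLp_mollify (hρ k)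
  have t1 := tendsto_integral_inner_of_L2 hGk hGk T.memLp T.memLp hL2 hL2
  -- The extension of `u` is only known to have finite energy near compact sets that meet `{z = 0}`
  -- over the open ball. `K'` is such a set, because `r' + δ₀ < r`, and it contains the supports of
  -- all the mollified gradients.
  set K' := hthicken δ₀ K with hK'
  have hK'c : IsCompact K' := isCompact_hthicken T.isCompact
  have hVK : MemLp (wgt s (extGrad s u)) 2 (volume.restrict K') := by
    refine memLp_wgt_extGrad hs.1 hum hu Metric.isOpen_ball hfin hK'c ?_
    rintro X ⟨⟨Y, t⟩, ⟨hY, ht⟩, rfl⟩ hX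
    have h1 := T.slice Y hY hX
    have h2 := mem_closedBall_zero_iff.1 ht
    have h3 := norm_add_le Y.1 t
    rw [mem_ball_zero_iff]
    simp only at h1 h2 h3 ⊢
    rw [hδ₀] at h2
    linarith
  have hz1 : ∀ k, ∀ X ∉ K', wgt s (mollify (ρ k) G) X = 0 := fun k X hX => by
    refine wgt_eq_zero (mollify_eq_zero (hρ k) T.grad_eq_zero X fun h => hX ?_)
    obtain ⟨⟨Y, t⟩, ⟨hY, ht⟩, rfl⟩ := h
    exact ⟨(Y, t), ⟨hY, Metric.closedBall_subset_closedBall (hδle k) ht⟩, rfl⟩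
  have hz2 : ∀ X ∉ K', wgt s G X = 0 := fun X hX => by
    refine wgt_eq_zero (T.grad_eq_zero X fun h => hX ⟨(X, 0), ⟨h, ?_⟩, by simp⟩)
    simp [hδ₀0.le]
  have hin : ∀ g : Eucl n × ℝ → EuclProd n, (∀ X ∉ K', g X = 0) →
      ∫ X in K', inner ℝ (wgt s (extGrad s u) X) (g X) = ∫ X, inner ℝ (wgt s (extGrad s u) X) (g X) :=
    fun g hg => setIntegral_eq_integral_of_forall_compl_eq_zero fun X hX => by rw [hg X hX, inner_zero_right]
  have t2 := tendsto_integral_inner_of_L2 (fun _ => hVK) (fun k => (hGk k).restrict K') hVK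
    (T.memLp.restrict K') (by simp) (tendsto_of_tendsto_of_tendsto_of_le_of_le tendsto_const_nhds hL2
      (fun _ => zero_le) fun k => setLIntegral_le_lintegral _ _)
  rw [hin _ hz2] at t2
  simp_rw [fun k => hin _ (hz1 k)] at t2
  have t3 : Tendsto (fun k => (gagliardo s Q u).toReal + normConst n s *
      (2 * (∫ X, inner ℝ (wgt s (extGrad s u) X) (wgt s (mollify (ρ k) G) X)) +
        ∫ X, inner ℝ (wgt s (mollify (ρ k) G) X) (wgt s (mollify (ρ k) G) X))) atTop
      (𝓝 ((gagliardo s Q u).toReal + normConst n s *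
        (2 * (∫ X, inner ℝ (wgt s (extGrad s u) X) (wgt s G X)) + ∫ X, ‖wgt s G X‖ ^ 2))) := by
    have e : ∫ X, ‖wgt s G X‖ ^ 2 = ∫ X, inner ℝ (wgt s G X) (wgt s G X) :=
      integral_congr_ae (Eventually.of_forall fun X => (real_inner_self_eq_norm_sq _).symm)
    rw [e]
    exact (((t2.const_mul 2).add t1).const_mul _).const_add _
  refine ⟨?_, ge_of_tendsto' t3 fun k => (hle k).2⟩
  -- lower semicontinuity
  have hae := hconv h T.integrable_trace.locallyIntegrable
  have hae2 : ∀ᵐ q : Eucl n × Eucl n, Tendsto (fun k => conv (ρ k) h q.1) atTop (𝓝 (h q.1)) ∧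
      Tendsto (fun k => conv (ρ k) h q.2) atTop (𝓝 (h q.2)) := by
    rw [Measure.volume_eq_prod]
    filter_upwards [Measure.quasiMeasurePreserving_fst.ae hae, Measure.quasiMeasurePreserving_snd.ae hae]
      with q h1 h2 using ⟨h1, h2⟩
  have hwm : ∀ k, Measurable (conv (ρ k) h) := fun k => measurable_conv (hρ k).measurable T.measurable_trace
  calc gagliardo s Q (fun x => u x + h x)
      = ∫⁻ q in Q, liminf (fun k => ENNReal.ofReal (|u q.1 + conv (ρ k) h q.1 - (u q.2 + conv (ρ k) h q.2)| ^ 2 /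
          ‖q.1 - q.2‖ ^ ((n : ℝ) + 2 * s))) atTop := by
        refine lintegral_congr_ae (ae_restrict_of_ae ?_)
        filter_upwards [hae2] with q hq
        refine (Tendsto.liminf_eq ?_).symm
        exact ENNReal.tendsto_ofReal (((((hq.1.const_add _).sub (hq.2.const_add _)).abs).pow 2).div_const _)
    _ ≤ liminf (fun k => gagliardo s Q (fun x => u x + conv (ρ k) h x)) atTop := by
        refine lintegral_liminf_le fun k => ?_
        have := hwm k
        fun_prop
    _ ≤ liminf (fun k => ENNReal.ofReal ((gagliardo s Q u).toReal + normConst n s *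
      (2 * (∫ X, inner ℝ (wgt s (extGrad s u) X) (wgt s (mollify (ρ k) G) X)) +
        ∫ X, inner ℝ (wgt s (mollify (ρ k) G) X) (wgt s (mollify (ρ k) G) X)))) atTop :=
        liminf_le_liminf (Eventually.of_forall fun k => (hle k).1)
    _ = _ := (ENNReal.tendsto_ofReal t3).liminf_eq

end IsTracePair

/-! ### From a competitor to a trace pair -/

lemma gagliardo_congr_ae {s : ℝ} {Q : Set (Eucl n × Eucl n)} {u w : Eucl n → ℝ} (h : u =ᵐ[volume] w) :
    gagliardo s Q u = gagliardo s Q w := by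
  refine lintegral_congr_ae (ae_restrict_of_ae ?_)
  rw [Measure.volume_eq_prod]
  filter_upwards [Measure.quasiMeasurePreserving_fst.ae h, Measure.quasiMeasurePreserving_snd.ae h]
    with q h1 h2
  rw [h1, h2]

lemma extend_congr_ae {s : ℝ} {u w : Eucl n → ℝ} (h : u =ᵐ[volume] w) : extend s u = extend s w := by
  funext X
  refine integral_congr_ae ?_
  filter_upwards [h] with y hy
  rw [hy]

lemma IsTrace.congr_ae {v : Eucl n × ℝ → ℝ} {g g' : Eucl n → ℝ} (hg : IsTrace v g)
    (h : g =ᵐ[volume] g') : IsTrace v g' := by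
  refine ⟨(locallyIntegrable_congr h).1 hg.1, fun R hR => ?_⟩
  have h1 : ∀ᵐ X : Eucl n × ℝ, g X.1 = g' X.1 := by
    rw [Measure.volume_eq_prod]
    exact Measure.quasiMeasurePreserving_fst.ae h
  refine (hg.2 R hR).congr fun ε => ?_
  congr 1
  refine lintegral_congr_ae (ae_restrict_of_ae ?_)
  filter_upwards [h1] with X hX
  rw [hX]

/-- Pairing with a fixed vector of `ℝⁿ × ℝ`. -/
def pairing (e : Eucl n × ℝ) : Eucl n × ℝ →L[ℝ] ℝ :=
  (innerSL ℝ e.1).comp (ContinuousLinearMap.fst ℝ (Eucl n) ℝ) + e.2 • ContinuousLinearMap.snd ℝ (Eucl n) ℝ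

lemma pairing_apply (e Y : Eucl n × ℝ) : pairing e Y = inner ℝ Y.1 e.1 + Y.2 * e.2 := by
  simp [pairing, real_inner_comm, mul_comm]

lemma LocallyIntegrableOn.clm_comp {X E F : Type*} [TopologicalSpace X] [MeasurableSpace X]
    [NormedAddCommGroup E] [NormedSpace ℝ E] [NormedAddCommGroup F] [NormedSpace ℝ F] {μ : Measure X}
    {U : Set X} {f : X → E} (L : E →L[ℝ] F) (hf : LocallyIntegrableOn f U μ) :
    LocallyIntegrableOn (fun x => L (f x)) U μ := fun x hx => by
  obtain ⟨t, ht, hi⟩ := hf x hx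
  exact ⟨t, ht, L.integrable_comp hi⟩

namespace HasWeakGradOn

variable {U : Set (Eucl n × ℝ)} {w w' : Eucl n × ℝ → ℝ} {G G' : Eucl n × ℝ → Eucl n × ℝ}

lemma integrable_mul_fderiv (h : HasWeakGradOn U w G) {η : Eucl n × ℝ → ℝ} (hη : ContDiff ℝ ∞ η)
    (hηc : HasCompactSupport η) (hηU : tsupport η ⊆ U) (e : Eucl n × ℝ) :
    Integrable fun X => w X * fderiv ℝ η X e := by
  have h1 : tsupport (fun X => fderiv ℝ η X e) ⊆ tsupport η := tsupport_fderiv_apply_subset ℝ e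
  refine integrable_mul_of_integrableOn ((hη.continuous_fderiv (by simp)).clm_apply continuous_const)
    (hηc.of_isClosed_subset (isClosed_tsupport _) h1) ?_
  exact h.1.integrableOn_compact_subset (h1.trans hηU) (hηc.of_isClosed_subset (isClosed_tsupport _) h1)

lemma integrable_pairing_mul (h : HasWeakGradOn U w G) {η : Eucl n × ℝ → ℝ} (hη : ContDiff ℝ ∞ η)
    (hηc : HasCompactSupport η) (hηU : tsupport η ⊆ U) (e : Eucl n × ℝ) :
    Integrable fun X => (inner ℝ (G X).1 e.1 + (G X).2 * e.2) * η X := by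
  simp_rw [← pairing_apply]
  exact integrable_mul_of_integrableOn hη.continuous hηc
    ((LocallyIntegrableOn.clm_comp (pairing e) h.2.1).integrableOn_compact_subset hηU hηc)

lemma sub (h : HasWeakGradOn U w G) (h' : HasWeakGradOn U w' G') :
    HasWeakGradOn U (fun X => w X - w' X) (fun X => G X - G' X) := by
  refine ⟨h.1.sub h'.1, h.2.1.sub h'.2.1, fun η hη hηc hηU e => ?_⟩
  have e1 : ∀ X, (inner ℝ (G X - G' X).1 e.1 + (G X - G' X).2 * e.2) * η X =
      (inner ℝ (G X).1 e.1 + (G X).2 * e.2) * η X - (inner ℝ (G' X).1 e.1 + (G' X).2 * e.2) * η X := fun X => by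
    rw [Prod.fst_sub, Prod.snd_sub, inner_sub_left]; ring
  simp_rw [e1, sub_mul]
  rw [integral_sub (h.integrable_mul_fderiv hη hηc hηU e) (h'.integrable_mul_fderiv hη hηc hηU e),
    integral_sub (h.integrable_pairing_mul hη hηc hηU e) (h'.integrable_pairing_mul hη hηc hηU e),
    h.2.2 η hη hηc hηU e, h'.2.2 η hη hηc hηU e]
  ring

lemma congr_ae (h : HasWeakGradOn U w G) (hU : IsOpen U) (hw : ∀ᵐ X, X ∈ U → w X = w' X)
    (hG : ∀ᵐ X, X ∈ U → G X = G' X) : HasWeakGradOn U w' G' := by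
  have hw' := (ae_restrict_iff' hU.measurableSet).2 hw
  have hG' := (ae_restrict_iff' hU.measurableSet).2 hG
  have key : ∀ {E : Type} [NormedAddCommGroup E] {f f' : Eucl n × ℝ → E}, LocallyIntegrableOn f U →
      (∀ᵐ X, X ∈ U → f X = f' X) → LocallyIntegrableOn f' U := by
    intro E _ f f' hf hff' X hX
    obtain ⟨t, ht, hi⟩ := hf X hX
    refine ⟨t ∩ U, inter_mem ht self_mem_nhdsWithin, ?_⟩
    refine (hi.mono_set inter_subset_left).congr ?_
    exact ae_mono (Measure.restrict_mono inter_subset_right le_rfl) ((ae_restrict_iff' hU.measurableSet).2 hff')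
  refine ⟨key h.1 hw, key h.2.1 hG, fun η hη hηc hηU e => ?_⟩
  have h1 : ∫ X, w' X * fderiv ℝ η X e = ∫ X, w X * fderiv ℝ η X e := by
    refine integral_congr_ae ?_
    filter_upwards [hw] with X hX
    by_cases hXU : X ∈ U
    · rw [hX hXU]
    · have h2 : X ∉ tsupport η := fun h => hXU (hηU h)
      rw [fderiv_of_notMem_tsupport ℝ h2]; simp
  rw [h1, h.2.2 η hη hηc hηU e]
  congr 1
  refine integral_congr_ae ?_
  filter_upwards [hG] with X hX
  by_cases hXU : X ∈ U
  · rw [hX hXU]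
  · rw [image_eq_zero_of_notMem_tsupport fun h => hXU (hηU h)]; simp

/-- The weak gradient vanishes where the function does. -/
lemma ae_eq_zero (h : HasWeakGradOn U w G) {V : Set (Eucl n × ℝ)} (hV : IsOpen V) (hVU : V ⊆ U)
    (hw : ∀ᵐ X, X ∈ V → w X = 0) : ∀ᵐ X, X ∈ V → G X = 0 := by
  have key : ∀ e : Eucl n × ℝ, ∀ᵐ X, X ∈ V → pairing e (G X) = 0 := by
    intro e
    refine hV.ae_eq_zero_of_integral_contDiff_smul_eq_zero
      (LocallyIntegrableOn.clm_comp (pairing e) (h.2.1.mono_set hVU)) fun η hη hηc hηV => ?_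
    have h1 := h.2.2 η hη hηc (hηV.trans hVU) e
    have h2 : ∫ X, w X * fderiv ℝ η X e = 0 := by
      refine integral_eq_zero_of_ae ?_
      filter_upwards [hw] with X hX
      by_cases hXV : X ∈ V
      · rw [hX hXV]; simp
      · have h3 : X ∉ tsupport η := fun h => hXV (hηV h)
        rw [fderiv_of_notMem_tsupport ℝ h3]; simp
    rw [h2] at h1
    simp_rw [smul_eq_mul, pairing_apply, mul_comm (η _)]
    linarith
  have h1 : ∀ᵐ X, ∀ i : Fin n, X ∈ V → pairing (EuclideanSpace.basisFun (Fin n) ℝ i, 0) (G X) = 0 :=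
    ae_all_iff.2 fun i => key _
  filter_upwards [h1, key (0, 1)] with X hX hX' hXV
  refine Prod.ext ?_ ?_
  · ext i
    have h1 := hX i hXV
    simpa [pairing_apply, EuclideanSpace.inner_single_right] using h1
  · simpa [pairing_apply] using hX' hXV

end HasWeakGradOn

/-- Compactness leaves a gap `r - r'` between the slice of `K` and the sphere of radius `r`, even
for thin slabs. The gap leaves room for the mollifiers. -/
lemma exists_radius_lt {K : Set (Eucl n × ℝ)} (hK : IsCompact K) {r : ℝ}
    (h : ∀ X ∈ K, X.2 = 0 → ‖X.1‖ < r) :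
    ∃ r' < r, ∃ ε : ℝ, 0 < ε ∧ ∀ X ∈ K, |X.2| < ε → ‖X.1‖ ≤ r' := by
  have hK0 : IsCompact (K ∩ {X | X.2 = 0}) := hK.inter_right (isClosed_eq continuous_snd continuous_const)
  obtain ⟨r₁, hr₁, h₁⟩ : ∃ r₁ < r, ∀ X ∈ K, X.2 = 0 → ‖X.1‖ ≤ r₁ := by
    rcases (K ∩ {X | X.2 = 0}).eq_empty_or_nonempty with he | he
    -- When `K` misses `{z = 0}`, any radius below `r` will do.
    · exact ⟨r - 1, by linarith, fun X hX hX0 => absurd (he ▸ (⟨hX, hX0⟩ : X ∈ K ∩ {X | X.2 = 0})) (notMem_empty X)⟩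
    · obtain ⟨Y, hY, hmax⟩ := hK0.exists_isMaxOn he (f := fun X => ‖X.1‖) (by fun_prop)
      exact ⟨‖Y.1‖, h Y hY.1 hY.2, fun X hX hX0 => hmax ⟨hX, hX0⟩⟩
  have hK1 : IsCompact (K ∩ {X | (r₁ + r) / 2 ≤ ‖X.1‖}) :=
    hK.inter_right (isClosed_le continuous_const (by fun_prop))
  obtain ⟨ε, hε, hle⟩ := exists_le_abs_snd hK1 fun X hX hX0 => by
    have := h₁ X hX.1 hX0
    have h2 : (r₁ + r) / 2 ≤ ‖X.1‖ := hX.2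
    linarith
  refine ⟨(r₁ + r) / 2, by linarith, ε, hε, fun X hX hXε => ?_⟩
  by_contra hcon
  exact absurd (hle X ⟨hX, (not_le.1 hcon).le⟩) (not_le.2 hXε)

lemma setLIntegral_prod_eq {B : Set (Eucl n)} {I : Set ℝ} {f : Eucl n × ℝ → ℝ≥0∞} (hf : Measurable f) :
    ∫⁻ X in B ×ˢ I, f X = ∫⁻ z in I, ∫⁻ x in B, f (x, z) := by
  rw [Measure.volume_eq_prod, ← Measure.prod_restrict, lintegral_prod_symm _ hf.aemeasurable]

/-- Averages over thin slabs of the distance between `v - extend s u` and the difference of the traces. -/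
lemma tendsto_slab_sub {s : ℝ} (hs : 0 < s) {u : Eucl n → ℝ} (hum : Measurable u)
    (hu : Integrable fun y => u y * decay s y 1) {v φ : Eucl n × ℝ → ℝ} {g : Eucl n → ℝ} (hg : IsTrace v g)
    (hφ : ∀ᵐ X, φ X = v X - extend s u X) {R : ℝ} (hR : 0 < R) :
    Tendsto (fun ε : ℝ => (∫⁻ X in Metric.ball (0 : Eucl n) R ×ˢ Ioo (-ε) ε,
      ‖φ X - (g X.1 - kernelMass n s * u X.1)‖ₑ) / ENNReal.ofReal (2 * ε)) (𝓝[>] 0) (𝓝 0) := by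
  have hm : Measurable fun X : Eucl n × ℝ => ‖extend s u X - kernelMass n s * u X.1‖ₑ := by
    have := measurable_extend s hum
    fun_prop
  have h1 := tendsto_average_of_tendsto (tendsto_lintegral_extend_sub hs hum hu R)
  have h2 := (hg.2 R hR).add h1
  rw [add_zero] at h2
  refine tendsto_of_tendsto_of_tendsto_of_le_of_le tendsto_const_nhds h2 (fun _ => zero_le) fun ε => ?_
  simp only
  rw [← setLIntegral_prod_eq hm, ← ENNReal.add_div, ← lintegral_add_right _ hm]
  gcongr ?_ / _
  refine lintegral_mono_ae (ae_restrict_of_ae ?_)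
  filter_upwards [hφ] with X hX
  rw [hX]
  calc _ = ‖(v X - g X.1) - (extend s u X - kernelMass n s * u X.1)‖ₑ := by congr 1; ring
    _ ≤ _ := enorm_sub_le

lemma volume_prod_Ioo_div {A : Set (Eucl n)} {f : Eucl n → ℝ≥0∞} (hf : Measurable f) {ε : ℝ} (hε : 0 < ε) :
    (∫⁻ X in A ×ˢ Ioo (-ε) ε, f X.1) / ENNReal.ofReal (2 * ε) = ∫⁻ x in A, f x := by
  rw [setLIntegral_prod_eq (f := fun X : Eucl n × ℝ => f X.1) (by fun_prop)]
  simp only [lintegral_const, Measure.restrict_apply MeasurableSet.univ, univ_inter, Real.volume_Ioo]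
  rw [show ε - -ε = 2 * ε by ring]
  exact ENNReal.mul_div_cancel_right (by simpa using hε) ENNReal.ofReal_ne_top

/-- The difference between a competitor and the extension, its gradient and its trace. -/
lemma exists_isTracePair {s : ℝ} (hs : 0 < s) {u : Eucl n → ℝ} (hum : Measurable u)
    (hu : Integrable fun y => u y * decay s y 1) {r : ℝ} (hfin : gagliardo s (crossSet (Metric.ball 0 r)) u < ⊤)
    {U K : Set (Eucl n × ℝ)} (hU : IsOpen U) (hslice : ∀ X ∈ U, X.2 = 0 → X.1 ∈ Metric.ball (0 : Eucl n) r)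
    (hK : IsCompact K) (hKU : K ⊆ U) {v : Eucl n × ℝ → ℝ} (hv : ∀ᵐ X, X ∉ K → v X = extend s u X)
    {g : Eucl n → ℝ} (hgm : Measurable g) (hg : IsTrace v g) {Gv : Eucl n × ℝ → Eucl n × ℝ}
    (hGv : HasWeakGradOn U v Gv) (hE : ∫⁻ X in U, ‖wgt s Gv X‖ₑ ^ 2 < ⊤) :
    ∃ r' < r, ∃ φ G h, IsTracePair s r' K φ G h ∧ (∀ᵐ x, kernelMass n s * (u x + h x) = g x) ∧
      ∀ᵐ X, X ∈ U → Gv X = extGrad s u X + G X := by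
  have hκ := kernelMass_pos (n := n) hs
  have hKm := hK.measurableSet
  have hext := hasWeakGradOn_extend hs hum hu Metric.isOpen_ball hfin hU hslice
  have hdiff := hGv.sub hext
  obtain ⟨r', hr', ε₀, hε₀, hslab⟩ := exists_radius_lt hK (r := r) fun X hX hX0 =>
    mem_ball_zero_iff.1 (hslice X (hKU hX) hX0)
  -- the function
  have hφi := hdiff.1.integrableOn_compact_subset hKU hK
  set φ : Eucl n × ℝ → ℝ := K.indicator (hφi.1.mk _) with hφ
  have hφm : Measurable φ := hφi.1.stronglyMeasurable_mk.measurable.indicator hKm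
  have hφK : ∀ X ∉ K, φ X = 0 := fun X hX => indicator_of_notMem hX _
  have hφae : ∀ᵐ X, φ X = v X - extend s u X := by
    filter_upwards [(ae_restrict_iff' hKm).1 hφi.1.ae_eq_mk, hv] with X h1 h2
    by_cases hX : X ∈ K
    · rw [hφ, indicator_of_mem hX, ← h1 hX]
    · rw [hφK X hX, h2 hX, sub_self]
  have hφint : Integrable φ := by
    rw [hφ, integrable_indicator_iff hKm]
    exact hφi.congr hφi.1.ae_eq_mk
  -- the gradient
  have hGi := hdiff.2.1.integrableOn_compact_subset hKU hK
  set G : Eucl n × ℝ → Eucl n × ℝ := K.indicator (hGi.1.mk _) with hG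
  have hGm : Measurable G := hGi.1.stronglyMeasurable_mk.measurable.indicator hKm
  have hGK : ∀ X ∉ K, G X = 0 := fun X hX => indicator_of_notMem hX _
  -- Off `K` the competitor agrees with the extension, so the two weak gradients agree there and
  -- restricting the difference of gradients to `K` loses nothing.
  have hG0 := hdiff.ae_eq_zero (hU.sdiff hK.isClosed) sdiff_subset (by
    filter_upwards [hv] with X hX hXU
    rw [hX hXU.2, sub_self])
  have hGae : ∀ᵐ X, X ∈ U → G X = Gv X - extGrad s u X := by
    filter_upwards [(ae_restrict_iff' hKm).1 hGi.1.ae_eq_mk, hG0] with X h1 h2 hXU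
    by_cases hX : X ∈ K
    · rw [hG, indicator_of_mem hX, ← h1 hX]
    · rw [hGK X hX, h2 ⟨hXU, hX⟩]
  have hGint : Integrable G := by
    rw [hG, integrable_indicator_iff hKm]
    exact hGi.congr hGi.1.ae_eq_mk
  have hwk : HasWeakGradOn U φ G := hdiff.congr_ae hU
    (by filter_upwards [hφae] with X hX _ using hX.symm)
    (by filter_upwards [hGae] with X hX hXU using (hX hXU).symm)
  have hGv2 : MemLp (wgt s Gv) 2 (volume.restrict K) := by
    refine memLp_two_iff.2 ⟨aestronglyMeasurable_wgt s (hGv.2.1.integrableOn_compact_subset hKU hK).1, ?_⟩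
    exact (lintegral_mono_set hKU).trans_lt hE
  have hext2 : MemLp (wgt s (extGrad s u)) 2 (volume.restrict K) :=
    memLp_wgt_extGrad hs hum hu Metric.isOpen_ball hfin hK fun X hX hX0 => hslice X (hKU hX) hX0
  have hGL : MemLp (wgt s G) 2 := by
    have h1 : MemLp (wgt s G) 2 (volume.restrict K) := by
      refine (hGv2.sub hext2).ae_eq ?_
      refine (ae_restrict_iff' hKm).2 ?_
      filter_upwards [hGae] with X hX hXK
      have h2 := wgt_add s G (extGrad s u) X
      rw [Pi.sub_apply, sub_eq_iff_eq_add, ← h2]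
      simp only [wgt, hX (hKU hXK), sub_add_cancel]
    rw [← memLp_indicator_iff_restrict hKm] at h1
    have h2 : K.indicator (wgt s G) = wgt s G := indicator_eq_self.2 fun X hX => by
      by_contra h
      exact hX (wgt_eq_zero (hGK X h))
    rwa [h2] at h1
  -- the trace
  have hslab' : ∀ X : Eucl n × ℝ, |X.2| < ε₀ → r' < ‖X.1‖ → φ X = 0 := fun X h1 h2 =>
    hφK X fun h => not_le.2 h2 (hslab X h h1)
  set d : Eucl n → ℝ := fun x => g x - kernelMass n s * u x with hd
  have hdm : Measurable d := by fun_prop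
  -- Beyond radius `r'` the function `φ` vanishes in a whole slab. There the slab averages of `|φ -
  -- d|` equal the integral of `|d|`, independently of `ε`, and they tend to zero.
  have hout : ∀ᵐ x, r' < ‖x‖ → d x = 0 := by
    have key : ∀ k : ℕ, ∀ᵐ x, x ∈ Metric.ball (0 : Eucl n) (k + 1) ∩ {x | r' < ‖x‖} → d x = 0 := by
      intro k
      have hAm : MeasurableSet (Metric.ball (0 : Eucl n) (k + 1) ∩ {x | r' < ‖x‖}) :=
        measurableSet_ball.inter (measurableSet_lt measurable_const measurable_norm)
      have h1 := tendsto_slab_sub hs hum hu hg hφae (R := k + 1) (by positivity)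
      have h2 : ∫⁻ x in Metric.ball (0 : Eucl n) (k + 1) ∩ {x | r' < ‖x‖}, ‖d x‖ₑ ≤ 0 := by
        refine ge_of_tendsto h1 ?_
        filter_upwards [self_mem_nhdsWithin, mem_nhdsWithin_of_mem_nhds (Iio_mem_nhds hε₀)] with ε hε hεε
        have hε : 0 < ε := hε
        rw [← volume_prod_Ioo_div (by fun_prop) hε]
        gcongr ?_ / _
        calc _ = ∫⁻ X in (Metric.ball (0 : Eucl n) (k + 1) ∩ {x | r' < ‖x‖}) ×ˢ Ioo (-ε) ε,
              ‖φ X - (g X.1 - kernelMass n s * u X.1)‖ₑ := by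
              refine setLIntegral_congr_fun (hAm.prod measurableSet_Ioo) fun X hX => ?_
              rw [hslab' X ((abs_lt.2 hX.2).trans hεε) hX.1.2, zero_sub, enorm_neg]
          _ ≤ _ := lintegral_mono_set (prod_mono_left inter_subset_left)
      have h3 := (lintegral_eq_zero_iff (by fun_prop)).1 (le_antisymm h2 zero_le)
      filter_upwards [(ae_restrict_iff' hAm).1 h3] with x hx hxA
      simpa using hx hxA
    filter_upwards [ae_all_iff.2 key] with x hx hxr
    obtain ⟨k, hk⟩ := exists_nat_gt ‖x‖
    exact hx k ⟨mem_ball_zero_iff.2 (by linarith), hxr⟩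
  -- The restriction to the closed ball makes `h` vanish everywhere outside it, not merely almost
  -- everywhere.
  set h : Eucl n → ℝ := (Metric.closedBall (0 : Eucl n) r').indicator fun x => d x / kernelMass n s with hh
  have hhm : Measurable h := (hdm.div_const _).indicator measurableSet_closedBall
  have hh0 : ∀ x, r' < ‖x‖ → h x = 0 := fun x hx =>
    indicator_of_notMem (by simpa using hx) _
  have hhd : ∀ᵐ x, kernelMass n s * h x = d x := by
    filter_upwards [hout] with x hx
    rcases lt_or_ge r' ‖x‖ with h1 | h1
    · rw [hh0 x h1, hx h1, mul_zero]
    · rw [hh, indicator_of_mem (by simpa using h1)]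
      field_simp
  have hhint : Integrable h := by
    rw [hh, integrable_indicator_iff measurableSet_closedBall]
    refine Integrable.div_const (Integrable.sub ?_ (Integrable.const_mul ?_ _)) _
    · exact hg.1.integrableOn_isCompact (isCompact_closedBall _ _)
    · exact (integrableOn_ball_of_decay hs.le hu hum (r' + 1)).mono_set
        (Metric.closedBall_subset_ball (by linarith))
  refine ⟨r', hr', φ, G, h, ⟨hK, hφm, hφint, hφK, hGm, hGint, hGK, hGL,
    isFieldPair_of_hasWeakGradOn s hU hwk hK hKU (Eventually.of_forall hφK) (Eventually.of_forall hGK),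
    hhm, hhint, hh0, ⟨ε₀, hε₀, hslab'⟩, fun X hX hX0 => hslab X hX (by rw [hX0, abs_zero]; exact hε₀), ?_⟩, ?_, ?_⟩
  · obtain ⟨R₀, hR₀⟩ := hK.isBounded.exists_norm_le
    set R : ℝ := max (max R₀ r') 0 + 1 with hR
    have hR1 : R₀ < R := by
      have := (le_max_left R₀ r').trans (le_max_left (max R₀ r') 0); linarith
    have hR2 : r' < R := by
      have := (le_max_right R₀ r').trans (le_max_left (max R₀ r') 0); linarith
    have hR3 : 0 < R := by
      have := le_max_right (max R₀ r') 0; linarith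
    refine (tendsto_slab_sub hs hum hu hg hφae hR3).congr fun ε => ?_
    congr 1
    have h1 : ∀ᵐ X : Eucl n × ℝ, kernelMass n s * h X.1 = d X.1 := by
      rw [Measure.volume_eq_prod]
      exact Measure.quasiMeasurePreserving_fst.ae hhd
    calc _ = ∫⁻ X in Metric.ball (0 : Eucl n) R ×ˢ Ioo (-ε) ε, ‖φ X - kernelMass n s * h X.1‖ₑ := by
          refine lintegral_congr_ae (ae_restrict_of_ae ?_)
          filter_upwards [h1] with X hX
          rw [hX]
      _ = _ := by
          rw [setLIntegral_prod_eq (by fun_prop)]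
          refine lintegral_congr fun z => setLIntegral_eq_of_support_subset fun x hx => ?_
          by_contra hcon
          rw [mem_ball_zero_iff, not_lt] at hcon
          have h2 : φ (x, z) = 0 := hφK _ fun hK' => by
            have h3 := hR₀ _ hK'
            have h4 : ‖x‖ ≤ ‖(x, z)‖ := norm_fst_le (x, z)
            linarith
          simp [h2, hh0 x (hR2.trans_le hcon)] at hx
  · filter_upwards [hhd] with x hx
    rw [mul_add, hx, hd]; ring
  · filter_upwards [hGae] with X hX hXU
    rw [hX hXU]; abel

/-! ### Membership in `H^s` and the comparison of energies -/

lemma gagliardo_le_add {s : ℝ} {Q : Set (Eucl n × Eucl n)} {u h : Eucl n → ℝ} (hum : Measurable u)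
    (hhm : Measurable h) :
    gagliardo s Q h ≤ 2 * gagliardo s Q (fun x => u x + h x) + 2 * gagliardo s Q u := by
  unfold gagliardo
  rw [← lintegral_const_mul _ (by fun_prop), ← lintegral_const_mul _ (by fun_prop),
    ← lintegral_add_left (by fun_prop)]
  refine lintegral_mono fun q => ?_
  simp only
  have h2 : ∀ x : ℝ, (2 : ℝ≥0∞) * ENNReal.ofReal x = ENNReal.ofReal (2 * x) := fun x => by
    rw [ENNReal.ofReal_mul (by norm_num), ENNReal.ofReal_ofNat]
  rw [h2, h2, ← ENNReal.ofReal_add (by positivity) (by positivity),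
    ← mul_add, ← add_div, ← mul_div_assoc]
  refine ENNReal.ofReal_le_ofReal (div_le_div_of_nonneg_right ?_ (by positivity))
  simp only [sq_abs]
  nlinarith [sq_nonneg ((u q.1 + h q.1 - (u q.2 + h q.2)) + (u q.1 - u q.2))]

lemma gagliardo_univ_eq {s : ℝ} {B : Set (Eucl n)} {h : Eucl n → ℝ}
    (hhB : ∀ x, x ∉ B → h x = 0) : gagliardo s univ h = gagliardo s (crossSet B) h := by
  unfold gagliardo
  rw [Measure.restrict_univ]
  refine (setLIntegral_eq_of_support_subset fun q hq => ?_).symm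
  by_contra hcon
  obtain ⟨h1, h2⟩ := eq_zero_of_notMem_crossSet hhB hcon
  simp [h1, h2] at hq

/-- A function vanishing outside a ball with finite Gagliardo seminorm belongs to `H^s`. -/
lemma memHs_of_eq_zero {s : ℝ} (hn : 1 ≤ n) (hs : 0 < s) {r : ℝ} (hr : 0 < r) {h : Eucl n → ℝ} (hhm : Measurable h)
    (hhB : ∀ x, x ∉ Metric.ball (0 : Eucl n) r → h x = 0)
    (hfin : gagliardo s (crossSet (Metric.ball 0 r)) h < ⊤) : MemHs s h := by
  have hun := gagliardo_univ_eq (s := s) hhB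
  refine ⟨memLp_two_iff.2 ⟨hhm.aestronglyMeasurable, ?_⟩, hun ▸ hfin⟩
  have hp : 0 < (n : ℝ) + 2 * s := by positivity
  -- The unit ball about `y₀` lies outside the ball of radius `r`, so `h` vanishes there, and its
  -- points are within `2r + 3` of those of the ball. These pairs alone make the Gagliardo energy
  -- bound the `L²` norm.
  set y₀ : Eucl n := EuclideanSpace.single ⟨0, hn⟩ (r + 2) with hy₀
  have hy₀n : ‖y₀‖ = r + 2 := by
    rw [hy₀, PiLp.norm_single, Real.norm_of_nonneg (by linarith)]
  set M : ℝ := (2 * r + 3) ^ ((n : ℝ) + 2 * s) with hM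
  have hM0 : 0 < M := by positivity
  set A := Metric.ball y₀ 1 with hA
  have hAv : volume A ≠ 0 := (Metric.measure_ball_pos volume y₀ one_pos).ne'
  have h1 : (∫⁻ x in Metric.ball (0 : Eucl n) r, ENNReal.ofReal (|h x| ^ 2 / M)) * volume A ≤
      gagliardo s univ h := by
    calc _ = ∫⁻ q in Metric.ball (0 : Eucl n) r ×ˢ A, ENNReal.ofReal (|h q.1| ^ 2 / M) := by
          rw [Measure.volume_eq_prod, ← Measure.prod_restrict,
            lintegral_prod _ (Measurable.aemeasurable (by fun_prop))]
          simp only [lintegral_const, Measure.restrict_apply MeasurableSet.univ, univ_inter]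
          rw [lintegral_mul_const _ (by fun_prop)]
      _ ≤ ∫⁻ q in Metric.ball (0 : Eucl n) r ×ˢ A,
            ENNReal.ofReal (|h q.1 - h q.2| ^ 2 / ‖q.1 - q.2‖ ^ ((n : ℝ) + 2 * s)) := by
          refine setLIntegral_mono' (measurableSet_ball.prod measurableSet_ball) fun q hq => ?_
          have hq1 : ‖q.1‖ < r := mem_ball_zero_iff.1 hq.1
          have hq2 : ‖q.2 - y₀‖ < 1 := mem_ball_iff_norm.1 hq.2
          have h3 : ‖q.2‖ < r + 3 := by
            have := norm_le_norm_add_norm_sub' q.2 y₀; linarith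
          have h4 : r + 1 < ‖q.2‖ := by
            have := norm_sub_norm_le y₀ q.2; rw [norm_sub_rev] at this; linarith
          have h5 : h q.2 = 0 := hhB _ fun h => by
            have := mem_ball_zero_iff.1 h; linarith
          have h6 : ‖q.1 - q.2‖ ≤ 2 * r + 3 := by
            have := norm_sub_le q.1 q.2; linarith
          have h7 : 0 < ‖q.1 - q.2‖ := by
            have := norm_sub_norm_le q.2 q.1; rw [norm_sub_rev] at this; linarith
          rw [h5, sub_zero]
          refine ENNReal.ofReal_le_ofReal (div_le_div_of_nonneg_left (by positivity) (by positivity) ?_)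
          exact Real.rpow_le_rpow h7.le h6 hp.le
      _ ≤ _ := lintegral_mono_set (subset_univ _)
  have h2 : ∫⁻ x in Metric.ball (0 : Eucl n) r, ENNReal.ofReal (|h x| ^ 2 / M) < ⊤ := by
    by_contra hcon
    rw [not_lt, top_le_iff] at hcon
    rw [hcon, ENNReal.top_mul hAv, hun] at h1
    exact absurd (h1.trans_lt hfin) (lt_irrefl _)
  have h3 : ∫⁻ x, ‖h x‖ₑ ^ 2 = ENNReal.ofReal M * ∫⁻ x in Metric.ball (0 : Eucl n) r, ENNReal.ofReal (|h x| ^ 2 / M) := by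
    rw [← lintegral_const_mul' _ _ ENNReal.ofReal_ne_top,
      ← setLIntegral_eq_of_support_subset (s := Metric.ball (0 : Eucl n) r) (f := fun x => ‖h x‖ₑ ^ 2)]
    · refine lintegral_congr fun x => ?_
      rw [← ENNReal.ofReal_mul hM0.le, mul_div_cancel₀ _ hM0.ne', ← ofReal_norm,
        ← ENNReal.ofReal_pow (norm_nonneg _), Real.norm_eq_abs]
    · intro x hx
      by_contra hcon
      simp [hhB x hcon] at hx
  rw [h3]
  exact ENNReal.mul_lt_top ENNReal.ofReal_lt_top h2

lemma normConst_pos {s : ℝ} (hs : 0 < s) : 0 < normConst n s := by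
  have hκ := kernelMass_pos (n := n) hs
  unfold normConst; positivity

lemma integral_norm_add_sq {α E : Type*} [MeasurableSpace α] {μ : Measure α} [NormedAddCommGroup E]
    [InnerProductSpace ℝ E] {f g : α → E} (hf : MemLp f 2 μ) (hg : MemLp g 2 μ) :
    ∫ a, ‖f a + g a‖ ^ 2 ∂μ = (∫ a, ‖f a‖ ^ 2 ∂μ) + (2 * (∫ a, inner ℝ (f a) (g a) ∂μ) + ∫ a, ‖g a‖ ^ 2 ∂μ) := by
  have h1 := hf.integrable_norm_pow (p := 2) (by norm_num)
  have h2 := hg.integrable_norm_pow (p := 2) (by norm_num)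
  have h3 := (integrable_inner_of_memLp hf hg).const_mul 2
  have h4 : Integrable (fun a => 2 * inner ℝ (f a) (g a) + ‖g a‖ ^ 2) μ := h3.add h2
  rw [← integral_const_mul, ← integral_add h3 h2, ← integral_add h1 h4]
  refine integral_congr_ae (Eventually.of_forall fun a => ?_)
  simp only
  rw [norm_add_sq_real]; ring

lemma ofReal_integral_norm_sq {α E : Type*} [MeasurableSpace α] {μ : Measure α} [NormedAddCommGroup E]
    {f : α → E} (hf : MemLp f 2 μ) : ENNReal.ofReal (∫ a, ‖f a‖ ^ 2 ∂μ) = ∫⁻ a, ‖f a‖ₑ ^ 2 ∂μ := by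
  rw [ofReal_integral_eq_lintegral_ofReal (hf.integrable_norm_pow (p := 2) (by norm_num))
    (Eventually.of_forall fun a => by positivity)]
  refine lintegral_congr fun a => ?_
  rw [ENNReal.ofReal_pow (norm_nonneg _), ofReal_norm]

/-- The energy comparison for a measurable representative of the minimizer, and a fixed weak
gradient of the competitor. -/
lemma energy_le_of_hasWeakGradOn (hn : 1 ≤ n) {s σ : ℝ} (hs : s ∈ Ioo (0 : ℝ) 1) {r : ℝ} (hr : 0 < r)
    {u : Eucl n → ℝ} (hum : Measurable u) {E : Set (Eucl n)}
    (hmin : IsMinimizing s σ (Metric.ball 0 r) u E) {U K : Set (Eucl n × ℝ)} (hU : IsOpen U)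
    (hslice : ∀ X ∈ U, X.2 = 0 → X.1 ∈ Metric.ball (0 : Eucl n) r) (hK : IsCompact K) (hKU : K ⊆ U)
    {v : Eucl n × ℝ → ℝ} (hv : ∀ᵐ X, X ∉ K → v X = extend s u X) {F : Set (Eucl n)}
    (hF : NullMeasurableSet F) (hFE : F \ Metric.ball 0 r = E \ Metric.ball 0 r) {g : Eucl n → ℝ}
    (hgm : Measurable g) (hg : IsTrace v g) (hpos : ∀ᵐ x, x ∈ F → 0 ≤ g x) (hneg : ∀ᵐ x, x ∉ F → g x ≤ 0)
    {Gv : Eucl n × ℝ → Eucl n × ℝ} (hGv : HasWeakGradOn U v Gv) :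
    ENNReal.ofReal (normConst n s) * weightedEnergy (1 - 2 * s) U (extend s u) +
        fracPer σ E (Metric.ball 0 r) ≤
      ENNReal.ofReal (normConst n s) * (∫⁻ X in U, ‖wgt s Gv X‖ₑ ^ 2) + fracPer σ F (Metric.ball 0 r) := by
  have hs0 := hs.1
  have hκ := kernelMass_pos (n := n) hs0
  have hc := normConst_pos (n := n) hs0
  obtain ⟨-, -, hEfin, hcomp⟩ := hmin
  have hgu : gagliardo s (crossSet (Metric.ball 0 r)) u < ⊤ := (le_self_add).trans_lt hEfin
  have hu := integrable_mul_decay hs0 hum hn (Metric.measure_ball_pos volume (0 : Eucl n) hr).ne' hgu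
  rcases eq_top_or_lt_top (∫⁻ X in U, ‖wgt s Gv X‖ₑ ^ 2) with htop | hlt
  · rw [htop, ENNReal.mul_top (by simpa using hc), top_add]; exact le_top
  obtain ⟨r', hr', φ, G, h, T, hgh, hGG⟩ := exists_isTracePair hs0 hum hu hgu hU hslice hK hKU hv hgm hg hGv hlt
  obtain ⟨hle, hnn⟩ := T.gagliardo_add_le hn hs hum hu hgu hr'
  have hhB : ∀ x, x ∉ Metric.ball (0 : Eucl n) r → h x = 0 := fun x hx =>
    T.trace_eq_zero x (hr'.trans_le (by simpa using hx))
  have hhs : MemHs s h := by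
    -- The energy of `u + h` is finite by the bound just obtained, and `h` is the difference of two
    -- functions of finite energy.
    refine memHs_of_eq_zero hn hs0 hr T.measurable_trace hhB
      ((gagliardo_le_add hum T.measurable_trace).trans_lt ?_)
    exact ENNReal.add_lt_top.2 ⟨ENNReal.mul_lt_top (by simp) (hle.trans_lt ENNReal.ofReal_lt_top),
      ENNReal.mul_lt_top (by simp) hgu⟩
  have hmin' := hcomp (fun x => u x + h x) F
    ⟨(hum.add T.measurable_trace).aemeasurable, hF,
      by
        filter_upwards [hgh, hpos] with x h1 h2 hx
        exact nonneg_of_mul_nonneg_right (h1 ▸ h2 hx) hκ,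
      by
        filter_upwards [hgh, hneg] with x h1 h2 hx
        exact nonpos_of_mul_nonpos_right (h1 ▸ h2 hx) hκ⟩
    (by
      have e : (fun x => u x - (u x + h x)) = -h := by funext x; simp
      rw [e]
      refine ⟨hhs.1.neg, ?_⟩
      refine lt_of_eq_of_lt ?_ hhs.2
      refine lintegral_congr fun q => ?_
      simp only [Pi.neg_apply]
      rw [← abs_neg (h q.1 - h q.2)]
      congr 4; ring)
    (Eventually.of_forall fun x hx => by rw [hhB x hx, add_zero]) hFE.symm
  -- the energies in `K` and in `U \ K`
  have hKm := hK.measurableSet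
  have hV : MemLp (wgt s (extGrad s u)) 2 (volume.restrict K) :=
    memLp_wgt_extGrad hs0 hum hu Metric.isOpen_ball hgu hK fun X hX hX0 => hslice X (hKU hX) hX0
  have hW : MemLp (wgt s G) 2 (volume.restrict K) := T.memLp.restrict K
  have hWK : ∀ X ∉ K, wgt s G X = 0 := fun X hX => wgt_eq_zero (T.grad_eq_zero X hX)
  have hadd : ∀ᵐ X, X ∈ U → wgt s Gv X = wgt s (extGrad s u) X + wgt s G X := by
    filter_upwards [hGG] with X hX hXU
    rw [← wgt_add]
    simp only [wgt, hX hXU]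
  have hsq := integral_norm_add_sq hV hW
  rw [setIntegral_eq_integral_of_forall_compl_eq_zero (s := K) (f := fun X => inner ℝ (wgt s (extGrad s u) X) (wgt s G X))
      (fun X hX => by rw [hWK X hX, inner_zero_right]),
    setIntegral_eq_integral_of_forall_compl_eq_zero (s := K) (f := fun X => ‖wgt s G X‖ ^ 2)
      (fun X hX => by rw [hWK X hX]; simp)] at hsq
  set J : ℝ := 2 * (∫ X, inner ℝ (wgt s (extGrad s u) X) (wgt s G X)) + ∫ X, ‖wgt s G X‖ ^ 2
  set dE : ℝ := ∫ X in K, ‖wgt s (extGrad s u) X‖ ^ 2 with hdE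
  set dV : ℝ := ∫ X in K, ‖wgt s (extGrad s u) X + wgt s G X‖ ^ 2 with hdV
  have hdE0 : 0 ≤ dE := integral_nonneg fun _ => by positivity
  have hdV0 : 0 ≤ dV := integral_nonneg fun _ => by positivity
  -- The energy on `U \ K` is common to both sides and may be infinite. It is kept as a separate
  -- summand in `[0, ∞]`, so that real arithmetic is only done on `K`.
  have eV : ∫⁻ X in U, ‖wgt s Gv X‖ₑ ^ 2 = ENNReal.ofReal dV + ∫⁻ X in U \ K, ‖wgt s (extGrad s u) X‖ₑ ^ 2 := by
    rw [← lintegral_inter_add_sdiff _ U hKm, inter_eq_self_of_subset_right hKU]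
    congr 1
    · have h1 := ofReal_integral_norm_sq (hV.add hW)
      simp only [Pi.add_apply] at h1
      rw [hdV, h1]
      refine setLIntegral_congr_fun_ae hKm ?_
      filter_upwards [hadd] with X hX hXK
      rw [hX (hKU hXK)]
    · refine setLIntegral_congr_fun_ae (hU.measurableSet.diff hKm) ?_
      filter_upwards [hadd] with X hX hXK
      rw [hX hXK.1, hWK X hXK.2, add_zero]
  have eE : ∫⁻ X in U, ‖wgt s (extGrad s u) X‖ₑ ^ 2 =
      ENNReal.ofReal dE + ∫⁻ X in U \ K, ‖wgt s (extGrad s u) X‖ₑ ^ 2 := by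
    rw [← lintegral_inter_add_sdiff _ U hKm, inter_eq_self_of_subset_right hKU,
      hdE, ofReal_integral_norm_sq hV]
  -- Uniqueness of weak gradients is not needed: on the side of the extension one candidate bounds
  -- the infimum from above, and the competitor is treated for an arbitrary weak gradient.
  have hEle : weightedEnergy (1 - 2 * s) U (extend s u) ≤ ∫⁻ X in U, ‖wgt s (extGrad s u) X‖ₑ ^ 2 := by
    simp_rw [← energy_density_eq]
    exact iInf₂_le (extGrad s u) (hasWeakGradOn_extend hs0 hum hu Metric.isOpen_ball hgu hU hslice)
  set a : ℝ := (gagliardo s (crossSet (Metric.ball 0 r)) u).toReal with ha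
  have ha0 : 0 ≤ a := ENNReal.toReal_nonneg
  have hga : gagliardo s (crossSet (Metric.ball 0 r)) u = ENNReal.ofReal a := (ENNReal.ofReal_toReal hgu.ne).symm
  unfold totalEnergy at hmin'
  set PE := fracPer σ E (Metric.ball 0 r)
  set PF := fracPer σ F (Metric.ball 0 r)
  have key : ENNReal.ofReal (normConst n s * dE) + PE ≤ ENNReal.ofReal (normConst n s * dV) + PF := by
    -- The finite Gagliardo energy `a` of `u` is added to both sides so that minimality can be
    -- inserted, and is cancelled afterwards.
    rw [← ENNReal.add_le_add_iff_left (a := ENNReal.ofReal a) ENNReal.ofReal_ne_top]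
    calc _ = ENNReal.ofReal (normConst n s * dE) + (gagliardo s (crossSet (Metric.ball 0 r)) u + PE) := by
          rw [hga]; ring
      _ ≤ ENNReal.ofReal (normConst n s * dE) + (ENNReal.ofReal (a + normConst n s * J) + PF) :=
          add_le_add_right (hmin'.trans (add_le_add_left hle _)) _
      _ = _ := by
          rw [← add_assoc, ← add_assoc, ← ENNReal.ofReal_add (by positivity) hnn,
            ← ENNReal.ofReal_add ha0 (by positivity), hsq]
          congr 2; ring
  rw [eV]
  calc _ ≤ ENNReal.ofReal (normConst n s) * (ENNReal.ofReal dE + ∫⁻ X in U \ K, ‖wgt s (extGrad s u) X‖ₑ ^ 2) + PE := by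
        rw [← eE]; gcongr
    _ = (ENNReal.ofReal (normConst n s * dE) + PE) +
          ENNReal.ofReal (normConst n s) * ∫⁻ X in U \ K, ‖wgt s (extGrad s u) X‖ₑ ^ 2 := by
        rw [ENNReal.ofReal_mul hc.le]; ring
    _ ≤ (ENNReal.ofReal (normConst n s * dV) + PF) +
          ENNReal.ofReal (normConst n s) * ∫⁻ X in U \ K, ‖wgt s (extGrad s u) X‖ₑ ^ 2 := by gcongr
    _ = _ := by rw [ENNReal.ofReal_mul hc.le]; ring

lemma IsMinimizing.congr_ae {s σ : ℝ} {Ω : Set (Eucl n)} {u u' : Eucl n → ℝ} {E : Set (Eucl n)}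
    (h : IsMinimizing s σ Ω u E) (huu : u =ᵐ[volume] u') : IsMinimizing s σ Ω u' E := by
  obtain ⟨h1, h2, h3, h4⟩ := h
  have e : totalEnergy s σ Ω u E = totalEnergy s σ Ω u' E := by
    unfold totalEnergy; rw [gagliardo_congr_ae huu]
  refine ⟨h1.congr huu, h2, e ▸ h3, fun v F hv hs hout hEF => e ▸ h4 v F hv ?_ ?_ hEF⟩
  · have h5 : (fun x => u' x - v x) =ᵐ[volume] fun x => u x - v x := by
      filter_upwards [huu] with x hx
      rw [hx]
    exact ⟨hs.1.ae_eq h5, gagliardo_congr_ae h5 ▸ hs.2⟩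
  · filter_upwards [hout, huu] with x hx hx' hxΩ
    rw [hx', hx hxΩ]

end FracFreeBdry

end

/-! ### Measurable representatives and the infimum over weak gradients -/

theorem lemma2p1 (n : ℕ) (hn : 1 ≤ n) (s σ : ℝ) (hs : s ∈ Set.Ioo (0 : ℝ) 1)
    (hσ : σ ∈ Set.Ioo (0 : ℝ) 1) (r : ℝ) (hr : 0 < r)
    (u : FracFreeBdry.Eucl n → ℝ) (E : Set (FracFreeBdry.Eucl n))
    (hmin : FracFreeBdry.IsMinimizing s σ (Metric.ball 0 r) u E)
    (U : Set (FracFreeBdry.Eucl n × ℝ)) (hU : FracFreeBdry.IsLipschitzDomain U)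
    (hbdd : Bornology.IsBounded U)
    (hsymm : ∀ (x : FracFreeBdry.Eucl n) (z : ℝ), (x, z) ∈ U ↔ (x, -z) ∈ U)
    (hslice : ∀ x : FracFreeBdry.Eucl n, (x, (0 : ℝ)) ∈ U → x ∈ Metric.ball 0 r)
    (v : FracFreeBdry.Eucl n × ℝ → ℝ) (F : Set (FracFreeBdry.Eucl n))
    (hF : NullMeasurableSet F)
    (hFE : F \ Metric.ball 0 r = E \ Metric.ball 0 r)
    (hsupp : ∃ K : Set (FracFreeBdry.Eucl n × ℝ), IsCompact K ∧ K ⊆ U ∧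
      ∀ᵐ X : FracFreeBdry.Eucl n × ℝ, X ∉ K → v X = FracFreeBdry.extend s u X)
    (g : FracFreeBdry.Eucl n → ℝ) (hg : FracFreeBdry.IsTrace v g)
    (hpos : ∀ᵐ x, x ∈ F → 0 ≤ g x)
    (hneg : ∀ᵐ x, x ∉ F → g x ≤ 0) :
    ENNReal.ofReal (FracFreeBdry.normConst n s) *
          FracFreeBdry.weightedEnergy (1 - 2 * s) U (FracFreeBdry.extend s u) +
        FracFreeBdry.fracPer σ E (Metric.ball 0 r) ≤
      ENNReal.ofReal (FracFreeBdry.normConst n s) *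
          FracFreeBdry.weightedEnergy (1 - 2 * s) U v +
        FracFreeBdry.fracPer σ F (Metric.ball 0 r) := by
  obtain ⟨K, hK, hKU, hv⟩ := hsupp
  -- The extension, the trace and minimality depend on `u` and `g` only up to null sets, so Borel
  -- representatives may be used.
  obtain ⟨u', hum, huu⟩ := hmin.1
  obtain ⟨g', hgm, hgg⟩ := hg.1.aestronglyMeasurable.aemeasurable
  rw [FracFreeBdry.extend_congr_ae huu] at hv ⊢
  have hc := FracFreeBdry.normConst_pos (n := n) hs.1
  have hc0 : ENNReal.ofReal (FracFreeBdry.normConst n s) ≠ 0 := by simpa using hc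
  conv_rhs => rw [FracFreeBdry.weightedEnergy]
  -- The constant is positive and finite, hence commutes with the infimum. If the competitor has no
  -- weak gradient the infimum is empty and the right side is infinite.
  rw [ENNReal.mul_iInf_of_ne hc0 ENNReal.ofReal_ne_top, ENNReal.iInf_add]
  refine le_iInf fun G => ?_
  rw [ENNReal.mul_iInf_of_ne hc0 ENNReal.ofReal_ne_top, ENNReal.iInf_add]
  refine le_iInf fun hG => ?_
  simp_rw [FracFreeBdry.energy_density_eq]
  refine FracFreeBdry.energy_le_of_hasWeakGradOn hn hs hr hum (hmin.congr_ae huu) hU.1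
    (fun X hX hX0 => hslice X.1 ?_) hK hKU hv hF hFE hgm (hg.congr_ae hgg) ?_ ?_ hG
  · rw [← hX0]; exact hX
  · filter_upwards [hpos, hgg] with x h1 h2 hx using h2 ▸ h1 hx
  · filter_upwards [hneg, hgg] with x h1 h2 hx using h2 ▸ h1 hx
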